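/- **Setup.** Let $W^0$ be a finite Weyl group with set of simple reflections $S$, contained in an extended Weyl group $W$, and let $W^D=W^0\epsilon$ be a coset, where $\epsilon\in W$ satisfies $\epsilon S\epsilon^{-1}=S$. Let $\ell$ and $\leqslant$ be the length and the Bruhat order on $W^0$; extend them to $W^D$ by $\ell(w\epsilon)=\ell(w)$, and $w\epsilon\leqslant w'\epsilon$ if and only if $w\leqslant w'$. A $W^0$-conjugacy class $\mathcal C\subset W^D$ is *elliptic* if $\mathcal C\cap W_J\epsilon=\emptyset$ for every $J\subsetneq S$ with $\epsilon J\epsilon^{-1}=J$, where $W_J=\langle J\rangle$. Let $\mathcal C_{\min}$ be the set of minimal length elements of $\mathcal C$. For elliptic classes $\mathcal C,\mathcal C'\subset W^D$ write $\mathcal C\preceq_W\mathcal C'$ if there are $w\in\mathcal C_{\min}$ and $w'\in\mathcal C'_{\min}$ with $w\leqslant w'$. For partitions $\alpha=(\alpha_1\geqslant\alpha_2\geqslant\cdots)$ and $\beta$ of $n$, write $\beta\leqslant\alpha$ (dominance order) if $\beta_1+\cdots+\beta_k\leqslant\alpha_1+\cdots+\alpha_k$ for all $k$. Let $B_n$ be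 the group of permutations $w$ of $\{\pm1,\dots,\pm n\}$ with $w(-i)=-w(i)$, let $D_n\subset B_n$ be the subgroup of those $w$ for which $\#\{i\mid 1\leqslant i\leqslant n,\ w(i)<0\}$ is even, and let $\delta\in B_n$ (for $n\geqslant1$) be the sign change of the coordinate $1$. For a partition $\alpha=(\alpha_1,\dots,\alpha_l)$ of $n$ (with positive parts), let $\mathcal C_\alpha\subset B_n$ be the set of those $w$ for which there is a decomposition $\{1,\dots,n\}=I_1\sqcup\cdots\sqcup I_l$ with $|I_j|=\alpha_j$ such that the orbits of $w$ on $\{\pm1,\dots,\pm n\}$ are the sets $I_j\sqcup -I_j$. **Proposition.** Let $n\geqslant 0$. In each of the following cases, and for all partitions $\alpha,\beta$ of $n$ of the indicated kind, $\mathcal C_\alpha$ and $\mathcal C_\beta$ are elliptic $W^0$-conjugacy classes in $W^D$, and $$\mathcal C_\alpha\preceq_W\mathcal C_\beta\iff\beta\leqslant\alpha .$$ 1. Type $B_n/C_n$: $W^D=W^0=B_n$ (with $\epsilon=1$); all partitions. 2. Type $D_n$: $W^D=W^0=D_n$ (with $\epsilon=1$); partitions with an even number of parts. 3. Type ${}^2D_n$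 (the non-identity component of $O(2n)$): $W^0=D_n$, $W^D=D_n\delta$, $\epsilon=\delta$; partitions with an odd number of parts. 4. Type $A_{n-1}$: $W^D=W^0=S_n$ (with $\epsilon=1$); only the partition with at most one part, $\alpha=\beta=(n)$, with $\mathcal C_{(n)}$ the class of elements acting with a single orbit of size $n$ (the identity if $n=0$). 5. Type ${}^2A_{n-1}$: $W^0=S_n\times\{1\}\subset W=S_n\times\{\pm1\}$ and $\epsilon=(w_0,-1)$, where $w_0(i)=n+1-i$; partitions with only odd parts, with $\mathcal C_\alpha$ the set of elements $(w,1)\epsilon=(ww_0,-1)$ such that the orbits of $ww_0$ on $\{1,\dots,n\}$ have sizes $\alpha_1,\dots,\alpha_l$. Here the simple reflections are the standard ones: the adjacent transpositions in type $A$; in types $B$ and $D$ the elements $i\leftrightarrow i+1$, $-i\leftrightarrow-(i+1)$ for $1\leqslant i\leqslant n-1$, together with the sign change $1\leftrightarrow-1$ in type $B$ (if $n\geqslant1$), and $1\leftrightarrow-2$, $-1\leftrightarrow2$ in type $D$ (if $n\geqslant2$). -/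

import Mathlib

/-! ### Extended Weyl groups, their cosets, length, Bruhat order, elliptic classes -/

/-- The data of a coset `W^D = W⁰ ε` in an extended Weyl group `G`: the Weyl group `W⁰`, its set `S`
of simple reflections, and the length-zero element `ε` of the coset (`ε S ε⁻¹ = S`).
This is used only for the explicit classical examples below. -/
structure WeylCoset (G : Type*) [Group G] where
  /-- the Weyl group `W⁰` -/
  W0 : Subgroup G
  /-- the simple reflections of `W⁰` -/
  S : Set G
  /-- the length-zero element of the coset -/
  eps : G

namespace WeylCoset

variable {G : Type*} [Group G] (D : WeylCoset G)

/-- The length of `w ∈ W⁰`: the least length of a word in the simple reflections with product `w`. -/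
noncomputable def len (w : G) : ℕ :=
  sInf {k | ∃ l : List G, (∀ s ∈ l, s ∈ D.S) ∧ l.prod = w ∧ l.length = k}

/-- The reflections of `W⁰`: the conjugates of the simple reflections. -/
def reflections : Set G :=
  {t | ∃ g ∈ D.W0, ∃ s ∈ D.S, t = g * s * g⁻¹}

/-- The Bruhat order on `W⁰`: the reflexive transitive closure of the relation
`x → x t`, where `t` is a reflection and `ℓ(x) < ℓ(x t)`. -/
def bruhatLE (x y : G) : Prop :=
  Relation.ReflTransGen (fun a b => ∃ t ∈ D.reflections, b = a * t ∧ D.len a < D.len b) x y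

/-- The coset `W^D = W⁰ ε`. -/
def coset : Set G := {x | ∃ w ∈ D.W0, x = w * D.eps}

/-- The length on `W^D = W⁰ ε`: `ℓ(w ε) = ℓ(w)`. -/
noncomputable def cosetLen (x : G) : ℕ := D.len (x * D.eps⁻¹)

/-- The Bruhat order on `W^D = W⁰ ε`: `w ε ≤ w' ε` if and only if `w ≤ w'`. -/
def cosetLE (x y : G) : Prop := D.bruhatLE (x * D.eps⁻¹) (y * D.eps⁻¹)

/-- The `W⁰`-conjugacy class of `x`. -/
def conjClass (x : G) : Set G := {y | ∃ g ∈ D.W0, y = g * x * g⁻¹}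

/-- The set of elliptic `W⁰`-conjugacy classes in `W^D`: those meeting no `W_J ε`, for `J` a proper
subset of `S` with `ε J ε⁻¹ = J`, where `W_J` is the subgroup generated by `J`. -/
def ellipticClasses : Set (Set G) :=
  {C | (∃ x ∈ D.coset, C = D.conjClass x) ∧
    ∀ J : Set G, J ⊆ D.S → J ≠ D.S → (fun s => D.eps * s * D.eps⁻¹) '' J = J →
      C ∩ {x | ∃ w ∈ Subgroup.closure J, x = w * D.eps} = ∅}

/-- The set of minimal length elements of a class. -/
def minElts (C : Set G) : Set G := {x | x ∈ C ∧ ∀ y ∈ C, D.cosetLen x ≤ D.cosetLen y}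

/-- The relation `C ⪯ C'` on classes: some minimal length element of `C` lies below some minimal
length element of `C'` in the Bruhat order. -/
def precW (C C' : Set G) : Prop :=
  ∃ w' ∈ D.minElts C', ∃ w ∈ D.minElts C, D.cosetLE w w'

end WeylCoset

/-! ### The dominance order on partitions -/

namespace Nat.Partition

/-- `α₁ + ⋯ + αₖ`, where `α₁ ≥ α₂ ≥ ⋯` are the parts of `α` (padded by zeros). -/
def partialSum {n : ℕ} (α : n.Partition) (k : ℕ) : ℕ :=
  ((α.parts.sort (· ≥ ·)).take k).sum

/-- The dominance order `α ≤ β` on partitions of `n`. -/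
def DominanceLE {n : ℕ} (α β : n.Partition) : Prop :=
  ∀ k, α.partialSum k ≤ β.partialSum k

end Nat.Partition

/-! ### Types B, C and D -/

/-- The group of permutations `w` of `{±1, …, ±n}` with `w(-i) = -w(i)`. Such a permutation is
regarded as a permutation of `ℤ` that fixes `0` and all `i` with `|i| > n`
(`w 0 = 0` follows from `w (-0) = -w 0`). -/
def signedPerm (n : ℕ) : Subgroup (Equiv.Perm ℤ) where
  carrier := {w | (∀ i, w (-i) = -w i) ∧ ∀ i, (n : ℤ) < |i| → w i = i}
  one_mem' := by simp
  mul_mem' := by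
    rintro a b ⟨ha, ha'⟩ ⟨hb, hb'⟩
    refine ⟨fun i => by simp [ha, hb], fun i hi => ?_⟩
    simp [hb' i hi, ha' i hi]
  inv_mem' := by
    rintro a ⟨ha, ha'⟩
    refine ⟨fun i => ?_, fun i hi => ?_⟩
    · rw [Equiv.Perm.inv_eq_iff_eq, ha]; simp
    · rw [Equiv.Perm.inv_eq_iff_eq, ha' i hi]

/-- The sign change of the coordinate `1`: `δ(1) = -1` and `δ(k) = k` for `k ≥ 2`. -/
def signChange : Equiv.Perm ℤ := Equiv.swap 1 (-1)

/-- The simple reflections `i ↔ i + 1`, `-i ↔ -(i + 1)` for `1 ≤ i ≤ n - 1`. -/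
def adjacentSigned (n : ℕ) : Set (Equiv.Perm ℤ) :=
  {s | ∃ i : ℤ, 1 ≤ i ∧ i + 1 ≤ n ∧ s = Equiv.swap i (i + 1) * Equiv.swap (-i) (-(i + 1))}

/-- Type `B_n` and `C_n`: the Weyl group of `SO(2n+1)` and `Sp(2n)`. The simple reflections are the
adjacent transpositions and the sign change of `1`. -/
def weylB (n : ℕ) : WeylCoset (Equiv.Perm ℤ) where
  W0 := signedPerm n
  S := adjacentSigned n ∪ {s | 1 ≤ n ∧ s = signChange}
  eps := 1

/-- The number of sign changes `#{i | 1 ≤ i ≤ n, w(i) < 0}` of a signed permutation. -/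
noncomputable def numNeg (n : ℕ) (w : Equiv.Perm ℤ) : ℕ :=
  ((Finset.Icc (1 : ℤ) n).filter (fun i => w i < 0)).card

theorem signedPerm_apply_zero {n : ℕ} {w : Equiv.Perm ℤ} (hw : w ∈ signedPerm n) : w 0 = 0 := by
  have := hw.1 0
  simp at this
  omega

theorem signedPerm_apply_ne_zero {n : ℕ} {w : Equiv.Perm ℤ} (hw : w ∈ signedPerm n) {i : ℤ}
    (hi : i ≠ 0) : w i ≠ 0 := by
  intro h
  exact hi (w.injective (h.trans (signedPerm_apply_zero hw).symm))

theorem signedPerm_abs_image {n : ℕ} {w : Equiv.Perm ℤ} (hw : w ∈ signedPerm n) :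
    Set.InjOn (fun i => |w i|) (Finset.Icc (1 : ℤ) n) ∧
      (Finset.Icc (1 : ℤ) n).image (fun i => |w i|) = Finset.Icc (1 : ℤ) n := by
  have hinj : Set.InjOn (fun i => |w i|) (Finset.Icc (1 : ℤ) n) := by
    intro i hi j hj h
    simp only [Finset.coe_Icc, Set.mem_Icc] at hi hj
    rcases abs_eq_abs.1 h with h | h
    · exact w.injective h
    · rw [← hw.1] at h
      have := w.injective h
      omega
  refine ⟨hinj, Finset.eq_of_subset_of_card_le ?_ (Finset.card_image_of_injOn hinj).ge⟩
  intro k hk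
  obtain ⟨i, hi, rfl⟩ := Finset.mem_image.1 hk
  rw [Finset.mem_Icc] at hi ⊢
  refine ⟨Int.one_le_abs (signedPerm_apply_ne_zero hw (by omega)), ?_⟩
  by_contra! h
  have h1 := w.injective (hw.2 _ h)
  rw [h1, abs_of_nonneg (by omega)] at h
  omega

theorem prod_sign_eq {n : ℕ} {w : Equiv.Perm ℤ} (hw : w ∈ signedPerm n) :
    ∏ i ∈ Finset.Icc (1 : ℤ) n, (w i).sign = (-1) ^ numNeg n w := by
  rw [numNeg, ← Finset.prod_const, Finset.prod_filter]
  refine Finset.prod_congr rfl fun i hi => ?_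
  have := signedPerm_apply_ne_zero hw (i := i) (by simp at hi; omega)
  split_ifs with h
  · exact Int.sign_eq_neg_one_of_neg h
  · exact Int.sign_eq_one_of_pos (by omega)

theorem prod_sign_mul {n : ℕ} {a b : Equiv.Perm ℤ} (ha : a ∈ signedPerm n)
    (hb : b ∈ signedPerm n) :
    ∏ i ∈ Finset.Icc (1 : ℤ) n, ((a * b) i).sign =
      (∏ i ∈ Finset.Icc (1 : ℤ) n, (a i).sign) * ∏ i ∈ Finset.Icc (1 : ℤ) n, (b i).sign := by
  obtain ⟨hinj, him⟩ := signedPerm_abs_image hb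
  conv_rhs => rw [← him, Finset.prod_image hinj, him, ← Finset.prod_mul_distrib]
  refine Finset.prod_congr rfl fun i hi => ?_
  have := signedPerm_apply_ne_zero hb (i := i) (by simp at hi; omega)
  rcases lt_or_gt_of_ne this with h | h
  · rw [abs_of_neg h, ha.1, Int.sign_neg, Int.sign_eq_neg_one_of_neg h]
    simp
  · rw [abs_of_pos h, Int.sign_eq_one_of_pos h]
    simp

theorem even_numNeg_iff {n : ℕ} {w : Equiv.Perm ℤ} (hw : w ∈ signedPerm n) :
    Even (numNeg n w) ↔ ∏ i ∈ Finset.Icc (1 : ℤ) n, (w i).sign = 1 := by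
  rw [prod_sign_eq hw, neg_one_pow_eq_one_iff_even (by norm_num)]

/-- The Weyl group of `SO(2n)`: the signed permutations with an even number of sign changes. -/
def evenSignedPerm (n : ℕ) : Subgroup (Equiv.Perm ℤ) where
  carrier := {w | w ∈ signedPerm n ∧ Even (numNeg n w)}
  one_mem' := by
    refine ⟨one_mem _, ?_⟩
    rw [even_numNeg_iff (one_mem _)]
    refine Finset.prod_eq_one fun i hi => ?_
    rw [Finset.mem_Icc] at hi
    exact Int.sign_eq_one_of_pos (by simp; omega)
  mul_mem' := by
    rintro a b ⟨ha, ha'⟩ ⟨hb, hb'⟩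
    refine ⟨mul_mem ha hb, ?_⟩
    rw [even_numNeg_iff ha] at ha'
    rw [even_numNeg_iff hb] at hb'
    rw [even_numNeg_iff (mul_mem ha hb), prod_sign_mul ha hb, ha', hb', mul_one]
  inv_mem' := by
    rintro a ⟨ha, ha'⟩
    refine ⟨inv_mem ha, ?_⟩
    rw [even_numNeg_iff ha] at ha'
    rw [even_numNeg_iff (inv_mem ha)]
    have h := prod_sign_mul ha (inv_mem ha)
    rw [ha', one_mul, mul_inv_cancel] at h
    rw [← h]
    refine Finset.prod_eq_one fun i hi => ?_
    rw [Finset.mem_Icc] at hi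
    exact Int.sign_eq_one_of_pos (by simp; omega)

/-- The simple reflections of type `D_n`: the adjacent transpositions and, if `n ≥ 2`, the
reflection `1 ↔ -2`, `-1 ↔ 2`. -/
def simpleD (n : ℕ) : Set (Equiv.Perm ℤ) :=
  adjacentSigned n ∪ {s | 2 ≤ n ∧ s = Equiv.swap 1 (-2) * Equiv.swap (-1) 2}

/-- Type `D_n`: the identity component `SO(2n)` of `O(2n)`. -/
def weylD (n : ℕ) : WeylCoset (Equiv.Perm ℤ) where
  W0 := evenSignedPerm n
  S := simpleD n
  eps := 1

/-- Type `²D_n`: the other component of `O(2n)`, with length-zero element `δ`. The coset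
`W⁰ δ` consists of the signed permutations with an odd number of sign changes (`n ≥ 1`). -/
def weylTwistedD (n : ℕ) : WeylCoset (Equiv.Perm ℤ) where
  W0 := evenSignedPerm n
  S := simpleD n
  eps := signChange

/-- The class `C_α` in types `B`, `C`, `D`, `²D`: the signed permutations `w` for which there is a
decomposition `{1, …, n} = I₁ ⊔ ⋯ ⊔ I_l` with `|I_j| = α_j`, such that the orbits of `w` on
`{±1, …, ±n}` are the sets `I_j ⊔ -I_j`. -/
def signedClass {n : ℕ} (α : n.Partition) : Set (Equiv.Perm ℤ) :=
  {w | w ∈ signedPerm n ∧ ∃ P : Finpartition (Finset.Icc (1 : ℤ) n),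
    P.parts.val.map Finset.card = α.parts ∧
    ∀ I ∈ P.parts, ∀ x ∈ I, ∀ y : ℤ, w.SameCycle x y ↔ (y ∈ I ∨ -y ∈ I)}

/-! ### Type A, untwisted and twisted -/

/-- The simple reflections `(i, i + 1)` of `S_n`, inside the extended Weyl group
`S_n × {±1}` of the group generated by `GL(n)` and the transpose-inverse automorphism. -/
def simpleA (n : ℕ) : Set (Equiv.Perm (Fin n) × ℤˣ) :=
  {s | ∃ i j : Fin n, (j : ℕ) = i + 1 ∧ s = (Equiv.swap i j, 1)}

/-- Type `A_{n-1}`: the component `GL(n)`. -/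
def weylA (n : ℕ) : WeylCoset (Equiv.Perm (Fin n) × ℤˣ) where
  W0 := (⊤ : Subgroup (Equiv.Perm (Fin n))).prod ⊥
  S := simpleA n
  eps := 1

/-- Type `²A_{n-1}`: the other component. Its length-zero element is `ε = (δ, -1)`, where
`δ = (1, n)(2, n-1)⋯` is the longest element of `S_n`, so that `w ε = (w δ, -1)` for `w ∈ S_n`,
and `W⁰`-conjugation of `w ε` is `δ`-twisted conjugation of `w`. -/
def weylTwistedA (n : ℕ) : WeylCoset (Equiv.Perm (Fin n) × ℤˣ) where
  W0 := (⊤ : Subgroup (Equiv.Perm (Fin n))).prod ⊥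
  S := simpleA n
  eps := (Fin.revPerm, -1)

/-- The set of `u ∈ S_n` with orbits of sizes `α₁, …, α_l`, in the component `c = ±1` of
`S_n × {±1}`. For `c = -1`, these are the elements `w ε` for which the orbits of `w δ` have sizes
`α₁, …, α_l`. -/
def permClass {n : ℕ} (α : n.Partition) (c : ℤˣ) : Set (Equiv.Perm (Fin n) × ℤˣ) :=
  {u | u.1.partition.parts = α.parts ∧ u.2 = c}

/-! ### The order-reversing property -/

/-- For a coset `D` and a family of sets `C_α`, indexed by the partitions `α` of `n` satisfying `Q`:
each `C_α` is an elliptic class of `D`, and `C_α ⪯ C_β` if and only if `β ≤ α`. -/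
def EllipticOrderReversing {G : Type*} [Group G] (D : WeylCoset G) {n : ℕ}
    (Q : n.Partition → Prop) (C : n.Partition → Set G) : Prop :=
  (∀ α, Q α → C α ∈ D.ellipticClasses) ∧
    ∀ α β, Q α → Q β → (D.precW (C α) (C β) ↔ β.DominanceLE α)

/-! ### Bruhat orders with a length function, and cyclic shifts -/

/-! The relation `⪯` does not depend on the chosen minimal elements, and this reduces everything to
explicit normal forms. If `x ≤ y` and `y` is replaced by a cyclic shift `s y s` of the same length,
then the lifting property of the Bruhat order puts `x` or `s x s` below `s y s`, with no increase of
length. So if every minimal element of a class reaches one normal form by shifts that never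
lengthen, `⪯` can be tested at that normal form (`Red.below_iff`), and it is transitive
(`Below.trans`).

Lengths are weighted inversion numbers. Types B, D and ²D live in the group of all signed
permutations: opposite labels have weight 2 in type B and weight 0 in type D, so that `δ` has length
zero and both cosets of `D_n` are treated together (`signedData`). In type ²A the element `w ε` is
recorded as `w w₀`: twisted conjugation becomes conjugation, and the length becomes the number of
non-inversions (`twData`). `WeylCoset.Model` compares these data with word length and with the
Bruhat order of the coset.

Normal forms. A signed permutation all of whose cycles are negative reduces to a product of negative
cycles on consecutive intervals (`exists_red_negBlocks`). A permutation with odd cycles reduces to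
nested spirals (`exists_red_twBlocks`). Apart from terms depending only on the set of parts, the
length is an increasing function of `tailSums`, so minimality forces the largest part to be
outermost.

Necessity of dominance. The number of labels `≤ i` with image `> j` is monotone for the order. In
the normal form of `β`, take as level the sum of the parts after the `s`-th one: at most `s` labels
cross it. An element of `C_α` below the normal form then also has at most `s` crossings. A negative
cycle that contains a label above the level contains its opposite as well, hence crosses. So at most
`s` cycles cover all labels above the level, and `β₁ + ⋯ + β_s ≤ α₁ + ⋯ + α_s`
(`sum_take_le_of_below`). For ²A the cycles that avoid a small set of labels would alternate between
the two outer regions and have even length (`sum_take_le_of_twData_below`).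

Sufficiency. Between `β` and `α` there is a chain of elementary raisings that respects the
restrictions on the partitions: one unit moves from a smaller part to a larger one in type B; the
parity of the number of parts is kept in types D and ²D; all parts stay odd in type ²A
(`exists_raise_one`, `exists_raise_even`, `exists_raise_odd`). For each elementary raising the
larger cycle gives up a label, cyclic shifts carry this label inwards past the intermediate cycles,
and increasing reflections detach it and attach it to the smaller cycle (`redLE_raise_one`,
`redLE_raise_two`, `redLE_raise_three`, `redLE_absorb`).

Ellipticity. When a simple reflection, or an `ε`-orbit of them, is missing from `J`, the elements of
`W_J ε` preserve a set of labels containing some `a` but not `-a`, or exchange two disjoint sets of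
labels in type ²A. This contradicts negative, respectively odd, cycles. In type A only the class of
`n`-cycles occurs, and its order statement is reflexivity. -/

/-- A group with a set `S` of simple reflections, a set `T` of reflections, a set `Ω` of elements of
length zero and a length function, whose values on `x` and `x * s` differ by `gap`. -/
structure ShiftData (G : Type*) [Group G] where
  /-- the ambient group -/
  H : Subgroup G
  /-- the simple reflections -/
  S : Set G
  /-- the reflections -/
  T : Set G
  /-- elements whose conjugation action preserves the length -/
  Ω : Set G
  /-- the length -/
  len : G → ℕ
  /-- the length of a simple reflection -/
  gap : ℕ
  S_sub : S ⊆ T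
  T_sub : ∀ t ∈ T, t ∈ H
  sq : ∀ t ∈ T, t * t = 1
  conj_mem : ∀ g ∈ H, ∀ t ∈ T, g * t * g⁻¹ ∈ T
  Ω_sub : ∀ g ∈ Ω, g ∈ H
  Ω_inv : ∀ g ∈ Ω, g⁻¹ ∈ Ω
  Ω_len : ∀ g ∈ Ω, ∀ x ∈ H, len (g * x * g⁻¹) = len x
  gap_pos : 0 < gap
  len_inv : ∀ x ∈ H, len x⁻¹ = len x
  len_mul : ∀ x ∈ H, ∀ s ∈ S, len (x * s) = len x + gap ∨ len (x * s) + gap = len x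
  len_exch : ∀ x ∈ H, ∀ s ∈ S, ∀ t ∈ T, s ≠ t → len x < len (x * t) →
    len (x * s) < len (x * t * s)

namespace ShiftData

variable {G : Type*} [Group G] (D : ShiftData G)

/-- An elementary step of the Bruhat order. -/
def Step (a b : G) : Prop := ∃ t ∈ D.T, b = a * t ∧ D.len a < D.len b

/-- The Bruhat order. -/
def le (x y : G) : Prop := Relation.ReflTransGen D.Step x y

/-- The larger one of `x` and `x * s`. -/
noncomputable def up (s x : G) : G := if D.len x < D.len (x * s) then x * s else x

/-- The smaller one of `x` and `x * s`. -/
noncomputable def dn (s x : G) : G := if D.len x < D.len (x * s) then x else x * s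

variable {D}

theorem inv_eq_self {t : G} (ht : t ∈ D.T) : t⁻¹ = t :=
  inv_eq_of_mul_eq_one_left (D.sq t ht)

theorem S_mem {s : G} (hs : s ∈ D.S) : s ∈ D.H := D.T_sub s (D.S_sub hs)

theorem mul_simple_cancel {s : G} (hs : s ∈ D.S) (x : G) : x * s * s = x := by
  rw [mul_assoc, D.sq s (D.S_sub hs), mul_one]

theorem simple_mul_cancel {s : G} (hs : s ∈ D.S) (x : G) : s * (s * x) = x := by
  rw [← mul_assoc, D.sq s (D.S_sub hs), one_mul]

theorem Step.mem {x y : G} (hx : x ∈ D.H) (h : D.Step x y) : y ∈ D.H := by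
  obtain ⟨t, ht, rfl, -⟩ := h
  exact mul_mem hx (D.T_sub t ht)

theorem le.mem {x y : G} (hx : x ∈ D.H) (h : D.le x y) : y ∈ D.H := by
  induction h with
  | refl => exact hx
  | tail _ h ih => exact h.mem ih

theorem Step.le {x y : G} (h : D.Step x y) : D.le x y := Relation.ReflTransGen.single h

theorem le.trans {x y z : G} (h : D.le x y) (h' : D.le y z) : D.le x z :=
  Relation.ReflTransGen.trans h h'

theorem le.rfl {x : G} : D.le x x := Relation.ReflTransGen.refl

theorem le.inv {x y : G} (hx : x ∈ D.H) (h : D.le x y) : D.le x⁻¹ y⁻¹ := by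
  induction h with
  | refl => exact .refl
  | @tail a b hxa hab ih =>
    refine ih.tail ?_
    have ha : a ∈ D.H := le.mem hx hxa
    have hb : b ∈ D.H := hab.mem ha
    obtain ⟨t, ht, rfl, hl⟩ := hab
    refine ⟨a * t * a⁻¹, D.conj_mem a ha t ht, ?_, ?_⟩
    · rw [mul_inv_rev, inv_eq_self ht]
      group
    · rwa [D.len_inv a ha, D.len_inv _ hb]

/-! ### Lifting property, and inequalities under cyclic shifts. -/

theorem le_mul_simple {s x : G} (hs : s ∈ D.S) (h : D.len x < D.len (x * s)) : D.le x (x * s) :=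
  Step.le ⟨s, D.S_sub hs, rfl, h⟩

theorem mul_simple_le {s x : G} (hs : s ∈ D.S) (hx : x ∈ D.H) (h : ¬ D.len x < D.len (x * s)) :
    D.le (x * s) x := by
  refine Step.le ⟨s, D.S_sub hs, (mul_simple_cancel hs x).symm, ?_⟩
  have := D.gap_pos
  rcases D.len_mul x hx s hs with h' | h' <;> omega

theorem le_up {s x : G} (hs : s ∈ D.S) (hx : x ∈ D.H) : D.le x (D.up s x) ∧
    D.le (x * s) (D.up s x) := by
  unfold up
  split_ifs with h
  · exact ⟨le_mul_simple hs h, le.rfl⟩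
  · exact ⟨le.rfl, mul_simple_le hs hx h⟩

theorem dn_le {s x : G} (hs : s ∈ D.S) (hx : x ∈ D.H) : D.le (D.dn s x) x ∧
    D.le (D.dn s x) (x * s) := by
  unfold dn
  split_ifs with h
  · exact ⟨le.rfl, le_mul_simple hs h⟩
  · exact ⟨mul_simple_le hs hx h, le.rfl⟩

/-- The lifting property. If `y = x s`, the two elements have the same maximum and the same minimum
over their right `s`-coset. Otherwise `len_exch` makes `x s → y s` a Bruhat step too, and each
maximum or minimum is compared through whichever of the two steps applies. -/
theorem Step.up_dn {s x y : G} (hs : s ∈ D.S) (hx : x ∈ D.H) (h : D.Step x y) :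
    D.le (D.up s x) (D.up s y) ∧ D.le (D.dn s x) (D.dn s y) := by
  have hy := h.mem hx
  have hxy := h.le
  obtain ⟨t, ht, rfl, hl⟩ := h
  by_cases hst : s = t
  · subst hst
    have e := mul_simple_cancel hs x
    have h1 : ¬ D.len (x * s) < D.len x := by omega
    constructor <;> simp only [up, dn, e, if_pos hl, if_neg h1] <;> exact le.rfl
  · have h2 : D.Step (x * s) (x * t * s) := by
      refine ⟨s * t * s⁻¹, D.conj_mem s (S_mem hs) t ht, ?_, D.len_exch x hx s hs t ht hst hl⟩
      have := D.sq s (D.S_sub hs)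
      rw [inv_eq_self (D.S_sub hs)]
      calc x * t * s = x * (s * s) * t * s := by rw [this, mul_one]
        _ = _ := by group
    have hu := le_up hs hy
    have hd := dn_le hs hx
    constructor
    · unfold up
      by_cases h3 : D.len x < D.len (x * s)
      · rw [if_pos h3]; exact h2.le.trans hu.2
      · rw [if_neg h3]; exact hxy.trans hu.1
    · by_cases h3 : D.len (x * t) < D.len (x * t * s)
      · rw [show D.dn s (x * t) = x * t from if_pos h3]
        exact hd.1.trans hxy
      · rw [show D.dn s (x * t) = x * t * s from if_neg h3]
        exact hd.2.trans h2.le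

theorem le.up_dn {s x y : G} (hs : s ∈ D.S) (hx : x ∈ D.H) (h : D.le x y) :
    D.le (D.up s x) (D.up s y) ∧ D.le (D.dn s x) (D.dn s y) := by
  induction h with
  | refl => exact ⟨le.rfl, le.rfl⟩
  | @tail a b hxa hab ih =>
    have := hab.up_dn hs (le.mem hx hxa)
    exact ⟨ih.1.trans this.1, ih.2.trans this.2⟩

/-- Following a length-preserving cyclic shift `y → s y s` with `y s < y`. -/
theorem le.shift_right {s x y : G} (hs : s ∈ D.S) (hx : x ∈ D.H) (h : D.le x y)
    (h1 : D.len (y * s) < D.len y) (h2 : D.len (s * y * s) = D.len y) :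
    ∃ x', (x' = x ∨ x' = s * x * s) ∧ D.len x' ≤ D.len x ∧ D.le x' (s * y * s) := by
  have hy := le.mem hx h
  have hsH := S_mem hs
  -- Minima on the right give `dn x ≤ y s`. Inverting turns the missing left factor `s` into a right
  -- one, and maxima then give an inequality with top `(s y s)⁻¹`.
  have hd := (h.up_dn hs hx).2
  have e1 : D.dn s y = y * s := if_neg (by omega)
  rw [e1] at hd
  have hdx : D.dn s x ∈ D.H := by
    unfold dn; split_ifs
    · exact hx
    · exact mul_mem hx hsH
  have hl := (hd.inv hdx).up_dn hs (inv_mem hdx)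
  have e2 : (y * s)⁻¹ * s = (s * y * s)⁻¹ := by
    simp only [mul_inv_rev, inv_eq_self (D.S_sub hs)]; group
  have hyy : s * y * s ∈ D.H := mul_mem (mul_mem hsH hy) hsH
  have e3 : D.up s (y * s)⁻¹ = (s * y * s)⁻¹ := by
    rw [up, e2, if_pos]
    rw [D.len_inv _ hyy, D.len_inv _ (mul_mem hy hsH)]; omega
  have h3 := hl.1
  rw [e3] at h3
  have hu := le_up hs (inv_mem hdx)
  have fin : ∀ z : G, z ∈ D.H → D.le z (s * y * s)⁻¹ → D.le z⁻¹ (s * y * s) := fun z hz hz' => by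
    have := hz'.inv hz
    rwa [inv_inv] at this
  by_cases h4 : D.len x < D.len (x * s)
  · rw [show D.dn s x = x from if_pos h4] at hu h3
    exact ⟨x, .inl (Eq.refl _), le_refl _, by simpa using fin _ (inv_mem hx) (hu.1.trans h3)⟩
  · rw [show D.dn s x = x * s from if_neg h4] at hu h3 hdx
    refine ⟨s * x * s, .inr (Eq.refl _), ?_, ?_⟩
    -- In this case `x s` is shorter than `x` by the gap, and a factor `s` on the left adds at most
    -- the gap.
    · have h5 := D.len_mul x hx s hs
      have h6 := D.len_mul (x * s)⁻¹ (inv_mem hdx) s hs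
      have e4 : (x * s)⁻¹ * s = (s * x * s)⁻¹ := by
        simp only [mul_inv_rev, inv_eq_self (D.S_sub hs)]; group
      rw [e4, D.len_inv _ (mul_mem (mul_mem hsH hx) hsH), D.len_inv _ hdx] at h6
      omega
    · have := fin _ (mul_mem (inv_mem hdx) hsH) (hu.2.trans h3)
      simpa [mul_inv_rev, inv_eq_self (D.S_sub hs), mul_assoc] using this

/-- The mirror image of `le.shift_right`: inversion preserves both length and order. -/
theorem le.shift_left {s x y : G} (hs : s ∈ D.S) (hx : x ∈ D.H) (h : D.le x y)
    (h1 : D.len (s * y) < D.len y) (h2 : D.len (s * y * s) = D.len y) :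
    ∃ x', (x' = x ∨ x' = s * x * s) ∧ D.len x' ≤ D.len x ∧ D.le x' (s * y * s) := by
  have hy := le.mem hx h
  have hsH := S_mem hs
  have e : ∀ z : G, s * z⁻¹ * s = (s * z * s)⁻¹ := fun z => by
    simp only [mul_inv_rev, inv_eq_self (D.S_sub hs)]; group
  have e' : y⁻¹ * s = (s * y)⁻¹ := by
    simp only [mul_inv_rev, inv_eq_self (D.S_sub hs)]
  obtain ⟨x', h3, h4, h5⟩ := (h.inv hx).shift_right hs (inv_mem hx)
    (by rw [e', D.len_inv _ (mul_mem hsH hy), D.len_inv _ hy]; exact h1)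
    (by rw [e, D.len_inv _ (mul_mem (mul_mem hsH hy) hsH), D.len_inv _ hy]; exact h2)
  have hx' : x' ∈ D.H := by
    rcases h3 with rfl | rfl
    · exact inv_mem hx
    · exact mul_mem (mul_mem hsH (inv_mem hx)) hsH
  refine ⟨x'⁻¹, ?_, ?_, ?_⟩
  · rcases h3 with rfl | rfl
    · left; simp
    · right; rw [e]; simp
  · rwa [D.len_inv _ hx', ← D.len_inv x hx]
  · have := h5.inv hx'
    rw [e] at this
    simpa using this

theorem le.conj {g x y : G} (hg : g ∈ D.Ω) (hx : x ∈ D.H) (h : D.le x y) :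
    D.le (g * x * g⁻¹) (g * y * g⁻¹) := by
  induction h with
  | refl => exact .refl
  | @tail a b hxa hab ih =>
    refine ih.tail ?_
    have ha : a ∈ D.H := le.mem hx hxa
    have hb : b ∈ D.H := hab.mem ha
    obtain ⟨t, ht, rfl, hl⟩ := hab
    refine ⟨g * t * g⁻¹, D.conj_mem g (D.Ω_sub g hg) t ht, by group, ?_⟩
    rwa [D.Ω_len g hg _ ha, D.Ω_len g hg _ hb]

/-! ### Non-lengthening shifts and minimal elements of conjugation-stable sets. -/

variable (D) in
/-- A cyclic shift that does not increase the length. -/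
def Move (y y' : G) : Prop :=
  (∃ s ∈ D.S, y' = s * y * s ∧ (D.len (s * y) < D.len y ∨ D.len (y * s) < D.len y)) ∨
    ∃ g ∈ D.Ω, y' = g * y * g⁻¹

variable (D) in
/-- Iterated cyclic shifts that do not increase the length. -/
def Red (y y' : G) : Prop := Relation.ReflTransGen D.Move y y'

theorem Red.trans {x y z : G} (h : D.Red x y) (h' : D.Red y z) : D.Red x z :=
  Relation.ReflTransGen.trans h h'

theorem Red.rfl {x : G} : D.Red x x := Relation.ReflTransGen.refl

theorem Move.red {x y : G} (h : D.Move x y) : D.Red x y := Relation.ReflTransGen.single h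

theorem len_left_mul {x s : G} (hx : x ∈ D.H) (hs : s ∈ D.S) :
    D.len (s * x) = D.len x + D.gap ∨ D.len (s * x) + D.gap = D.len x := by
  have h := D.len_mul x⁻¹ (inv_mem hx) s hs
  have e : x⁻¹ * s = (s * x)⁻¹ := by simp [mul_inv_rev, inv_eq_self (D.S_sub hs)]
  rwa [e, D.len_inv _ (mul_mem (S_mem hs) hx), D.len_inv _ hx] at h

theorem Move.len_le {y y' : G} (hy : y ∈ D.H) (h : D.Move y y') : D.len y' ≤ D.len y := by
  rcases h with ⟨s, hs, rfl, h⟩ | ⟨g, hg, rfl⟩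
  · have h1 := D.len_mul (s * y) (mul_mem (S_mem hs) hy) s hs
    have h2 := D.len_mul y hy s hs
    have h3 := len_left_mul hy hs
    have h4 := len_left_mul (mul_mem hy (S_mem hs)) hs
    rw [← mul_assoc] at h4
    omega
  · exact (D.Ω_len g hg y hy).le

theorem Move.mem {y y' : G} (hy : y ∈ D.H) (h : D.Move y y') : y' ∈ D.H := by
  rcases h with ⟨s, hs, rfl, h⟩ | ⟨g, hg, rfl⟩
  · exact mul_mem (mul_mem (S_mem hs) hy) (S_mem hs)
  · have := D.Ω_sub g hg
    exact mul_mem (mul_mem this hy) (inv_mem this)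

theorem Move.symm {y y' : G} (h : D.Move y y') (hl : D.len y' = D.len y) :
    D.Move y' y := by
  rcases h with ⟨s, hs, rfl, h⟩ | ⟨g, hg, rfl⟩
  · refine .inl ⟨s, hs, ?_, ?_⟩
    · rw [mul_assoc s y s, simple_mul_cancel hs, mul_simple_cancel hs]
    · rw [mul_simple_cancel hs, mul_assoc s y s, simple_mul_cancel hs, ← mul_assoc]
      omega
  · exact .inr ⟨g⁻¹, D.Ω_inv g hg, by group⟩

theorem Red.mem {y y' : G} (hy : y ∈ D.H) (h : D.Red y y') : y' ∈ D.H := by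
  induction h with
  | refl => exact hy
  | tail _ h ih => exact h.mem ih

theorem Red.len_le {y y' : G} (hy : y ∈ D.H) (h : D.Red y y') : D.len y' ≤ D.len y := by
  induction h with
  | refl => exact le_refl _
  | tail h1 h ih => exact (h.len_le (Red.mem hy h1)).trans ih

variable (D) in
/-- The elements of minimal length of a set. -/
def minSet (C : Set G) : Set G := {x | x ∈ C ∧ ∀ y ∈ C, D.len x ≤ D.len y}

variable (D) in
/-- Some element of minimal length of `C` lies below `y`. -/
def Below (C : Set G) (y : G) : Prop := ∃ x ∈ D.minSet C, D.le x y

variable (D) in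
/-- Stability under conjugation. -/
structure Stable (C : Set G) : Prop where
  sub : C ⊆ D.H
  simple : ∀ x ∈ C, ∀ s ∈ D.S, s * x * s ∈ C
  omega : ∀ x ∈ C, ∀ g ∈ D.Ω, g * x * g⁻¹ ∈ C

theorem Stable.move {C : Set G} (hC : D.Stable C) {y y' : G} (hy : y ∈ C) (h : D.Move y y') :
    y' ∈ C := by
  rcases h with ⟨s, hs, rfl, h⟩ | ⟨g, hg, rfl⟩
  · exact hC.simple y hy s hs
  · exact hC.omega y hy g hg

theorem Stable.red {C : Set G} (hC : D.Stable C) {y y' : G} (hy : y ∈ C) (h : D.Red y y') :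
    y' ∈ C := by
  induction h with
  | refl => exact hy
  | tail _ h ih => exact hC.move ih h

/-- The minimal element below `y` may have to be replaced by its own shift. That shift stays in `C`
and is not longer, hence it is minimal as well. -/
theorem Below.move {C : Set G} (hC : D.Stable C) {y y' : G} (h : D.Move y y')
    (hl : D.len y' = D.len y) (hb : D.Below C y) : D.Below C y' := by
  obtain ⟨x, ⟨hx, hmin⟩, hxy⟩ := hb
  have key : ∀ s ∈ D.S, ∀ x', (x' = x ∨ x' = s * x * s) → D.len x' ≤ D.len x →
      x' ∈ D.minSet C := by
    rintro s hs x' (rfl | rfl) hl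
    · exact ⟨hx, hmin⟩
    · exact ⟨hC.simple x hx s hs, fun z hz => hl.trans (hmin z hz)⟩
  rcases h with ⟨s, hs, rfl, h | h⟩ | ⟨g, hg, rfl⟩
  · obtain ⟨x', h1, h2, h3⟩ := hxy.shift_left hs (hC.sub hx) h hl
    exact ⟨x', key s hs x' h1 h2, h3⟩
  · obtain ⟨x', h1, h2, h3⟩ := hxy.shift_right hs (hC.sub hx) h hl
    exact ⟨x', key s hs x' h1 h2, h3⟩
  · refine ⟨g * x * g⁻¹, ⟨hC.omega x hx g hg, fun z hz => ?_⟩, hxy.conj hg (hC.sub hx)⟩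
    rw [D.Ω_len g hg x (hC.sub hx)]
    exact hmin z hz

theorem Red.minSet {C : Set G} (hC : D.Stable C) {y y' : G} (hy : y ∈ D.minSet C)
    (h : D.Red y y') : y' ∈ D.minSet C :=
  ⟨hC.red hy.1 h, fun z hz => (h.len_le (hC.sub hy.1)).trans (hy.2 z hz)⟩

/-- Starting from a minimal element no shift can shorten, so all moves preserve the length and can
be undone; `Below.move` then applies in both directions. -/
theorem Red.below_iff {C C' : Set G} (hC : D.Stable C) (hC' : D.Stable C') {y y' : G}
    (hy : y ∈ D.minSet C') (h : D.Red y y') : D.Below C y ↔ D.Below C y' := by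
  induction h with
  | refl => exact Iff.rfl
  | @tail a b h1 h ih =>
    have ha := Red.minSet hC' hy h1
    have hb : b ∈ D.minSet C' := Red.minSet hC' ha h.red
    have hl : D.len b = D.len a := le_antisymm (hb.2 _ ha.1) (ha.2 _ hb.1)
    exact ih.trans ⟨fun hb' => hb'.move hC h hl,
      fun hb' => hb'.move hC (h.symm hl) hl.symm⟩

/-- If all elements of minimal length of `C'` reduce to `y`, then `Below` is transitive along `C'`. -/
theorem Below.trans {C C' : Set G} (hC : D.Stable C) (hC' : D.Stable C') {y z : G}
    (hy : ∀ x ∈ D.minSet C', D.Red x y) (h : D.Below C y) (h' : D.Below C' z) : D.Below C z := by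
  obtain ⟨x', hx', hxz⟩ := h'
  obtain ⟨x, hx, hxy⟩ := ((hy x' hx').below_iff hC hC' hx').2 h
  exact ⟨x, hx, hxy.trans hxz⟩

theorem exists_minSet {C : Set G} (hC : C.Nonempty) : (D.minSet C).Nonempty := by
  obtain ⟨x, hx, h⟩ := exists_minimalFor_of_wellFoundedLT (· ∈ C) D.len hC
  exact ⟨x, hx, fun y hy => (le_total (D.len x) (D.len y)).elim id (fun h' => h hy h')⟩

end ShiftData

/-! ### Weighted inversion numbers -/

/-- The weighted number of inversions of a function `x` on a finite set `E` of integers. -/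
def invSum (E : Finset ℤ) (wt : ℤ → ℤ → ℕ) (x : ℤ → ℤ) : ℕ :=
  ∑ p ∈ (E ×ˢ E).filter (fun p => p.1 < p.2 ∧ x p.2 < x p.1), wt p.1 p.2

/-- The inversions of `x` that are reversed by `t`. -/
def revInv (E : Finset ℤ) (t x : ℤ → ℤ) : Finset (ℤ × ℤ) :=
  (E ×ˢ E).filter (fun p => (p.1 < p.2 ∧ x p.2 < x p.1) ∧ t p.2 < t p.1)

/-- The inversions of `x` whose order is kept by `t`. -/
def keepInv (E : Finset ℤ) (t x : ℤ → ℤ) : Finset (ℤ × ℤ) :=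
  (E ×ˢ E).filter (fun p => (p.1 < p.2 ∧ x p.2 < x p.1) ∧ ¬ t p.2 < t p.1)

section

variable {E : Finset ℤ} {wt : ℤ → ℤ → ℕ} {x t : ℤ → ℤ}

theorem invSum_eq_keep_add_rev : invSum E wt x =
    (∑ p ∈ keepInv E t x, wt p.1 p.2) + ∑ p ∈ revInv E t x, wt p.1 p.2 := by
  rw [invSum, keepInv, revInv, ← Finset.sum_filter_add_sum_filter_not _ (fun p => t p.2 < t p.1),
    Finset.filter_filter, Finset.filter_filter, add_comm]

/-- The bijection `(c, d) ↦ (t c, t d)` keeps weights and matches the inversions of `x ∘ t` whose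
order `t` keeps with those of `x`. Hence only the pairs reversed by `t` affect the change of length.
-/
theorem sum_keepInv_comp (ht : ∀ c, t (t c) = c) (hE : ∀ c ∈ E, t c ∈ E)
    (hwt : ∀ c ∈ E, ∀ d ∈ E, wt (t c) (t d) = wt c d) :
    ∑ p ∈ keepInv E t (x ∘ t), wt p.1 p.2 = ∑ p ∈ keepInv E t x, wt p.1 p.2 := by
  have hinj : ∀ c d, t c = t d → c = d := fun c d h => by rw [← ht c, h, ht]
  have key : ∀ y : ℤ → ℤ, ∀ p ∈ keepInv E t (y ∘ t), (t p.1, t p.2) ∈ keepInv E t y := by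
    intro y p hp
    simp only [keepInv, Finset.mem_filter, Finset.mem_product, Function.comp, ht] at hp ⊢
    have : t p.1 ≠ t p.2 := fun h => by have := hinj _ _ h; omega
    exact ⟨⟨hE _ hp.1.1, hE _ hp.1.2⟩, ⟨by omega, hp.2.1.2⟩, by omega⟩
  refine Finset.sum_nbij' (fun p => (t p.1, t p.2)) (fun p => (t p.1, t p.2)) (key x) ?_ ?_ ?_ ?_
  · intro p hp
    refine key (x ∘ t) p ?_
    convert hp using 1
    congr 1
    funext c
    simp [ht]
  · intro p _; simp [ht]
  · intro p _; simp [ht]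
  · intro p hp
    simp only [keepInv, Finset.mem_filter, Finset.mem_product] at hp
    exact (hwt _ hp.1.1 _ hp.1.2).symm

/-- Among the pairs reversed by `t`, the hypothesis `hrev` says that inversions of `x` remain
inversions of `x ∘ t`, while `(a, b)` is a new one of positive weight. -/
theorem invSum_lt_comp (ht : ∀ c, t (t c) = c) (hE : ∀ c ∈ E, t c ∈ E)
    (hwt : ∀ c ∈ E, ∀ d ∈ E, wt (t c) (t d) = wt c d) {a b : ℤ} (ha : a ∈ E) (hb : b ∈ E)
    (hab : a < b) (htab : t a = b) (hw : 0 < wt a b) (hx : x a < x b)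
    (hrev : ∀ c ∈ E, ∀ d ∈ E, c < d → t d < t c → x d < x c → x (t d) < x (t c)) :
    invSum E wt x < invSum E wt (x ∘ t) := by
  rw [invSum_eq_keep_add_rev (t := t), invSum_eq_keep_add_rev (t := t) (x := x ∘ t),
    sum_keepInv_comp ht hE hwt]
  have htba : t b = a := by rw [← htab, ht]
  refine Nat.add_lt_add_left (Finset.sum_lt_sum_of_subset (i := (a, b)) ?_ ?_ ?_ hw ?_) _
  · intro p hp
    simp only [revInv, Finset.mem_filter, Finset.mem_product, Function.comp] at hp ⊢
    exact ⟨hp.1, ⟨hp.2.1.1, hrev _ hp.1.1 _ hp.1.2 hp.2.1.1 hp.2.2 hp.2.1.2⟩, hp.2.2⟩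
  · simp only [revInv, Finset.mem_filter, Finset.mem_product, Function.comp, htab, htba]
    exact ⟨⟨ha, hb⟩, ⟨hab, hx⟩, hab⟩
  · simp only [revInv, Finset.mem_filter, Finset.mem_product]
    omega
  · intros; exact Nat.zero_le _

/-- When `Q` contains all reversed pairs of positive weight, and each of them is a non-inversion of
`x` that becomes an inversion, the increase is exactly the weight of `Q`. -/
theorem invSum_comp_eq (ht : ∀ c, t (t c) = c) (hE : ∀ c ∈ E, t c ∈ E)
    (hwt : ∀ c ∈ E, ∀ d ∈ E, wt (t c) (t d) = wt c d) (Q : Finset (ℤ × ℤ))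
    (hQ : ∀ c ∈ E, ∀ d ∈ E, c < d → t d < t c → 0 < wt c d → (c, d) ∈ Q)
    (hQ' : ∀ p ∈ Q, p.1 ∈ E ∧ p.2 ∈ E ∧ p.1 < p.2 ∧ t p.2 < t p.1 ∧ x p.1 < x p.2 ∧
      x (t p.2) < x (t p.1)) :
    invSum E wt (x ∘ t) = invSum E wt x + ∑ p ∈ Q, wt p.1 p.2 := by
  rw [invSum_eq_keep_add_rev (t := t), invSum_eq_keep_add_rev (t := t) (x := x),
    sum_keepInv_comp ht hE hwt, add_assoc]
  congr 1
  have h1 : ∑ p ∈ revInv E t x, wt p.1 p.2 = 0 := by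
    refine Finset.sum_eq_zero fun p hp => ?_
    simp only [revInv, Finset.mem_filter, Finset.mem_product] at hp
    by_contra hne
    have := hQ' p (hQ _ hp.1.1 _ hp.1.2 hp.2.1.1 hp.2.2 (Nat.pos_of_ne_zero hne))
    omega
  rw [h1, zero_add]
  symm
  refine Finset.sum_subset (fun p hp => ?_) (fun p hp hpQ => ?_)
  · have := hQ' p hp
    simp only [revInv, Finset.mem_filter, Finset.mem_product, Function.comp]
    tauto
  · simp only [revInv, Finset.mem_filter, Finset.mem_product, Function.comp] at hp
    by_contra hne
    exact hpQ (hQ _ hp.1.1 _ hp.1.2 hp.2.1.1 hp.2.2 (Nat.pos_of_ne_zero hne))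

end

/-- The pair `(c, d)` is an inversion of `f` exactly when `(f d, f c)` is one of its inverse. -/
theorem invSum_symm {E : Finset ℤ} {wt : ℤ → ℤ → ℕ} {f g : ℤ → ℤ} (hgf : ∀ c ∈ E, g (f c) = c)
    (hfg : ∀ c ∈ E, f (g c) = c)
    (hf : ∀ c ∈ E, f c ∈ E) (hg : ∀ c ∈ E, g c ∈ E)
    (hwt : ∀ c ∈ E, ∀ d ∈ E, wt (f d) (f c) = wt c d) :
    invSum E wt f = invSum E wt g := by
  refine Finset.sum_nbij' (fun p => (f p.2, f p.1)) (fun p => (g p.2, g p.1)) ?_ ?_ ?_ ?_ ?_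
  · intro p hp
    simp only [Finset.mem_filter, Finset.mem_product] at hp ⊢
    rw [hgf _ hp.1.1, hgf _ hp.1.2]
    exact ⟨⟨hf _ hp.1.2, hf _ hp.1.1⟩, hp.2.2, hp.2.1⟩
  · intro p hp
    simp only [Finset.mem_filter, Finset.mem_product] at hp ⊢
    rw [hfg _ hp.1.1, hfg _ hp.1.2]
    exact ⟨⟨hg _ hp.1.2, hg _ hp.1.1⟩, hp.2.2, hp.2.1⟩
  · intro p hp
    simp only [Finset.mem_filter, Finset.mem_product] at hp
    simp [hgf _ hp.1.1, hgf _ hp.1.2]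
  · intro p hp
    simp only [Finset.mem_filter, Finset.mem_product] at hp
    simp [hfg _ hp.1.1, hfg _ hp.1.2]
  · intro p hp
    simp only [Finset.mem_filter, Finset.mem_product] at hp
    exact (hwt _ hp.1.1 _ hp.1.2).symm

theorem invSum_eq_zero {E : Finset ℤ} {wt : ℤ → ℤ → ℕ} {x : ℤ → ℤ}
    (h : ∀ c ∈ E, ∀ d ∈ E, c < d → 0 < wt c d → x c ≤ x d) : invSum E wt x = 0 := by
  refine Finset.sum_eq_zero fun p hp => ?_
  simp only [Finset.mem_filter, Finset.mem_product] at hp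
  by_contra hne
  have := h _ hp.1.1 _ hp.1.2 hp.2.1 (Nat.pos_of_ne_zero hne)
  omega

theorem le_of_invSum_eq_zero {E : Finset ℤ} {wt : ℤ → ℤ → ℕ} {x : ℤ → ℤ} (h : invSum E wt x = 0)
    {c d : ℤ} (hc : c ∈ E) (hd : d ∈ E) (hcd : c < d) (hw : 0 < wt c d) : x c ≤ x d := by
  by_contra! hlt
  rw [invSum, Finset.sum_eq_zero_iff] at h
  have := h (c, d) (by simp [hc, hd, hcd, hlt])
  simp at this
  omega

/-! ### Crossing numbers, a monotone statistic for the Bruhat order. -/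

/-- The number of `a ≤ i` in `E` with `x a > j`. -/
def crossing (E : Finset ℤ) (x : ℤ → ℤ) (i j : ℤ) : ℕ :=
  (E.filter (fun a => a ≤ i ∧ j < x a)).card

/-- The exchange moves the larger value to the left. If `b ≤ i`, both positions are counted and the
swap is a bijection of the counted labels. If `i < b`, the only value that changes at a counted
position is that at `a`, and it grows. -/
theorem crossing_le_comp_swap {E : Finset ℤ} {x : ℤ → ℤ} {a b : ℤ} (ha : a ∈ E) (hb : b ∈ E)
    (hab : a < b) (hx : x a < x b) (i j : ℤ) :
    crossing E x i j ≤ crossing E (x ∘ Equiv.swap a b) i j := by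
  by_cases hbi : b ≤ i
  · refine Finset.card_le_card_of_injOn (Equiv.swap a b) ?_ (Equiv.swap a b).injective.injOn
    intro c hc
    simp only [Finset.coe_filter, Set.mem_ofPred_eq, Function.comp, Equiv.swap_apply_self] at hc ⊢
    refine ⟨?_, ?_, hc.2.2⟩ <;> rw [Equiv.swap_apply_def] <;> split_ifs <;> first | tauto | omega
  · refine Finset.card_le_card fun c hc => ?_
    simp only [Finset.mem_filter, Function.comp] at hc ⊢
    refine ⟨hc.1, hc.2.1, ?_⟩
    rw [Equiv.swap_apply_def]
    split_ifs with h1 h2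
    · subst h1; omega
    · omega
    · exact hc.2.2

/-! ### Signed permutations -/

/-- The nonzero labels of absolute value at most `n`. -/
noncomputable def signedLabels (n : ℕ) : Finset ℤ := (Finset.Icc (-(n : ℤ)) n).erase 0

theorem mem_signedLabels {n : ℕ} {a : ℤ} : a ∈ signedLabels n ↔ a ≠ 0 ∧ -(n : ℤ) ≤ a ∧ a ≤ n := by
  simp [signedLabels]

theorem signedPerm_apply_le {n : ℕ} {x : Equiv.Perm ℤ} (hx : x ∈ signedPerm n) {a : ℤ}
    (h1 : -(n : ℤ) ≤ a) (h2 : a ≤ n) : -(n : ℤ) ≤ x a ∧ x a ≤ n := by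
  by_contra hn
  have h3 : (n : ℤ) < |x a| := by
    rw [lt_abs]
    omega
  have h4 := x.injective (hx.2 _ h3)
  rw [h4, lt_abs] at h3
  omega

theorem signedPerm_apply_mem {n : ℕ} {x : Equiv.Perm ℤ} (hx : x ∈ signedPerm n) {a : ℤ}
    (ha : a ∈ signedLabels n) : x a ∈ signedLabels n := by
  rw [mem_signedLabels] at *
  exact ⟨signedPerm_apply_ne_zero hx ha.1, signedPerm_apply_le hx ha.2.1 ha.2.2⟩

theorem signedPerm_mono {m n : ℕ} (h : m ≤ n) : signedPerm m ≤ signedPerm n :=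
  fun x hx => ⟨hx.1, fun i hi => hx.2 i (by omega)⟩

theorem signedPerm_apply_of_lt {n : ℕ} {x : Equiv.Perm ℤ} (hx : x ∈ signedPerm n) {a : ℤ}
    (ha : (n : ℤ) < a ∨ a < -(n : ℤ)) : x a = a := hx.2 a (by rw [lt_abs]; omega)

/-- Two signed permutations agreeing on positive labels are equal. -/
theorem signedPerm_ext {n : ℕ} {x y : Equiv.Perm ℤ} (hx : x ∈ signedPerm n)
    (hy : y ∈ signedPerm n) (h : ∀ i : ℤ, 1 ≤ i → i ≤ n → x i = y i) : x = y := by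
  have h' : ∀ i : ℤ, 0 < i → x i = y i := fun i hi => by
    by_cases hin : i ≤ n
    · exact h i (by omega) hin
    · rw [signedPerm_apply_of_lt hx (by omega), signedPerm_apply_of_lt hy (by omega)]
  ext i
  rcases lt_trichotomy i 0 with hi | rfl | hi
  · have := h' (-i) (by omega)
    rw [hx.1, hy.1] at this
    omega
  · rw [signedPerm_apply_zero hx, signedPerm_apply_zero hy]
  · exact h' i hi

/-- The reflection exchanging `a` and `b` and also `-a` and `-b`. -/
def signedSwap (a b : ℤ) : Equiv.Perm ℤ :=
  if a = -b then Equiv.swap a b else Equiv.swap a b * Equiv.swap (-a) (-b)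

theorem signedSwap_apply {a b : ℤ} (ha : a ≠ 0) (hb : b ≠ 0) (hab : a ≠ b) (x : ℤ) :
    signedSwap a b x = if x = a then b else if x = b then a else if x = -a then -b else
      if x = -b then -a else x := by
  unfold signedSwap
  split_ifs <;> simp only [Equiv.Perm.mul_apply, Equiv.swap_apply_def] <;> split_ifs <;> omega

theorem signedSwap_mem {n : ℕ} {a b : ℤ} (ha : a ∈ signedLabels n) (hb : b ∈ signedLabels n)
    (hab : a ≠ b) : signedSwap a b ∈ signedPerm n := by
  rw [mem_signedLabels] at ha hb
  refine ⟨fun i => ?_, fun i hi => ?_⟩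
  · rw [signedSwap_apply ha.1 hb.1 hab, signedSwap_apply ha.1 hb.1 hab]
    split_ifs <;> omega
  · rw [lt_abs] at hi
    rw [signedSwap_apply ha.1 hb.1 hab]
    split_ifs <;> omega

theorem signedSwap_sq {a b : ℤ} (ha : a ≠ 0) (hb : b ≠ 0) (hab : a ≠ b) :
    signedSwap a b * signedSwap a b = 1 := by
  ext x
  rw [Equiv.Perm.mul_apply, signedSwap_apply ha hb hab, signedSwap_apply ha hb hab]
  simp only [Equiv.Perm.one_apply]
  split_ifs <;> omega

theorem conj_signedSwap {n : ℕ} {g : Equiv.Perm ℤ} (hg : g ∈ signedPerm n) (a b : ℤ) :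
    g * signedSwap a b * g⁻¹ = signedSwap (g a) (g b) := by
  have h : a = -b ↔ g a = - g b := by rw [← hg.1]; exact g.injective.eq_iff.symm
  have hs : ∀ c d, g * Equiv.swap c d * g⁻¹ = Equiv.swap (g c) (g d) := fun c d =>
    (Equiv.swap_apply_apply g c d).symm
  unfold signedSwap
  by_cases hab : a = -b
  · rw [if_pos hab, if_pos (h.1 hab), hs]
  · rw [if_neg hab, if_neg (mt h.2 hab), ← hg.1, ← hg.1, ← hs, ← hs]
    group

/-! ### Lengths of signed permutations as weighted inversion numbers. -/

/-- The weight of a pair of labels: `κ` on opposite labels and `1` otherwise. -/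
def signedWt (κ : ℕ) (c d : ℤ) : ℕ := if c = -d then κ else 1

theorem signedWt_apply {n κ : ℕ} {x : Equiv.Perm ℤ} (hx : x ∈ signedPerm n) (c d : ℤ) :
    signedWt κ (x c) (x d) = signedWt κ c d := by
  have h : c = -d ↔ x c = - x d := by rw [← hx.1]; exact x.injective.eq_iff.symm
  simp [signedWt, h]

theorem signedWt_symm (κ : ℕ) (c d : ℤ) : signedWt κ c d = signedWt κ d c := by
  simp only [signedWt, show c = -d ↔ d = -c by omega]

/-- Twice the length of a signed permutation, in type `B` for `κ = 2` and in type `D` for `κ = 0`. -/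
noncomputable def signedLen (n κ : ℕ) (x : Equiv.Perm ℤ) : ℕ := invSum (signedLabels n) (signedWt κ) x

theorem signedLen_inv {n κ : ℕ} {x : Equiv.Perm ℤ} (hx : x ∈ signedPerm n) :
    signedLen n κ x⁻¹ = signedLen n κ x := by
  refine (invSum_symm (fun c _ => by simp) (fun c _ => by simp)
    (fun c hc => signedPerm_apply_mem hx hc) (fun c hc => signedPerm_apply_mem (inv_mem hx) hc)
    (fun c _ d _ => ?_)).symm
  rw [signedWt_apply hx, signedWt_symm]

theorem signedLen_lt {n κ : ℕ} {x : Equiv.Perm ℤ} (hx : x ∈ signedPerm n) {a b : ℤ}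
    (ha : a ∈ signedLabels n) (hb : b ∈ signedLabels n) (hab : a < b) (hw : 0 < signedWt κ a b)
    (h : x a < x b) : signedLen n κ x < signedLen n κ (x * signedSwap a b) := by
  have hs := signedSwap_mem ha hb hab.ne
  have ha0 := (mem_signedLabels.1 ha).1
  have hb0 := (mem_signedLabels.1 hb).1
  have e := signedSwap_apply ha0 hb0 hab.ne
  refine invSum_lt_comp (t := signedSwap a b) (fun c => ?_)
    (fun c hc => signedPerm_apply_mem hs hc) (fun c _ d _ => signedWt_apply hs c d) ha hb hab
    (by simp [e]) hw h ?_
  · rw [← Equiv.Perm.mul_apply, signedSwap_sq ha0 hb0 hab.ne, Equiv.Perm.one_apply]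
  -- A pair reversed by the reflection contains one of `±a`, `±b`. Each case follows from `x a < x
  -- b` and from `x` commuting with negation.
  · intro c hc d hd hcd
    have h1 := hx.1 a
    have h2 := hx.1 b
    have h3 := hx.1 c
    have h4 := hx.1 d
    rw [e, e]
    split_ifs <;> subst_vars <;> intros <;> simp only [hx.1, neg_neg] at * <;> omega

theorem signedLen_lt_iff {n κ : ℕ} {x : Equiv.Perm ℤ} (hx : x ∈ signedPerm n) {a b : ℤ}
    (ha : a ∈ signedLabels n) (hb : b ∈ signedLabels n) (hab : a < b) (hw : 0 < signedWt κ a b) :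
    signedLen n κ x < signedLen n κ (x * signedSwap a b) ↔ x a < x b := by
  refine ⟨fun h => ?_, signedLen_lt hx ha hb hab hw⟩
  by_contra hn
  have ha0 := (mem_signedLabels.1 ha).1
  have hb0 := (mem_signedLabels.1 hb).1
  have e := signedSwap_apply ha0 hb0 hab.ne
  have hne : x a ≠ x b := fun h => hab.ne (x.injective h)
  have := signedLen_lt (κ := κ) (mul_mem hx (signedSwap_mem ha hb hab.ne)) ha hb hab hw
    (by simp [e, hab.ne']; omega)
  rw [mul_assoc, signedSwap_sq ha0 hb0 hab.ne, mul_one] at this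
  omega

/-- The pairs `a < b` for which `signedSwap a b` is a simple reflection. -/
def SimplePair (n κ : ℕ) (a b : ℤ) : Prop :=
  (1 ≤ a ∧ b = a + 1 ∧ b ≤ n) ∨ (κ = 2 ∧ 1 ≤ n ∧ a = -1 ∧ b = 1) ∨
    (κ = 0 ∧ 2 ≤ n ∧ a = -1 ∧ b = 2)

theorem SimplePair.mem {n κ : ℕ} {a b : ℤ} (h : SimplePair n κ a b) :
    a ∈ signedLabels n ∧ b ∈ signedLabels n ∧ a < b ∧ 0 < signedWt κ a b := by
  simp only [mem_signedLabels, signedWt]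
  rcases h with ⟨h1, rfl, h2⟩ | ⟨rfl, h1, rfl, rfl⟩ | ⟨rfl, h1, rfl, rfl⟩
  · rw [if_neg (by omega)]; omega
  · simp; omega
  · simp; omega

/-- In type D the reflection in `(-1, 2)` also reverses the opposite pairs `(-1, 1)` and `(-2, 2)`;
these have weight zero, which is why positivity of the weight is assumed. -/
theorem SimplePair.eq_of_rev {n κ : ℕ} {a b : ℤ} (h : SimplePair n κ a b) {c d : ℤ}
    (hc : c ≠ 0) (hd : d ≠ 0) (hcd : c < d) (hr : signedSwap a b d < signedSwap a b c)
    (hw : 0 < signedWt κ c d) : (c = a ∧ d = b) ∨ (c = -b ∧ d = -a) := by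
  obtain ⟨ha, hb, hab, -⟩ := h.mem
  rw [mem_signedLabels] at ha hb
  rw [signedSwap_apply ha.1 hb.1 hab.ne, signedSwap_apply ha.1 hb.1 hab.ne] at hr
  unfold signedWt at hw
  unfold SimplePair at h
  split_ifs at hr hw <;> omega

/-- The pairs `(a, b)` and `(-b, -a)` have total weight 2. They coincide only for the sign change of
type B, where the single opposite pair has weight `κ = 2`. So every simple reflection changes
`signedLen` by 2, which is why it is twice the length. -/
theorem signedLen_mul_simple {n κ : ℕ} {x : Equiv.Perm ℤ} (hx : x ∈ signedPerm n) {a b : ℤ}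
    (hs : SimplePair n κ a b) (h : x a < x b) :
    signedLen n κ (x * signedSwap a b) = signedLen n κ x + 2 := by
  obtain ⟨ha, hb, hab, -⟩ := hs.mem
  have hm := signedSwap_mem ha hb hab.ne
  have ha0 := (mem_signedLabels.1 ha)
  have hb0 := (mem_signedLabels.1 hb)
  have e := signedSwap_apply ha0.1 hb0.1 hab.ne
  have := invSum_comp_eq (x := x) (t := signedSwap a b) (E := signedLabels n)
    (wt := signedWt κ) (fun c => ?_)
    (fun c hc => signedPerm_apply_mem hm hc) (fun c _ d _ => signedWt_apply hm c d)
    {(a, b), (-b, -a)} ?_ ?_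
  · refine this.trans (congrArg _ ?_)
    by_cases hab' : a = -b
    · have : ((-b, -a) : ℤ × ℤ) = (a, b) := by ext <;> simp <;> omega
      rw [this, Finset.pair_eq_singleton, Finset.sum_singleton]
      unfold SimplePair at hs
      rw [signedWt, if_pos hab']
      omega
    · rw [Finset.sum_pair (by simp; omega)]
      simp only [signedWt]
      rw [if_neg (by omega), if_neg (by omega)]
  · rw [← Equiv.Perm.mul_apply, signedSwap_sq ha0.1 hb0.1 hab.ne, Equiv.Perm.one_apply]
  · intro c hc d hd hcd hr hw
    simpa using hs.eq_of_rev (mem_signedLabels.1 hc).1 (mem_signedLabels.1 hd).1 hcd hr hw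
  · intro p hp
    simp only [Finset.mem_insert, Finset.mem_singleton] at hp
    rcases hp with rfl | rfl
    · have e1 : signedSwap a b a = b := by simp [e]
      have e2 : signedSwap a b b = a := by simp [e, hab.ne']
      simp only [e1, e2]
      exact ⟨ha, hb, hab, hab, h, h⟩
    · have e1 : signedSwap a b (-a) = -b := by rw [hm.1]; simp [e]
      have e2 : signedSwap a b (-b) = -a := by rw [hm.1]; simp [e, hab.ne']
      simp only [e1, e2, hx.1, mem_signedLabels]
      omega

theorem signChange_eq : signChange = signedSwap (-1) 1 := by
  rw [signChange, signedSwap, if_pos rfl, Equiv.swap_comm]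

theorem signChange_apply (x : ℤ) : signChange x = if x = 1 then -1 else if x = -1 then 1 else x := by
  rw [signChange, Equiv.swap_apply_def]

theorem signChange_mem {n : ℕ} (hn : 1 ≤ n) : signChange ∈ signedPerm n := by
  rw [signChange_eq]
  exact signedSwap_mem (by simp [mem_signedLabels]; omega) (by simp [mem_signedLabels]; omega)
    (by norm_num)

theorem signChange_inv : signChange⁻¹ = signChange := Equiv.swap_inv _ _

/-- The only pair of labels reversed by `δ` is `(-1, 1)`, of weight zero in type D. -/
theorem signedLen_mul_signChange {n : ℕ} (hn : 1 ≤ n) (x : Equiv.Perm ℤ) :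
    signedLen n 0 (x * signChange) = signedLen n 0 x := by
  have hm := signChange_mem hn
  have := invSum_comp_eq (x := x) (t := signChange) (E := signedLabels n)
    (wt := signedWt 0) (fun c => ?_)
    (fun c hc => signedPerm_apply_mem hm hc) (fun c _ d _ => signedWt_apply hm c d) ∅ ?_ (by simp)
  · exact this.trans (by rw [Finset.sum_empty]; rfl)
  · by_cases h1 : c = 1
    · subst h1; simp [signChange_apply]
    · by_cases h2 : c = -1
      · subst h2; simp [signChange_apply]
      · simp [signChange_apply, h1, h2]
  · intro c hc d hd hcd hr hw
    rw [mem_signedLabels] at hc hd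
    simp only [signChange_apply, signedWt] at hr hw
    split_ifs at hr hw <;> omega

theorem signedLen_conj_signChange {n : ℕ} (hn : 1 ≤ n) {x : Equiv.Perm ℤ}
    (hx : x ∈ signedPerm n) :
    signedLen n 0 (signChange * x * signChange⁻¹) = signedLen n 0 x := by
  have hm := signChange_mem hn
  rw [signChange_inv, signedLen_mul_signChange hn, ← signedLen_inv (mul_mem hm hx), mul_inv_rev,
    signChange_inv, signedLen_mul_signChange hn, signedLen_inv hx]

/-- The signed permutations with the reflections, length and Bruhat order of type `B` (`κ = 2`)
or `D` (`κ = 0`). In type `D`, the sign change has length zero. -/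
noncomputable def signedData (n κ : ℕ) : ShiftData (Equiv.Perm ℤ) where
  H := signedPerm n
  S := {s | ∃ a b, SimplePair n κ a b ∧ s = signedSwap a b}
  T := {t | ∃ a ∈ signedLabels n, ∃ b ∈ signedLabels n, a < b ∧ 0 < signedWt κ a b ∧
    t = signedSwap a b}
  Ω := {g | κ = 0 ∧ 1 ≤ n ∧ g = signChange}
  len := signedLen n κ
  gap := 2
  S_sub := by
    rintro s ⟨a, b, h, rfl⟩
    exact ⟨a, h.mem.1, b, h.mem.2.1, h.mem.2.2.1, h.mem.2.2.2, rfl⟩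
  T_sub := by
    rintro t ⟨a, ha, b, hb, hab, -, rfl⟩
    exact signedSwap_mem ha hb hab.ne
  sq := by
    rintro t ⟨a, ha, b, hb, hab, -, rfl⟩
    exact signedSwap_sq (mem_signedLabels.1 ha).1 (mem_signedLabels.1 hb).1 hab.ne
  conj_mem := by
    rintro g hg t ⟨a, ha, b, hb, hab, hw, rfl⟩
    rw [conj_signedSwap hg]
    have ha' := signedPerm_apply_mem hg ha
    have hb' := signedPerm_apply_mem hg hb
    rw [← signedWt_apply hg] at hw
    rcases lt_trichotomy (g a) (g b) with h | h | h
    · exact ⟨_, ha', _, hb', h, hw, rfl⟩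
    · exact absurd (g.injective h) hab.ne
    · refine ⟨_, hb', _, ha', h, by rwa [signedWt_symm], ?_⟩
      ext i
      rw [signedSwap_apply (mem_signedLabels.1 ha').1 (mem_signedLabels.1 hb').1 h.ne',
        signedSwap_apply (mem_signedLabels.1 hb').1 (mem_signedLabels.1 ha').1 h.ne]
      split_ifs <;> omega
  Ω_sub := by
    rintro g ⟨-, hn, rfl⟩
    exact signChange_mem hn
  Ω_inv := by
    rintro g ⟨h, hn, rfl⟩
    exact ⟨h, hn, signChange_inv⟩
  Ω_len := by
    rintro g ⟨rfl, hn, rfl⟩ x hx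
    exact signedLen_conj_signChange hn hx
  gap_pos := two_pos
  len_inv := fun x hx => signedLen_inv hx
  len_mul := by
    rintro x hx s ⟨a, b, h, rfl⟩
    obtain ⟨ha, hb, hab, -⟩ := h.mem
    have ha0 := (mem_signedLabels.1 ha)
    have hb0 := (mem_signedLabels.1 hb)
    have hne : x a ≠ x b := fun h => hab.ne (x.injective h)
    rcases lt_or_gt_of_ne hne with h' | h'
    · exact .inl (signedLen_mul_simple hx h h')
    · right
      have := signedLen_mul_simple (mul_mem hx (signedSwap_mem ha hb hab.ne)) h
        (by simp [signedSwap_apply ha0.1 hb0.1 hab.ne, hab.ne', h'])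
      rw [mul_assoc, signedSwap_sq ha0.1 hb0.1 hab.ne, mul_one] at this
      exact this.symm
  len_exch := by
    rintro x hx s ⟨a, b, h, rfl⟩ t ⟨c, hc, d, hd, hcd, hw, rfl⟩ hst hlt
    obtain ⟨ha, hb, hab, -⟩ := h.mem
    have ha0 := (mem_signedLabels.1 ha)
    have hb0 := (mem_signedLabels.1 hb)
    have hm := signedSwap_mem ha hb hab.ne
    have hsq := signedSwap_sq ha0.1 hb0.1 hab.ne
    have hinv : (signedSwap a b)⁻¹ = signedSwap a b := inv_eq_of_mul_eq_one_left hsq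
    rw [signedLen_lt_iff hx hc hd hcd hw] at hlt
    -- A simple reflection reverses no weighted pair except its own and the negated one, and both
    -- describe the reflection `s` itself. So a different `t` keeps its orientation, and `x t s` is
    -- `x s` times the conjugated reflection.
    have h1 : signedSwap a b c < signedSwap a b d := by
      by_contra hn
      have hne : signedSwap a b c ≠ signedSwap a b d := fun h => hcd.ne (Equiv.injective _ h)
      rcases h.eq_of_rev (mem_signedLabels.1 hc).1 (mem_signedLabels.1 hd).1 hcd (by omega) hw with ⟨rfl, rfl⟩ | ⟨rfl, rfl⟩
      · exact hst rfl
      · refine hst ?_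
        ext i
        rw [signedSwap_apply (by omega) (by omega) (by omega), signedSwap_apply (by omega)
          (by omega) (by omega)]
        split_ifs <;> omega
    have e : x * signedSwap c d * signedSwap a b =
        x * signedSwap a b * signedSwap (signedSwap a b c) (signedSwap a b d) := by
      rw [← conj_signedSwap hm, hinv, ← mul_assoc, ← mul_assoc, mul_assoc x (signedSwap a b), hsq,
        mul_one]
    have e' : ∀ c, signedSwap a b (signedSwap a b c) = c := fun c => by
      rw [← Equiv.Perm.mul_apply, hsq, Equiv.Perm.one_apply]
    rw [e]
    refine signedLen_lt (mul_mem hx hm) (signedPerm_apply_mem hm hc) (signedPerm_apply_mem hm hd)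
      h1 (by rwa [signedWt_apply hm]) ?_
    simpa [e'] using hlt

/-! ### Products of negative cycles on intervals -/

/-- The negative cycle `m + 1 → m + 2 → ⋯ → m + b → -(m + 1)`. -/
def negBlock (m b : ℕ) : Equiv.Perm ℤ where
  toFun x := if (m : ℤ) < x ∧ x < m + b then x + 1 else if x = m + b ∧ 0 < b then -(m + 1) else
    if -(m + b : ℤ) < x ∧ x < -m then x - 1 else if x = -(m + b) ∧ 0 < b then m + 1 else x
  invFun x := if (m : ℤ) + 1 < x ∧ x ≤ m + b then x - 1 else if x = m + 1 ∧ 0 < b then -(m + b) else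
    if -(m + b : ℤ) ≤ x ∧ x < -(m + 1) then x + 1 else if x = -(m + 1) ∧ 0 < b then m + b else x
  left_inv x := by dsimp only; split_ifs <;> omega
  right_inv x := by dsimp only; split_ifs <;> omega

theorem negBlock_apply (m b : ℕ) (x : ℤ) : negBlock m b x =
    if (m : ℤ) < x ∧ x < m + b then x + 1 else if x = m + b ∧ 0 < b then -(m + 1) else
    if -(m + b : ℤ) < x ∧ x < -m then x - 1 else if x = -(m + b) ∧ 0 < b then m + 1 else x := rfl

theorem negBlock_apply_of_le {m b : ℕ} {x : ℤ} (h1 : -(m : ℤ) ≤ x) (h2 : x ≤ m) :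
    negBlock m b x = x := by
  rw [negBlock_apply]; split_ifs <;> omega

theorem negBlock_apply_of_gt {m b : ℕ} {x : ℤ} (h : (m + b : ℤ) < x ∨ x < -(m + b : ℤ)) :
    negBlock m b x = x := by
  rw [negBlock_apply]; split_ifs <;> omega

theorem negBlock_apply_mid {m b : ℕ} {x : ℤ} (h1 : (m : ℤ) < x) (h2 : x < m + b) :
    negBlock m b x = x + 1 := by
  rw [negBlock_apply]; split_ifs <;> omega

theorem negBlock_apply_top {m b : ℕ} (hb : 0 < b) : negBlock m b (m + b) = -(m + 1) := by
  rw [negBlock_apply]; split_ifs <;> omega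

theorem negBlock_mem {m b n : ℕ} (h : m + b ≤ n) : negBlock m b ∈ signedPerm n := by
  refine ⟨fun x => ?_, fun x hx => ?_⟩
  · rw [negBlock_apply, negBlock_apply]; split_ifs <;> omega
  · rw [lt_abs] at hx
    exact negBlock_apply_of_gt (by omega)

@[simp] theorem negBlock_zero (m : ℕ) : negBlock m 0 = 1 := by
  ext x
  rw [negBlock_apply, Equiv.Perm.one_apply]; split_ifs <;> omega

theorem signedPerm_commute_negBlock {m b : ℕ} {u : Equiv.Perm ℤ} (hu : u ∈ signedPerm m) :
    Commute u (negBlock m b) := by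
  ext x
  rw [Equiv.Perm.mul_apply, Equiv.Perm.mul_apply]
  by_cases hx : -(m : ℤ) ≤ x ∧ x ≤ m
  · have := signedPerm_apply_le hu hx.1 hx.2
    rw [negBlock_apply_of_le hx.1 hx.2, negBlock_apply_of_le this.1 this.2]
  · rw [signedPerm_apply_of_lt hu (a := x) (by omega), signedPerm_apply_of_lt hu]
    rw [negBlock_apply]; split_ifs <;> omega

/-- Appending a label on the outside of a negative cycle is multiplication by an adjacent
reflection; this drives the length count by induction on `b`. -/
theorem negBlock_succ (m b : ℕ) (hb : 0 < b) :
    negBlock m (b + 1) = negBlock m b * signedSwap (m + b) (m + b + 1) := by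
  refine signedPerm_ext (n := m + b + 1) (negBlock_mem (by omega))
    (mul_mem (negBlock_mem (by omega)) (signedSwap_mem ?_ ?_ (by omega))) fun i hi hi' => ?_
  · rw [mem_signedLabels]; push_cast; omega
  · rw [mem_signedLabels]; push_cast; omega
  · rw [Equiv.Perm.mul_apply, signedSwap_apply (by omega) (by omega) (by omega)]
    push_cast at hi'
    by_cases h1 : i = m + b
    · subst h1
      rw [if_pos rfl, negBlock_apply_of_gt (b := b) (by omega),
        negBlock_apply_mid (b := b + 1) (by omega) (by push_cast; omega)]
    · by_cases h2 : i = m + b + 1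
      · subst h2
        rw [if_neg (by omega), if_pos rfl, negBlock_apply_top hb]
        have := negBlock_apply_top (m := m) (b := b + 1) (by omega)
        push_cast at this
        rw [add_assoc]
        exact this
      · rw [if_neg h1, if_neg h2, if_neg (by omega), if_neg (by omega)]
        by_cases h3 : i ≤ m
        · rw [negBlock_apply_of_le (by omega) h3, negBlock_apply_of_le (by omega) h3]
        · rw [negBlock_apply_mid (by omega) (by push_cast; omega),
            negBlock_apply_mid (by omega) (by omega)]

theorem negBlock_one_apply (m : ℕ) (x : ℤ) : negBlock m 1 x =
    if x = m + 1 then -((m : ℤ) + 1) else if x = -((m : ℤ) + 1) then (m : ℤ) + 1 else x := by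
  rw [negBlock_apply, Nat.cast_one]
  split_ifs <;> omega

theorem negBlock_zero_one : negBlock 0 1 = signChange := by
  ext x
  rw [negBlock_one_apply, signChange_apply]
  norm_num

theorem negBlock_one_succ (m : ℕ) : negBlock (m + 1) 1 =
    signedSwap (m + 1) (m + 2) * negBlock m 1 * signedSwap (m + 1) (m + 2) := by
  ext x
  rw [Equiv.Perm.mul_apply, Equiv.Perm.mul_apply,
    signedSwap_apply (by omega) (by omega) (by omega),
    signedSwap_apply (by omega) (by omega) (by omega), negBlock_one_apply, negBlock_one_apply,
    Nat.cast_add, Nat.cast_one]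
  by_cases h1 : x = m + 1
  · rw [if_pos h1]; split_ifs <;> omega
  by_cases h2 : x = m + 2
  · rw [if_neg h1, if_pos h2]; split_ifs <;> omega
  by_cases h3 : x = -(m + 1)
  · rw [if_neg h1, if_neg h2, if_pos h3]; split_ifs <;> omega
  by_cases h4 : x = -(m + 2)
  · rw [if_neg h1, if_neg h2, if_neg h3, if_pos h4]; split_ifs <;> omega
  · rw [if_neg h1, if_neg h2, if_neg h3, if_neg h4]; split_ifs <;> omega

/-- The sign change at `m + 1` is that at 1 conjugated by `m` adjacent reflections. Since `y (m +
1)` exceeds all values on `[-m, m]`, each of the `2m` reflections lengthens, adding 2, and the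
central sign change adds `κ`. -/
theorem signedLen_mul_negBlock_one {n κ : ℕ} (hκ : κ = 0 ∨ κ = 2) (m : ℕ) (hm : m + 1 ≤ n)
    {y : Equiv.Perm ℤ} (hy : y ∈ signedPerm n)
    (h : ∀ i : ℤ, -(m : ℤ) ≤ i → i ≤ m → y i < y (m + 1)) :
    signedLen n κ (y * negBlock m 1) = signedLen n κ y + 4 * m + κ := by
  induction m generalizing y with
  | zero =>
    rw [negBlock_zero_one]
    rcases hκ with rfl | rfl
    · rw [signedLen_mul_signChange (by omega)]; rfl
    · rw [signChange_eq, signedLen_mul_simple hy (.inr (.inl ⟨rfl, by omega, rfl, rfl⟩))]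
      have h0 := h 0 (by simp) (by simp)
      have := signedPerm_apply_zero hy
      rw [hy.1]
      simp only [Nat.cast_zero, zero_add] at h0
      omega
  | succ m ih =>
    have hs : SimplePair n κ (m + 1) (m + 2) := .inl ⟨by omega, by ring, by push_cast at *; omega⟩
    have hsm := signedSwap_mem hs.mem.1 hs.mem.2.1 hs.mem.2.2.1.ne
    have e := signedSwap_apply (a := m + 1) (b := m + 2) (by omega) (by omega) (by omega)
    push_cast at h
    have e1 : (m : ℤ) + 1 + 1 = m + 2 := by ring
    rw [e1] at h
    have hb := negBlock_mem (m := m) (b := 1) (n := n) (by omega)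
    have hy1 := mul_mem hy hsm
    have hy2 := mul_mem hy1 hb
    have h1 : (y * signedSwap (m + 1) (m + 2)) (m + 1) = y (m + 2) := by
      rw [Equiv.Perm.mul_apply, e, if_pos rfl]
    have h2 : (y * signedSwap (m + 1) (m + 2)) (m + 2) = y (m + 1) := by
      rw [Equiv.Perm.mul_apply, e, if_neg (by omega), if_pos rfl]
    rw [negBlock_one_succ, ← mul_assoc, ← mul_assoc, signedLen_mul_simple hy2 hs,
      ih (by omega) hy1, signedLen_mul_simple hy hs]
    · ring
    · exact h _ (by omega) (by omega)
    · intro i hi hi'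
      rw [h1, Equiv.Perm.mul_apply, e, if_neg (by omega), if_neg (by omega), if_neg (by omega),
        if_neg (by omega)]
      exact h i (by omega) (by omega)
    · rw [Equiv.Perm.mul_apply, Equiv.Perm.mul_apply _ (negBlock m 1) (m + 2 : ℤ),
        negBlock_apply_of_gt (x := m + 2) (by push_cast; omega), h2,
        show negBlock m 1 (m + 1) = -(m + 1) from negBlock_apply_top one_pos, hy1.1, h1]
      have := h (-(m + 1)) (by omega) (by omega)
      rw [hy.1] at this
      omega

/-- The sign change at `m + 1` adds `4m + κ`, and each of the remaining `b - 1` labels adds 2. The 2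
on the left avoids a truncated subtraction. -/
theorem signedLen_mul_negBlock {n κ : ℕ} (hκ : κ = 0 ∨ κ = 2) {m b : ℕ} (hb : 0 < b)
    (hm : m + b ≤ n) {u : Equiv.Perm ℤ} (hu : u ∈ signedPerm m) :
    signedLen n κ (u * negBlock m b) + 2 = signedLen n κ u + 4 * m + 2 * b + κ := by
  have hu' := signedPerm_mono (show m ≤ n by omega) hu
  induction b, hb using Nat.le_induction with
  | base =>
    rw [signedLen_mul_negBlock_one hκ m hm hu' fun i hi hi' => ?_]
    · ring
    · rw [signedPerm_apply_of_lt hu (a := m + 1) (by omega)]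
      have := signedPerm_apply_le hu hi hi'
      omega
  | succ b hb ih =>
    have hs : SimplePair n κ (m + b) (m + b + 1) :=
      .inl ⟨by omega, by ring, by push_cast at *; omega⟩
    rw [negBlock_succ m b hb, ← mul_assoc,
      signedLen_mul_simple (mul_mem hu' (negBlock_mem (by omega))) hs]
    · have := ih (by omega)
      omega
    · rw [Equiv.Perm.mul_apply, Equiv.Perm.mul_apply, negBlock_apply_top hb,
        negBlock_apply_of_gt (by omega), signedPerm_apply_of_lt hu (by omega),
        signedPerm_apply_of_lt hu (by omega)]
      omega

/-- The product of the negative cycles of lengths in `L` on consecutive intervals above `m`, the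
last entry of `L` giving the innermost interval. -/
def negBlocks (m : ℕ) : List ℕ → Equiv.Perm ℤ
  | [] => 1
  | b :: L => negBlocks m L * negBlock (m + L.sum) b

theorem negBlocks_mem {m n : ℕ} {L : List ℕ} (h : m + L.sum ≤ n) :
    negBlocks m L ∈ signedPerm n := by
  induction L with
  | nil => exact one_mem _
  | cons b L ih =>
    rw [List.sum_cons] at h
    exact mul_mem (ih (by omega)) (negBlock_mem (by omega))

theorem negBlocks_append (m : ℕ) (K L : List ℕ) :
    negBlocks m (K ++ L) = negBlocks m L * negBlocks (m + L.sum) K := by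
  induction K with
  | nil => simp [negBlocks]
  | cons b K ih =>
    simp only [List.cons_append, negBlocks, ih, List.sum_append, mul_assoc]
    rw [show m + (K.sum + L.sum) = m + L.sum + K.sum by ring]

/-- Each block outside the level `m` contributes at most one crossing, at the negative of its
outermost label: all other labels `≤ m` either stay there or are treated by the inner blocks. -/
theorem crossing_mul_negBlocks {n m : ℕ} {u : Equiv.Perm ℤ} (hu : u ∈ signedPerm m) (K : List ℕ) :
    crossing (signedLabels n) (u * negBlocks m K : Equiv.Perm ℤ) m m ≤ K.length := by
  induction K with
  | nil =>
    rw [List.length_nil, Nat.le_zero, crossing, Finset.card_eq_zero, Finset.filter_eq_empty_iff]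
    rintro a - ⟨h1, h2⟩
    simp only [negBlocks, mul_one] at h2
    by_cases h : -(m : ℤ) ≤ a
    · have := signedPerm_apply_le hu h h1
      omega
    · rw [signedPerm_apply_of_lt hu (by omega)] at h2
      omega
  | cons b K ih =>
    refine le_trans (Finset.card_le_card (t := insert (-((m + K.sum : ℕ) + b : ℤ))
      ((signedLabels n).filter (fun a => a ≤ (m : ℤ) ∧
        (m : ℤ) < (u * negBlocks m K : Equiv.Perm ℤ) a))) ?_)
      ((Finset.card_insert_le _ _).trans (by simpa [crossing] using ih))
    intro a ha
    rw [Finset.mem_filter, negBlocks, ← mul_assoc] at ha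
    rw [Finset.mem_insert, Finset.mem_filter]
    rw [or_iff_not_imp_left]
    intro hne
    refine ⟨ha.1, ha.2.1, ?_⟩
    have h2 := ha.2.2
    rw [Equiv.Perm.mul_apply] at h2
    by_cases h : -((m + K.sum : ℕ) : ℤ) ≤ a
    · rwa [negBlock_apply_of_le h (by omega)] at h2
    · exfalso
      have h3 : negBlock (m + K.sum) b a < -((m + K.sum : ℕ) : ℤ) := by
        rw [negBlock_apply]; split_ifs <;> omega
      rw [Equiv.Perm.mul_apply, signedPerm_apply_of_lt (negBlocks_mem le_rfl : negBlocks m K ∈ _) (.inr h3),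
        signedPerm_apply_of_lt hu (by omega)] at h2
      omega

/-! ### Reduction of elliptic signed permutations to products of negative cycles -/

theorem Equiv.Perm.SameCycle.mem_iff_of_stable {α : Type*} {w : Equiv.Perm α} {A : Set α}
    (hA : ∀ x, w x ∈ A ↔ x ∈ A) {x y : α} (h : w.SameCycle x y) : x ∈ A ↔ y ∈ A := by
  have hz : ∀ (k : ℕ) x, (w ^ k) x ∈ A ↔ x ∈ A := by
    intro k
    induction k with
    | zero => simp
    | succ k ih => intro x; rw [pow_succ', Equiv.Perm.mul_apply, hA, ih]
  obtain ⟨k, rfl⟩ := h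
  obtain ⟨k, rfl | rfl⟩ := k.eq_nat_or_neg
  · rw [zpow_natCast, hz]
  · rw [zpow_neg, zpow_natCast, ← hz k ((w ^ k)⁻¹ x), ← Equiv.Perm.mul_apply, mul_inv_cancel,
      Equiv.Perm.one_apply]

theorem Equiv.Perm.sameCycle_congr_of_stable {α : Type*} {w v : Equiv.Perm α} {A : Set α}
    (hA : ∀ x, w x ∈ A ↔ x ∈ A) (hwv : ∀ x ∈ A, w x = v x) {x y : α} (hx : x ∈ A) :
    w.SameCycle x y ↔ v.SameCycle x y := by
  have hp : ∀ (k : ℕ), ∀ x ∈ A, (w ^ k) x = (v ^ k) x ∧ (w ^ k) x ∈ A := by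
    intro k
    induction k with
    | zero => intro x hx; simp [hx]
    | succ k ih =>
      intro x hx
      rw [pow_succ', pow_succ', Equiv.Perm.mul_apply, Equiv.Perm.mul_apply, ← (ih x hx).1,
        hwv _ (ih x hx).2]
      exact ⟨rfl, by rw [← hwv _ (ih x hx).2, hA]; exact (ih x hx).2⟩
  have hinv : ∀ x ∈ A, ∀ k : ℕ, (w ^ k)⁻¹ x = (v ^ k)⁻¹ x := by
    intro x hx k
    have hm : (w ^ k)⁻¹ x ∈ A := by
      have h : w.SameCycle ((w ^ k)⁻¹ x) x := ⟨k, by simp⟩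
      exact (h.mem_iff_of_stable hA).2 hx
    rw [Equiv.Perm.eq_inv_iff_eq, ← (hp k _ hm).1, ← Equiv.Perm.mul_apply, mul_inv_cancel,
      Equiv.Perm.one_apply]
  have hz : ∀ k : ℤ, (w ^ k) x = (v ^ k) x := by
    intro k
    obtain ⟨k, rfl | rfl⟩ := k.eq_nat_or_neg
    · simpa using (hp k x hx).1
    · simpa using hinv x hx k
  simp only [Equiv.Perm.SameCycle, hz]

/-- All cycles of the signed permutation `w` are negative: each orbit is stable under negation. -/
def NegCycles (n : ℕ) (w : Equiv.Perm ℤ) : Prop :=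
  w ∈ signedPerm n ∧ ∀ x ∈ signedLabels n, w.SameCycle x (-x)

theorem NegCycles.conj {n : ℕ} {w g : Equiv.Perm ℤ} (hw : NegCycles n w) (hg : g ∈ signedPerm n) :
    NegCycles n (g * w * g⁻¹) := by
  refine ⟨mul_mem (mul_mem hg hw.1) (inv_mem hg), fun x hx => ?_⟩
  rw [Equiv.Perm.sameCycle_conj, (inv_mem hg).1]
  exact hw.2 _ (signedPerm_apply_mem (inv_mem hg) hx)

theorem ShiftData.Move.exists_conj {G : Type*} [Group G] {D : ShiftData G} {x y : G}
    (h : D.Move x y) : ∃ g ∈ D.H, y = g * x * g⁻¹ := by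
  rcases h with ⟨s, hs, rfl, -⟩ | ⟨g, hg, rfl⟩
  · exact ⟨s, ShiftData.S_mem hs, by rw [ShiftData.inv_eq_self (D.S_sub hs)]⟩
  · exact ⟨g, D.Ω_sub g hg, rfl⟩

theorem ShiftData.Red.exists_conj {G : Type*} [Group G] {D : ShiftData G} {x y : G}
    (h : D.Red x y) : ∃ g ∈ D.H, y = g * x * g⁻¹ := by
  induction h with
  | refl => exact ⟨1, one_mem _, by simp⟩
  | tail _ h ih =>
    obtain ⟨g, hg, rfl⟩ := ih
    obtain ⟨g', hg', rfl⟩ := h.exists_conj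
    exact ⟨g' * g, mul_mem hg' hg, by group⟩

theorem signedLen_mul_simple_lt_iff {n κ : ℕ} {x : Equiv.Perm ℤ} (hx : x ∈ signedPerm n) {a b : ℤ}
    (hs : SimplePair n κ a b) :
    signedLen n κ (x * signedSwap a b) < signedLen n κ x ↔ x b < x a := by
  obtain ⟨ha, hb, hab, hw⟩ := hs.mem
  have h := signedLen_lt_iff hx ha hb hab hw
  have h2 := (signedData n κ).len_mul x hx _ ⟨a, b, hs, rfl⟩
  simp only [signedData] at h2
  have hne : x a ≠ x b := fun h => hab.ne (x.injective h)
  omega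

theorem signedLen_simple_mul_lt_iff {n κ : ℕ} {x : Equiv.Perm ℤ} (hx : x ∈ signedPerm n) {a b : ℤ}
    (hs : SimplePair n κ a b) :
    signedLen n κ (signedSwap a b * x) < signedLen n κ x ↔ x⁻¹ b < x⁻¹ a := by
  have hS : signedSwap a b ∈ (signedData n κ).S := ⟨a, b, hs, rfl⟩
  have hm : signedSwap a b ∈ signedPerm n := ShiftData.S_mem hS
  rw [← signedLen_mul_simple_lt_iff (inv_mem hx) hs, signedLen_inv hx,
    ← signedLen_inv (mul_mem hm hx), mul_inv_rev,
    ShiftData.inv_eq_self ((signedData n κ).S_sub hS)]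

theorem signedData_move {n κ : ℕ} {x : Equiv.Perm ℤ} (hx : x ∈ signedPerm n) {a b : ℤ}
    (hs : SimplePair n κ a b) (h : x b < x a ∨ x⁻¹ b < x⁻¹ a) :
    (signedData n κ).Move x (signedSwap a b * x * signedSwap a b) := by
  refine .inl ⟨_, ⟨a, b, hs, rfl⟩, rfl, ?_⟩
  rcases h with h | h
  · exact .inr ((signedLen_mul_simple_lt_iff hx hs).2 h)
  · exact .inl ((signedLen_simple_mul_lt_iff hx hs).2 h)

theorem signedSwap_neg_neg {a b : ℤ} (ha : a ≠ 0) (hb : b ≠ 0) (hab : a ≠ b) :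
    signedSwap (-a) (-b) = signedSwap b a := by
  ext x
  rw [signedSwap_apply (by omega) (by omega) (by omega), signedSwap_apply hb ha hab.symm]
  split_ifs <;> omega

theorem signedSwap_comm {a b : ℤ} (ha : a ≠ 0) (hb : b ≠ 0) (hab : a ≠ b) :
    signedSwap a b = signedSwap b a := by
  ext x
  rw [signedSwap_apply ha hb hab, signedSwap_apply hb ha hab.symm]
  split_ifs <;> omega

/-- Conjugation by the reflection in two adjacent labels `a < b`, where `w b < w a`. -/
theorem signedData_move_adjacent {n κ : ℕ} (hκ : κ = 0 ∨ κ = 2) {w : Equiv.Perm ℤ}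
    (hw : w ∈ signedPerm n) {a b : ℤ} (ha : a ∈ signedLabels n) (hb : b ∈ signedLabels n)
    (hab : b = a + 1 ∨ (a = -1 ∧ b = 1)) (h : w b < w a) :
    (signedData n κ).Move w (signedSwap a b * w * signedSwap a b) := by
  rw [mem_signedLabels] at ha hb
  by_cases h0 : 0 < a
  · exact signedData_move hw (.inl ⟨by omega, by omega, by omega⟩) (.inl h)
  by_cases h1 : a = -1
  · obtain rfl : b = 1 := by omega
    subst h1
    rcases hκ with rfl | rfl
    · exact .inr ⟨signChange, ⟨rfl, by omega, rfl⟩, by rw [signChange_inv, signChange_eq]⟩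
    · exact signedData_move hw (.inr (.inl ⟨rfl, by omega, rfl, rfl⟩)) (.inl h)
  · have e : signedSwap a b = signedSwap (-b) (-a) := by
      rw [signedSwap_neg_neg hb.1 ha.1 (by omega)]
    rw [e]
    refine signedData_move hw (.inl ⟨by omega, by omega, by omega⟩) (.inl ?_)
    rw [hw.1, hw.1]
    omega

/-- The label `p` with image `m + 1` is moved upwards to `m`, one label at a time and skipping 0, so
that the chain `m + 1 → ⋯ → n` gets the new first arrow `m → m + 1`. -/
theorem exists_red_move_up {n κ : ℕ} (hκ : κ = 0 ∨ κ = 2) {m : ℕ} (hm : m < n) (k : ℕ)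
    {w : Equiv.Perm ℤ} (hw : w ∈ signedPerm n) {p : ℤ} (hp : p ∈ signedLabels m) (hk : m - p = k)
    (hwp : w p = m + 1) (hchain : ∀ j : ℤ, m + 1 ≤ j → j < n → w j = j + 1) :
    ∃ w', (signedData n κ).Red w w' ∧ ∀ j : ℤ, m ≤ j → j < n → w' j = j + 1 := by
  induction k using Nat.strong_induction_on generalizing w p with
  | _ k ih =>
  rw [mem_signedLabels] at hp
  by_cases hpm : p = m
  · subst hpm
    refine ⟨w, .rfl, fun j hj hj' => ?_⟩
    rcases hj.eq_or_lt with rfl | hj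
    · exact hwp
    · exact hchain j (by omega) hj'
  obtain ⟨q, hq⟩ : ∃ q : ℤ, (p = -1 ∧ q = 1) ∨ (p ≠ -1 ∧ q = p + 1) := by
    by_cases h : p = -1
    · exact ⟨1, .inl ⟨h, rfl⟩⟩
    · exact ⟨p + 1, .inr ⟨h, rfl⟩⟩
  -- The values `m + 2, …, n` are already taken by the chain, so `w p = m + 1` is the largest value
  -- left. This makes conjugation by the swap of `p` and `q` a permitted shift.
  have hlt : w q < w p := by
    rw [hwp]
    by_contra! hn
    rcases hn.eq_or_lt with hn | hn
    · have := w.injective (hwp.trans hn)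
      omega
    · have hqn := (signedPerm_apply_le hw (a := q) (by omega) (by omega)).2
      have := hchain (w q - 1) (by omega) (by omega)
      have := w.injective (this.trans (by ring : w q - 1 + 1 = w q))
      omega
  have hpn : p ∈ signedLabels n := by rw [mem_signedLabels]; omega
  have hqn : q ∈ signedLabels n := by rw [mem_signedLabels]; omega
  have hmove := signedData_move_adjacent hκ hw hpn hqn (by omega) hlt
  have e := signedSwap_apply (a := p) (b := q) (by omega) (by omega) (by omega)
  have e1 : ∀ j : ℤ, m < j → signedSwap p q j = j := fun j hj => by
    rw [e, if_neg (by omega), if_neg (by omega), if_neg (by omega), if_neg (by omega)]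
  have hwq : (signedSwap p q * w * signedSwap p q) q = m + 1 := by
    rw [Equiv.Perm.mul_apply, Equiv.Perm.mul_apply, e q, if_neg (by omega), if_pos rfl, hwp,
      e1 _ (by omega)]
  have hc : ∀ j : ℤ, m + 1 ≤ j → j < n →
      (signedSwap p q * w * signedSwap p q) j = j + 1 := by
    intro j hj hj'
    rw [Equiv.Perm.mul_apply, Equiv.Perm.mul_apply, e1 j (by omega), hchain j hj hj',
      e1 _ (by omega)]
  obtain ⟨w', h1, h2⟩ := ih (m - q).toNat (by omega)
    (ShiftData.Move.mem (D := signedData n κ) hw hmove)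
    (by rw [mem_signedLabels]; omega) (by omega) hwq hc
  exact ⟨w', hmove.red.trans h1, h2⟩

/-- Look at the preimage `p` of the bottom `m + 1` of the chain. If `p = -n`, the chain closes to a
negative cycle. If `p` lies in `[-m, m]`, `exists_red_move_up` prolongs the chain downwards. The
other positions are excluded. -/
theorem exists_red_top_cycle {n κ : ℕ} (hκ : κ = 0 ∨ κ = 2) (m : ℕ) (hm : m < n)
    {w : Equiv.Perm ℤ} (hw : NegCycles n w)
    (hchain : ∀ j : ℤ, m + 1 ≤ j → j < n → w j = j + 1) :
    ∃ m' < n, ∃ w', (signedData n κ).Red w w' ∧ (∀ j : ℤ, (m' : ℤ) + 1 ≤ j → j < n → w' j = j + 1) ∧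
      w' n = -(m' + 1) := by
  induction m using Nat.strong_induction_on generalizing w with
  | _ m ih =>
  obtain ⟨p, hp⟩ : ∃ p, w p = m + 1 := w.surjective _
  by_cases h1 : p = -n
  · refine ⟨m, hm, w, .rfl, hchain, ?_⟩
    rw [← hp, h1, hw.1.1, neg_neg]
  -- The chain would close to a positive cycle: the labels above `m` would form an invariant set
  -- containing `m + 1` but not its negative.
  by_cases h2 : p = n
  · have := (hw.2 (m + 1) (by rw [mem_signedLabels]; omega)).mem_iff_of_stable
      (A := {x | (m : ℤ) < x}) fun x => ?_
    · simp only [Set.mem_ofPred_eq] at this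
      omega
    · simp only [Set.mem_ofPred_eq]
      constructor
      · intro hx
        by_contra hn
        by_cases hx' : w x = m + 1
        · have := w.injective (hx'.trans hp.symm)
          omega
        by_cases hx'' : w x ≤ n
        · have := w.injective ((hchain (w x - 1) (by omega) (by omega)).trans
            (by ring : w x - 1 + 1 = w x))
          omega
        · have := w.injective (signedPerm_apply_of_lt hw.1 (a := w x) (by omega))
          omega
      · intro hx
        by_cases hx' : (n : ℤ) < x
        · rwa [signedPerm_apply_of_lt hw.1 (by omega)]
        · rcases (show x ≤ n by omega).eq_or_lt with rfl | h
          · rw [← h2, hp]; omega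
          · rw [hchain x (by omega) h]; omega
  by_cases h3 : p ∈ signedLabels m
  · have h3' := mem_signedLabels.1 h3
    obtain ⟨w', hr, hc⟩ := exists_red_move_up hκ hm (m - p).toNat hw.1 h3 (by omega) hp hchain
    obtain ⟨g, hg, rfl⟩ := hr.exists_conj
    obtain ⟨m', hm', w'', h4, h5⟩ := ih (m - 1) (by omega) (by omega) (hw.conj hg)
      (fun j hj hj' => hc j (by omega) hj')
    exact ⟨m', hm', w'', hr.trans h4, h5⟩
  · exfalso
    rw [mem_signedLabels] at h3
    have hpn : -(n : ℤ) ≤ p ∧ p ≤ n := by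
      by_contra hn
      rw [signedPerm_apply_of_lt hw.1 (by omega)] at hp
      omega
    have hp0 : p ≠ 0 := by
      rintro rfl
      rw [signedPerm_apply_zero hw.1] at hp
      omega
    by_cases h4 : 0 < p
    · have := hchain p (by omega) (by omega)
      omega
    · have := hchain (-p) (by omega) (by omega)
      rw [hw.1.1] at this
      omega

/-- Once the top cycle is a chain on an interval, the permutation agrees with `negBlock m b` outside
`[-m, m]`; the quotient therefore lives on `[-m, m]`, where it inherits negative cycles. -/
theorem exists_red_mul_negBlock {n κ : ℕ} (hκ : κ = 0 ∨ κ = 2) (hn : 0 < n) {w : Equiv.Perm ℤ}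
    (hw : NegCycles n w) : ∃ m b, 0 < b ∧ m + b = n ∧ ∃ u, NegCycles m u ∧
      (signedData n κ).Red w (u * negBlock m b) := by
  obtain ⟨m, hm, w', hr, hc, ht⟩ := exists_red_top_cycle hκ (n - 1) (by omega) hw
    (fun j hj hj' => by omega)
  obtain ⟨b, rfl⟩ : ∃ b, n = m + b := ⟨n - m, by omega⟩
  have hb : 0 < b := by omega
  have hw' : NegCycles (m + b) w' := by
    obtain ⟨g, hg, rfl⟩ := hr.exists_conj
    exact hw.conj hg
  have hbm : negBlock m b ∈ signedPerm (m + b) := negBlock_mem le_rfl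
  have heq : ∀ x : ℤ, (m : ℤ) < x → w' x = negBlock m b x := by
    intro x hx
    by_cases h1 : x < m + b
    · rw [negBlock_apply_mid hx h1, hc x (by omega) (by push_cast; omega)]
    · rcases (not_lt.1 h1).eq_or_lt with rfl | h
      · rw [negBlock_apply_top hb, ← ht]; push_cast; rfl
      · rw [negBlock_apply_of_gt (by omega), signedPerm_apply_of_lt hw'.1 (by push_cast; omega)]
  have hu : w' * (negBlock m b)⁻¹ ∈ signedPerm m := by
    have hm' := mul_mem hw'.1 (inv_mem hbm)
    have hpos : ∀ i : ℤ, (m : ℤ) < i → (w' * (negBlock m b)⁻¹) i = i := by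
      intro i hi
      obtain ⟨j, rfl⟩ := (negBlock m b).surjective i
      change w' ((negBlock m b).symm (negBlock m b j)) = _
      rw [Equiv.symm_apply_apply]
      by_cases hj : (m : ℤ) < j
      · exact heq j hj
      · by_cases hj' : j < -m
        · have := heq (-j) (by omega)
          rw [hw'.1.1, hbm.1] at this
          omega
        · rw [negBlock_apply_of_le (by omega) (by omega)] at hi
          omega
    refine ⟨hm'.1, fun i hi => ?_⟩
    rcases lt_abs.1 hi with h | h
    · exact hpos i h
    · have := hpos (-i) h
      rw [hm'.1] at this
      omega
  refine ⟨m, b, hb, rfl, w' * (negBlock m b)⁻¹, ⟨hu, fun x hx => ?_⟩, by simpa using hr⟩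
  have hx' := mem_signedLabels.1 hx
  have hag : ∀ x ∈ {x : ℤ | -(m : ℤ) ≤ x ∧ x ≤ m}, w' x = (w' * (negBlock m b)⁻¹) x := by
    rintro x ⟨h1, h2⟩
    rw [Equiv.Perm.mul_apply]
    congr 1
    rw [Equiv.Perm.eq_inv_iff_eq, negBlock_apply_of_le h1 h2]
  refine (Equiv.Perm.sameCycle_congr_of_stable (A := {x : ℤ | -(m : ℤ) ≤ x ∧ x ≤ m})
    (fun x => ⟨fun h => ?_, fun h => ?_⟩) hag (y := -x) ⟨hx'.2.1, hx'.2.2⟩).1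
    (hw'.2 x (by rw [mem_signedLabels]; omega))
  · obtain ⟨z, hz⟩ := (w' * (negBlock m b)⁻¹).surjective (w' x)
    have hz' : z ∈ {x : ℤ | -(m : ℤ) ≤ x ∧ x ≤ m} := by
      by_contra hn
      simp only [Set.mem_ofPred_eq] at hn h
      rw [signedPerm_apply_of_lt hu (by omega)] at hz
      omega
    rw [← hag z hz'] at hz
    rwa [← w'.injective hz]
  · rw [hag x h]
    exact signedPerm_apply_le hu h.1 h.2

/-- Conjugation by elements acting on `[-m, m]` commutes with the block. The block fixes these
labels, so the descents that permit a shift are the same with and without it. -/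
theorem signedData_red_mul_negBlock {m b n κ : ℕ} (hn : m + b ≤ n) {u u' : Equiv.Perm ℤ}
    (hu : u ∈ signedPerm m) (h : (signedData m κ).Red u u') :
    (signedData n κ).Red (u * negBlock m b) (u' * negBlock m b) := by
  induction h with
  | refl => exact .rfl
  | @tail v v' h1 h ih =>
    refine ih.trans (ShiftData.Move.red ?_)
    have hv : v ∈ signedPerm m := ShiftData.Red.mem (D := signedData m κ) hu h1
    have hvn := mul_mem (signedPerm_mono (show m ≤ n by omega) hv)
      (negBlock_mem (m := m) (b := b) hn)
    rcases h with ⟨s, ⟨a, c, hs, rfl⟩, rfl, h⟩ | ⟨g, ⟨h1, h2, rfl⟩, rfl⟩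
    · have hs' : SimplePair n κ a c := by unfold SimplePair at *; omega
      have hc := signedPerm_commute_negBlock (b := b)
        (signedSwap_mem hs.mem.1 hs.mem.2.1 hs.mem.2.2.1.ne)
      have e : signedSwap a c * v * signedSwap a c * negBlock m b =
          signedSwap a c * (v * negBlock m b) * signedSwap a c := by
        rw [mul_assoc, hc.eq]; group
      rw [e]
      obtain ⟨ha, hc, -⟩ := hs.mem
      have hfix : ∀ x ∈ signedLabels m, negBlock m b x = x := fun x hx => by
        rw [mem_signedLabels] at hx
        exact negBlock_apply_of_le hx.2.1 hx.2.2
      have hfix' : ∀ x ∈ signedLabels m, (v * negBlock m b)⁻¹ x = v⁻¹ x := fun x hx => by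
        rw [mul_inv_rev, Equiv.Perm.mul_apply, Equiv.Perm.inv_eq_iff_eq,
          hfix _ (signedPerm_apply_mem (inv_mem hv) hx)]
      refine signedData_move hvn hs' ?_
      rw [Equiv.Perm.mul_apply, Equiv.Perm.mul_apply, hfix a ha, hfix c hc, hfix' a ha, hfix' c hc]
      exact h.symm.imp (signedLen_mul_simple_lt_iff hv hs).1 (signedLen_simple_mul_lt_iff hv hs).1
    · refine .inr ⟨signChange, ⟨h1, by omega, rfl⟩, ?_⟩
      have hc := signedPerm_commute_negBlock (b := b) (signChange_mem h2)
      rw [signChange_inv, mul_assoc, hc.eq]; group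

/-- Every signed permutation with negative cycles reduces, by cyclic shifts that do not increase the
length, to a product of negative cycles on consecutive intervals. -/
theorem exists_red_negBlocks {n κ : ℕ} (hκ : κ = 0 ∨ κ = 2) {w : Equiv.Perm ℤ}
    (hw : NegCycles n w) : ∃ L : List ℕ, (∀ b ∈ L, 0 < b) ∧ L.sum = n ∧
      (signedData n κ).Red w (negBlocks 0 L) := by
  induction n using Nat.strong_induction_on generalizing w with
  | _ n ih =>
  rcases Nat.eq_zero_or_pos n with rfl | hn
  · refine ⟨[], by simp, rfl, ?_⟩
    have : w = 1 := by
      ext x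
      rcases eq_or_ne x 0 with rfl | hx
      · rw [signedPerm_apply_zero hw.1]; rfl
      · rw [signedPerm_apply_of_lt hw.1 (by push_cast; omega)]; rfl
    rw [this]
    exact .rfl
  · obtain ⟨m, b, hb, rfl, u, hu, hr⟩ := exists_red_mul_negBlock hκ hn hw
    obtain ⟨L, hL, rfl, hr'⟩ := ih m (by omega) hu
    refine ⟨b :: L, by simpa [hb] using hL, by simp [add_comm], hr.trans ?_⟩
    rw [negBlocks, zero_add]
    exact signedData_red_mul_negBlock le_rfl hu.1 hr'

/-! ### Sizes of the classes of an equivalence relation on a finite set -/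

open Classical in
/-- The sizes of the classes of `r` on `E`. -/
noncomputable def classSizes {α : Type*} [DecidableEq α] (r : α → α → Prop) (E : Finset α) : Multiset ℕ :=
  (E.image (fun x => E.filter (r x))).val.map Finset.card

section

variable {α β : Type*} [DecidableEq α] [DecidableEq β] {r : α → α → Prop} {E : Finset α}

open Classical in
theorem map_card_parts_eq_classSizes (P : Finpartition E)
    (hP : ∀ I ∈ P.parts, ∀ x ∈ I, ∀ y ∈ E, r x y ↔ y ∈ I) :
    P.parts.val.map Finset.card = classSizes r E := by
  have key : ∀ I ∈ P.parts, ∀ x ∈ I, E.filter (r x) = I := by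
    intro I hI x hx
    ext y
    rw [Finset.mem_filter]
    exact ⟨fun h => (hP I hI x hx y h.1).1 h.2,
      fun h => ⟨P.le hI h, (hP I hI x hx y (P.le hI h)).2 h⟩⟩
  have : P.parts = E.image (fun x => E.filter (r x)) := by
    ext I
    rw [Finset.mem_image]
    constructor
    · intro hI
      obtain ⟨x, hx⟩ := P.nonempty_of_mem_parts hI
      exact ⟨x, P.le hI hx, key I hI x hx⟩
    · rintro ⟨x, hx, rfl⟩
      obtain ⟨I, hI, hxI⟩ := P.exists_mem hx
      rwa [key I hI x hxI]
  rw [this, classSizes]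

open Classical in
theorem exists_finpartition_classSizes (hr : Equivalence r) :
    ∃ P : Finpartition E, P.parts.val.map Finset.card = classSizes r E ∧
      ∀ I ∈ P.parts, ∀ x ∈ I, ∀ y ∈ E, r x y ↔ y ∈ I := by
  have key : ∀ I ∈ (Finpartition.ofSetSetoid ⟨r, hr⟩ E).parts, ∀ x ∈ I, ∀ y ∈ E,
      r x y ↔ y ∈ I := by
    intro I hI x hx y hy
    rw [Finpartition.ofSetSetoid] at hI
    obtain ⟨z, hz, rfl⟩ := Finset.mem_image.1 hI
    simp only [Finset.mem_filter] at hx ⊢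
    exact ⟨fun h => ⟨hy, hr.trans hx.2 h⟩, fun h => hr.trans (hr.symm hx.2) h.2⟩
  exact ⟨_, map_card_parts_eq_classSizes _ key, key⟩

open Classical in
theorem classSizes_congr {r' : α → α → Prop} (h : ∀ x ∈ E, ∀ y ∈ E, r x y ↔ r' x y) :
    classSizes r E = classSizes r' E := by
  unfold classSizes
  congr 2
  refine Finset.image_congr fun x hx => Finset.filter_congr fun y hy => h x hx y hy

open Classical in
theorem classSizes_union {E₁ E₂ : Finset α} (hr : ∀ x ∈ E₁ ∪ E₂, r x x)
    (h₁₂ : ∀ x ∈ E₁, ∀ y ∈ E₂, ¬ r x y) (h₂₁ : ∀ x ∈ E₂, ∀ y ∈ E₁, ¬ r x y) :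
    classSizes r (E₁ ∪ E₂) = classSizes r E₁ + classSizes r E₂ := by
  have e₁ : ∀ x ∈ E₁, (E₁ ∪ E₂).filter (r x) = E₁.filter (r x) := fun x hx => by
    rw [Finset.filter_union, Finset.filter_eq_empty_iff.2 fun y hy => h₁₂ x hx y hy,
      Finset.union_empty]
  have e₂ : ∀ x ∈ E₂, (E₁ ∪ E₂).filter (r x) = E₂.filter (r x) := fun x hx => by
    rw [Finset.filter_union, Finset.filter_eq_empty_iff.2 fun y hy => h₂₁ x hx y hy,
      Finset.empty_union]
  unfold classSizes
  rw [Finset.image_union, Finset.image_congr (s := E₁) (fun x hx => e₁ x hx),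
    Finset.image_congr (s := E₂) (fun x hx => e₂ x hx), ← Multiset.map_add,
    ← Finset.disjUnion_val, Finset.disjUnion_eq_union]
  rw [Finset.disjoint_left]
  intro I hI hI'
  obtain ⟨x, hx, rfl⟩ := Finset.mem_image.1 hI
  obtain ⟨y, hy, h⟩ := Finset.mem_image.1 hI'
  have : x ∈ E₂.filter (r y) := by
    rw [h, Finset.mem_filter]
    exact ⟨hx, hr x (Finset.mem_union_left _ hx)⟩
  exact h₂₁ y hy x hx (Finset.mem_filter.1 this).2

open Classical in
theorem classSizes_singleton (hE : E.Nonempty) (h : ∀ x ∈ E, ∀ y ∈ E, r x y) :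
    classSizes r E = {E.card} := by
  have : E.image (fun x => E.filter (r x)) = {E} := by
    rw [Finset.eq_singleton_iff_unique_mem]
    have e : ∀ x ∈ E, E.filter (r x) = E := fun x hx => Finset.filter_true_of_mem (h x hx)
    refine ⟨?_, fun I hI => ?_⟩
    · obtain ⟨x, hx⟩ := hE
      exact Finset.mem_image.2 ⟨x, hx, e x hx⟩
    · obtain ⟨x, hx, rfl⟩ := Finset.mem_image.1 hI
      exact e x hx
  rw [classSizes, this]
  rfl

@[simp] theorem classSizes_empty : classSizes r ∅ = 0 := by
  classical
  rw [classSizes, Finset.image_empty]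
  rfl

open Classical in
theorem classSizes_image {r' : β → β → Prop} {f : α → β} (hf : Set.InjOn f E)
    (h : ∀ x ∈ E, ∀ y ∈ E, r x y ↔ r' (f x) (f y)) :
    classSizes r' (E.image f) = classSizes r E := by
  have e : ∀ x ∈ E, (E.image f).filter (r' (f x)) = (E.filter (r x)).image f := by
    intro x hx
    rw [Finset.filter_image]
    congr 1
    exact Finset.filter_congr fun y hy => (h x hx y hy).symm
  unfold classSizes
  rw [Finset.image_image]
  have e' : E.image ((fun y => (E.image f).filter (r' y)) ∘ f) =
      (E.image (fun x => E.filter (r x))).image (fun I => I.image f) := by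
    rw [Finset.image_image]
    exact Finset.image_congr fun x hx => e x hx
  rw [e', Finset.image_val_of_injOn, Multiset.map_map]
  · refine Multiset.map_congr rfl fun I hI => ?_
    obtain ⟨x, hx, rfl⟩ := Finset.mem_image.1 hI
    exact Finset.card_image_of_injOn (hf.mono fun y hy => Finset.filter_subset _ _ hy)
  · intro I hI J hJ hIJ
    obtain ⟨x, hx, rfl⟩ := Finset.mem_image.1 hI
    obtain ⟨y, hy, rfl⟩ := Finset.mem_image.1 hJ
    have key : ∀ I ⊆ E, ∀ J ⊆ E, I.image f = J.image f → I ⊆ J := by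
      intro I hI J hJ h a ha
      obtain ⟨b, hb, hba⟩ := Finset.mem_image.1 (h ▸ Finset.mem_image_of_mem f ha)
      rwa [← hf (hJ hb) (hI ha) hba]
    exact (key _ (Finset.filter_subset _ _) _ (Finset.filter_subset _ _) hIJ).antisymm
      (key _ (Finset.filter_subset _ _) _ (Finset.filter_subset _ _) hIJ.symm)

open Classical in
/-- A set covered by the classes of the elements of `Z` has at most as many elements as there are in
some `Z.card` classes. -/
theorem exists_le_classSizes {O Z : Finset α} (hO : O ⊆ E) (hZ : Z ⊆ E)
    (h : ∀ x ∈ O, ∃ z ∈ Z, r z x) :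
    ∃ A ≤ classSizes r E, Multiset.card A ≤ Z.card ∧ O.card ≤ A.sum := by
  refine ⟨(Z.image (fun x => E.filter (r x))).val.map Finset.card,
    Multiset.map_le_map (Finset.val_le_iff.2 (Finset.image_subset_image hZ)), ?_, ?_⟩
  · rw [Multiset.card_map]
    exact Finset.card_image_le
  · have : O ⊆ (Z.image (fun x => E.filter (r x))).biUnion id := by
      intro x hx
      obtain ⟨z, hz, hzx⟩ := h x hx
      exact Finset.mem_biUnion.2 ⟨_, Finset.mem_image_of_mem _ hz,
        Finset.mem_filter.2 ⟨hO hx, hzx⟩⟩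
    exact (Finset.card_le_card this).trans Finset.card_biUnion_le

end

theorem Multiset.sum_le_sum_take {l : List ℕ} (hl : l.Pairwise (· ≥ ·)) {A : Multiset ℕ}
    (hA : A ≤ ↑l) {s : ℕ} (hs : Multiset.card A ≤ s) : A.sum ≤ (l.take s).sum := by
  induction l generalizing A s with
  | nil => simp_all
  | cons a l ih =>
    rw [List.pairwise_cons] at hl
    rcases s with _ | s
    · rw [Nat.le_zero, Multiset.card_eq_zero] at hs
      simp [hs]
    rw [List.take_succ_cons, List.sum_cons]
    by_cases ha : a ∈ A
    · obtain ⟨B, rfl⟩ := Multiset.exists_cons_of_mem ha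
      rw [Multiset.sum_cons]
      rw [← Multiset.cons_coe, Multiset.cons_le_cons_iff] at hA
      rw [Multiset.card_cons] at hs
      have := ih hl.2 hA (s := s) (by omega)
      omega
    -- The head is not used by `A`: compare with the first `s + 1` entries of the tail and exchange
    -- the last of them for the larger head.
    · rw [← Multiset.cons_coe, Multiset.le_cons_of_notMem ha] at hA
      have h1 := ih hl.2 hA hs
      rcases lt_or_ge s l.length with h | h
      · rw [List.take_succ_eq_append_getElem h, List.sum_append, List.sum_singleton] at h1
        have := hl.1 _ (List.getElem_mem h)
        omega
      · rw [List.take_of_length_le (by omega)] at h1 ⊢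
        omega

/-! ### The classes of signed permutations with negative cycles -/

theorem sameCycle_neg {n : ℕ} {w : Equiv.Perm ℤ} (hw : w ∈ signedPerm n) {x y : ℤ} :
    w.SameCycle (-x) (-y) ↔ w.SameCycle x y := by
  have h : ∀ k : ℤ, (w ^ k) (-x) = -(w ^ k) x := fun k => ((signedPerm n).zpow_mem hw k).1 x
  simp only [Equiv.Perm.SameCycle, h, neg_inj]

theorem NegCycles.neg {n : ℕ} {w : Equiv.Perm ℤ} (hw : NegCycles n w) {x : ℤ} (hx : -(n : ℤ) ≤ x)
    (hx' : x ≤ n) : w.SameCycle x (-x) := by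
  rcases eq_or_ne x 0 with rfl | h
  · exact .refl _ _
  · exact hw.2 x (mem_signedLabels.2 ⟨h, hx, hx'⟩)

/-- The half sizes of the orbits of a signed permutation with negative cycles. -/
noncomputable def negType (n : ℕ) (w : Equiv.Perm ℤ) : Multiset ℕ :=
  classSizes w.SameCycle (Finset.Icc 1 (n : ℤ))

/-- Every orbit has the form `I ⊔ -I` exactly when each label is in the orbit of its negative; the
parts are then the sizes of the traces of the orbits on the positive labels. -/
theorem mem_signedClass_iff {n : ℕ} {α : n.Partition} {w : Equiv.Perm ℤ} :
    w ∈ signedClass α ↔ NegCycles n w ∧ negType n w = α.parts := by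
  constructor
  · rintro ⟨hw, P, hP, hI⟩
    refine ⟨⟨hw, fun x hx => ?_⟩, ?_⟩
    · have key : ∀ x : ℤ, 1 ≤ x → x ≤ n → w.SameCycle x (-x) := by
        intro x h1 h2
        obtain ⟨I, hIP, hxI⟩ := P.exists_mem (Finset.mem_Icc.2 ⟨h1, h2⟩)
        exact (hI I hIP x hxI _).2 (.inr (by rwa [neg_neg]))
      rw [mem_signedLabels] at hx
      by_cases h : 0 < x
      · exact key x (by omega) (by omega)
      · have := (key (-x) (by omega) (by omega)).symm
        rwa [neg_neg] at this
    · rw [negType, ← hP]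
      refine (map_card_parts_eq_classSizes P fun I hIP x hx y hy => ?_).symm
      rw [hI I hIP x hx]
      refine ⟨fun h => h.resolve_right fun h' => ?_, .inl⟩
      have := Finset.mem_Icc.1 (P.le hIP h')
      have := Finset.mem_Icc.1 hy
      omega
  · rintro ⟨hw, hα⟩
    obtain ⟨P, hP, hI⟩ := exists_finpartition_classSizes (E := Finset.Icc 1 (n : ℤ))
      (⟨.refl w, .symm, .trans⟩ : Equivalence w.SameCycle)
    refine ⟨hw.1, P, hP.trans hα, fun I hIP x hx y => ?_⟩
    have hx' := Finset.mem_Icc.1 (P.le hIP hx)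
    have hst : ∀ z, w z ∈ {z : ℤ | z ∈ signedLabels n} ↔ z ∈ {z : ℤ | z ∈ signedLabels n} := by
      intro z
      refine ⟨fun h => ?_, fun h => signedPerm_apply_mem hw.1 h⟩
      have := signedPerm_apply_mem (inv_mem hw.1) h
      simpa using this
    constructor
    · intro h
      have hy := (h.mem_iff_of_stable hst).1 (mem_signedLabels.2 (by omega))
      have hy' := mem_signedLabels.1 hy
      by_cases hy0 : 0 < y
      · exact .inl ((hI I hIP x hx y (Finset.mem_Icc.2 (by omega))).1 h)
      · exact .inr ((hI I hIP x hx (-y) (Finset.mem_Icc.2 (by omega))).1 (h.trans (hw.2 y hy)))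
    · rintro (h | h)
      · exact (hI I hIP x hx y (P.le hIP h)).2 h
      · have hy := Finset.mem_Icc.1 (P.le hIP h)
        have := (hI I hIP x hx (-y) (P.le hIP h)).2 h
        have h2 := hw.neg (x := -y) (by omega) (by omega)
        rw [neg_neg] at h2
        exact this.trans h2

/-- The map `x ↦ |g x|` permutes the positive labels, and `|g x|` lies in the same negative cycle as
`g x`. -/
theorem negType_conj {n : ℕ} {w g : Equiv.Perm ℤ} (hw : NegCycles n w) (hg : g ∈ signedPerm n) :
    negType n (g * w * g⁻¹) = negType n w := by
  obtain ⟨hinj, him⟩ := signedPerm_abs_image hg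
  have hc := hw.conj hg
  have hab : ∀ x ∈ Finset.Icc 1 (n : ℤ), (g * w * g⁻¹).SameCycle |g x| (g x) := by
    intro x hx
    rw [Finset.mem_Icc] at hx
    have h := signedPerm_apply_le hg (a := x) (by omega) (by omega)
    rcases abs_choice (g x) with h' | h' <;> rw [h']
    have := hc.neg (x := -g x) (by omega) (by omega)
    rwa [neg_neg] at this
  have key := classSizes_image (r := w.SameCycle) (r' := (g * w * g⁻¹).SameCycle) hinj
    fun x hx y hy => ?_
  · rw [negType, negType, ← key]
    congr 1
    convert him.symm
  · have : w.SameCycle x y ↔ (g * w * g⁻¹).SameCycle (g x) (g y) := by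
      rw [Equiv.Perm.sameCycle_conj]
      simp
    rw [this]
    exact ⟨fun h => ((hab x hx).trans h).trans (hab y hy).symm,
      fun h => ((hab x hx).symm.trans h).trans (hab y hy)⟩

theorem sameCycle_negBlock {m b : ℕ} {u : Equiv.Perm ℤ} (hu : u ∈ signedPerm m) {x : ℤ}
    (hx : (m : ℤ) < x) (hx' : x ≤ m + b) : (u * negBlock m b).SameCycle (m + 1) x ∧
      (u * negBlock m b).SameCycle x (-x) := by
  have hw : u * negBlock m b ∈ signedPerm (m + b) :=
    mul_mem (signedPerm_mono (by omega) hu) (negBlock_mem le_rfl)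
  have hstep : ∀ x : ℤ, (m : ℤ) < x → x < m + b → (u * negBlock m b) x = x + 1 := by
    intro x h1 h2
    rw [Equiv.Perm.mul_apply, negBlock_apply_mid h1 h2, signedPerm_apply_of_lt hu (by omega)]
  have h1 : ∀ k : ℕ, k < b → (u * negBlock m b).SameCycle (m + 1) (m + 1 + k) := by
    intro k
    induction k with
    | zero => intro _; simpa using Equiv.Perm.SameCycle.refl _ _
    | succ k ih =>
      intro hk
      refine (ih (by omega)).trans ?_
      have := hstep (m + 1 + k) (by omega) (by omega)
      push_cast
      rw [← add_assoc, ← this]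
      exact Equiv.Perm.sameCycle_apply_right.2 (.refl _ _)
  have h2 : ∀ x : ℤ, (m : ℤ) < x → x ≤ m + b → (u * negBlock m b).SameCycle (m + 1) x := by
    intro x h h'
    have := h1 (x - m - 1).toNat (by omega)
    rwa [show (m : ℤ) + 1 + ((x - m - 1).toNat : ℤ) = x by omega] at this
  have h3 : (u * negBlock m b).SameCycle (m + 1) (-(m + 1)) := by
    refine (h2 (m + b) (by omega) (by omega)).trans ?_
    have : (u * negBlock m b) (m + b) = -(m + 1) := by
      rw [Equiv.Perm.mul_apply, negBlock_apply_top (by omega), signedPerm_apply_of_lt hu (by omega)]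
    rw [← this]
    exact Equiv.Perm.sameCycle_apply_right.2 (.refl _ _)
  exact ⟨h2 x hx hx', (h2 x hx hx').symm.trans (h3.trans ((sameCycle_neg hw).2 (h2 x hx hx')))⟩

theorem NegCycles.mul_negBlock {m b : ℕ} {u : Equiv.Perm ℤ} (hu : NegCycles m u) (hb : 0 < b) :
    NegCycles (m + b) (u * negBlock m b) ∧
      negType (m + b) (u * negBlock m b) = b ::ₘ negType m u := by
  have hw : u * negBlock m b ∈ signedPerm (m + b) :=
    mul_mem (signedPerm_mono (by omega) hu.1) (negBlock_mem le_rfl)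
  have hag : ∀ x ∈ {x : ℤ | -(m : ℤ) ≤ x ∧ x ≤ m}, (u * negBlock m b) x = u x := by
    rintro x ⟨h1, h2⟩
    rw [Equiv.Perm.mul_apply, negBlock_apply_of_le h1 h2]
  have hst : ∀ x, (u * negBlock m b) x ∈ {x : ℤ | -(m : ℤ) ≤ x ∧ x ≤ m} ↔
      x ∈ {x : ℤ | -(m : ℤ) ≤ x ∧ x ≤ m} := by
    intro x
    refine ⟨fun h => ?_, fun h => ?_⟩
    · by_contra hx
      simp only [Set.mem_ofPred_eq] at h hx
      have h3 : negBlock m b x < -(m : ℤ) ∨ (m : ℤ) < negBlock m b x := by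
        rw [negBlock_apply]; split_ifs <;> omega
      rw [Equiv.Perm.mul_apply, signedPerm_apply_of_lt hu.1 h3.symm] at h
      omega
    · rw [hag x h]
      exact signedPerm_apply_le hu.1 h.1 h.2
  have hcyc : ∀ x y : ℤ, -(m : ℤ) ≤ x → x ≤ m →
      ((u * negBlock m b).SameCycle x y ↔ u.SameCycle x y) := fun x y h1 h2 =>
    Equiv.Perm.sameCycle_congr_of_stable hst hag ⟨h1, h2⟩
  refine ⟨⟨hw, fun x hx => ?_⟩, ?_⟩
  · rw [mem_signedLabels] at hx
    push_cast at hx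
    by_cases h1 : -(m : ℤ) ≤ x ∧ x ≤ m
    · exact (hcyc x _ h1.1 h1.2).2 (hu.neg h1.1 h1.2)
    · by_cases h2 : 0 < x
      · exact (sameCycle_negBlock hu.1 (by omega) (by omega)).2
      · have := (sameCycle_negBlock hu.1 (x := -x) (b := b) (by omega) (by omega)).2.symm
        rwa [neg_neg] at this
  · have hsplit : Finset.Icc 1 ((m + b : ℕ) : ℤ) =
        Finset.Icc 1 (m : ℤ) ∪ Finset.Icc ((m : ℤ) + 1) (m + b) := by
      ext x
      simp only [Finset.mem_Icc, Finset.mem_union]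
      push_cast
      omega
    rw [negType, hsplit, classSizes_union (fun x _ => Equiv.Perm.SameCycle.refl _ _), add_comm,
      classSizes_singleton (E := Finset.Icc ((m : ℤ) + 1) (m + b)), Int.card_Icc,
      classSizes_congr (E := Finset.Icc 1 (m : ℤ)) (r' := u.SameCycle), negType,
      Multiset.singleton_add]
    · congr 1
      omega
    · intro x hx y hy
      rw [Finset.mem_Icc] at hx
      exact hcyc x y (by omega) hx.2
    · exact ⟨m + 1, by simp; omega⟩
    · intro x hx y hy
      rw [Finset.mem_Icc] at hx hy
      exact (sameCycle_negBlock hu.1 (by omega) hx.2).1.symm.trans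
        (sameCycle_negBlock hu.1 (by omega) hy.2).1
    · intro x hx y hy h
      rw [Finset.mem_Icc] at hx hy
      have := (h.mem_iff_of_stable hst).1 ⟨by omega, hx.2⟩
      simp only [Set.mem_ofPred_eq] at this
      omega
    · intro x hx y hy h
      rw [Finset.mem_Icc] at hx hy
      have := (h.mem_iff_of_stable hst).2 ⟨by omega, hy.2⟩
      simp only [Set.mem_ofPred_eq] at this
      omega

theorem negCycles_negBlocks (L : List ℕ) : NegCycles L.sum (negBlocks 0 L) ∧
    negType L.sum (negBlocks 0 L) = (L.filter (0 < ·) : List ℕ) := by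
  induction L with
  | nil =>
    refine ⟨⟨one_mem _, fun x hx => ?_⟩, ?_⟩
    · rw [mem_signedLabels, List.sum_nil] at hx
      push_cast at hx
      omega
    · simp [negType]
  | cons b L ih =>
    rw [negBlocks, List.sum_cons, zero_add]
    rcases Nat.eq_zero_or_pos b with rfl | hb
    · simpa using ih
    · rw [List.filter_cons_of_pos (by simpa using hb), add_comm b]
      have := ih.1.mul_negBlock hb
      exact ⟨this.1, by rw [this.2, ih.2]; rfl⟩

/-- A signed permutation that moves an interval to an interval by translation conjugates the
corresponding negative cycles. -/
theorem conj_negBlock {n m m' b : ℕ} {g : Equiv.Perm ℤ} (hg : g ∈ signedPerm n)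
    (h : ∀ x : ℤ, (m : ℤ) < x → x ≤ m + b → g x = x + (m' - m)) :
    g * negBlock m b * g⁻¹ = negBlock m' b := by
  rw [mul_inv_eq_iff_eq_mul]
  ext x
  rw [Equiv.Perm.mul_apply, Equiv.Perm.mul_apply]
  have hneg : ∀ x : ℤ, x < -m → -(m + b : ℤ) ≤ x → g x = x - (m' - m) := by
    intro x h1 h2
    have := h (-x) (by omega) (by omega)
    rw [hg.1] at this
    omega
  by_cases h1 : (m : ℤ) < x ∧ x ≤ m + b
  · rw [h x h1.1 h1.2]
    rcases h1.2.eq_or_lt with rfl | h2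
    · rw [negBlock_apply_top (by omega), hneg _ (by omega) (by omega), negBlock_apply]
      split_ifs <;> omega
    · rw [negBlock_apply_mid h1.1 h2, h _ (by omega) (by omega), negBlock_apply_mid (by omega)
        (by omega)]
      ring
  by_cases h2 : x < -m ∧ -(m + b : ℤ) ≤ x
  · rw [hneg x h2.1 h2.2]
    rcases h2.2.eq_or_lt with rfl | h3
    · rw [(negBlock_mem le_rfl).1, negBlock_apply_top (by omega), neg_neg,
        h _ (by omega) (by omega), negBlock_apply]
      split_ifs <;> omega
    · have e1 : negBlock m b x = x - 1 := by
        rw [negBlock_apply]; split_ifs <;> omega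
      rw [e1, hneg _ (by omega) (by omega), negBlock_apply]
      split_ifs <;> omega
  · have e1 : negBlock m b x = x := by
      rw [negBlock_apply]; split_ifs <;> omega
    rw [e1]
    have h3 : ¬ ((m' : ℤ) < g x ∧ g x ≤ m' + b) := by
      intro h3
      have := g.injective ((h (g x - (m' - m)) (by omega) (by omega)).trans (by ring))
      omega
    have h4 : ¬ (g x < -m' ∧ -(m' + b : ℤ) ≤ g x) := by
      intro h4
      have := g.injective ((hneg (g x + (m' - m)) (by omega) (by omega)).trans (by ring))
      omega
    rw [negBlock_apply]; split_ifs <;> omega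

/-- The signed permutation exchanging the intervals `(m, m + a]` and `(m + a, m + a + b]`. -/
def blockSwap (m a b : ℕ) : Equiv.Perm ℤ where
  toFun x := if (m : ℤ) < x ∧ x ≤ m + a then x + b else if (m : ℤ) + a < x ∧ x ≤ m + a + b then x - a
    else if x < -m ∧ -(m + a : ℤ) ≤ x then x - b
    else if x < -(m + a : ℤ) ∧ -(m + a + b : ℤ) ≤ x then x + a else x
  invFun x := if (m : ℤ) < x ∧ x ≤ m + b then x + a else if (m : ℤ) + b < x ∧ x ≤ m + b + a then x - b
    else if x < -m ∧ -(m + b : ℤ) ≤ x then x - a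
    else if x < -(m + b : ℤ) ∧ -(m + b + a : ℤ) ≤ x then x + b else x
  left_inv x := by dsimp only; split_ifs <;> omega
  right_inv x := by dsimp only; split_ifs <;> omega

theorem blockSwap_apply (m a b : ℕ) (x : ℤ) : blockSwap m a b x =
    if (m : ℤ) < x ∧ x ≤ m + a then x + b else if (m : ℤ) + a < x ∧ x ≤ m + a + b then x - a
    else if x < -m ∧ -(m + a : ℤ) ≤ x then x - b
    else if x < -(m + a : ℤ) ∧ -(m + a + b : ℤ) ≤ x then x + a else x := rfl

theorem blockSwap_mem (m a b : ℕ) : blockSwap m a b ∈ signedPerm (m + a + b) := by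
  refine ⟨fun x => ?_, fun x hx => ?_⟩
  · rw [blockSwap_apply, blockSwap_apply]; split_ifs <;> omega
  · rw [lt_abs] at hx
    rw [blockSwap_apply]; split_ifs <;> omega

theorem conj_blockSwap (m a b : ℕ) {u : Equiv.Perm ℤ} (hu : u ∈ signedPerm m) :
    blockSwap m a b * (u * negBlock m a * negBlock (m + a) b) * (blockSwap m a b)⁻¹ =
      u * negBlock m b * negBlock (m + b) a := by
  have hg := blockSwap_mem m a b
  have h1 : blockSwap m a b * negBlock m a * (blockSwap m a b)⁻¹ = negBlock (m + b) a :=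
    conj_negBlock hg fun x h1 h2 => by
      rw [blockSwap_apply, if_pos ⟨h1, h2⟩]; push_cast; ring
  have h2 : blockSwap m a b * negBlock (m + a) b * (blockSwap m a b)⁻¹ = negBlock m b :=
    conj_negBlock hg fun x h1 h2 => by
      push_cast at h1 h2
      rw [blockSwap_apply, if_neg (by omega), if_pos ⟨h1, h2⟩]; push_cast; ring
  have h3 : blockSwap m a b * u * (blockSwap m a b)⁻¹ = u := by
    rw [mul_inv_eq_iff_eq_mul]
    ext x
    rw [Equiv.Perm.mul_apply, Equiv.Perm.mul_apply]
    have hfix : ∀ y : ℤ, -(m : ℤ) ≤ y → y ≤ m → blockSwap m a b y = y := fun y _ _ => by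
      rw [blockSwap_apply]; split_ifs <;> omega
    by_cases hx : -(m : ℤ) ≤ x ∧ x ≤ m
    · have := signedPerm_apply_le hu hx.1 hx.2
      rw [hfix x hx.1 hx.2, hfix _ this.1 this.2]
    · rw [signedPerm_apply_of_lt hu (a := x) (by omega), signedPerm_apply_of_lt hu]
      rw [blockSwap_apply]; split_ifs <;> omega
  have h4 : Commute (negBlock m b) (negBlock (m + b) a) :=
    signedPerm_commute_negBlock (negBlock_mem le_rfl)
  calc _ = blockSwap m a b * u * (blockSwap m a b)⁻¹ *
        ((blockSwap m a b * negBlock m a * (blockSwap m a b)⁻¹) *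
          (blockSwap m a b * negBlock (m + a) b * (blockSwap m a b)⁻¹)) := by group
    _ = _ := by rw [h1, h2, h3, mul_assoc u, h4.eq]

/-- Exchanging two consecutive parts is conjugation by `blockSwap`, which exchanges the
corresponding intervals and leaves all other labels alone. -/
theorem exists_conj_negBlocks_of_perm {L L' : List ℕ} (h : L.Perm L') :
    ∃ g ∈ signedPerm L.sum, negBlocks 0 L' = g * negBlocks 0 L * g⁻¹ := by
  induction h with
  | nil => exact ⟨1, one_mem _, by simp⟩
  | @cons b L L' h ih =>
    obtain ⟨g, hg, e⟩ := ih
    refine ⟨g, signedPerm_mono (by simp) hg, ?_⟩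
    have hc := signedPerm_commute_negBlock (b := b) (inv_mem hg)
    rw [negBlocks, negBlocks, e, ← h.sum_eq, zero_add, mul_assoc _ g⁻¹, hc.eq]
    group
  | swap a b L =>
    refine ⟨_, signedPerm_mono ?_ (blockSwap_mem L.sum a b), ?_⟩
    · simp only [List.sum_cons]; omega
    · have := conj_blockSwap L.sum a b (u := negBlocks 0 L) (negBlocks_mem (by simp))
      simp only [negBlocks, List.sum_cons, zero_add]
      rw [add_comm a, add_comm b, ← this]
  | trans h₁ _ ih₁ ih₂ =>
    obtain ⟨g, hg, e⟩ := ih₁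
    obtain ⟨g', hg', e'⟩ := ih₂
    rw [← h₁.sum_eq] at hg'
    exact ⟨g' * g, mul_mem hg' hg, by rw [e', e]; group⟩

/-- A signed permutation with negative cycles of half sizes `L` is conjugate to `negBlocks 0 L`. -/
theorem NegCycles.exists_conj_negBlocks {n : ℕ} {w : Equiv.Perm ℤ} (hw : NegCycles n w)
    {L : List ℕ} (h : negType n w = L) :
    ∃ g ∈ signedPerm n, w = g * negBlocks 0 L * g⁻¹ := by
  obtain ⟨L', hL', rfl, hr⟩ := exists_red_negBlocks (κ := 2) (.inr rfl) hw
  obtain ⟨g, hg, e⟩ := hr.exists_conj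
  have h1 := (negCycles_negBlocks L').2
  rw [List.filter_eq_self.2 (by simpa using hL'), e, negType_conj hw hg, h, Multiset.coe_eq_coe]
    at h1
  obtain ⟨g', hg', e'⟩ := exists_conj_negBlocks_of_perm h1
  have hg'' : g ∈ signedPerm L'.sum := hg
  rw [h1.sum_eq] at hg'
  refine ⟨g⁻¹ * g', mul_mem (inv_mem hg'') hg', ?_⟩
  have : w = g⁻¹ * negBlocks 0 L' * g := by rw [e]; group
  rw [this, e']
  group

/-! ### Elements of minimal length in the classes of signed permutations -/

open ShiftData

/-- The signed permutations with negative cycles of the half sizes in `M`. -/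
def negClass (n : ℕ) (M : Multiset ℕ) : Set (Equiv.Perm ℤ) := {w | NegCycles n w ∧ negType n w = M}

theorem signedClass_eq_negClass {n : ℕ} (α : n.Partition) :
    signedClass α = negClass n α.parts := Set.ext fun _ => mem_signedClass_iff

theorem negClass_conj {n : ℕ} {M : Multiset ℕ} {w g : Equiv.Perm ℤ} (hw : w ∈ negClass n M)
    (hg : g ∈ signedPerm n) : g * w * g⁻¹ ∈ negClass n M :=
  ⟨hw.1.conj hg, (negType_conj hw.1 hg).trans hw.2⟩

theorem stable_negClass (n κ : ℕ) (M : Multiset ℕ) : (signedData n κ).Stable (negClass n M) where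
  sub _ hx := hx.1.1
  simple x hx s hs := by
    have := negClass_conj hx (ShiftData.S_mem hs)
    rwa [ShiftData.inv_eq_self ((signedData n κ).S_sub hs)] at this
  omega _ hx g hg := negClass_conj hx ((signedData n κ).Ω_sub g hg)

/-- The sum of the sums of the proper tails of a list. -/
def tailSums : List ℕ → ℕ
  | [] => 0
  | _ :: L => tailSums L + L.sum

theorem tailSums_append (K L : List ℕ) :
    tailSums (K ++ L) = tailSums K + tailSums L + K.length * L.sum := by
  induction K with
  | nil => simp [tailSums]
  | cons a K ih =>
    simp only [List.cons_append, tailSums, ih, List.sum_append, List.length_cons]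
    ring

theorem signedLen_one (n κ : ℕ) : signedLen n κ 1 = 0 :=
  invSum_eq_zero fun c _ d _ h _ => by simpa using h.le

/-- A block of size `b` around labels of total size `m` adds `4m + 2b + κ - 2`. The order of the
parts enters only through `tailSums`. -/
theorem signedLen_negBlocks {n κ : ℕ} (hκ : κ = 0 ∨ κ = 2) {L : List ℕ} (hL : ∀ b ∈ L, 0 < b)
    (hn : L.sum ≤ n) : signedLen n κ (negBlocks 0 L) + 2 * L.length =
      4 * tailSums L + 2 * L.sum + κ * L.length := by
  induction L with
  | nil => simp [negBlocks, tailSums, signedLen_one]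
  | cons b L ih =>
    rw [List.sum_cons] at hn
    have h := signedLen_mul_negBlock hκ (hL b (by simp)) (m := 0 + L.sum) (n := n) (by omega)
      (negBlocks_mem (L := L) le_rfl)
    have := ih (fun c hc => hL c (by simp [hc])) (by omega)
    simp only [negBlocks, tailSums, List.sum_cons, List.length_cons, mul_add]
    rw [zero_add] at h ⊢
    omega

theorem negBlocks_filter (m : ℕ) (L : List ℕ) : negBlocks m (L.filter (0 < ·)) = negBlocks m L := by
  have hs : ∀ L : List ℕ, (L.filter (0 < ·)).sum = L.sum := by
    intro L
    induction L with
    | nil => rfl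
    | cons b L ih =>
      rcases Nat.eq_zero_or_pos b with rfl | hb
      · simpa using ih
      · rw [List.filter_cons_of_pos (by simpa using hb), List.sum_cons, List.sum_cons, ih]
  induction L with
  | nil => rfl
  | cons b L ih =>
    rcases Nat.eq_zero_or_pos b with rfl | hb
    · simpa [negBlocks] using ih
    · rw [List.filter_cons_of_pos (by simpa using hb), negBlocks, negBlocks, ih, hs]

/-- If `a < b` were adjacent with `a` further out, exchanging them would give an element of the same
class with `tailSums` smaller by `b - a`. -/
theorem pairwise_of_negBlocks_mem_minSet {n κ : ℕ} (hκ : κ = 0 ∨ κ = 2) {M : Multiset ℕ}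
    {L : List ℕ} (hL : ∀ b ∈ L, 0 < b) (hn : L.sum = n)
    (h : negBlocks 0 L ∈ (signedData n κ).minSet (negClass n M)) : L.Pairwise (· ≥ ·) := by
  subst hn
  rw [← List.isChain_iff_pairwise, List.isChain_iff_forall_rel_of_append_cons_cons]
  rintro a b X Y hXY
  by_contra hab
  subst hXY
  have hp : (X ++ a :: b :: Y).Perm (X ++ b :: a :: Y) := (List.Perm.swap b a Y).append_left X
  have hL' : ∀ c ∈ X ++ b :: a :: Y, 0 < c := fun c hc => hL c (hp.mem_iff.2 hc)
  have h1 := negCycles_negBlocks (X ++ b :: a :: Y)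
  have h2 := negCycles_negBlocks (X ++ a :: b :: Y)
  rw [List.filter_eq_self.2 (by simpa using hL')] at h1
  rw [List.filter_eq_self.2 (by simpa using hL)] at h2
  rw [← hp.sum_eq, ← Multiset.coe_eq_coe.2 hp, ← h2.2, h.1.2] at h1
  have h3 := h.2 _ h1
  have h4 := signedLen_negBlocks hκ hL le_rfl
  have h5 := signedLen_negBlocks hκ hL' hp.sum_eq.ge
  change signedLen _ _ _ ≤ signedLen _ _ _ at h3
  rw [← hp.sum_eq, ← hp.length_eq] at h5
  simp only [tailSums_append, tailSums, List.sum_cons] at h4 h5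
  rw [show b + (a + Y.sum) = a + (b + Y.sum) by ring] at h5
  omega

/-- A minimal element reduces to some product of blocks, which is again minimal, hence has
decreasing sizes; the type determines these sizes. Filtering discards padding zeros, which give
trivial blocks. -/
theorem red_negBlocks_of_mem_minSet {n κ : ℕ} (hκ : κ = 0 ∨ κ = 2) {L : List ℕ}
    (hL : L.Pairwise (· ≥ ·)) {w : Equiv.Perm ℤ}
    (hw : w ∈ (signedData n κ).minSet (negClass n (L.filter (0 < ·) : List ℕ))) :
    (signedData n κ).Red w (negBlocks 0 L) := by
  obtain ⟨L', hL', hs, hr⟩ := exists_red_negBlocks hκ hw.1.1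
  have hm := Red.minSet (stable_negClass n κ _) hw hr
  have hp := pairwise_of_negBlocks_mem_minSet hκ hL' hs hm
  subst hs
  have h1 := (negCycles_negBlocks L').2
  rw [List.filter_eq_self.2 (by simpa using hL'), hm.1.2, Multiset.coe_eq_coe] at h1
  have h2 : L.filter (0 < ·) = L' := h1.eq_of_pairwise (le := (· ≥ ·))
    (fun a b _ _ h h' => le_antisymm h' h) (hL.filter _) hp
  rwa [← negBlocks_filter, h2]

/-- Some minimal element exists and reduces to this one. No length estimate for general elements of
the class is needed. -/
theorem negBlocks_mem_minSet {n κ : ℕ} (hκ : κ = 0 ∨ κ = 2) {L : List ℕ} (hn : L.sum = n)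
    (hL : L.Pairwise (· ≥ ·)) :
    negBlocks 0 L ∈ (signedData n κ).minSet (negClass n (L.filter (0 < ·) : List ℕ)) := by
  subst hn
  obtain ⟨w, hw⟩ := exists_minSet (D := signedData L.sum κ)
    ⟨_, show _ ∈ negClass L.sum (L.filter (0 < ·) : List ℕ) from negCycles_negBlocks L⟩
  exact Red.minSet (stable_negClass _ κ _) hw (red_negBlocks_of_mem_minSet hκ hL hw)

/-- A reflection is one transposition or a product of two disjoint ones. In an upward step each of
them exchanges increasing values, so `crossing_le_comp_swap` applies once or twice. -/
theorem crossing_le_of_le {n κ : ℕ} {x y : Equiv.Perm ℤ} (hx : x ∈ signedPerm n)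
    (h : (signedData n κ).le x y) (i j : ℤ) :
    crossing (signedLabels n) x i j ≤ crossing (signedLabels n) y i j := by
  induction h with
  | refl => rfl
  | @tail y z h1 h ih =>
    refine ih.trans ?_
    have hy : y ∈ signedPerm n := ShiftData.le.mem hx h1
    obtain ⟨t, ⟨a, ha, b, hb, hab, hw, rfl⟩, rfl, hl⟩ := h
    have hlt := (signedLen_lt_iff hy ha hb hab hw).1 hl
    unfold signedSwap
    split_ifs with hab'
    · exact crossing_le_comp_swap ha hb hab hlt i j
    · rw [mem_signedLabels] at ha hb
      have h2 := crossing_le_comp_swap (mem_signedLabels.2 ha) (mem_signedLabels.2 hb) hab hlt i j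
      refine h2.trans ?_
      have h3 := crossing_le_comp_swap (E := signedLabels n) (x := y ∘ Equiv.swap a b)
        (a := -b) (b := -a) (by rw [mem_signedLabels]; omega) (by rw [mem_signedLabels]; omega)
        (by omega) ?_ i j
      · rw [Equiv.swap_comm (-a)]
        exact h3
      · rw [Function.comp, Function.comp, Equiv.swap_apply_of_ne_of_ne (by omega) (by omega),
          Equiv.swap_apply_of_ne_of_ne (by omega) (by omega), hy.1, hy.1]
        omega

theorem Equiv.Perm.apply_mem_iff_of_mapsTo {α : Type*} {w : Equiv.Perm α} {A : Finset α}
    (h : ∀ x ∈ A, w x ∈ A) (x : α) : w x ∈ A ↔ x ∈ A := by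
  refine ⟨fun hx => ?_, h x⟩
  have : A.map w.toEmbedding = A := by
    refine Finset.eq_of_subset_of_card_le (fun y hy => ?_) (Finset.card_map _).ge
    obtain ⟨z, hz, rfl⟩ := Finset.mem_map.1 hy
    exact h z hz
  rw [← this, Finset.mem_map] at hx
  obtain ⟨z, hz, e⟩ := hx
  exact w.injective e ▸ hz

/-- A signed permutation with negative cycles and few crossings at `m` has large cycles. -/
theorem sub_le_sum_take_of_crossing_le {n m s : ℕ} {w : Equiv.Perm ℤ} {L : List ℕ}
    (hL : L.Pairwise (· ≥ ·)) (hw : w ∈ negClass n L)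
    (h : crossing (signedLabels n) w m m ≤ s) : n ≤ m + (L.take s).sum := by
  classical
  set X := (signedLabels n).filter (fun a => a ≤ (m : ℤ) ∧ (m : ℤ) < w a) with hX
  have hZ : X.image (fun a => |a|) ⊆ Finset.Icc 1 (n : ℤ) := by
    intro z hz
    obtain ⟨a, ha, rfl⟩ := Finset.mem_image.1 hz
    have := mem_signedLabels.1 (Finset.mem_filter.1 ha).1
    rw [Finset.mem_Icc]
    have h1 := abs_pos.2 this.1
    have h2 := abs_le.2 this.2
    omega
  -- The cycle of `y > m` contains `-y ≤ m`. If it never crossed the level, its labels `≤ m` would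
  -- be stable under `w` and would contain `-y` without `y`. The labels above the level are thus
  -- covered by the cycles through crossings.
  have hcov : ∀ y ∈ Finset.Icc ((m : ℤ) + 1) n, ∃ z ∈ X.image (fun a => |a|), w.SameCycle z y := by
    intro y hy
    rw [Finset.mem_Icc] at hy
    by_contra hno
    have hin : ∀ a ∈ X, ¬ w.SameCycle y a := by
      intro a ha hya
      refine hno ⟨_, Finset.mem_image_of_mem _ ha, ?_⟩
      have h2 := (mem_signedLabels.1 (Finset.mem_filter.1 ha).1)
      rcases abs_choice a with e | e <;> simp only [e]
      · exact hya.symm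
      · exact (hya.trans (hw.1.neg h2.2.1 h2.2.2)).symm
    set B := (signedLabels n).filter (fun a => a ≤ (m : ℤ) ∧ w.SameCycle y a) with hB
    have hst : ∀ x, w x ∈ B ↔ x ∈ B := Equiv.Perm.apply_mem_iff_of_mapsTo fun x hx => by
      rw [hB, Finset.mem_filter] at hx ⊢
      refine ⟨signedPerm_apply_mem hw.1.1 hx.1, ?_, Equiv.Perm.sameCycle_apply_right.2 hx.2.2⟩
      by_contra hlt
      exact hin x (Finset.mem_filter.2 ⟨hx.1, hx.2.1, by omega⟩) hx.2.2
    have hyn := hw.1.neg (x := y) (by omega) (by omega)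
    have h1 : -y ∈ B := Finset.mem_filter.2 ⟨mem_signedLabels.2 (by omega), by omega, hyn⟩
    have h2 : y ∈ B := (hyn.mem_iff_of_stable (A := {x | x ∈ B}) hst).2 h1
    have := (Finset.mem_filter.1 h2).2.1
    omega
  obtain ⟨A, hA, hA1, hA2⟩ := exists_le_classSizes
    (Finset.Icc_subset_Icc_left (by omega)) hZ hcov
  change A ≤ negType n w at hA
  rw [hw.2] at hA
  have := Multiset.sum_le_sum_take hL hA (s := s) (hA1.trans (Finset.card_image_le.trans h))
  rw [Int.card_Icc] at hA2
  omega

/-- Necessity of dominance. At the level `m = (L'.drop s).sum` the normal form has at most `s`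
crossings, since only the first `s` blocks lie outside it. The same bound holds for any `x` below
it, so the `s` largest parts of `x` have sum at least `n - m`. -/
theorem sum_take_le_of_below {n κ : ℕ} {L L' : List ℕ} (hL : L.Pairwise (· ≥ ·))
    (hL' : L'.sum = n) (h : (signedData n κ).Below (negClass n L) (negBlocks 0 L')) (s : ℕ) :
    (L'.take s).sum ≤ (L.take s).sum := by
  obtain ⟨x, hx, hle⟩ := h
  have h1 := crossing_le_of_le hx.1.1.1 hle ((L'.drop s).sum : ℕ) ((L'.drop s).sum : ℕ)
  have h2 := crossing_mul_negBlocks (n := n) (negBlocks_mem (m := 0) (L := L'.drop s) le_rfl)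
    (L'.take s)
  rw [zero_add] at h2
  have h3 := negBlocks_append 0 (L'.take s) (L'.drop s)
  rw [List.take_append_drop, zero_add] at h3
  rw [← h3] at h2
  have h4 := sub_le_sum_take_of_crossing_le hL hx.1
    ((h1.trans h2).trans (List.length_take_le _ _))
  have h5 := congrArg List.sum (List.take_append_drop s L')
  rw [List.sum_append, hL'] at h5
  omega

/-! ### The dominance order on lists -/

/-- The list is decreasing, with entries at most `c`. -/
def Desc : ℕ → List ℕ → Prop
  | _, [] => True
  | c, b :: L => b ≤ c ∧ Desc b L

/-- Each partial sum of the first list exceeds that of the second one by at most `d`. -/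
def Dom : ℕ → List ℕ → List ℕ → Prop
  | d, b :: L, a :: M => b ≤ a + d ∧ Dom (a + d - b) L M
  | _, _, _ => True

theorem Desc.mono {c c' : ℕ} {L : List ℕ} (h : Desc c L) (hc : c ≤ c') : Desc c' L := by
  cases L with
  | nil => trivial
  | cons b L => exact ⟨h.1.trans hc, h.2⟩

theorem Desc.le {c : ℕ} {L : List ℕ} (h : Desc c L) {b : ℕ} (hb : b ∈ L) : b ≤ c := by
  induction L generalizing c with
  | nil => simp at hb
  | cons a L ih =>
    rcases List.mem_cons.1 hb with rfl | hb
    · exact h.1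
    · exact (ih h.2 hb).trans h.1

theorem Desc.pairwise {c : ℕ} {L : List ℕ} (h : Desc c L) : L.Pairwise (· ≥ ·) := by
  induction L generalizing c with
  | nil => exact .nil
  | cons a L ih => exact .cons (fun b hb => h.2.le hb) (ih h.2)

theorem desc_of_pairwise {c : ℕ} {L : List ℕ} (h : L.Pairwise (· ≥ ·)) (hc : ∀ b ∈ L, b ≤ c) :
    Desc c L := by
  induction L generalizing c with
  | nil => trivial
  | cons a L ih =>
    rw [List.pairwise_cons] at h
    exact ⟨hc a (by simp), ih h.2 h.1⟩

/-- Without excess, the head of `L` is at most the head of `M`; this restores the bound on the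
entries after a tail has been modified. -/
theorem Desc.of_dom {c a : ℕ} {L M : List ℕ} (h : Desc c L) (hM : Desc a M) (hd : Dom 0 L M)
    (hl : L.length = M.length) : Desc a L := by
  cases L with
  | nil => trivial
  | cons b L =>
    cases M with
    | nil => simp at hl
    | cons a' M => exact ⟨le_trans hd.1 hM.1, h.2⟩

theorem Desc.sum_eq_zero {L : List ℕ} (h : Desc 0 L) : L.sum = 0 :=
  List.sum_eq_zero fun _ hb => Nat.le_zero.1 (h.le hb)

theorem dom_of_sum_le {d : ℕ} {L M : List ℕ} (h : L.sum ≤ d) : Dom d L M := by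
  induction L generalizing d M with
  | nil => trivial
  | cons b L ih =>
    rw [List.sum_cons] at h
    cases M with
    | nil => trivial
    | cons a M => exact ⟨by omega, ih (by omega)⟩

theorem dom_of_take {d : ℕ} {L M : List ℕ}
    (h : ∀ k, (L.take k).sum ≤ (M.take k).sum + d) : Dom d L M := by
  induction L generalizing d M with
  | nil => trivial
  | cons b L ih =>
    cases M with
    | nil => trivial
    | cons a M =>
      have h1 := h 1
      simp at h1
      refine ⟨h1, ih fun k => ?_⟩
      have := h (k + 1)
      simp only [List.take_succ_cons, List.sum_cons] at this
      omega

/-! ### Lowering a list with excess over another one. -/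

/-- `R'` is a decreasing list obtained from `R` by lowering the sum by `e`, which is compatible with
a lower excess over `M`. -/
structure Lowers (c d e : ℕ) (R R' M : List ℕ) : Prop where
  desc : Desc c R'
  dom : Dom (d - e) R' M
  length : R'.length = R.length
  sum : R'.sum + e = R.sum
  tail : tailSums R' ≤ tailSums R

theorem Lowers.cons {c d e a b : ℕ} {R R' M : List ℕ} (hb : b ≤ c) (hbd : b + e ≤ a + d)
    (hed : e ≤ d) (h : Lowers b (a + d - b) e R R' M) : Lowers c d e (b :: R) (b :: R') (a :: M) where
  desc := ⟨hb, h.desc⟩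
  dom := ⟨by omega, by rw [show a + (d - e) - b = a + d - b - e by omega]; exact h.dom⟩
  length := by simp [h.length]
  sum := by simp [← h.sum]; omega
  tail := by
    have := h.sum
    have := h.tail
    simp only [tailSums]; omega

/-- At an entry that uses up the excess, the tail has excess zero, so its entries are at most `a ≤
q`; the entry may be lowered to `q` without spoiling the order. -/
theorem Lowers.head {c d e q : ℕ} {a : ℕ} {Y M : List ℕ} (hc : q ≤ c) (hq : q + e = a + d)
    (hed : e ≤ d) (hqa : a ≤ q)
    (hY : Desc (q + e) Y) (hM : Desc a M) (hd : Dom (a + d - (q + e)) Y M)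
    (hl : Y.length = M.length) : Lowers c d e ((q + e) :: Y) (q :: Y) (a :: M) where
  desc := by
    rw [show a + d - (q + e) = 0 by omega] at hd
    exact ⟨hc, (hY.of_dom hM hd hl).mono hqa⟩
  dom := ⟨by omega, by rw [show a + (d - e) - q = a + d - (q + e) by omega]; exact hd⟩
  length := rfl
  sum := by simp; omega
  tail := le_rfl

/-- The number of nonzero entries. -/
def numPos (L : List ℕ) : ℕ := (L.filter (0 < ·)).length

theorem numPos_cons (b : ℕ) (L : List ℕ) : numPos (b :: L) = numPos L + if 0 < b then 1 else 0 := by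
  unfold numPos
  rcases Nat.eq_zero_or_pos b with rfl | hb
  · simp
  · rw [List.filter_cons_of_pos (by simpa using hb), if_pos hb, List.length_cons]

/-- Lower the first entry at which the partial sum of `R` reaches that of `M` plus `d`. Such an
entry exists because the total sums differ by exactly `d`. -/
theorem exists_lower_one {c d : ℕ} {R M : List ℕ} (hl : R.length = M.length) (hR : Desc c R)
    {a : ℕ} (hM : Desc a M) (hd : 0 < d) (hs : R.sum = M.sum + d) (h : Dom d R M) :
    ∃ K q Y, R = K ++ (q + 1) :: Y ∧ Lowers c d 1 R (K ++ q :: Y) M := by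
  induction R generalizing c d M a with
  | nil => simp at hs; omega
  | cons b R ih =>
    cases M with
    | nil => simp at hl
    | cons a' M =>
      obtain ⟨hba, h⟩ := h
      rw [List.sum_cons, List.sum_cons] at hs
      rw [List.length_cons, List.length_cons, add_left_inj] at hl
      rcases Nat.eq_zero_or_pos (a' + d - b) with h0 | h0
      · obtain ⟨q, rfl⟩ : ∃ q, b = q + 1 := ⟨b - 1, by omega⟩
        exact ⟨[], q, R, rfl, .head (by have := hR.1; omega) (by omega) hd (by omega) hR.2 hM.2 h hl⟩
      · obtain ⟨K, q, Y, rfl, hL⟩ := ih hl hR.2 hM.2 h0 (by omega) h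
        exact ⟨b :: K, q, Y, rfl, hL.cons hR.1 (by omega) hd⟩

/-- The last two nonzero entries of a decreasing list with an even number of nonzero entries. -/
theorem exists_last_two {c : ℕ} {R : List ℕ} (hR : Desc c R) (he : Even (numPos R))
    (hs : 0 < R.sum) : ∃ K f g Z, R = K ++ (f + 1) :: (g + 1) :: Z ∧ Desc 0 Z := by
  induction R using List.twoStepInduction generalizing c with
  | nil => simp at hs
  | singleton b =>
    rw [List.sum_singleton] at hs
    rw [numPos_cons, if_pos hs] at he
    simp [numPos] at he
  | cons_cons b b' R ih _ =>
    have h1 := hR.1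
    have h2 := hR.2.1
    have hb' : 0 < b' := by
      by_contra h0
      obtain rfl : b' = 0 := by omega
      have h3 := hR.2.2
      have h4 := h3.sum_eq_zero
      have h5 : numPos R = 0 := by
        rw [numPos, List.length_eq_zero_iff, List.filter_eq_nil_iff]
        intro x hx
        have := h3.le hx
        simpa using this
      simp only [List.sum_cons] at hs
      rw [numPos_cons, numPos_cons, h5, if_neg (lt_irrefl 0), if_pos (by omega)] at he
      simp at he
    rcases Nat.eq_zero_or_pos R.sum with h0 | h0
    · obtain ⟨f, rfl⟩ : ∃ f, b = f + 1 := ⟨b - 1, by omega⟩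
      obtain ⟨g, rfl⟩ : ∃ g, b' = g + 1 := ⟨b' - 1, by omega⟩
      refine ⟨[], f, g, R, rfl, desc_of_pairwise hR.2.2.pairwise fun x hx => ?_⟩
      exact (List.sum_eq_zero_iff.1 h0 x hx).le
    · rw [numPos_cons, numPos_cons, if_pos hb', if_pos (by omega), add_assoc,
        Nat.even_add] at he
      obtain ⟨K, f, g, Z, rfl, hZ⟩ := ih hR.2.2 (by simpa using he) h0
      exact ⟨b :: b' :: K, f, g, Z, rfl, hZ⟩

theorem Desc.append_cons_lower {c q r : ℕ} {K Y Y' : List ℕ} (h : Desc c (K ++ r :: Y))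
    (hq : q ≤ r) (hY : Desc q Y') : Desc c (K ++ q :: Y') := by
  induction K generalizing c with
  | nil => exact ⟨hq.trans h.1, hY⟩
  | cons b K ih => exact ⟨h.1, ih h.2⟩

theorem Desc.tail_append {c : ℕ} {K Y : List ℕ} (h : Desc c (K ++ Y)) : ∃ c', Desc c' Y := by
  induction K generalizing c with
  | nil => exact ⟨c, h⟩
  | cons b K ih => exact ih h.2

/-- When the whole sum is at most the permitted excess, domination is automatic and only the shape
of the list matters. This is the situation once `M` has run out of nonzero entries. -/
theorem Lowers.of_sum_le {c d e : ℕ} {K Y Y' M : List ℕ} (hs : (K ++ Y).sum ≤ d)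
    (hD : Desc c (K ++ Y')) (hl : Y'.length = Y.length) (hsum : Y'.sum + e = Y.sum)
    (ht : tailSums Y' ≤ tailSums Y) : Lowers c d e (K ++ Y) (K ++ Y') M where
  desc := hD
  dom := dom_of_sum_le (by rw [List.sum_append] at *; omega)
  length := by simp [hl]
  sum := by simp [← hsum, add_assoc]
  tail := by
    rw [tailSums_append, tailSums_append]
    have : K.length * Y'.sum ≤ K.length * Y.sum := Nat.mul_le_mul_left _ (by omega)
    omega

/-- Lowering the excess of a list by one (or two), while keeping the parity of the number of nonzero
entries. -/
theorem exists_lower_even {c d : ℕ} {R M : List ℕ} (hl : R.length = M.length) (hR : Desc c R)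
    {a : ℕ} (hM : Desc a M) (hd : 0 < d) (hs : R.sum = M.sum + d) (h : Dom d R M)
    (he : Even (numPos R + numPos M)) :
    (∃ K q Y, 0 < q ∧ R = K ++ (q + 1) :: Y ∧ Lowers c d 1 R (K ++ q :: Y) M) ∨
    (∃ K Z, 2 ≤ d ∧ R = K ++ 1 :: 1 :: Z ∧ Lowers c d 2 R (K ++ 0 :: 0 :: Z) M) ∨
    (∃ K k K' Z c', R = K ++ k :: (K' ++ 1 :: 1 :: Z) ∧
      Lowers c' d 1 R (K ++ (k + 1) :: (K' ++ 0 :: 0 :: Z)) M ∧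
      (c' = c ∨ (K = [] ∧ c' = c + 1 ∧ d = 1))) := by
  induction R generalizing c d M a with
  | nil => simp at hs; omega
  | cons b R ih =>
    cases M with
    | nil => simp at hl
    | cons a' M =>
      obtain ⟨hba, h⟩ := h
      rw [List.sum_cons, List.sum_cons] at hs
      rw [List.length_cons, List.length_cons, add_left_inj] at hl
      have hb : 0 < b := by
        by_contra hb
        obtain rfl : b = 0 := by omega
        have := hR.2.sum_eq_zero
        omega
      rcases Nat.eq_zero_or_pos a' with rfl | ha'
      -- Here `M` is exhausted and the sum of the list is exactly `d`. By parity the list has an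
      -- even, positive number of nonzero entries, so it has a last pair.
      · have hM0 := hM.2.sum_eq_zero
        have hn : numPos (0 :: M) = 0 := by
          rw [numPos, List.length_eq_zero_iff, List.filter_eq_nil_iff]
          intro x hx
          have := Desc.le (c := 0) (L := 0 :: M) ⟨le_rfl, hM.2⟩ hx
          simpa using this
        rw [hn, add_zero] at he
        obtain ⟨K, f, g, Z, hK, hZ⟩ := exists_last_two hR he (by rw [List.sum_cons]; omega)
        have hsum : (b :: R).sum = d := by rw [List.sum_cons]; omega
        rw [hK] at hR hsum ⊢
        obtain ⟨c', hc'⟩ := hR.tail_append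
        have hfg := hc'.2.1
        -- A single 1 must not become 0. Lower the last nonzero entry if it exceeds 1, otherwise the
        -- one before it if that exceeds 1, and otherwise erase both ones.
        rcases Nat.eq_zero_or_pos g with rfl | hg
        · rcases Nat.eq_zero_or_pos f with rfl | hf
          · refine .inr (.inl ⟨K, Z, ?_, rfl, .of_sum_le hsum.le ?_ rfl ?_ ?_⟩)
            · simp only [List.sum_append, List.sum_cons] at hsum; omega
            · exact hR.append_cons_lower (by omega) ⟨le_rfl, hZ⟩
            · simp; omega
            · simp [tailSums]
          · refine .inl ⟨K, f, _, hf, rfl, .of_sum_le hsum.le ?_ rfl ?_ le_rfl⟩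
            · exact hR.append_cons_lower (by omega) ⟨by omega, hc'.2.2⟩
            · simp; omega
        · refine .inl ⟨K ++ [f + 1], g, Z, hg, by simp, ?_⟩
          have : K ++ (f + 1) :: (g + 1) :: Z = (K ++ [f + 1]) ++ (g + 1) :: Z := by simp
          rw [this] at hR hsum ⊢
          refine .of_sum_le hsum.le (hR.append_cons_lower (by omega) (hZ.mono (by omega))) rfl ?_ le_rfl
          simp; omega
      · rcases Nat.eq_zero_or_pos (a' + d - b) with h0 | h0
        · obtain ⟨q, rfl⟩ : ∃ q, b = q + 1 := ⟨b - 1, by omega⟩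
          exact .inl ⟨[], q, R, by omega, rfl,
            .head (by have := hR.1; omega) (by omega) hd (by omega) hR.2 hM.2 h hl⟩
        · rw [numPos_cons, numPos_cons, if_pos hb, if_pos ha'] at he
          rcases ih hl hR.2 hM.2 h0 (by omega) h (by revert he; simp only [Nat.even_iff]; omega)
            with ⟨K, q, Y, hq, rfl, hL⟩ | ⟨K, Z, hd2, rfl, hL⟩ | ⟨K, k, K', Z, c', rfl, hL, hc'⟩
          · exact .inl ⟨b :: K, q, Y, hq, rfl, hL.cons hR.1 (by omega) hd⟩
          -- The tail could only be lowered by two. If the excess at this entry is just 1, the entry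
          -- itself takes back one unit, possibly exceeding the bound `c` by one.
          · by_cases hd' : 2 ≤ d
            · exact .inr (.inl ⟨b :: K, Z, hd', rfl, hL.cons hR.1 (by omega) hd'⟩)
            · refine .inr (.inr ⟨[], b, K, Z, c + 1, rfl, ⟨⟨by have := hR.1; omega, hL.desc.mono (by omega)⟩,
                ⟨by omega, ?_⟩, ?_, ?_, ?_⟩, .inr ⟨rfl, rfl, by omega⟩⟩)
              · rw [show a' + (d - 1) - (b + 1) = a' + d - b - 2 by omega]
                exact hL.dom
              · simp
              · have := hL.sum
                simp only [List.nil_append, List.sum_cons]; omega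
              · have := hL.sum
                have := hL.tail
                simp only [List.nil_append, tailSums]; omega
          · refine .inr (.inr ⟨b :: K, k, K', Z, c, rfl, ?_, .inl rfl⟩)
            have hL' : Lowers b (a' + d - b) 1 (K ++ k :: (K' ++ 1 :: 1 :: Z))
                (K ++ (k + 1) :: (K' ++ 0 :: 0 :: Z)) M := by
              rcases hc' with rfl | ⟨rfl, rfl, h1⟩
              · exact hL
              -- The head of the tail was raised beyond its bound, but the remaining excess was 1
              -- and is now 0. So this head is at most `a'`, which is at most `b`.
              · refine ⟨?_, hL.dom, hL.length, hL.sum, hL.tail⟩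
                have h2 := hL.dom
                rw [h1] at h2
                exact (hL.desc.of_dom hM.2 h2 (hL.length.trans hl)).mono (by omega)
            exact hL'.cons hR.1 (by omega) hd

/-- Lowering the excess of a list by two, while keeping its nonzero entries odd. -/
theorem exists_lower_odd {c d : ℕ} {R M : List ℕ} (hl : R.length = M.length) (hR : Desc c R)
    {a : ℕ} (hM : Desc a M) (hd : 0 < d) (hde : Even d) (hs : R.sum = M.sum + d) (h : Dom d R M)
    (hR' : ∀ b ∈ R, b = 0 ∨ Odd b) (hM' : ∀ b ∈ M, b = 0 ∨ Odd b) :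
    (∃ K q Y, Odd q ∧ R = K ++ (q + 2) :: Y ∧ Lowers c d 2 R (K ++ q :: Y) M) ∨
    (∃ K Z, R = K ++ 1 :: 1 :: Z ∧ Desc 0 Z ∧ Lowers c d 2 R (K ++ 0 :: 0 :: Z) M) := by
  induction R generalizing c d M a with
  | nil => simp at hs; omega
  | cons b R ih =>
    cases M with
    | nil => simp at hl
    | cons a' M =>
      obtain ⟨hba, h⟩ := h
      rw [List.length_cons, List.length_cons, add_left_inj] at hl
      have hb : 0 < b := by
        by_contra hb
        obtain rfl : b = 0 := by omega
        have := hR.2.sum_eq_zero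
        simp only [List.sum_cons] at hs
        omega
      have hbo := (hR' b (by simp)).resolve_left (by omega)
      rw [Nat.even_iff] at hde
      rcases Nat.eq_zero_or_pos a' with rfl | ha'
      · have hM0 := hM.2.sum_eq_zero
        have hsum : (b :: R).sum = d := by rw [hs, List.sum_cons]; omega
        -- Nonzero entries are odd, so their number has the parity of the sum. Here the sum is the
        -- even number `d`, which yields a last pair of nonzero entries.
        have he : ∀ L : List ℕ, (∀ b ∈ L, b = 0 ∨ Odd b) → numPos L % 2 = L.sum % 2 := by
          intro L hL
          induction L with
          | nil => rfl
          | cons x L ih =>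
            have h1 := ih fun y hy => hL y (by simp [hy])
            have h2 := hL x (by simp)
            rw [Nat.odd_iff] at h2
            rw [numPos_cons, List.sum_cons]
            split_ifs <;> omega
        have he' := he _ hR'
        obtain ⟨K, f, g, Z, hK, hZ⟩ := exists_last_two hR (by rw [Nat.even_iff]; omega) (by omega)
        rw [hK] at hR hsum hR' ⊢
        obtain ⟨c', hc'⟩ := hR.tail_append
        have hfg := hc'.2.1
        have hf2 := (hR' (f + 1) (by simp)).resolve_left (by omega)
        have hg2 := (hR' (g + 1) (by simp)).resolve_left (by omega)
        rw [Nat.odd_iff] at hf2 hg2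
        rcases Nat.eq_zero_or_pos g with rfl | hg
        · rcases Nat.eq_zero_or_pos f with rfl | hf
          · refine .inr ⟨K, Z, rfl, hZ, .of_sum_le hsum.le ?_ rfl ?_ ?_⟩
            · exact hR.append_cons_lower (by omega) ⟨le_rfl, hZ⟩
            · simp; omega
            · simp [tailSums]
          · obtain ⟨f, rfl⟩ : ∃ f', f = f' + 1 := ⟨f - 1, by omega⟩
            refine .inl ⟨K, f, _, by rw [Nat.odd_iff]; omega, rfl, .of_sum_le hsum.le ?_ rfl ?_ le_rfl⟩
            · exact hR.append_cons_lower (by omega) ⟨by omega, hc'.2.2⟩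
            · simp; omega
        · obtain ⟨g, rfl⟩ : ∃ g', g = g' + 1 := ⟨g - 1, by omega⟩
          refine .inl ⟨K ++ [f + 1], g, Z, by rw [Nat.odd_iff]; omega, by simp, ?_⟩
          have : K ++ (f + 1) :: (g + 1 + 1) :: Z = (K ++ [f + 1]) ++ (g + 2) :: Z := by simp
          rw [this] at hR hsum ⊢
          refine .of_sum_le hsum.le (hR.append_cons_lower (by omega) (hZ.mono (by omega))) rfl ?_ le_rfl
          simp; omega
      · have hao := (hM' a' (by simp)).resolve_left (by omega)
        rw [Nat.odd_iff] at hao hbo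
        rw [List.sum_cons, List.sum_cons] at hs
        rcases Nat.eq_zero_or_pos (a' + d - b) with h0 | h0
        -- Here `b = a' + d` with `a'` odd and `d` even and positive, so `b - 2` is odd and at least
        -- `a'`.
        · obtain ⟨q, rfl⟩ : ∃ q, b = q + 2 := ⟨b - 2, by omega⟩
          exact .inl ⟨[], q, R, by rw [Nat.odd_iff]; omega, rfl,
            .head (by have := hR.1; omega) (by omega) (by omega) (by omega) hR.2 hM.2 h hl⟩
        · rcases ih hl hR.2 hM.2 h0 (by rw [Nat.even_iff]; omega) (by omega) h
            (fun x hx => hR' x (by simp [hx])) (fun x hx => hM' x (by simp [hx]))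
            with ⟨K, q, Y, hq, rfl, hL⟩ | ⟨K, Z, rfl, hZ, hL⟩
          · exact .inl ⟨b :: K, q, Y, hq, rfl, hL.cons hR.1 (by omega) (by omega)⟩
          · exact .inr ⟨b :: K, Z, rfl, hZ, hL.cons hR.1 (by omega) (by omega)⟩

/-! ### Elementary raisings towards a dominating list. -/

/-- `L'` is a decreasing list between `L` and `M` for the dominance order. -/
structure Raises (L L' M : List ℕ) : Prop where
  desc : ∃ c, Desc c L'
  dom : Dom 0 L' M
  length : L'.length = L.length
  sum : L'.sum = L.sum
  tail : tailSums L' < tailSums L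

theorem Raises.cons {a b : ℕ} {L L' M : List ℕ} (hM : Desc a M) (hba : b = a)
    (hl : L.length = M.length) (h : Raises L L' M) :
    Raises (b :: L) (b :: L') (a :: M) where
  desc := by
    obtain ⟨c, hc⟩ := h.desc
    exact ⟨b, le_rfl, hba ▸ hc.of_dom hM h.dom (h.length.trans hl)⟩
  dom := ⟨by omega, by rw [show a + 0 - b = 0 by omega]; exact h.dom⟩
  length := by simp [h.length]
  sum := by simp [h.sum]
  tail := by
    have := h.sum
    have := h.tail
    simp only [tailSums]; omega

theorem Lowers.raises {c a p e : ℕ} {R R' M : List ℕ} (he : 0 < e) (hpa : p + e ≤ a)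
    (hc : c ≤ p + e) (h : Lowers c (a - p) e R R' M) :
    Raises (p :: R) ((p + e) :: R') (a :: M) where
  desc := ⟨p + e, le_rfl, h.desc.mono hc⟩
  dom := ⟨by omega, by rw [show a + 0 - (p + e) = a - p - e by omega]; exact h.dom⟩
  length := by simp [h.length]
  sum := by
    have := h.sum
    simp only [List.sum_cons]; omega
  tail := by
    have := h.sum
    have := h.tail
    simp only [tailSums]; omega

/-- At the first index where the lists differ, the entry of `L` is the smaller one. Raise it by one
and pay from the tail, whose excess over the tail of `M` is the difference of the two entries. -/
theorem exists_raise_one {c a : ℕ} {L M : List ℕ} (hl : L.length = M.length) (hL : Desc c L)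
    (hM : Desc a M) (hs : L.sum = M.sum) (h : Dom 0 L M) (hne : L ≠ M) :
    ∃ X p K q Y, L = X ++ p :: (K ++ (q + 1) :: Y) ∧
      Raises L (X ++ (p + 1) :: (K ++ q :: Y)) M := by
  induction L generalizing c M a with
  | nil => exact absurd (List.length_eq_zero_iff.1 hl.symm).symm hne
  | cons b L ih =>
    cases M with
    | nil => simp at hl
    | cons a' M =>
      obtain ⟨hba, h⟩ := h
      rw [List.sum_cons, List.sum_cons] at hs
      rw [List.length_cons, List.length_cons, add_left_inj] at hl
      rw [add_zero] at hba h
      rcases hba.eq_or_lt with rfl | hlt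
      · rw [Nat.sub_self] at h
        obtain ⟨X, p, K, q, Y, rfl, hR⟩ := ih hl hL.2 hM.2 (by omega) h (by simpa using hne)
        exact ⟨b :: X, p, K, q, Y, rfl, hR.cons hM.2 rfl hl⟩
      · obtain ⟨K, q, Y, rfl, hR⟩ := exists_lower_one hl hL.2 hM.2 (d := a' - b) (by omega)
          (by omega) h
        exact ⟨[], b, K, q, Y, rfl, hR.raises one_pos hlt (by omega)⟩

/-- The parity condition forbids turning a single 1 into 0. The two extra moves erase two ones at
once and give the two units either to the entry directly before them or to two different larger
entries. -/
theorem exists_raise_even {c a : ℕ} {L M : List ℕ} (hl : L.length = M.length) (hL : Desc c L)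
    (hM : Desc a M) (hs : L.sum = M.sum) (h : Dom 0 L M) (hne : L ≠ M)
    (he : Even (numPos L + numPos M)) :
    (∃ X p K q Y, 0 < q ∧ L = X ++ p :: (K ++ (q + 1) :: Y) ∧
      Raises L (X ++ (p + 1) :: (K ++ q :: Y)) M) ∨
    (∃ X p Z, L = X ++ p :: 1 :: 1 :: Z ∧ Raises L (X ++ (p + 2) :: 0 :: 0 :: Z) M) ∨
    (∃ X p K k K' Z, L = X ++ p :: (K ++ k :: (K' ++ 1 :: 1 :: Z)) ∧
      Raises L (X ++ (p + 1) :: (K ++ (k + 1) :: (K' ++ 0 :: 0 :: Z))) M) := by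
  induction L generalizing c M a with
  | nil => exact absurd (List.length_eq_zero_iff.1 hl.symm).symm hne
  | cons b L ih =>
    cases M with
    | nil => simp at hl
    | cons a' M =>
      obtain ⟨hba, h⟩ := h
      rw [List.sum_cons, List.sum_cons] at hs
      rw [List.length_cons, List.length_cons, add_left_inj] at hl
      rw [add_zero] at hba h
      rw [numPos_cons, numPos_cons] at he
      rcases hba.eq_or_lt with rfl | hlt
      · rw [Nat.sub_self] at h
        rcases ih hl hL.2 hM.2 (by omega) h (by simpa using hne)
          (by revert he; simp only [Nat.even_iff]; omega) with
          ⟨X, p, K, q, Y, hq, rfl, hR⟩ | ⟨X, p, Z, rfl, hR⟩ | ⟨X, p, K, k, K', Z, rfl, hR⟩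
        · exact .inl ⟨b :: X, p, K, q, Y, hq, rfl, hR.cons hM.2 rfl hl⟩
        · exact .inr (.inl ⟨b :: X, p, Z, rfl, hR.cons hM.2 rfl hl⟩)
        · exact .inr (.inr ⟨b :: X, p, K, k, K', Z, rfl, hR.cons hM.2 rfl hl⟩)
      · have hb : 0 < b := by
          by_contra hb
          obtain rfl : b = 0 := by omega
          have := hL.2.sum_eq_zero
          omega
        rw [if_pos hb, if_pos (by omega)] at he
        rcases exists_lower_even hl hL.2 hM.2 (d := a' - b) (by omega) (by omega) h
          (by revert he; simp only [Nat.even_iff]; omega) with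
          ⟨K, q, Y, hq, rfl, hR⟩ | ⟨K, Z, hd, rfl, hR⟩ | ⟨K, k, K', Z, c', rfl, hR, hc'⟩
        · exact .inl ⟨[], b, K, q, Y, hq, rfl, hR.raises one_pos hlt (by omega)⟩
        · cases K with
          | nil => exact .inr (.inl ⟨[], b, Z, rfl, hR.raises two_pos (by omega) (by omega)⟩)
          -- The move that gives both units to `p` is used only when the two ones follow `p`
          -- directly. With entries in between, one unit goes to the next entry `k`; the dominance
          -- of the list lowered by two leaves room for it.
          | cons k K =>
            refine .inr (.inr ⟨[], b, [], k, K, Z, rfl, ?_⟩)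
            have hR' : Lowers (b + 1) (a' - b) 1 (k :: K ++ 1 :: 1 :: Z)
                ((k + 1) :: (K ++ 0 :: 0 :: Z)) M := by
              obtain ⟨h1, h2, h3, h4, h5⟩ := hR
              cases M with
              | nil => simp at hl
              | cons m M =>
                have h6 := h2.1
                refine ⟨⟨by have := h1.1; omega, h1.2.mono (by omega)⟩,
                  ⟨by omega, ?_⟩, by simp, ?_, h5⟩
                · have h7 := h2.2
                  rwa [show m + (a' - b - 2) - k = m + (a' - b - 1) - (k + 1) by omega] at h7
                · simp only [List.cons_append, List.sum_cons] at h4 ⊢; omega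
            exact hR'.raises one_pos hlt (by omega)
        · exact .inr (.inr ⟨[], b, K, k, K', Z, rfl, hR.raises one_pos hlt (by omega)⟩)

/-- At the first difference both entries are odd, so they differ by an even number, and two units
are moved at once. Their source is one odd entry at least 3, or two entries 1. -/
theorem exists_raise_odd {c a : ℕ} {L M : List ℕ} (hl : L.length = M.length) (hL : Desc c L)
    (hM : Desc a M) (hs : L.sum = M.sum) (h : Dom 0 L M) (hne : L ≠ M)
    (hL' : ∀ b ∈ L, b = 0 ∨ Odd b) (hM' : ∀ b ∈ M, b = 0 ∨ Odd b) :
    (∃ X p K q Y, Odd p ∧ Odd q ∧ L = X ++ p :: (K ++ (q + 2) :: Y) ∧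
      Raises L (X ++ (p + 2) :: (K ++ q :: Y)) M) ∨
    (∃ X p K Z, Odd p ∧ Desc 0 Z ∧ L = X ++ p :: (K ++ 1 :: 1 :: Z) ∧
      Raises L (X ++ (p + 2) :: (K ++ 0 :: 0 :: Z)) M) := by
  induction L generalizing c M a with
  | nil => exact absurd (List.length_eq_zero_iff.1 hl.symm).symm hne
  | cons b L ih =>
    cases M with
    | nil => simp at hl
    | cons a' M =>
      obtain ⟨hba, h⟩ := h
      rw [List.sum_cons, List.sum_cons] at hs
      rw [List.length_cons, List.length_cons, add_left_inj] at hl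
      rw [add_zero] at hba h
      rcases hba.eq_or_lt with rfl | hlt
      · rw [Nat.sub_self] at h
        rcases ih hl hL.2 hM.2 (by omega) h (by simpa using hne)
          (fun x hx => hL' x (by simp [hx])) (fun x hx => hM' x (by simp [hx])) with
          ⟨X, p, K, q, Y, hp, hq, rfl, hR⟩ | ⟨X, p, K, Z, hp, hZ, rfl, hR⟩
        · exact .inl ⟨b :: X, p, K, q, Y, hp, hq, rfl, hR.cons hM.2 rfl hl⟩
        · exact .inr ⟨b :: X, p, K, Z, hp, hZ, rfl, hR.cons hM.2 rfl hl⟩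
      · have hb : 0 < b := by
          by_contra hb
          obtain rfl : b = 0 := by omega
          have := hL.2.sum_eq_zero
          omega
        have hbo := (hL' b (by simp)).resolve_left (by omega)
        have hao := (hM' a' (by simp)).resolve_left (by omega)
        have h2 : Even (a' - b) := Nat.Odd.sub_odd hao hbo
        have h3 : 2 ≤ a' - b := by rw [Nat.even_iff] at h2; omega
        rcases exists_lower_odd hl hL.2 hM.2 (d := a' - b) (by omega) h2 (by omega) h
          (fun x hx => hL' x (by simp [hx])) (fun x hx => hM' x (by simp [hx])) with
          ⟨K, q, Y, hq, rfl, hR⟩ | ⟨K, Z, rfl, hZ, hR⟩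
        · exact .inl ⟨[], b, K, q, Y, hbo, hq, rfl, hR.raises two_pos (by omega) (by omega)⟩
        · exact .inr ⟨[], b, K, Z, hbo, hZ, rfl, hR.raises two_pos (by omega) (by omega)⟩

/-! ### Passing a label from one negative cycle to another -/

theorem negBlocks_apply_of_le {m : ℕ} (K : List ℕ) {x : ℤ} (h1 : -(m : ℤ) ≤ x) (h2 : x ≤ m) :
    negBlocks m K x = x := by
  induction K with
  | nil => rfl
  | cons b K ih =>
    rw [negBlocks, Equiv.Perm.mul_apply, negBlock_apply_of_le (by omega) (by omega), ih]

theorem conj_negBlocks {n m m' : ℕ} {g : Equiv.Perm ℤ} (hg : g ∈ signedPerm n) (K : List ℕ)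
    (h : ∀ x : ℤ, (m : ℤ) < x → x ≤ m + K.sum → g x = x + (m' - m)) :
    g * negBlocks m K * g⁻¹ = negBlocks m' K := by
  induction K with
  | nil => simp [negBlocks]
  | cons b K ih =>
    rw [List.sum_cons] at h
    have h1 := ih fun x h1 h2 => h x h1 (by omega)
    have h2 := conj_negBlock (m := m + K.sum) (m' := m' + K.sum) (b := b) hg fun x h1 h2 => by
      rw [h x (by omega) (by omega)]; omega
    rw [negBlocks, negBlocks, ← h1, ← h2]
    group

theorem commute_of_fix {m : ℕ} {u g : Equiv.Perm ℤ} (hu : u ∈ signedPerm m)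
    (hg : ∀ x : ℤ, -(m : ℤ) ≤ x → x ≤ m → g x = x) : Commute u g := by
  ext x
  rw [Equiv.Perm.mul_apply, Equiv.Perm.mul_apply]
  by_cases hx : -(m : ℤ) ≤ x ∧ x ≤ m
  · have := signedPerm_apply_le hu hx.1 hx.2
    rw [hg x hx.1 hx.2, hg _ this.1 this.2]
  · rw [signedPerm_apply_of_lt hu (a := x) (by omega), signedPerm_apply_of_lt hu]
    by_contra hn
    have := g.injective (hg (g x) (by omega) (by omega))
    omega

theorem signedLabels_mono {m n : ℕ} (h : m ≤ n) {a : ℤ} (ha : a ∈ signedLabels m) :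
    a ∈ signedLabels n := by
  rw [mem_signedLabels] at *
  omega

theorem signedData_step {n κ : ℕ} {x : Equiv.Perm ℤ} (hx : x ∈ signedPerm n) {a b : ℤ}
    (ha : a ∈ signedLabels n) (hb : b ∈ signedLabels n) (hab : a < b) (hw : 0 < signedWt κ a b)
    (h : x a < x b) : (signedData n κ).Step x (x * signedSwap a b) :=
  ⟨_, ⟨a, ha, b, hb, hab, hw, rfl⟩, rfl, signedLen_lt hx ha hb hab hw h⟩

/-- Transport of the Bruhat order along a map that is increasing on labels. -/
theorem signedData_le_map {m n κ : ℕ} {f : Equiv.Perm ℤ → Equiv.Perm ℤ} {σ : Equiv.Perm ℤ}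
    (hσ : σ ∈ signedPerm n) (hmn : m ≤ n)
    (hf : ∀ x ∈ signedPerm m, f x ∈ signedPerm n)
    (hmono : ∀ a ∈ signedLabels m, ∀ b ∈ signedLabels m, a < b → σ a < σ b)
    (hlt : ∀ x ∈ signedPerm m, ∀ a ∈ signedLabels m, ∀ b ∈ signedLabels m, x a < x b →
      f x (σ a) < f x (σ b))
    (hmul : ∀ x ∈ signedPerm m, ∀ t ∈ signedPerm m, f (x * t) = f x * (σ * t * σ⁻¹))
    {x y : Equiv.Perm ℤ} (hx : x ∈ signedPerm m) (h : (signedData m κ).le x y) :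
    (signedData n κ).le (f x) (f y) := by
  induction h with
  | refl => exact .refl
  | @tail y z h1 h ih =>
    refine ih.tail ?_
    have hy : y ∈ signedPerm m := ShiftData.le.mem hx h1
    obtain ⟨t, ⟨a, ha, b, hb, hab, hw, rfl⟩, rfl, hl⟩ := h
    have hl' := (signedLen_lt_iff hy ha hb hab hw).1 hl
    rw [hmul y hy _ (signedSwap_mem ha hb hab.ne), conj_signedSwap hσ]
    exact signedData_step (hf y hy) (signedPerm_apply_mem hσ (signedLabels_mono hmn ha))
      (signedPerm_apply_mem hσ (signedLabels_mono hmn hb)) (hmono a ha b hb hab)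
      (by rwa [signedWt_apply hσ]) (hlt y hy a ha b hb hl')

theorem signedData_le_mul {m n κ : ℕ} (hmn : m ≤ n) {g : Equiv.Perm ℤ} (hg : g ∈ signedPerm n)
    (hfix : ∀ x : ℤ, -(m : ℤ) ≤ x → x ≤ m → g x = x) {x y : Equiv.Perm ℤ}
    (hx : x ∈ signedPerm m) (h : (signedData m κ).le x y) :
    (signedData n κ).le (x * g) (y * g) := by
  refine signedData_le_map (f := (· * g)) (σ := 1) (one_mem _) hmn
    (fun x hx => mul_mem (signedPerm_mono hmn hx) hg) (fun _ _ _ _ h => h) ?_ ?_ hx h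
  · intro x _ a ha b hb hab
    rw [mem_signedLabels] at ha hb
    simpa [hfix a ha.2.1 ha.2.2, hfix b hb.2.1 hb.2.2] using hab
  · intro x _ t ht
    simp only [one_mul, inv_one, mul_one]
    rw [mul_assoc, mul_assoc, (commute_of_fix ht hfix).eq]

theorem blockSwap_zero (m b : ℕ) : blockSwap m 0 b = 1 := by
  ext x
  rw [blockSwap_apply, Equiv.Perm.one_apply]
  push_cast
  split_ifs <;> omega

theorem blockSwap_succ_one (j r : ℕ) : blockSwap j (r + 1) 1 =
    signedSwap (j + 1) (j + 2) * blockSwap (j + 1) r 1 := by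
  refine signedPerm_ext (n := j + (r + 1) + 1) (blockSwap_mem _ _ _) (mul_mem (signedSwap_mem
    (by rw [mem_signedLabels]; push_cast; omega) (by rw [mem_signedLabels]; push_cast; omega)
    (by omega)) (signedPerm_mono (by omega) (blockSwap_mem _ _ _))) fun i hi hi' => ?_
  push_cast at hi'
  have e := signedSwap_apply (a := j + 1) (b := j + 2) (by omega) (by omega) (by omega)
  rw [Equiv.Perm.mul_apply]
  simp only [blockSwap_apply]
  push_cast
  by_cases h1 : i ≤ j
  · rw [if_neg (by omega), if_neg (by omega), if_neg (by omega), if_neg (by omega),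
      if_neg (by omega), if_neg (by omega), if_neg (by omega), if_neg (by omega), e]
    split_ifs <;> omega
  by_cases h2 : i = j + 1
  · rw [if_pos (by omega), if_neg (by omega), if_neg (by omega), if_neg (by omega),
      if_neg (by omega), e, if_pos (by omega)]
    omega
  by_cases h3 : i ≤ j + r + 1
  · rw [if_pos (by omega), if_pos (by omega), e]
    split_ifs <;> omega
  · rw [if_neg (by omega), if_pos (by omega), if_neg (by omega), if_pos (by omega), e,
      if_neg (by omega), if_pos (by omega)]
    omega

/-- The innermost label `m + 1` of the outer block moves inwards to `j + 1`, one position per shift.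
Its preimage is always the smallest label `-(m + p + 1)`, so each adjacent conjugation is permitted.
-/
theorem red_conj_blockSwap {n κ m j r p : ℕ} (hm : m = j + r) (hp : 0 < p) (hn : m + p + 1 ≤ n)
    {v : Equiv.Perm ℤ} (hv : v ∈ signedPerm m) : (signedData n κ).Red (v * negBlock m (p + 1))
      (blockSwap j r 1 * (v * negBlock m (p + 1)) * (blockSwap j r 1)⁻¹) := by
  induction r generalizing j with
  | zero => rw [blockSwap_zero]; simpa using ShiftData.Red.rfl
  | succ r ih =>
    refine (ih (j := j + 1) (by omega)).trans (ShiftData.Move.red ?_)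
    set σ := blockSwap (j + 1) r 1 with hσ
    set w := v * negBlock m (p + 1) with hw
    have hwm : w ∈ signedPerm n := mul_mem (signedPerm_mono (by omega) hv)
      (negBlock_mem (by omega))
    have hσm : σ ∈ signedPerm n := signedPerm_mono (by omega) (blockSwap_mem _ _ _)
    have hs : SimplePair n κ (j + 1) (j + 2) := .inl ⟨by omega, by omega, by omega⟩
    have hs2 := signedSwap_sq (a := j + 1) (b := j + 2) (by omega) (by omega) (by omega)
    have e : blockSwap j (r + 1) 1 * w * (blockSwap j (r + 1) 1)⁻¹ =
        signedSwap (j + 1) (j + 2) * (σ * w * σ⁻¹) * signedSwap (j + 1) (j + 2) := by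
      rw [blockSwap_succ_one, mul_inv_rev, inv_eq_of_mul_eq_one_left hs2, ← hσ]
      simp only [mul_assoc]
    rw [e]
    have hwσ := mul_mem (mul_mem hσm hwm) (inv_mem hσm)
    refine signedData_move hwσ hs (.inr ?_)
    have htop : (σ * w * σ⁻¹) (-(m + p + 1)) = j + 2 := by
      rw [hwσ.1, Equiv.Perm.mul_apply, Equiv.Perm.mul_apply]
      have h1 : σ⁻¹ (m + p + 1) = m + p + 1 :=
        signedPerm_apply_of_lt (inv_mem (blockSwap_mem (j + 1) r 1)) (by push_cast; omega)
      have h2 := negBlock_apply_top (m := m) (b := p + 1) (by omega)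
      push_cast at h2
      rw [h1, hw, Equiv.Perm.mul_apply, add_assoc, h2, signedPerm_apply_of_lt hv (by omega),
        hσm.1, hσ, blockSwap_apply]
      push_cast
      rw [if_neg (by omega), if_pos (by omega)]
      omega
    have h1 : (σ * w * σ⁻¹)⁻¹ (j + 2) = -(m + p + 1) := by
      rw [Equiv.Perm.inv_eq_iff_eq, htop]
    have hwM : σ * w * σ⁻¹ ∈ signedPerm (m + p + 1) := by
      have hσm' : σ ∈ signedPerm (m + p + 1) := signedPerm_mono (by omega) (blockSwap_mem _ _ _)
      exact mul_mem (mul_mem hσm' (mul_mem (signedPerm_mono (by omega) hv)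
        (negBlock_mem (by omega)))) (inv_mem hσm')
    have h2 := signedPerm_apply_le (inv_mem hwM) (a := j + 1) (by push_cast; omega)
      (by push_cast; omega)
    have h3 : (σ * w * σ⁻¹)⁻¹ (j + 1) ≠ (σ * w * σ⁻¹)⁻¹ (j + 2) := fun h => by
      have := (σ * w * σ⁻¹)⁻¹.injective h
      omega
    push_cast at h2
    omega

/-- Splitting `m + 1` off a negative cycle is multiplication by one reflection: the shorter cycle
then starts at `m + 2` and `m + 1` is fixed. -/
theorem negBlock_eq_mul_signedSwap (m : ℕ) {p : ℕ} (hp : 0 < p) :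
    negBlock m (p + 1) = negBlock (m + 1) p * signedSwap (m + 1) (-(m + p + 1)) := by
  refine signedPerm_ext (n := m + p + 1) (negBlock_mem (by omega))
    (mul_mem (negBlock_mem (by omega)) (signedSwap_mem ?_ ?_ (by omega))) fun i hi hi' => ?_
  · rw [mem_signedLabels]; push_cast; omega
  · rw [mem_signedLabels]; push_cast; omega
  · push_cast at hi'
    rw [Equiv.Perm.mul_apply, signedSwap_apply (by omega) (by omega) (by omega)]
    have ht := negBlock_apply_top (m := m) (b := p + 1) (by omega)
    have ht' := negBlock_apply_top (m := m + 1) (b := p) hp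
    push_cast at ht ht'
    by_cases h1 : i = m + 1
    · rw [if_pos h1, (negBlock_mem le_rfl).1, show (m : ℤ) + p + 1 = m + 1 + p by ring, ht', h1,
        negBlock_apply_mid (by omega) (by push_cast; omega)]
      ring
    by_cases h2 : i = m + p + 1
    · rw [if_neg h1, if_neg (by omega), if_neg (by omega), if_pos (by omega), h2, add_assoc, ht,
        negBlock_apply_of_le (by push_cast; omega) (by push_cast; omega)]
    · rw [if_neg h1, if_neg (by omega), if_neg (by omega), if_neg (by omega)]
      rw [negBlock_apply, negBlock_apply]
      push_cast
      split_ifs <;> omega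

/-- The right side is the left side times the reflection that detaches the label, now at `j + 1`,
from the outer cycle. The left side has the values `j + 1` at `-(m + p + 1)` and `m + 2` at `j + 1`,
so the reflection lengthens. -/
theorem conj_blockSwap_le {n κ m j r p : ℕ} (hm : m = j + r) (hp : 0 < p) (hn : m + p + 1 ≤ n)
    {v : Equiv.Perm ℤ} (hv : v ∈ signedPerm m) : (signedData n κ).le
      (blockSwap j r 1 * (v * negBlock m (p + 1)) * (blockSwap j r 1)⁻¹)
      (blockSwap j r 1 * v * (blockSwap j r 1)⁻¹ * negBlock (m + 1) p) := by
  set σ := blockSwap j r 1 with hσ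
  have hσm : σ ∈ signedPerm (m + 1) := signedPerm_mono (by omega) (blockSwap_mem _ _ _)
  have hv' : σ * v * σ⁻¹ ∈ signedPerm (m + 1) :=
    mul_mem (mul_mem hσm (signedPerm_mono (by omega) hv)) (inv_mem hσm)
  have hσe : σ (m + 1) = j + 1 := by
    rw [hσ, blockSwap_apply]; push_cast
    rw [if_neg (by omega), if_pos (by omega)]; omega
  have hσM : σ (-(m + p + 1)) = -(m + p + 1) :=
    signedPerm_apply_of_lt hσm (by push_cast; omega)
  have hc := signedPerm_commute_negBlock (b := p) (inv_mem hσm)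
  have e : σ * (v * negBlock m (p + 1)) * σ⁻¹ =
      σ * v * σ⁻¹ * negBlock (m + 1) p * signedSwap (j + 1) (-(m + p + 1)) := by
    have hs := conj_signedSwap hσm (m + 1) (-(m + p + 1))
    rw [hσe, hσM] at hs
    rw [negBlock_eq_mul_signedSwap m hp, ← hs, mul_assoc (σ * v) σ⁻¹, hc.eq]
    simp only [mul_assoc, inv_mul_cancel_left]
  set y := σ * v * σ⁻¹ * negBlock (m + 1) p with hy
  have hym : y ∈ signedPerm n := mul_mem (signedPerm_mono (by omega) hv') (negBlock_mem (by omega))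
  have ha : -(m + p + 1 : ℤ) ∈ signedLabels n := by rw [mem_signedLabels]; omega
  have hb : (j + 1 : ℤ) ∈ signedLabels n := by rw [mem_signedLabels]; omega
  have hxm : y * signedSwap (j + 1) (-(m + p + 1)) ∈ signedPerm n :=
    mul_mem hym (signedSwap_mem hb ha (by omega))
  rw [e]
  have hsw := signedSwap_apply (a := j + 1) (b := -(m + p + 1)) (by omega) (by omega) (by omega)
  have h1 : y (j + 1) = j + 1 := by
    have : σ⁻¹ (j + 1) = m + 1 := by rw [Equiv.Perm.inv_eq_iff_eq, hσe]
    rw [hy, Equiv.Perm.mul_apply, negBlock_apply_of_le (by push_cast; omega) (by push_cast; omega),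
      Equiv.Perm.mul_apply, Equiv.Perm.mul_apply, this, signedPerm_apply_of_lt hv (by omega), hσe]
  have h2 : y (-(m + p + 1)) = m + 2 := by
    have ht' := negBlock_apply_top (m := m + 1) (b := p) hp
    push_cast at ht'
    rw [hym.1, hy, Equiv.Perm.mul_apply, show (m : ℤ) + p + 1 = m + 1 + p by ring, ht',
      signedPerm_apply_of_lt hv' (by push_cast; omega)]
    ring
  clear_value y
  have := signedData_step (κ := κ) hxm ha hb (by omega)
    (by rw [signedWt, if_neg (by omega)]; exact one_pos) ?_
  · rw [signedSwap_comm (a := -(m + p + 1 : ℤ)) (by omega) (by omega) (by omega), mul_assoc,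
      signedSwap_sq (by omega) (by omega) (by omega), mul_one] at this
    exact this.le
  · rw [Equiv.Perm.mul_apply, Equiv.Perm.mul_apply, hsw, hsw, if_neg (by omega), if_pos rfl,
      if_pos rfl, h1, h2]
    omega

/-- Some element obtained from `w` by cyclic shifts lies below `y`. -/
def ShiftData.RedLE {G : Type*} [Group G] (D : ShiftData G) (w y : G) : Prop :=
  ∃ w', D.Red w w' ∧ D.le w' y

theorem signedData_red_mul_negBlocks {m n κ : ℕ} {u u' : Equiv.Perm ℤ} (hu : u ∈ signedPerm m)
    (h : (signedData m κ).Red u u') (K : List ℕ) (hn : n = m + K.sum) :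
    (signedData n κ).Red (u * negBlocks m K) (u' * negBlocks m K) := by
  subst hn
  induction K with
  | nil => simpa [negBlocks] using h
  | cons b K ih =>
    rw [negBlocks, ← mul_assoc, ← mul_assoc]
    refine signedData_red_mul_negBlock (by simp; omega) ?_ ih
    exact mul_mem (signedPerm_mono (by omega) hu) (negBlocks_mem le_rfl)

theorem redLE_append {n κ : ℕ} (X : List ℕ) {L L' : List ℕ} (hs : L'.sum = L.sum)
    (hn : (X ++ L).sum = n)
    (h : (signedData L.sum κ).RedLE (negBlocks 0 L') (negBlocks 0 L)) :
    (signedData n κ).RedLE (negBlocks 0 (X ++ L')) (negBlocks 0 (X ++ L)) := by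
  obtain ⟨w, h1, h2⟩ := h
  rw [List.sum_append] at hn
  have h0 : negBlocks 0 L' ∈ signedPerm L.sum := negBlocks_mem (by omega)
  refine ⟨w * negBlocks L.sum X, ?_, ?_⟩
  · rw [negBlocks_append, zero_add, hs]
    exact signedData_red_mul_negBlocks h0 h1 X (by omega)
  · rw [negBlocks_append, zero_add]
    exact signedData_le_mul (by omega) (negBlocks_mem (by omega))
      (fun x => negBlocks_apply_of_le X) (ShiftData.Red.mem (D := signedData L.sum κ) h0 h1) h2

/-- The fixed label just outside the block of size `q` is joined to it by one reflection. For `q =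
0` this creates a sign change, which is a reflection only in type B. -/
theorem negBlocks_cons_le {κ : ℕ} (q : ℕ) (Y : List ℕ) (hq : κ = 2 ∨ 0 < q) :
    (signedData (Y.sum + q + 1) κ).le (negBlocks 0 (q :: Y)) (negBlocks 0 ((q + 1) :: Y)) := by
  have hY : negBlocks 0 Y ∈ signedPerm Y.sum := negBlocks_mem (by omega)
  have hx : negBlocks 0 Y * negBlock Y.sum q ∈ signedPerm (Y.sum + q + 1) :=
    mul_mem (signedPerm_mono (by omega) hY) (negBlock_mem (by omega))
  have hb : (Y.sum + q + 1 : ℤ) ∈ signedLabels (Y.sum + q + 1) := by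
    rw [mem_signedLabels]; omega
  simp only [negBlocks, zero_add]
  rcases Nat.eq_zero_or_pos q with rfl | hq0
  · obtain rfl : κ = 2 := by omega
    have e : negBlock Y.sum 1 = signedSwap (-(Y.sum + 1)) (Y.sum + 1) := by
      ext x
      rw [negBlock_one_apply, signedSwap_apply (by omega) (by omega) (by omega)]
      split_ifs <;> omega
    rw [negBlock_zero, mul_one] at hx ⊢
    rw [e]
    simp only [Nat.cast_zero, add_zero] at hb
    refine (signedData_step hx ?_ hb (by omega) (by simp [signedWt]) ?_).le
    · rw [mem_signedLabels]; omega
    · rw [hY.1, signedPerm_apply_of_lt hY (by omega)]; omega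
  · rw [negBlock_succ _ _ hq0, ← mul_assoc]
    refine (signedData_step hx ?_ hb (by omega) ?_ ?_).le
    · rw [mem_signedLabels]; omega
    · rw [signedWt, if_neg (by omega)]; exact one_pos
    · rw [Equiv.Perm.mul_apply, Equiv.Perm.mul_apply, negBlock_apply_top hq0,
        negBlock_apply_of_gt (by omega), signedPerm_apply_of_lt hY (by omega),
        signedPerm_apply_of_lt hY (by omega)]
      omega

/-- The outer block gives up a label, the label travels inwards past the blocks of `K`, and it is
absorbed by the block of size `q`. -/
theorem redLE_raise_one {κ : ℕ} {p : ℕ} (hp : 0 < p) (K : List ℕ) (q : ℕ) (Y : List ℕ)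
    (hq : κ = 2 ∨ 0 < q) : (signedData (p :: (K ++ (q + 1) :: Y)).sum κ).RedLE
      (negBlocks 0 ((p + 1) :: (K ++ q :: Y))) (negBlocks 0 (p :: (K ++ (q + 1) :: Y))) := by
  set n := (p :: (K ++ (q + 1) :: Y)).sum with hn
  set m := (K ++ q :: Y).sum with hm
  have hmj : m = (Y.sum + q) + K.sum := by simp [hm]; omega
  have hnm : n = m + p + 1 := by simp [hm, hn]; omega
  have hv : negBlocks 0 (K ++ q :: Y) ∈ signedPerm m := negBlocks_mem (by omega)
  have hm' : (K ++ (q + 1) :: Y).sum = m + 1 := by simp [hm]; omega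
  rw [negBlocks, negBlocks, ← hm, hm', zero_add, zero_add]
  refine ⟨_, red_conj_blockSwap hmj hp hnm.ge hv, (conj_blockSwap_le hmj hp hnm.ge hv).trans ?_⟩
  have hσ := blockSwap_mem (Y.sum + q) K.sum 1
  have hqY : negBlocks 0 (q :: Y) ∈ signedPerm (Y.sum + q) :=
    negBlocks_mem (by simp [add_comm])
  have e1 : blockSwap (Y.sum + q) K.sum 1 * negBlocks (Y.sum + q) K *
      (blockSwap (Y.sum + q) K.sum 1)⁻¹ = negBlocks (Y.sum + q + 1) K := by
    refine conj_negBlocks hσ K fun x h1 h2 => ?_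
    rw [blockSwap_apply, if_pos ⟨h1, h2⟩]
    omega
  have e2 : Commute (negBlocks 0 (q :: Y)) (blockSwap (Y.sum + q) K.sum 1) := by
    refine commute_of_fix hqY fun x h1 h2 => ?_
    rw [blockSwap_apply]
    rw [if_neg (by omega), if_neg (by omega), if_neg (by omega), if_neg (by omega)]
  have e3 : blockSwap (Y.sum + q) K.sum 1 * negBlocks 0 (K ++ q :: Y) *
      (blockSwap (Y.sum + q) K.sum 1)⁻¹ = negBlocks 0 (q :: Y) * negBlocks (Y.sum + q + 1) K := by
    rw [negBlocks_append, ← e1, show 0 + (q :: Y).sum = Y.sum + q by simp [add_comm], ← mul_assoc,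
      ← e2.eq]
    group
  rw [e3, negBlocks_append, show 0 + ((q + 1) :: Y).sum = Y.sum + q + 1 by simp; omega, mul_assoc,
    mul_assoc]
  refine signedData_le_mul (m := Y.sum + q + 1) (by omega)
    (mul_mem (negBlocks_mem (by omega)) (negBlock_mem (by omega))) (fun x h1 h2 => ?_)
    (negBlocks_mem (by simp; omega)) (negBlocks_cons_le q Y hq)
  rw [Equiv.Perm.mul_apply, negBlock_apply_of_le (by omega) (by omega),
    negBlocks_apply_of_le K h1 h2]

/-- Changing the signs of both 1 and 2 is the product of the reflections in `(1, 2)` and `(-1, 2)`,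
which exist in types B and D. In type D this replaces the missing creation of a single block of size
one. -/
theorem le_negBlocks_one_one {κ : ℕ} : (signedData 2 κ).le 1 (negBlocks 0 [1, 1]) := by
  have h1 : (1 : ℤ) ∈ signedLabels 2 := by rw [mem_signedLabels]; norm_num
  have h2 : (2 : ℤ) ∈ signedLabels 2 := by rw [mem_signedLabels]; norm_num
  have h3 : (-1 : ℤ) ∈ signedLabels 2 := by rw [mem_signedLabels]; norm_num
  have hs := signedSwap_apply (a := 1) (b := 2) (by omega) (by omega) (by omega)
  have hs' := signedSwap_apply (a := -1) (b := 2) (by omega) (by omega) (by omega)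
  have e : negBlocks 0 [1, 1] = 1 * signedSwap 1 2 * signedSwap (-1) 2 := by
    refine signedPerm_ext (n := 2) (negBlocks_mem (by simp)) (mul_mem (mul_mem (one_mem _)
      (signedSwap_mem h1 h2 (by omega))) (signedSwap_mem h3 h2 (by omega))) fun i hi hi' => ?_
    simp only [negBlocks, List.sum_cons, List.sum_nil, one_mul, Equiv.Perm.mul_apply,
      negBlock_one_apply, hs, hs']
    push_cast at hi' ⊢
    split_ifs <;> omega
  rw [e]
  have hm := signedSwap_mem h1 h2 (by omega)
  refine ((signedData_step (one_mem _) h1 h2 (by norm_num) (by simp [signedWt]) (by simp)).le).trans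
    (signedData_step (mul_mem (one_mem _) hm) h3 h2 (by norm_num) (by simp [signedWt]) ?_).le
  rw [one_mul, hs, hs]
  norm_num

theorem Desc.negBlocks_eq_one {Z : List ℕ} (hZ : Desc 0 Z) (m : ℕ) : negBlocks m Z = 1 := by
  induction Z with
  | nil => rfl
  | cons b Z ih =>
    obtain rfl : b = 0 := Nat.le_zero.1 hZ.1
    rw [negBlocks, negBlock_zero, ih hZ.2, one_mul]

/-- Detach the two innermost labels of the block of size `p + 2`, here without any shift, and turn
these two fixed labels into two sign changes. -/
theorem redLE_raise_two {κ : ℕ} {p : ℕ} (hp : 0 < p) {Z : List ℕ} (hZ : Desc 0 Z) :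
    (signedData (p :: 1 :: 1 :: Z).sum κ).RedLE (negBlocks 0 ((p + 2) :: 0 :: 0 :: Z))
      (negBlocks 0 (p :: 1 :: 1 :: Z)) := by
  have hZ0 := hZ.sum_eq_zero
  have e1 : negBlocks 0 ((p + 2) :: 0 :: 0 :: Z) = negBlock 0 (p + 1 + 1) := by
    simp [negBlocks, hZ.negBlocks_eq_one, hZ0]
  have e2 : negBlocks 0 (p :: 1 :: 1 :: Z) = negBlocks 0 [1, 1] * negBlock 2 p := by
    simp [negBlocks, hZ.negBlocks_eq_one, hZ0]
  have hn : (p :: 1 :: 1 :: Z).sum = p + 2 := by simp [hZ0]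
  rw [e1, e2, hn]
  have h1 := conj_blockSwap_le (n := p + 2) (κ := κ) (m := 0) (j := 0) (r := 0) (p := p + 1) rfl
    (by omega) (by omega) (one_mem _)
  have h2 := conj_blockSwap_le (n := p + 2) (κ := κ) (m := 1) (j := 1) (r := 0) (p := p) rfl
    hp (by omega) (one_mem _)
  simp only [blockSwap_zero, one_mul, mul_one, inv_one] at h1 h2
  refine ⟨_, .rfl, (h1.trans h2).trans ?_⟩
  have := signedData_le_mul (n := p + 2) (κ := κ) (by omega) (negBlock_mem (m := 2) (b := p) (by omega))
    (fun x => negBlock_apply_of_le) (one_mem _) le_negBlocks_one_one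
  rwa [one_mul] at this

/-- On `[-m, m]` the permutation `blockSwap 0 m 1` only moves positive labels up and negative labels
down by one. It is increasing there, so the order is transported. -/
theorem signedData_le_conj_blockSwap {m n κ : ℕ} (hn : m + 1 ≤ n) {x y : Equiv.Perm ℤ}
    (hx : x ∈ signedPerm m) (h : (signedData m κ).le x y) : (signedData n κ).le
      (blockSwap 0 m 1 * x * (blockSwap 0 m 1)⁻¹) (blockSwap 0 m 1 * y * (blockSwap 0 m 1)⁻¹) := by
  have hσ : blockSwap 0 m 1 ∈ signedPerm n := signedPerm_mono (by omega) (blockSwap_mem _ _ _)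
  have hmono : ∀ a ∈ signedLabels m, ∀ b ∈ signedLabels m, a < b →
      blockSwap 0 m 1 a < blockSwap 0 m 1 b := by
    intro a ha b hb hab
    rw [mem_signedLabels] at ha hb
    rw [blockSwap_apply, blockSwap_apply]
    push_cast
    split_ifs <;> omega
  refine signedData_le_map (f := fun x => blockSwap 0 m 1 * x * (blockSwap 0 m 1)⁻¹) hσ (by omega)
    (fun x hx => mul_mem (mul_mem hσ (signedPerm_mono (by omega) hx)) (inv_mem hσ)) hmono ?_ ?_ hx h
  · intro x hx a ha b hb hab
    simpa using hmono _ (signedPerm_apply_mem hx ha) _ (signedPerm_apply_mem hx hb) hab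
  · intro x _ t _
    group

/-- Two different blocks give up one label each. Both labels are brought to the innermost positions
1 and 2, where they become two sign changes. -/
theorem redLE_raise_three {κ : ℕ} {p k : ℕ} (hp : 0 < p) (hk : 0 < k) (K K' : List ℕ) {Z : List ℕ}
    (hZ : Desc 0 Z) : (signedData (p :: (K ++ k :: (K' ++ 1 :: 1 :: Z))).sum κ).RedLE
      (negBlocks 0 ((p + 1) :: (K ++ (k + 1) :: (K' ++ 0 :: 0 :: Z))))
      (negBlocks 0 (p :: (K ++ k :: (K' ++ 1 :: 1 :: Z)))) := by
  have hZ0 := hZ.sum_eq_zero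
  set r := K'.sum with hr
  set m := r + k + 1 + K.sum with hm
  have e1 : negBlocks 0 ((p + 1) :: (K ++ (k + 1) :: (K' ++ 0 :: 0 :: Z))) =
      negBlocks 0 K' * negBlock r (k + 1) * negBlocks (r + k + 1) K * negBlock m (p + 1) := by
    simp [negBlocks, negBlocks_append, hZ.negBlocks_eq_one, hZ0, mul_assoc, add_assoc]
    rw [show K.sum + (k + (1 + r)) = m by omega, show k + (1 + r) = r + (k + 1) by omega]
  have e2 : negBlocks 0 (p :: (K ++ k :: (K' ++ 1 :: 1 :: Z))) =
      negBlocks 0 [1, 1] * (negBlocks 2 (K ++ k :: K') * negBlock (m + 1) p) := by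
    simp only [negBlocks, negBlocks_append, hZ.negBlocks_eq_one, hZ0, mul_assoc, List.sum_append,
      List.sum_cons, List.sum_nil, one_mul, zero_add]
    rw [show K.sum + (k + (K'.sum + (1 + (1 + 0)))) = m + 1 by omega,
      show k + (K'.sum + (1 + (1 + 0))) = 2 + (k + K'.sum) by omega,
      show K'.sum + (1 + (1 + 0)) = 2 + K'.sum by omega]
  have hn : (p :: (K ++ k :: (K' ++ 1 :: 1 :: Z))).sum = m + p + 1 := by
    simp [hZ0]; omega
  rw [e1, e2, hn]
  have hK' : negBlocks 0 K' ∈ signedPerm r := negBlocks_mem (by omega)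
  -- The block of size `k + 1` loses its innermost label, which passes the blocks of `K'` and
  -- becomes the fixed label 1.
  have hA := red_conj_blockSwap (n := r + k + 1) (κ := κ) (zero_add r).symm hk le_rfl hK'
  have hB := conj_blockSwap_le (n := r + k + 1) (κ := κ) (zero_add r).symm hk le_rfl hK'
  have e3 : blockSwap 0 r 1 * negBlocks 0 K' * (blockSwap 0 r 1)⁻¹ = negBlocks 1 K' :=
    conj_negBlocks (blockSwap_mem 0 r 1) K' fun x h1 h2 => by
      rw [blockSwap_apply, if_pos (by omega)]; omega
  rw [e3] at hB
  set v := blockSwap 0 r 1 * (negBlocks 0 K' * negBlock r (k + 1)) * (blockSwap 0 r 1)⁻¹ with hv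
  have hv0 : negBlocks 0 K' * negBlock r (k + 1) ∈ signedPerm (r + k + 1) :=
    mul_mem (signedPerm_mono (by omega) hK') (negBlock_mem (by omega))
  have hvm : v ∈ signedPerm (r + k + 1) := ShiftData.Red.mem (D := signedData (r + k + 1) κ) hv0 hA
  have hKm : negBlocks (r + k + 1) K ∈ signedPerm m := negBlocks_mem (by omega)
  have hA' := signedData_red_mul_negBlocks hv0 hA K hm
  have hvm' : v * negBlocks (r + k + 1) K ∈ signedPerm m :=
    mul_mem (signedPerm_mono (by omega) hvm) hKm
  have hB' := signedData_le_mul (n := m) (by omega) hKm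
    (fun x => negBlocks_apply_of_le K) hvm hB
  have hA2 := signedData_red_mul_negBlock (n := m + p + 1) (b := p + 1) (by omega)
    (mul_mem (signedPerm_mono (by omega) hv0) hKm) hA'
  -- The outer block of size `p + 1` does the same, passing everything inside it. The label freed
  -- before is pushed from 1 to 2.
  have hA3 := red_conj_blockSwap (n := m + p + 1) (κ := κ) (zero_add m).symm hp le_rfl hvm'
  have hB3 := conj_blockSwap_le (n := m + p + 1) (κ := κ) (zero_add m).symm hp le_rfl hvm'
  have hB4 := signedData_le_conj_blockSwap (n := m + 1) le_rfl hvm' hB'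
  have hσ := blockSwap_mem 0 m 1
  rw [zero_add] at hσ
  have e5 : negBlocks 1 K' * negBlock (r + 1) k * negBlocks (r + k + 1) K =
      negBlocks 1 (K ++ k :: K') := by
    rw [negBlocks_append, negBlocks, List.sum_cons, ← hr, add_comm 1 r,
      show 1 + (k + r) = r + k + 1 by omega]
  have e4 : blockSwap 0 m 1 * (negBlocks 1 K' * negBlock (r + 1) k * negBlocks (r + k + 1) K) *
      (blockSwap 0 m 1)⁻¹ = negBlocks 2 (K ++ k :: K') := by
    rw [e5]
    refine conj_negBlocks hσ _ fun x h1 h2 => ?_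
    simp only [List.sum_append, List.sum_cons] at h2
    rw [blockSwap_apply, if_pos (by omega)]; omega
  rw [e4] at hB4
  have hB5 := signedData_le_mul (n := m + p + 1) (m := m + 1) (by omega)
    (negBlock_mem (m := m + 1) (b := p) (by omega)) (fun x => negBlock_apply_of_le)
    (mul_mem (mul_mem hσ (signedPerm_mono (by omega) hvm')) (inv_mem hσ)) hB4
  refine ⟨_, hA2.trans hA3, (hB3.trans hB5).trans ?_⟩
  -- The labels 1 and 2 are now fixed, and all remaining factors act outside `[-2, 2]`.
  have := signedData_le_mul (n := m + p + 1) (κ := κ) (m := 2) (by omega)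
    (g := negBlocks 2 (K ++ k :: K') * negBlock (m + 1) p)
    (mul_mem (negBlocks_mem (by simp; omega)) (negBlock_mem (by omega)))
    (fun x h1 h2 => ?_) (one_mem _) le_negBlocks_one_one
  · rwa [one_mul] at this
  · rw [Equiv.Perm.mul_apply, negBlock_apply_of_le (by omega)
      (by omega), negBlocks_apply_of_le _ h1 h2]

/-! ### The order on classes of signed permutations -/

theorem below_of_redLE {n κ : ℕ} (hκ : κ = 0 ∨ κ = 2) {L L' : List ℕ} (hL : L.Pairwise (· ≥ ·))
    (hn : L.sum = n) (h : (signedData n κ).RedLE (negBlocks 0 L) (negBlocks 0 L')) :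
    (signedData n κ).Below (negClass n (L.filter (0 < ·) : List ℕ)) (negBlocks 0 L') := by
  obtain ⟨w, hr, hle⟩ := h
  exact ⟨w, Red.minSet (stable_negClass n κ _) (negBlocks_mem_minSet hκ hn hL) hr, hle⟩

theorem numPos_append (K L : List ℕ) : numPos (K ++ L) = numPos K + numPos L := by
  simp [numPos]

/-- Each combinatorial raising is realised by the corresponding passage of labels. The common
initial parts form outer blocks, which are harmless by `redLE_append`. -/
theorem exists_redLE_raise {n κ : ℕ} {L M : List ℕ}
    (hlen : L.length = M.length) (hL : L.Pairwise (· ≥ ·)) (hM : M.Pairwise (· ≥ ·)) (hn : L.sum = n)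
    (hs : L.sum = M.sum) (h : Dom 0 L M) (hne : L ≠ M)
    (he : κ = 2 ∨ Even (numPos L + numPos M)) :
    ∃ L', Raises L L' M ∧ (κ = 2 ∨ Even (numPos L' + numPos M)) ∧
      (signedData n κ).RedLE (negBlocks 0 L') (negBlocks 0 L) := by
  have hL' := desc_of_pairwise hL fun b hb => List.le_sum_of_mem hb
  have hM' := desc_of_pairwise hM fun b hb => List.le_sum_of_mem hb
  have key : ∀ (X : List ℕ) p R p' R', L = X ++ p :: R → Raises L (X ++ p' :: R') M →
      (signedData (p :: R).sum κ).RedLE (negBlocks 0 (p' :: R')) (negBlocks 0 (p :: R)) →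
      (signedData n κ).RedLE (negBlocks 0 (X ++ p' :: R')) (negBlocks 0 L) := by
    rintro X p R p' R' rfl hR hr
    refine redLE_append X ?_ hn hr
    have := hR.sum
    rw [List.sum_append, List.sum_append] at this
    omega
  rcases he with rfl | he
  · obtain ⟨X, p, K, q, Y, e, hR⟩ := exists_raise_one hlen hL' hM' hs h hne
    refine ⟨_, hR, .inl rfl, key _ _ _ _ _ e hR (redLE_raise_one ?_ K q Y (.inl rfl))⟩
    rw [e] at hL'
    obtain ⟨c, hc⟩ := hL'.tail_append
    have := hc.2.le (b := q + 1) (by simp)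
    omega
  · rcases exists_raise_even hlen hL' hM' hs h hne he with
      ⟨X, p, K, q, Y, hq, e, hR⟩ | ⟨X, p, Z, e, hR⟩ | ⟨X, p, K, k, K', Z, e, hR⟩
    · have hp : q + 1 ≤ p := by
        rw [e] at hL'
        obtain ⟨c, hc⟩ := hL'.tail_append
        exact hc.2.le (by simp)
      refine ⟨_, hR, .inr ?_, key _ _ _ _ _ e hR (redLE_raise_one (by omega) K q Y (.inr hq))⟩
      subst e
      simp only [numPos_append, numPos_cons] at he ⊢
      rw [if_pos (by omega), if_pos (by omega)] at he ⊢
      exact he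
    · have hp : 1 ≤ p := by
        rw [e] at hL'
        obtain ⟨c, hc⟩ := hL'.tail_append
        exact hc.2.le (by simp)
      have hZ : Desc 0 Z := by
        obtain ⟨c, hc⟩ := hR.desc
        obtain ⟨c', hc'⟩ := hc.tail_append
        exact hc'.2.2.2
      refine ⟨_, hR, .inr ?_, key _ _ _ _ _ e hR (redLE_raise_two hp hZ)⟩
      subst e
      simp only [numPos_append, numPos_cons] at he ⊢
      revert he
      simp only [Nat.even_iff]
      split_ifs <;> omega
    · have hk : 1 ≤ k ∧ k ≤ p := by
        rw [e] at hL'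
        obtain ⟨c, hc⟩ := hL'.tail_append
        obtain ⟨c', hc'⟩ := hc.2.tail_append
        exact ⟨hc'.2.le (by simp), hc.2.le (by simp)⟩
      have hZ : Desc 0 Z := by
        obtain ⟨c, hc⟩ := hR.desc
        obtain ⟨c1, h1⟩ := hc.tail_append
        obtain ⟨c2, h2⟩ := h1.2.tail_append
        obtain ⟨c3, h3⟩ := h2.2.tail_append
        exact h3.2.2
      refine ⟨_, hR, .inr ?_, key _ _ _ _ _ e hR
        (redLE_raise_three (by omega) hk.1 K K' hZ)⟩
      subst e
      simp only [numPos_append, numPos_cons] at he ⊢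
      revert he
      simp only [Nat.even_iff]
      split_ifs <;> omega

/-- Sufficiency of dominance: perform one raising, use induction for the raised list, and compose by
`Below.trans`. Each raising strictly decreases `tailSums`. -/
theorem below_of_dom {n κ : ℕ} (hκ : κ = 0 ∨ κ = 2) {L M : List ℕ}
    (hlen : L.length = M.length) (hL : L.Pairwise (· ≥ ·)) (hM : M.Pairwise (· ≥ ·)) (hn : L.sum = n)
    (hs : L.sum = M.sum) (h : Dom 0 L M) (he : κ = 2 ∨ Even (numPos L + numPos M)) :
    (signedData n κ).Below (negClass n (M.filter (0 < ·) : List ℕ)) (negBlocks 0 L) := by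
  by_cases hne : L = M
  · subst hne
    exact ⟨_, negBlocks_mem_minSet hκ hn hL, ShiftData.le.rfl⟩
  · obtain ⟨L', hR, he', hr⟩ := exists_redLE_raise hlen hL hM hn hs h hne he
    obtain ⟨c, hc⟩ := hR.desc
    have hn' : L'.sum = n := hR.sum.trans hn
    have := hR.tail
    have ih := below_of_dom hκ (hR.length.trans hlen) hc.pairwise hM hn' (hR.sum.trans hs) hR.dom he'
    exact Below.trans (stable_negClass n κ _) (stable_negClass n κ _)
      (fun x hx => red_negBlocks_of_mem_minSet hκ hc.pairwise hx) ih
      (below_of_redLE hκ hc.pairwise hn' hr)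
termination_by tailSums L

/-! ### Partitions as decreasing lists padded to a common length. -/

namespace Nat.Partition

variable {n : ℕ}

/-- The parts in decreasing order. -/
noncomputable def sorted (α : n.Partition) : List ℕ := α.parts.sort (· ≥ ·)

theorem pairwise_sorted (α : n.Partition) : α.sorted.Pairwise (· ≥ ·) :=
  Multiset.pairwise_sort _ _

theorem coe_sorted (α : n.Partition) : (α.sorted : Multiset ℕ) = α.parts := Multiset.sort_eq _ _

theorem pos_of_mem_sorted (α : n.Partition) {b : ℕ} (hb : b ∈ α.sorted) : 0 < b :=
  α.parts_pos ((Multiset.mem_sort _).1 hb)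

theorem sum_sorted (α : n.Partition) : α.sorted.sum = n := by
  rw [← Multiset.sum_coe, coe_sorted, α.parts_sum]

theorem length_sorted (α : n.Partition) : α.sorted.length = Multiset.card α.parts :=
  Multiset.length_sort _

/-- The parts in decreasing order, padded by zeros to length `n`. -/
noncomputable def padded (α : n.Partition) : List ℕ :=
  α.sorted ++ List.replicate (n - α.sorted.length) 0

theorem length_sorted_le (α : n.Partition) : α.sorted.length ≤ n := by
  have := List.card_nsmul_le_sum α.sorted 1 fun b hb => α.pos_of_mem_sorted hb
  rwa [α.sum_sorted, smul_eq_mul, mul_one] at this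

theorem length_padded (α : n.Partition) : α.padded.length = n := by
  have := α.length_sorted_le
  simp only [padded, List.length_append, List.length_replicate]
  omega

theorem sum_padded (α : n.Partition) : α.padded.sum = n := by
  simp [padded, sum_sorted]

theorem filter_padded (α : n.Partition) : α.padded.filter (0 < ·) = α.sorted := by
  rw [padded, List.filter_append, List.filter_eq_self.2 fun b hb => by
    simpa using α.pos_of_mem_sorted hb, List.filter_eq_nil_iff.2, List.append_nil]
  intro a ha
  simp [List.eq_of_mem_replicate ha]

theorem pairwise_padded (α : n.Partition) : α.padded.Pairwise (· ≥ ·) := by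
  rw [padded, List.pairwise_append]
  refine ⟨α.pairwise_sorted, List.pairwise_replicate.2 (.inr le_rfl), fun a _ b hb => ?_⟩
  rw [List.eq_of_mem_replicate hb]
  exact Nat.zero_le a

theorem sum_take_padded (α : n.Partition) (k : ℕ) : (α.padded.take k).sum = α.partialSum k := by
  rw [padded, List.take_append, List.sum_append, List.take_replicate, List.sum_replicate,
    smul_zero, add_zero]
  rfl

theorem dominanceLE_iff (α β : n.Partition) :
    β.DominanceLE α ↔ ∀ k, (β.padded.take k).sum ≤ (α.padded.take k).sum := by
  simp only [DominanceLE, sum_take_padded]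

theorem numPos_padded (α : n.Partition) : numPos α.padded = Multiset.card α.parts := by
  rw [numPos, filter_padded, length_sorted]

end Nat.Partition

/-! ### The dominance criterion for classes of signed permutations. -/

theorem signedClass_eq_negClass_padded {n : ℕ} (α : n.Partition) :
    signedClass α = negClass n (α.padded.filter (0 < ·) : List ℕ) := by
  rw [signedClass_eq_negClass, α.filter_padded, α.coe_sorted]

/-- All minimal elements of the class of `β` lead to its normal form, so the minimal element on top
may be taken to be this normal form. The two directions are `sum_take_le_of_below` and
`below_of_dom`. -/
theorem exists_below_signedClass_iff {n κ : ℕ} (hκ : κ = 0 ∨ κ = 2) (α β : n.Partition)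
    (h : κ = 2 ∨ Even (Multiset.card α.parts + Multiset.card β.parts)) :
    (∃ y ∈ (signedData n κ).minSet (signedClass β), (signedData n κ).Below (signedClass α) y) ↔
      β.DominanceLE α := by
  rw [α.dominanceLE_iff, signedClass_eq_negClass_padded, signedClass_eq_negClass_padded]
  constructor
  · rintro ⟨y, hy, hb⟩ k
    have hr := red_negBlocks_of_mem_minSet hκ β.pairwise_padded hy
    have h1 := (hr.below_iff (stable_negClass n κ _) (stable_negClass n κ _) hy).1 hb
    have h2 := sum_take_le_of_below (α.pairwise_padded.filter _) β.sum_padded h1 k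
    rw [α.filter_padded] at h2
    rw [α.sum_take_padded]
    exact h2
  · intro hd
    refine ⟨_, negBlocks_mem_minSet hκ β.sum_padded β.pairwise_padded, below_of_dom hκ
      (β.length_padded.trans α.length_padded.symm) β.pairwise_padded α.pairwise_padded β.sum_padded
      (β.sum_padded.trans α.sum_padded.symm) (dom_of_take fun k => by simpa using hd k) ?_⟩
    rwa [β.numPos_padded, α.numPos_padded, add_comm]

/-! ### Models of cosets of Weyl groups -/

namespace WeylCoset

variable {G G' : Type*} [Group G] [Group G'] {D : WeylCoset G} {E : ShiftData G'} {φ : G →* G'}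

/-- The coset `D` is described by the combinatorial data `E` on its image under `φ`. -/
structure Model (D : WeylCoset G) (E : ShiftData G') (φ : G →* G') : Prop where
  S_sub : ∀ s ∈ D.S, s ∈ D.W0
  eps_S : ∀ s ∈ D.S, D.eps * s * D.eps⁻¹ ∈ D.S ∧ D.eps⁻¹ * s * D.eps ∈ D.S
  eps_W0 : ∀ g ∈ D.W0, D.eps * g * D.eps⁻¹ ∈ D.W0 ∧ D.eps⁻¹ * g * D.eps ∈ D.W0
  map_mem : ∀ w ∈ D.W0, φ (w * D.eps) ∈ E.H
  inj : ∀ w ∈ D.W0, φ w = 1 → w = 1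
  map_S : ∀ s ∈ D.S, φ s ∈ E.S
  map_reflections : ∀ t ∈ D.reflections, φ t ∈ E.T
  exists_reflection : ∀ t ∈ E.T, ∃ t' ∈ D.reflections, φ t' = t
  len_eps : E.len (φ D.eps) = 0
  exists_descent : ∀ w ∈ D.W0, E.len (φ (w * D.eps)) ≠ 0 →
    ∃ s ∈ D.S, E.len (φ (w * D.eps) * φ s) < E.len (φ (w * D.eps))
  eq_one : ∀ w ∈ D.W0, E.len (φ (w * D.eps)) = 0 → w = 1

theorem reflections_sub (hS : ∀ s ∈ D.S, s ∈ D.W0) {t : G} (ht : t ∈ D.reflections) :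
    t ∈ D.W0 := by
  obtain ⟨g, hg, s, hs, rfl⟩ := ht
  exact mul_mem (mul_mem hg (hS s hs)) (inv_mem hg)

namespace Model

/-- Since `w s ε = (w ε)(ε⁻¹ s ε)`, lengthening the word by `s` multiplies the coset element by
another simple reflection, which changes its length by one gap. -/
theorem len_word (h : Model D E φ) (l : List G) (hl : ∀ s ∈ l, s ∈ D.S) :
    l.prod ∈ D.W0 ∧ E.len (φ (l.prod * D.eps)) ≤ E.gap * l.length := by
  induction l using List.reverseRecOn with
  | nil => simp [h.len_eps]
  | append_singleton l s ih =>
    obtain ⟨h1, h2⟩ := ih fun t ht => hl t (by simp [ht])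
    have hs := hl s (by simp)
    refine ⟨by simpa using mul_mem h1 (h.S_sub s hs), ?_⟩
    have h3 := E.len_mul _ (h.map_mem _ h1) _ (h.map_S _ (h.eps_S s hs).2)
    have e : (l ++ [s]).prod * D.eps = l.prod * D.eps * (D.eps⁻¹ * s * D.eps) := by
      rw [List.prod_append, List.prod_singleton]
      group
    rw [e, map_mul, List.length_append, List.length_singleton, mul_add, mul_one]
    omega

/-- Descend along simple reflections until the combinatorial length is zero, where `eq_one` applies.
Every descent `s` of the coset element contributes the letter `ε s ε⁻¹`. -/
theorem exists_word (h : Model D E φ) {w : G} (hw : w ∈ D.W0) :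
    ∃ l : List G, (∀ s ∈ l, s ∈ D.S) ∧ l.prod = w ∧ E.gap * l.length = E.len (φ (w * D.eps)) := by
  induction hk : E.len (φ (w * D.eps)) using Nat.strong_induction_on generalizing w with
  | _ k ih =>
  subst hk
  by_cases h0 : E.len (φ (w * D.eps)) = 0
  · exact ⟨[], by simp, (h.eq_one w hw h0).symm, by rw [h0, List.length_nil, mul_zero]⟩
  obtain ⟨s, hs, hlt⟩ := h.exists_descent w hw h0
  have hs' := (h.eps_S s hs).1
  have e : w * D.eps * s = w * (D.eps * s * D.eps⁻¹) * D.eps := by group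
  rw [← map_mul, e] at hlt
  obtain ⟨l, h1, h2, h3⟩ := ih _ hlt (mul_mem hw (h.S_sub _ hs')) rfl
  refine ⟨l ++ [D.eps * s * D.eps⁻¹], ?_, ?_, ?_⟩
  · intro t ht
    rw [List.mem_append, List.mem_singleton] at ht
    rcases ht with ht | rfl
    · exact h1 t ht
    · exact hs'
  · have hsq : s * s = 1 := h.inj _ (mul_mem (h.S_sub s hs) (h.S_sub s hs))
      (by rw [map_mul]; exact E.sq _ (E.S_sub (h.map_S s hs)))
    rw [List.prod_append, List.prod_singleton, h2]
    calc _ = w * D.eps * (s * s) * D.eps⁻¹ := by group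
      _ = w := by rw [hsq]; group
  · have h4 := E.len_mul _ (h.map_mem _ hw) _ (h.map_S s hs)
    rw [← map_mul, e] at h4
    rw [List.length_append, List.length_singleton, mul_add, mul_one]
    omega

/-- No word is too short by `len_word`, and the bound is attained by `exists_word`. -/
theorem gap_mul_len (h : Model D E φ) {w : G} (hw : w ∈ D.W0) :
    E.gap * D.len w = E.len (φ (w * D.eps)) := by
  obtain ⟨l, h1, h2, h3⟩ := h.exists_word hw
  obtain ⟨l', h1', h2', h3'⟩ : D.len w ∈ {k | ∃ l : List G, (∀ s ∈ l, s ∈ D.S) ∧ l.prod = w ∧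
      l.length = k} := Nat.sInf_mem ⟨_, l, h1, h2, rfl⟩
  have h4 : D.len w ≤ l.length := Nat.sInf_le ⟨l, h1, h2, rfl⟩
  have h5 := (h.len_word l' h1').2
  rw [h2', h3'] at h5
  exact le_antisymm (h3 ▸ Nat.mul_le_mul_left _ h4) h5

theorem gap_mul_cosetLen (h : Model D E φ) {x : G} (hx : x ∈ D.coset) :
    E.gap * D.cosetLen x = E.len (φ x) := by
  obtain ⟨w, hw, rfl⟩ := hx
  rw [cosetLen, mul_inv_cancel_right, h.gap_mul_len hw]

theorem cosetLen_le_iff (h : Model D E φ) {x y : G} (hx : x ∈ D.coset) (hy : y ∈ D.coset) :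
    D.cosetLen x ≤ D.cosetLen y ↔ E.len (φ x) ≤ E.len (φ y) := by
  rw [← h.gap_mul_cosetLen hx, ← h.gap_mul_cosetLen hy, mul_le_mul_iff_right₀ E.gap_pos]

/-- Moving the right factor `t` past `ε` turns it into `ε⁻¹ t ε`, which is again a reflection
because `ε` normalizes both `W⁰` and `S`. -/
theorem le_of_bruhatLE (h : Model D E φ) {w w' : G} (hw : w ∈ D.W0) (hle : D.bruhatLE w w') :
    w' ∈ D.W0 ∧ E.le (φ (w * D.eps)) (φ (w' * D.eps)) := by
  induction hle with
  | refl => exact ⟨hw, .refl⟩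
  | @tail a b h1 h2 ih =>
    obtain ⟨t, ⟨g, hg, s, hs, rfl⟩, rfl, hl⟩ := h2
    have ht : g * s * g⁻¹ ∈ D.W0 := reflections_sub h.S_sub ⟨g, hg, s, hs, rfl⟩
    have hb := mul_mem ih.1 ht
    refine ⟨hb, ih.2.tail ⟨φ (D.eps⁻¹ * (g * s * g⁻¹) * D.eps), h.map_reflections _ ?_, ?_, ?_⟩⟩
    · refine ⟨D.eps⁻¹ * g * D.eps, (h.eps_W0 g hg).2, _, (h.eps_S s hs).2, ?_⟩
      group
    · rw [← map_mul]
      congr 1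
      group
    · rw [← h.gap_mul_len ih.1, ← h.gap_mul_len hb]
      exact Nat.mul_lt_mul_of_pos_left hl E.gap_pos

theorem exists_bruhatLE (h : Model D E φ) {w : G} {z : G'} (hw : w ∈ D.W0)
    (hle : E.le (φ (w * D.eps)) z) :
    ∃ w' ∈ D.W0, φ (w' * D.eps) = z ∧ D.bruhatLE w w' := by
  induction hle with
  | refl => exact ⟨w, hw, rfl, .refl⟩
  | @tail a b h1 h2 ih =>
    obtain ⟨w', hw', rfl, hle⟩ := ih
    obtain ⟨t, ht, rfl, hl⟩ := h2
    obtain ⟨t', ⟨g, hg, s, hs, rfl⟩, rfl⟩ := h.exists_reflection t ht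
    have ht' : D.eps * (g * s * g⁻¹) * D.eps⁻¹ ∈ D.reflections :=
      ⟨D.eps * g * D.eps⁻¹, (h.eps_W0 g hg).1, _, (h.eps_S s hs).1, by group⟩
    have hb := mul_mem hw' (reflections_sub h.S_sub ht')
    have e : w' * (D.eps * (g * s * g⁻¹) * D.eps⁻¹) * D.eps =
      w' * D.eps * (g * s * g⁻¹) := by group
    refine ⟨_, hb, by rw [e, map_mul], hle.tail ⟨_, ht', rfl, ?_⟩⟩
    rw [← map_mul, ← e, ← h.gap_mul_len hw', ← h.gap_mul_len hb] at hl
    exact Nat.lt_of_mul_lt_mul_left hl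

theorem injOn_coset (h : Model D E φ) : Set.InjOn φ D.coset := by
  rintro _ ⟨w, hw, rfl⟩ _ ⟨w', hw', rfl⟩ e
  rw [map_mul, map_mul, mul_left_inj] at e
  have := h.inj (w * w'⁻¹) (mul_mem hw (inv_mem hw')) (by rw [map_mul, map_inv, e, mul_inv_cancel])
  rw [mul_inv_eq_one.1 this]

theorem cosetLE_iff (h : Model D E φ) {x y : G} (hx : x ∈ D.coset) (hy : y ∈ D.coset) :
    D.cosetLE x y ↔ E.le (φ x) (φ y) := by
  have hx' := hx
  obtain ⟨w, hw, rfl⟩ := hx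
  obtain ⟨w', hw', rfl⟩ := hy
  rw [cosetLE, mul_inv_cancel_right, mul_inv_cancel_right]
  refine ⟨fun hle => (h.le_of_bruhatLE hw hle).2, fun hle => ?_⟩
  obtain ⟨w₁, h1, h2, h3⟩ := h.exists_bruhatLE hw hle
  rwa [mul_right_cancel (h.injOn_coset ⟨w₁, h1, rfl⟩ ⟨w', hw', rfl⟩ h2)] at h3

theorem mem_minElts_iff (h : Model D E φ) {C : Set G} (hC : C ⊆ D.coset) {x : G} (hx : x ∈ D.coset) :
    x ∈ D.minElts C ↔ φ x ∈ E.minSet (φ '' C) := by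
  constructor
  · rintro ⟨h1, h2⟩
    refine ⟨⟨x, h1, rfl⟩, ?_⟩
    rintro _ ⟨y, hy, rfl⟩
    exact (h.cosetLen_le_iff (hC h1) (hC hy)).1 (h2 y hy)
  · rintro ⟨⟨y, hy, e⟩, h2⟩
    rw [h.injOn_coset (hC hy) hx e] at hy
    exact ⟨hy, fun z hz => (h.cosetLen_le_iff hx (hC hz)).2 (h2 _ ⟨z, hz, rfl⟩)⟩

theorem precW_iff (h : Model D E φ) {C C' : Set G} (hC : C ⊆ D.coset) (hC' : C' ⊆ D.coset) :
    D.precW C C' ↔ ∃ y ∈ E.minSet (φ '' C'), E.Below (φ '' C) y := by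
  constructor
  · rintro ⟨w', hw', w, hw, hle⟩
    exact ⟨_, (h.mem_minElts_iff hC' (hC' hw'.1)).1 hw', _, (h.mem_minElts_iff hC (hC hw.1)).1 hw,
      (h.cosetLE_iff (hC hw.1) (hC' hw'.1)).1 hle⟩
  · rintro ⟨_, hy, _, hx, hle⟩
    obtain ⟨w', hw', rfl⟩ := hy.1
    obtain ⟨w, hw, rfl⟩ := hx.1
    exact ⟨w', (h.mem_minElts_iff hC' (hC' hw')).2 hy, w, (h.mem_minElts_iff hC (hC hw)).2 hx,
      (h.cosetLE_iff (hC hw) (hC' hw')).2 hle⟩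

end Model

end WeylCoset

/-! ### Elliptic classes -/

theorem Subgroup.apply_mem_of_mem_closure {α : Type*} {J : Set (Equiv.Perm α)} {A : Finset α}
    (hJ : ∀ s ∈ J, ∀ x ∈ A, s x ∈ A) {w : Equiv.Perm α} (hw : w ∈ Subgroup.closure J) :
    ∀ x ∈ A, w x ∈ A := by
  have key : ∀ x, w x ∈ A ↔ x ∈ A := by
    induction hw using Subgroup.closure_induction with
    | mem s hs => exact Equiv.Perm.apply_mem_iff_of_mapsTo (hJ s hs)
    | one => simp
    | mul a b _ _ ha hb => intro x; rw [Equiv.Perm.mul_apply, ha, hb]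
    | inv a _ ha =>
      intro x
      rw [← ha, ← Equiv.Perm.mul_apply, mul_inv_cancel, Equiv.Perm.one_apply]
  exact fun x hx => (key x).2 hx

theorem not_negCycles_of_mapsTo {n : ℕ} {w : Equiv.Perm ℤ} {A : Finset ℤ} (h : ∀ x ∈ A, w x ∈ A)
    {a : ℤ} (ha : a ∈ A) (ha' : a ∈ signedLabels n) (hna : -a ∉ A) : ¬ NegCycles n w := fun hw =>
  hna (((hw.2 a ha').mem_iff_of_stable (A := {x | x ∈ A})
    (Equiv.Perm.apply_mem_iff_of_mapsTo h)).1 ha)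

/-! ### Parity of signed permutations -/

/-- The product of the signs of the images of the positive labels. -/
noncomputable def signProd (n : ℕ) (w : Equiv.Perm ℤ) : ℤ := ∏ i ∈ Finset.Icc (1 : ℤ) n, (w i).sign

theorem mem_evenSignedPerm_iff {n : ℕ} {w : Equiv.Perm ℤ} :
    w ∈ evenSignedPerm n ↔ w ∈ signedPerm n ∧ signProd n w = 1 :=
  ⟨fun h => ⟨h.1, (even_numNeg_iff h.1).1 h.2⟩, fun h => ⟨h.1, (even_numNeg_iff h.1).2 h.2⟩⟩

theorem signProd_mul {n : ℕ} {a b : Equiv.Perm ℤ} (ha : a ∈ signedPerm n) (hb : b ∈ signedPerm n) :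
    signProd n (a * b) = signProd n a * signProd n b := prod_sign_mul ha hb

theorem signProd_eq_or {n : ℕ} {w : Equiv.Perm ℤ} (hw : w ∈ signedPerm n) :
    signProd n w = 1 ∨ signProd n w = -1 := by
  rw [signProd, prod_sign_eq hw]
  exact neg_one_pow_eq_or ℤ _

theorem signProd_one (n : ℕ) : signProd n 1 = 1 := (mem_evenSignedPerm_iff.1 (one_mem _)).2

theorem signProd_inv {n : ℕ} {a : Equiv.Perm ℤ} (ha : a ∈ signedPerm n) :
    signProd n a⁻¹ = signProd n a := by
  have h := signProd_mul ha (inv_mem ha)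
  rw [mul_inv_cancel, signProd_one] at h
  rcases signProd_eq_or ha with h' | h' <;> rw [h'] at h ⊢ <;> omega

theorem signProd_conj {n : ℕ} {a g : Equiv.Perm ℤ} (ha : a ∈ signedPerm n) (hg : g ∈ signedPerm n) :
    signProd n (g * a * g⁻¹) = signProd n a := by
  rw [signProd_mul (mul_mem hg ha) (inv_mem hg), signProd_mul hg ha, signProd_inv hg]
  rcases signProd_eq_or hg with h | h <;> rw [h] <;> ring

theorem signProd_negBlock {n m b : ℕ} (hb : 0 < b) (h : m + b ≤ n) :
    signProd n (negBlock m b) = -1 := by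
  have : (Finset.Icc (1 : ℤ) n).filter (fun i => negBlock m b i < 0) = {(m + b : ℤ)} := by
    ext i
    rw [Finset.mem_filter, Finset.mem_Icc, Finset.mem_singleton, negBlock_apply]
    split_ifs <;> omega
  rw [signProd, prod_sign_eq (negBlock_mem h), numNeg, this, Finset.card_singleton, pow_one]

theorem signProd_signChange {n : ℕ} (hn : 1 ≤ n) : signProd n signChange = -1 := by
  rw [← negBlock_zero_one]
  exact signProd_negBlock one_pos hn

theorem signProd_negBlocks {n : ℕ} {L : List ℕ} (h : L.sum ≤ n) :
    signProd n (negBlocks 0 L) = (-1) ^ numPos L := by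
  induction L with
  | nil => simp [negBlocks, signProd_one, numPos]
  | cons b L ih =>
    rw [List.sum_cons] at h
    rw [negBlocks, signProd_mul (negBlocks_mem (by omega)) (negBlock_mem (by omega)), ih (by omega),
      numPos_cons]
    rcases Nat.eq_zero_or_pos b with rfl | hb
    · rw [negBlock_zero, signProd_one]; simp
    · rw [signProd_negBlock hb (by omega), if_pos hb, pow_succ]

theorem signProd_of_mem_signedClass {n : ℕ} {α : n.Partition} {w : Equiv.Perm ℤ}
    (hw : w ∈ signedClass α) : signProd n w = (-1) ^ Multiset.card α.parts := by
  rw [mem_signedClass_iff, ← α.coe_sorted] at hw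
  obtain ⟨g, hg, rfl⟩ := hw.1.exists_conj_negBlocks hw.2
  rw [signProd_conj (negBlocks_mem (by simp [α.sum_sorted])) hg,
    signProd_negBlocks α.sum_sorted.le, ← α.coe_sorted, Multiset.coe_card, numPos,
    List.filter_eq_self.2 fun b hb => by simpa using α.pos_of_mem_sorted hb]

/-! ### Elements of small length -/

/-- Without descents `w` increases on `1, …, n`, and the last simple reflection gives `0 < w 1` in
type B or `-w 1 < w 2` in type D. This excludes every inversion of positive weight. -/
theorem exists_simplePair_descent {n κ : ℕ} (hκ : κ = 0 ∨ κ = 2) {w : Equiv.Perm ℤ}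
    (hw : w ∈ signedPerm n) (h : signedLen n κ w ≠ 0) :
    ∃ a b, SimplePair n κ a b ∧ w b < w a := by
  by_contra! hno
  have hlt : ∀ a b, SimplePair n κ a b → w a < w b := fun a b hab =>
    lt_of_le_of_ne (hno a b hab) fun e => hab.mem.2.2.1.ne (w.injective e)
  have h1 : ∀ k : ℕ, ∀ i : ℤ, 1 ≤ i → i + k ≤ n → w i ≤ w (i + k) := by
    intro k i hi
    induction k with
    | zero => simp
    | succ k ih =>
      intro hk
      have := hlt (i + k) (i + k + 1) (.inl ⟨by omega, by omega, by push_cast at hk; omega⟩)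
      push_cast at hk ⊢
      have := ih (by omega)
      rw [← add_assoc]
      omega
  have h2 : ∀ i j : ℤ, 1 ≤ i → i ≤ j → j ≤ n → w i ≤ w j := fun i j hi hij hj => by
    have := h1 (j - i).toNat i hi (by omega)
    rwa [show i + ((j - i).toNat : ℤ) = j by omega] at this
  have h3 : ∀ i : ℤ, 1 ≤ i → i ≤ n → (κ = 2 ∨ 2 ≤ i) → 0 < w i := by
    intro i hi hin hc
    by_cases hk : κ = 2
    · have := hlt (-1) 1 (.inr (.inl ⟨hk, by omega, rfl, rfl⟩))
      rw [hw.1] at this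
      have := h2 1 i le_rfl hi hin
      omega
    · have := hlt (-1) 2 (.inr (.inr ⟨by omega, by omega, rfl, rfl⟩))
      have h4 := hlt 1 2 (.inl ⟨by omega, by omega, by omega⟩)
      rw [hw.1] at this
      have := h2 2 i (by omega) (by omega) hin
      omega
  refine h (invSum_eq_zero fun c hc d hd hcd hwt => ?_)
  rw [mem_signedLabels] at hc hd
  by_cases hc0 : 0 < c
  · exact h2 c d (by omega) hcd.le hd.2.2
  by_cases hd0 : 0 < d
  · have e : w c = - w (-c) := by rw [hw.1, neg_neg]
    rw [e]
    by_cases hκ2 : κ = 2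
    · have := h3 (-c) (by omega) (by omega) (.inl hκ2)
      have := h3 d (by omega) (by omega) (.inl hκ2)
      omega
    · have hcd' : c ≠ -d := by
        intro h'
        rw [signedWt, if_pos h'] at hwt
        omega
      by_cases hc1 : c = -1
      · have h4 := hlt (-1) 2 (.inr (.inr ⟨by omega, by omega, rfl, rfl⟩))
        have := h2 2 d (by omega) (by omega) (by omega)
        rw [← e, hc1]
        omega
      by_cases hd1 : d = 1
      · have h4 := hlt (-1) 2 (.inr (.inr ⟨by omega, by omega, rfl, rfl⟩))
        have := h2 2 (-c) (by omega) (by omega) (by omega)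
        rw [hw.1] at h4
        rw [hd1]
        omega
      have := h3 (-c) (by omega) (by omega) (.inr (by omega))
      have := h3 d (by omega) (by omega) (.inr (by omega))
      omega
  · have := h2 (-d) (-c) (by omega) (by omega) (by omega)
    rw [hw.1, hw.1] at this
    omega

/-- For labels `i ≥ 2`, monotonicity forces `w i ≥ i` from below and `w i ≤ i` from above. Only the
sign of `w 1` stays open, and in type B the weight of `(-1, 1)` fixes it. -/
theorem eq_one_or_signChange_of_signedLen_eq_zero {n κ : ℕ} {w : Equiv.Perm ℤ}
    (hw : w ∈ signedPerm n) (h : signedLen n κ w = 0) : w = 1 ∨ (κ = 0 ∧ w = signChange) := by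
  have hlt : ∀ c ∈ signedLabels n, ∀ d ∈ signedLabels n, c < d → 0 < signedWt κ c d → w c < w d :=
    fun c hc d hd hcd hwt => lt_of_le_of_ne (le_of_invSum_eq_zero h hc hd hcd hwt)
      fun e => hcd.ne (w.injective e)
  simp only [mem_signedLabels, signedWt] at hlt
  have hstep : ∀ i : ℤ, 1 ≤ i → i + 1 ≤ n → w i < w (i + 1) := fun i hi hin =>
    hlt i (by omega) (i + 1) (by omega) (by omega) (by rw [if_neg (by omega)]; exact one_pos)
  have hge : ∀ k : ℕ, (k : ℤ) + 2 ≤ n → (k : ℤ) + 2 ≤ w (k + 2) := by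
    intro k
    induction k with
    | zero =>
      intro hk
      have h1 := hstep 1 le_rfl (by omega)
      have h2 := hlt (-1) (by omega) 2 (by omega) (by omega)
        (by rw [if_neg (by omega)]; exact one_pos)
      have h3 := signedPerm_apply_ne_zero hw (i := 1) (by omega)
      rw [hw.1] at h2
      norm_num at h1 ⊢
      omega
    | succ k ih =>
      intro hk
      have := hstep (k + 2) (by omega) (by push_cast at hk; omega)
      push_cast at hk ⊢
      have := ih (by omega)
      rw [show (k : ℤ) + 1 + 2 = k + 2 + 1 by ring]
      omega
  have hle : ∀ k : ℕ, 1 ≤ (n : ℤ) - k → w (n - k) ≤ n - k := by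
    intro k
    induction k with
    | zero =>
      intro hk
      have := (signedPerm_apply_le hw (a := n) (by omega) le_rfl).2
      simpa using this
    | succ k ih =>
      intro hk
      push_cast at hk ⊢
      have := hstep (n - (k + 1)) (by omega) (by omega)
      have := ih (by omega)
      rw [show (n : ℤ) - (k + 1) + 1 = n - k by ring] at *
      omega
  have heq : ∀ i : ℤ, 2 ≤ i → i ≤ n → w i = i := by
    intro i h1 h2
    have h3 := hge (i - 2).toNat (by omega)
    have h4 := hle (n - i).toNat (by omega)
    rw [show ((i - 2).toNat : ℤ) + 2 = i by omega] at h3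
    rw [show (n : ℤ) - ((n - i).toNat : ℤ) = i by omega] at h4
    omega
  by_cases hn : n = 0
  · exact .inl (signedPerm_ext hw (one_mem _) fun i h1 h2 => by omega)
  have h1 : w 1 = 1 ∨ w 1 = -1 := by
    have h2 := signedPerm_apply_ne_zero hw (i := 1) (by omega)
    have h3 := hle (n - 1) (by omega)
    rw [show (n : ℤ) - ((n - 1 : ℕ) : ℤ) = 1 by omega] at h3
    have h4 := signedPerm_apply_le hw (a := 1) (by omega) (by omega)
    by_cases hn1 : n = 1
    · omega
    · have h5 := hlt (-1) (by omega) 2 (by omega) (by omega)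
        (by rw [if_neg (by omega)]; exact one_pos)
      rw [hw.1, heq 2 le_rfl (by omega)] at h5
      omega
  rcases h1 with h1 | h1
  · refine .inl (signedPerm_ext hw (one_mem _) fun i hi hi' => ?_)
    rw [Equiv.Perm.one_apply]
    by_cases hi1 : i = 1
    · rw [hi1, h1]
    · exact heq i (by omega) hi'
  · right
    constructor
    · by_contra hκ
      have := hlt (-1) (by omega) 1 (by omega) (by omega) (by rw [if_pos rfl]; omega)
      rw [hw.1] at this
      omega
    · refine signedPerm_ext hw (signChange_mem (by omega)) fun i hi hi' => ?_
      rw [signChange_apply]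
      by_cases hi1 : i = 1
      · rw [hi1, h1, if_pos rfl]
      · rw [if_neg hi1, if_neg (by omega)]
        exact heq i (by omega) hi'

/-! ### Simple reflections and reflections -/

theorem signedPerm_exists_apply {n : ℕ} {a b : ℤ} (ha : a ∈ signedLabels n) (hb : b ∈ signedLabels n)
    (hab : a ≠ b) (hab' : a ≠ -b) : ∃ g ∈ signedPerm n, g 1 = a ∧ g 2 = b := by
  have hn : 2 ≤ n := by
    rw [mem_signedLabels] at ha hb
    omega
  have key : ∀ c d : ℤ, c ∈ signedLabels n → d ∈ signedLabels n → ∃ g ∈ signedPerm n, g c = d ∧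
      ∀ x, x ≠ c → x ≠ -c → x ≠ d → x ≠ -d → g x = x := by
    intro c d hc hd
    by_cases hcd : c = d
    · subst hcd
      exact ⟨1, one_mem _, rfl, fun _ _ _ _ _ => rfl⟩
    · have e := signedSwap_apply (mem_signedLabels.1 hc).1 (mem_signedLabels.1 hd).1 hcd
      refine ⟨_, signedSwap_mem hc hd hcd, by simp [e], fun x h1 h2 h3 h4 => ?_⟩
      rw [e, if_neg h1, if_neg h3, if_neg h2, if_neg h4]
  obtain ⟨g, hg, h1, -⟩ := key 1 a (by rw [mem_signedLabels]; omega) ha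
  have hc := signedPerm_apply_mem (inv_mem hg) hb
  have hgc : g (g⁻¹ b) = b := by rw [← Equiv.Perm.mul_apply, mul_inv_cancel, Equiv.Perm.one_apply]
  set c := g⁻¹ b with hcd
  obtain ⟨g', hg', h1', h2'⟩ := key 2 c (by rw [mem_signedLabels]; omega) hc
  refine ⟨g * g', mul_mem hg hg', ?_, by rw [Equiv.Perm.mul_apply, h1', hgc]⟩
  rw [Equiv.Perm.mul_apply, h2' 1 (by norm_num) (by norm_num) ?_ ?_, h1]
  · rintro h
    rw [← h] at hgc
    omega
  · rintro h
    rw [← neg_neg c, ← h, hg.1] at hgc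
    omega

theorem adjacentSigned_eq (n : ℕ) : adjacentSigned n =
    {s | ∃ i : ℤ, 1 ≤ i ∧ i + 1 ≤ n ∧ s = signedSwap i (i + 1)} := by
  ext s
  simp only [adjacentSigned, Set.mem_ofPred_eq]
  refine exists_congr fun i => and_congr_right fun hi => and_congr_right fun _ => ?_
  rw [signedSwap, if_neg (by omega)]

theorem mem_simpleB_iff {n : ℕ} {s : Equiv.Perm ℤ} :
    s ∈ (weylB n).S ↔ s ∈ (signedData n 2).S := by
  simp only [weylB, signedData, adjacentSigned_eq, Set.mem_union, Set.mem_ofPred_eq, SimplePair]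
  constructor
  · rintro (⟨i, h1, h2, rfl⟩ | ⟨h, rfl⟩)
    · exact ⟨i, i + 1, .inl ⟨h1, rfl, h2⟩, rfl⟩
    · exact ⟨-1, 1, .inr (.inl ⟨trivial, h, rfl, rfl⟩), signChange_eq⟩
  · rintro ⟨a, b, ⟨h1, rfl, h2⟩ | ⟨-, h, rfl, rfl⟩ | ⟨h, -⟩, rfl⟩
    · exact .inl ⟨a, h1, h2, rfl⟩
    · exact .inr ⟨h, signChange_eq.symm⟩
    · omega

theorem mem_simpleD_iff {n : ℕ} {s : Equiv.Perm ℤ} :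
    s ∈ simpleD n ↔ s ∈ (signedData n 0).S := by
  have e : Equiv.swap (1 : ℤ) (-2) * Equiv.swap (-1) 2 = signedSwap (-1) 2 := by
    rw [signedSwap, if_neg (by norm_num), neg_neg]
    refine (Equiv.Perm.Disjoint.commute fun x => ?_).eq
    simp only [Equiv.swap_apply_def]
    split_ifs <;> omega
  simp only [simpleD, signedData, adjacentSigned_eq, Set.mem_union, Set.mem_ofPred_eq, SimplePair, e]
  constructor
  · rintro (⟨i, h1, h2, rfl⟩ | ⟨h, rfl⟩)
    · exact ⟨i, i + 1, .inl ⟨h1, rfl, h2⟩, rfl⟩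
    · exact ⟨-1, 2, .inr (.inr ⟨trivial, h, rfl, rfl⟩), rfl⟩
  · rintro ⟨a, b, ⟨h1, rfl, h2⟩ | ⟨h, -⟩ | ⟨-, h, rfl, rfl⟩, rfl⟩
    · exact .inl ⟨a, h1, h2, rfl⟩
    · omega
    · exact .inr ⟨h, rfl⟩

theorem SimplePair.signProd {n : ℕ} {a b : ℤ} (h : SimplePair n 0 a b) :
    signProd n (signedSwap a b) = 1 := by
  obtain ⟨ha, hb, hab, -⟩ := h.mem
  have hm := signedSwap_mem ha hb hab.ne
  rcases h with ⟨h1, rfl, h2⟩ | ⟨h, -⟩ | ⟨-, h, rfl, rfl⟩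
  · refine Finset.prod_eq_one fun i hi => ?_
    rw [Finset.mem_Icc] at hi
    refine Int.sign_eq_one_of_pos ?_
    rw [signedSwap_apply (by omega) (by omega) (by omega)]
    split_ifs <;> omega
  · omega
  · have hs : signedSwap (-1) 2 = signChange * signedSwap 1 2 * signChange⁻¹ := by
      rw [conj_signedSwap (signChange_mem (n := n) (by omega)), signChange_apply, signChange_apply]
      norm_num
    have h1 : (1 : ℤ) ∈ signedLabels n := by rw [mem_signedLabels]; omega
    rw [hs, signProd_conj (signedSwap_mem h1 hb (by norm_num)) (signChange_mem (by omega))]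
    refine Finset.prod_eq_one fun i hi => ?_
    rw [Finset.mem_Icc] at hi
    refine Int.sign_eq_one_of_pos ?_
    rw [signedSwap_apply (by omega) (by omega) (by omega)]
    split_ifs <;> omega

theorem simpleD_sub {n : ℕ} {s : Equiv.Perm ℤ} (hs : s ∈ simpleD n) : s ∈ evenSignedPerm n := by
  rw [mem_simpleD_iff] at hs
  obtain ⟨a, b, h, rfl⟩ := hs
  exact mem_evenSignedPerm_iff.2 ⟨signedSwap_mem h.mem.1 h.mem.2.1 h.mem.2.2.1.ne, h.signProd⟩

theorem exists_reflection_B {n : ℕ} {t : Equiv.Perm ℤ} (ht : t ∈ (signedData n 2).T) :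
    t ∈ (weylB n).reflections := by
  obtain ⟨a, ha, b, hb, hab, hw, rfl⟩ := ht
  by_cases h : a = -b
  · subst h
    have hb0 := mem_signedLabels.1 hb
    by_cases h1 : b = 1
    · subst h1
      exact ⟨1, one_mem _, _, mem_simpleB_iff.2 ⟨-1, 1, .inr (.inl ⟨rfl, by omega, rfl, rfl⟩), rfl⟩,
        by simp⟩
    · have h1' : (1 : ℤ) ∈ signedLabels n := by rw [mem_signedLabels]; omega
      have hm := signedSwap_mem h1' hb (by omega)
      refine ⟨_, hm, _, mem_simpleB_iff.2 ⟨-1, 1, .inr (.inl ⟨rfl, by omega, rfl, rfl⟩), rfl⟩, ?_⟩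
      rw [conj_signedSwap hm, hm.1, signedSwap_apply (by omega) (by omega) (by omega), if_pos rfl]
  · obtain ⟨g, hg, rfl, rfl⟩ := signedPerm_exists_apply ha hb hab.ne h
    have hn : 2 ≤ n := by
      by_contra hn
      have h2 := signedPerm_apply_of_lt hg (a := 2) (by omega)
      rw [h2, mem_signedLabels] at hb
      omega
    exact ⟨g, hg, _, mem_simpleB_iff.2 ⟨1, 2, .inl ⟨le_rfl, rfl, by exact_mod_cast hn⟩, rfl⟩,
      (conj_signedSwap hg 1 2).symm⟩

/-- If the signed permutation carrying `(1, 2)` to `(a, b)` is odd, compose it with `δ`. The product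
is even, and it conjugates the other simple reflection, in `(-1, 2)`, to the given one. -/
theorem exists_reflection_D {n : ℕ} {t : Equiv.Perm ℤ} (ht : t ∈ (signedData n 0).T) :
    ∃ g ∈ evenSignedPerm n, ∃ s ∈ simpleD n, t = g * s * g⁻¹ := by
  obtain ⟨a, ha, b, hb, hab, hw, rfl⟩ := ht
  have h : a ≠ -b := by
    rintro h
    rw [signedWt, if_pos h] at hw
    omega
  obtain ⟨g, hg, rfl, rfl⟩ := signedPerm_exists_apply ha hb hab.ne h
  have hn : 2 ≤ n := by
    by_contra hn
    have h2 := signedPerm_apply_of_lt hg (a := 2) (by omega)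
    rw [h2, mem_signedLabels] at hb
    omega
  rcases signProd_eq_or hg with hs | hs
  · exact ⟨g, mem_evenSignedPerm_iff.2 ⟨hg, hs⟩, _,
      mem_simpleD_iff.2 ⟨1, 2, .inl ⟨le_rfl, rfl, by exact_mod_cast hn⟩, rfl⟩,
      (conj_signedSwap hg 1 2).symm⟩
  · have hc := signChange_mem (n := n) (by omega)
    have hgc := mul_mem hg hc
    refine ⟨g * signChange, mem_evenSignedPerm_iff.2 ⟨hgc, ?_⟩, _,
      mem_simpleD_iff.2 ⟨-1, 2, .inr (.inr ⟨rfl, hn, rfl, rfl⟩), rfl⟩, ?_⟩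
    · rw [signProd_mul hg hc, hs, signProd_signChange (by omega)]; norm_num
    · rw [conj_signedSwap hgc, Equiv.Perm.mul_apply, Equiv.Perm.mul_apply, signChange_apply,
        signChange_apply]
      norm_num

/-! ### Models of types B, D and ²D. -/

theorem model_weylB (n : ℕ) : (weylB n).Model (signedData n 2) (MonoidHom.id _) where
  S_sub s hs := ShiftData.S_mem (mem_simpleB_iff.1 hs)
  eps_S s hs := by simpa [weylB] using hs
  eps_W0 g hg := by simpa [weylB] using hg
  map_mem w hw := mul_mem hw (one_mem _)
  inj w _ h := h
  map_S s hs := mem_simpleB_iff.1 hs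
  map_reflections := by
    rintro _ ⟨g, hg, s, hs, rfl⟩
    exact (signedData n 2).conj_mem g hg s ((signedData n 2).S_sub (mem_simpleB_iff.1 hs))
  exists_reflection t ht := ⟨t, exists_reflection_B ht, rfl⟩
  len_eps := signedLen_one n 2
  exists_descent w hw h := by
    have e : w * (weylB n).eps = w := mul_one w
    simp only [MonoidHom.id_apply, e] at h ⊢
    obtain ⟨a, b, hab, hlt⟩ := exists_simplePair_descent (.inr rfl) hw h
    exact ⟨_, mem_simpleB_iff.2 ⟨a, b, hab, rfl⟩, (signedLen_mul_simple_lt_iff hw hab).2 hlt⟩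
  eq_one w hw h := by
    have e : w * (weylB n).eps = w := mul_one w
    simp only [MonoidHom.id_apply, e] at h
    exact (eq_one_or_signChange_of_signedLen_eq_zero hw h).resolve_right (by simp)

/-- Treats `ε = 1` and `ε = δ` together: all that matters is that right multiplication by `ε` keeps
the type D length and that conjugation by `ε` keeps the simple reflections. -/
theorem model_of_evenSignedPerm {n : ℕ} (D : WeylCoset (Equiv.Perm ℤ)) (hW : D.W0 = evenSignedPerm n)
    (hS : D.S = simpleD n) (heps : D.eps ∈ signedPerm n)
    (hlen : ∀ x, signedLen n 0 (x * D.eps) = signedLen n 0 x)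
    (hepsS : ∀ s ∈ simpleD n, D.eps * s * D.eps⁻¹ ∈ simpleD n ∧ D.eps⁻¹ * s * D.eps ∈ simpleD n) :
    D.Model (signedData n 0) (MonoidHom.id _) where
  S_sub s hs := by rw [hS] at hs; rw [hW]; exact simpleD_sub hs
  eps_S s hs := by rw [hS] at *; exact hepsS s hs
  eps_W0 g hg := by
    rw [hW, mem_evenSignedPerm_iff] at *
    rw [mem_evenSignedPerm_iff]
    refine ⟨⟨mul_mem (mul_mem heps hg.1) (inv_mem heps), ?_⟩,
      mul_mem (mul_mem (inv_mem heps) hg.1) heps, ?_⟩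
    · rw [signProd_conj hg.1 heps, hg.2]
    · have := signProd_conj hg.1 (inv_mem heps)
      rwa [inv_inv, hg.2] at this
  map_mem w hw := by
    rw [hW] at hw
    exact mul_mem hw.1 heps
  inj w _ h := h
  map_S s hs := by rw [hS] at hs; exact mem_simpleD_iff.1 hs
  map_reflections := by
    rintro _ ⟨g, hg, s, hs, rfl⟩
    rw [hS] at hs
    rw [hW] at hg
    exact (signedData n 0).conj_mem g hg.1 s ((signedData n 0).S_sub (mem_simpleD_iff.1 hs))
  exists_reflection t ht := by
    refine ⟨t, ?_, rfl⟩
    rw [WeylCoset.reflections, hW, hS]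
    exact exists_reflection_D ht
  len_eps := by
    have := hlen 1
    rw [one_mul, signedLen_one] at this
    exact this
  exists_descent w hw h := by
    rw [hW] at hw
    have hm : w * D.eps ∈ signedPerm n := mul_mem hw.1 heps
    obtain ⟨a, b, hab, hlt⟩ := exists_simplePair_descent (.inl rfl) hm h
    refine ⟨_, by rw [hS]; exact mem_simpleD_iff.2 ⟨a, b, hab, rfl⟩,
      (signedLen_mul_simple_lt_iff hm hab).2 hlt⟩
  eq_one w hw h := by
    rw [hW, mem_evenSignedPerm_iff] at hw
    have h' : signedLen n 0 w = 0 := (hlen w).symm.trans h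
    rcases eq_one_or_signChange_of_signedLen_eq_zero hw.1 h' with h1 | ⟨-, h1⟩
    · exact h1
    -- The other element of length zero is `δ`. It is odd for `n ≥ 1`, and it does not act on the
    -- empty set of labels for `n = 0`.
    · exfalso
      rcases Nat.eq_zero_or_pos n with rfl | hn
      · have := signedPerm_apply_of_lt hw.1 (a := 1) (by simp)
        rw [h1, signChange_apply] at this
        norm_num at this
      · have := hw.2
        rw [h1, signProd_signChange hn] at this
        norm_num at this

theorem model_weylD (n : ℕ) : (weylD n).Model (signedData n 0) (MonoidHom.id _) :=
  model_of_evenSignedPerm _ rfl rfl (one_mem _) (fun x => congrArg _ (mul_one x))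
    fun s hs => by simpa [weylD] using hs

theorem conj_signChange_mem_simpleD {n : ℕ} {s : Equiv.Perm ℤ} (hs : s ∈ simpleD n) :
    signChange * s * signChange⁻¹ ∈ simpleD n := by
  rw [mem_simpleD_iff] at *
  obtain ⟨a, b, h, rfl⟩ := hs
  have hn : 1 ≤ n := by
    have := h.mem
    simp only [mem_signedLabels] at this
    omega
  rw [conj_signedSwap (signChange_mem hn), signChange_apply, signChange_apply]
  rcases h with ⟨h1, rfl, h2⟩ | ⟨h, -⟩ | ⟨-, h, rfl, rfl⟩
  · by_cases ha : a = 1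
    · subst ha
      exact ⟨-1, 2, .inr (.inr ⟨rfl, by omega, rfl, rfl⟩), by norm_num⟩
    · refine ⟨a, a + 1, .inl ⟨h1, rfl, h2⟩, ?_⟩
      rw [if_neg ha, if_neg (by omega), if_neg (by omega), if_neg (by omega)]
  · omega
  · exact ⟨1, 2, .inl ⟨le_rfl, rfl, by exact_mod_cast h⟩, by norm_num⟩

theorem model_weylTwistedD {n : ℕ} (hn : 1 ≤ n) :
    (weylTwistedD n).Model (signedData n 0) (MonoidHom.id _) :=
  model_of_evenSignedPerm _ rfl rfl (signChange_mem hn) (signedLen_mul_signChange hn)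
    fun s hs => ⟨conj_signChange_mem_simpleD hs, by
      have := conj_signChange_mem_simpleD hs
      rw [signChange_inv] at this
      change signChange⁻¹ * s * signChange ∈ _
      rwa [signChange_inv]⟩

/-! ### The elliptic classes in types B, C, D -/

theorem negBlocks_sorted_mem {n : ℕ} (α : n.Partition) :
    negBlocks 0 α.sorted ∈ signedClass α := by
  rw [mem_signedClass_iff]
  have h := negCycles_negBlocks α.sorted
  rw [List.filter_eq_self.2 fun b hb => by simpa using α.pos_of_mem_sorted hb, α.coe_sorted] at h
  have hs := α.sum_sorted
  generalize α.sorted = L at *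
  subst hs
  exact h

theorem exists_conj_of_mem_signedClass {n : ℕ} {α : n.Partition} {w : Equiv.Perm ℤ}
    (hw : w ∈ signedClass α) : ∃ g ∈ signedPerm n, w = g * negBlocks 0 α.sorted * g⁻¹ := by
  rw [mem_signedClass_iff, ← α.coe_sorted] at hw
  exact hw.1.exists_conj_negBlocks hw.2

theorem conj_mem_signedClass {n : ℕ} {α : n.Partition} {w g : Equiv.Perm ℤ}
    (hw : w ∈ signedClass α) (hg : g ∈ signedPerm n) : g * w * g⁻¹ ∈ signedClass α := by
  rw [signedClass_eq_negClass] at *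
  exact negClass_conj hw hg

/-- An element of the centralizer that changes an odd number of signs. -/
theorem exists_commute_negBlocks {n : ℕ} (hn : 1 ≤ n) (L : List ℕ) (hL : L.sum = n)
    (hpos : ∀ b ∈ L, 0 < b) :
    ∃ h ∈ signedPerm n, Commute (negBlocks 0 L) h ∧ signProd n h = -1 := by
  cases L with
  | nil => simp at hL; omega
  | cons b L =>
    rw [List.sum_cons] at hL
    refine ⟨negBlock L.sum b, negBlock_mem (by omega), ?_,
      signProd_negBlock (hpos b (by simp)) (by omega)⟩
    rw [negBlocks, zero_add]
    exact (signedPerm_commute_negBlock (negBlocks_mem (by omega))).mul_left (.refl _)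

/-- A class under all signed permutations is a single class under the even ones: for `n ≥ 1` the
outermost block of the normal form is an odd element of the centralizer, and it can correct the
parity of a conjugator. -/
theorem exists_even_conj {n : ℕ} {α : n.Partition} {w : Equiv.Perm ℤ} (hw : w ∈ signedClass α) :
    ∃ g ∈ evenSignedPerm n, w = g * negBlocks 0 α.sorted * g⁻¹ := by
  obtain ⟨g, hg, rfl⟩ := exists_conj_of_mem_signedClass hw
  rcases signProd_eq_or hg with h | h
  · exact ⟨g, mem_evenSignedPerm_iff.2 ⟨hg, h⟩, rfl⟩
  · have hn : 1 ≤ n := by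
      by_contra hn
      obtain rfl : n = 0 := by omega
      simp [signProd] at h
    obtain ⟨k, hk, hc, hs⟩ := exists_commute_negBlocks hn α.sorted α.sum_sorted
      fun b hb => α.pos_of_mem_sorted hb
    refine ⟨g * k, mem_evenSignedPerm_iff.2 ⟨mul_mem hg hk, ?_⟩, ?_⟩
    · rw [signProd_mul hg hk, h, hs]; norm_num
    · rw [mul_inv_rev, mul_assoc g k, ← hc.eq]
      group

theorem signedClass_eq_conjClass {n : ℕ} (α : n.Partition) (D : WeylCoset (Equiv.Perm ℤ))
    (hD : D.W0 = signedPerm n ∨ D.W0 = evenSignedPerm n) :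
    signedClass α = D.conjClass (negBlocks 0 α.sorted) := by
  ext w
  rw [WeylCoset.conjClass, Set.mem_ofPred_eq]
  constructor
  · intro hw
    rcases hD with h | h <;> rw [h]
    · exact exists_conj_of_mem_signedClass hw
    · exact exists_even_conj hw
  · rintro ⟨g, hg, rfl⟩
    refine conj_mem_signedClass (negBlocks_sorted_mem α) ?_
    rcases hD with h | h <;> rw [h] at hg
    · exact hg
    · exact hg.1

/-- Elements of `W_J ε` preserve `A`, so the orbit of `a` stays in `A` and misses `-a`, whereas all
cycles in the class are negative. -/
theorem signedClass_inter_eq_empty {n : ℕ} (α : n.Partition) {J : Set (Equiv.Perm ℤ)}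
    {ε : Equiv.Perm ℤ} (A : Finset ℤ) (hJ : ∀ s ∈ J, ∀ x ∈ A, s x ∈ A) (hε : ∀ x ∈ A, ε x ∈ A)
    {a : ℤ} (ha : a ∈ A) (ha' : a ∈ signedLabels n) (hna : -a ∉ A) :
    signedClass α ∩ {x | ∃ w ∈ Subgroup.closure J, x = w * ε} = ∅ := by
  rw [Set.eq_empty_iff_forall_notMem]
  rintro _ ⟨hx, w, hw, rfl⟩
  exact not_negCycles_of_mapsTo
    (fun x hx => Subgroup.apply_mem_of_mem_closure hJ hw (ε x) (hε x hx)) ha ha' hna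
    (mem_signedClass_iff.1 hx).1

theorem exists_simplePair_notMem {n κ : ℕ} {J S : Set (Equiv.Perm ℤ)} (hJ : J ⊆ S) (hne : J ≠ S)
    (hS : ∀ s, s ∈ S ↔ s ∈ (signedData n κ).S) :
    ∃ a b, SimplePair n κ a b ∧ signedSwap a b ∉ J ∧
      ∀ s ∈ J, ∃ c d, SimplePair n κ c d ∧ s = signedSwap c d ∧ (c ≠ a ∨ d ≠ b) := by
  obtain ⟨s, hs, hsJ⟩ := Set.exists_of_ssubset (hJ.ssubset_of_ne hne)
  obtain ⟨a, b, hab, rfl⟩ := (hS _).1 hs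
  refine ⟨a, b, hab, hsJ, fun s hsJ' => ?_⟩
  obtain ⟨c, d, hcd, rfl⟩ := (hS _).1 (hJ hsJ')
  refine ⟨c, d, hcd, rfl, ?_⟩
  by_contra! h
  exact hsJ (h.1 ▸ h.2 ▸ hsJ')

theorem SimplePair.signedSwap_apply {n κ : ℕ} {a b : ℤ} (h : SimplePair n κ a b) (x : ℤ) :
    signedSwap a b x = if x = a then b else if x = b then a else if x = -a then -b else
      if x = -b then -a else x := by
  obtain ⟨ha, hb, hab, -⟩ := h.mem
  rw [mem_signedLabels] at ha hb
  exact _root_.signedSwap_apply ha.1 hb.1 hab.ne x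

theorem ellipticOrderReversing_signed {n κ : ℕ} (hκ : κ = 0 ∨ κ = 2) {D : WeylCoset (Equiv.Perm ℤ)}
    (hD : D.W0 = signedPerm n ∨ D.W0 = evenSignedPerm n) {Q : n.Partition → Prop}
    (hm : ∀ α, Q α → D.Model (signedData n κ) (MonoidHom.id _))
    (hQ : ∀ α β, Q α → Q β → κ = 2 ∨ Even (Multiset.card α.parts + Multiset.card β.parts))
    (hc : ∀ α, Q α → signedClass α ⊆ D.coset)
    (he : ∀ α, Q α → ∀ J ⊆ D.S, J ≠ D.S → (fun s => D.eps * s * D.eps⁻¹) '' J = J →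
      signedClass α ∩ {x | ∃ w ∈ Subgroup.closure J, x = w * D.eps} = ∅) :
    EllipticOrderReversing D Q signedClass := by
  refine ⟨fun α hα => ⟨⟨_, hc α hα (negBlocks_sorted_mem α), signedClass_eq_conjClass α D hD⟩,
    he α hα⟩, fun α β hα hβ => ?_⟩
  rw [(hm α hα).precW_iff (hc α hα) (hc β hβ), ← exists_below_signedClass_iff hκ α β (hQ α β hα hβ),
    MonoidHom.coe_id, Set.image_id, Set.image_id]

theorem ellipticOrderReversing_weylB (n : ℕ) :
    EllipticOrderReversing (weylB n) (fun _ : n.Partition => True) signedClass := by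
  refine ellipticOrderReversing_signed (.inr rfl) (.inl rfl) (fun _ _ => model_weylB n)
    (fun _ _ _ _ => .inl rfl) (fun α _ w hw => ⟨w, hw.1, (mul_one w).symm⟩)
    fun α _ J hJ hne _ => ?_
  obtain ⟨a, b, hab, -, hJ'⟩ := exists_simplePair_notMem hJ hne fun s => mem_simpleB_iff
  rcases hab with ⟨h1, rfl, h2⟩ | ⟨-, h, rfl, rfl⟩ | ⟨h, -⟩
  -- Without the reflection in `(a, a + 1)` no generator leads out of `[a + 1, n]`. Without the sign
  -- change, treated next, positive labels stay positive.
  · refine signedClass_inter_eq_empty α (Finset.Icc (a + 1) n) (fun s hs x hx => ?_)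
      (fun x hx => hx) (Finset.mem_Icc.2 ⟨le_rfl, h2⟩) (by rw [mem_signedLabels]; omega)
      (by rw [Finset.mem_Icc]; omega)
    obtain ⟨c, d, hcd, rfl, hne⟩ := hJ' s hs
    rw [hcd.signedSwap_apply]
    rw [Finset.mem_Icc] at *
    unfold SimplePair at hcd
    split_ifs <;> omega
  · refine signedClass_inter_eq_empty α (Finset.Icc 1 n) (fun s hs x hx => ?_)
      (fun x hx => hx) (Finset.mem_Icc.2 ⟨le_rfl, by omega⟩) (by rw [mem_signedLabels]; omega)
      (by rw [Finset.mem_Icc]; omega)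
    obtain ⟨c, d, hcd, rfl, hne⟩ := hJ' s hs
    rw [hcd.signedSwap_apply]
    rw [Finset.mem_Icc] at *
    unfold SimplePair at hcd
    split_ifs <;> omega
  · omega

theorem ellipticOrderReversing_weylD (n : ℕ) :
    EllipticOrderReversing (weylD n) (fun α : n.Partition => Even α.parts.card) signedClass := by
  refine ellipticOrderReversing_signed (.inl rfl) (.inr rfl) (fun _ _ => model_weylD n)
    (fun _ _ hα hβ => .inr (hα.add hβ)) (fun α hα w hw => ⟨w, ?_, (mul_one w).symm⟩)
    fun α _ J hJ hne _ => ?_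
  · refine mem_evenSignedPerm_iff.2 ⟨hw.1, ?_⟩
    rw [signProd_of_mem_signedClass hw, Even.neg_one_pow hα]
  obtain ⟨a, b, hab, -, hJ'⟩ := exists_simplePair_notMem hJ hne fun s => mem_simpleD_iff
  have key : ∀ A : Finset ℤ, ∀ k ∈ signedLabels n, k ∈ A → -k ∉ A →
      (∀ c d, SimplePair n 0 c d → (c ≠ a ∨ d ≠ b) → ∀ x ∈ A, signedSwap c d x ∈ A) →
      signedClass α ∩ {x | ∃ w ∈ Subgroup.closure J, x = w * (weylD n).eps} = ∅ := by
    intro A k h1 h2 h3 h4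
    refine signedClass_inter_eq_empty α A (fun s hs x hx => ?_) (fun x hx => hx) h2 h1 h3
    obtain ⟨c, d, hcd, rfl, hne⟩ := hJ' s hs
    exact h4 c d hcd hne x hx
  rcases hab with ⟨h1, rfl, h2⟩ | ⟨h, -⟩ | ⟨-, h, rfl, rfl⟩
  · by_cases ha1 : a = 1
    · subst ha1
      -- With the reflection in `(1, 2)` missing, the other generators see `-1` as the neighbour of
      -- 2, so `{-1, 2, …, n}` is preserved.
      refine key (insert (-1) (Finset.Icc 2 (n : ℤ))) 2 (by rw [mem_signedLabels]; omega)
        (by simp; omega) (by simp) fun c d hcd hne x hx => ?_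
      rw [hcd.signedSwap_apply]
      rw [Finset.mem_insert, Finset.mem_Icc] at *
      unfold SimplePair at hcd
      split_ifs <;> omega
    · refine key (Finset.Icc (a + 1) n) (a + 1) (by rw [mem_signedLabels]; omega)
        (by simp; omega) (by simp; omega) fun c d hcd hne x hx => ?_
      rw [hcd.signedSwap_apply]
      rw [Finset.mem_Icc] at *
      unfold SimplePair at hcd
      split_ifs <;> omega
  · omega
  · refine key (Finset.Icc 1 n) 1 (by rw [mem_signedLabels]; omega)
      (by simp; omega) (by simp) fun c d hcd hne x hx => ?_
    rw [hcd.signedSwap_apply]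
    rw [Finset.mem_Icc] at *
    unfold SimplePair at hcd
    split_ifs <;> omega

theorem ellipticOrderReversing_weylTwistedD (n : ℕ) :
    EllipticOrderReversing (weylTwistedD n) (fun α : n.Partition => Odd α.parts.card)
      signedClass := by
  have hn : ∀ α : n.Partition, Odd (Multiset.card α.parts) → 1 ≤ n := by
    intro α hα
    have h1 := α.length_sorted_le
    rw [α.length_sorted] at h1
    have := hα.pos
    omega
  refine ellipticOrderReversing_signed (.inl rfl) (.inr rfl)
    (fun α hα => model_weylTwistedD (hn α hα)) (fun _ _ hα hβ => .inr (hα.add_odd hβ))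
    (fun α hα w hw => ⟨w * signChange, ?_, ?_⟩) fun α hα J hJ hne hJε => ?_
  · have hs := signChange_mem (hn α hα)
    refine mem_evenSignedPerm_iff.2 ⟨mul_mem hw.1 hs, ?_⟩
    rw [signProd_mul hw.1 hs, signProd_of_mem_signedClass hw, Odd.neg_one_pow hα,
      signProd_signChange (hn α hα)]
    norm_num
  · have h : signChange * signChange = 1 := Equiv.swap_mul_self _ _
    change w = w * signChange * signChange
    rw [mul_assoc, h, mul_one]
  obtain ⟨a, b, hab, habJ, hJ'⟩ := exists_simplePair_notMem hJ hne fun s => mem_simpleD_iff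
  have hε : ∀ s ∈ J, signChange * s * signChange⁻¹ ∈ J := fun s hs => by
    have : (fun s => signChange * s * signChange⁻¹) '' J = J := hJε
    rw [← this]
    exact ⟨s, hs, rfl⟩
  have hm := signChange_mem (hn α hα)
  have h12 : signChange * signedSwap 1 2 * signChange⁻¹ = signedSwap (-1) 2 := by
    rw [conj_signedSwap hm, signChange_apply, signChange_apply]; norm_num
  have h12' : signChange * signedSwap (-1) 2 * signChange⁻¹ = signedSwap 1 2 := by
    rw [conj_signedSwap hm, signChange_apply, signChange_apply]; norm_num
  -- The invariant interval `[k, n]` must avoid `±1`, as `δ` acts too. For `k = 2` both reflections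
  -- in `(1, 2)` and `(-1, 2)` must be missing; they are exchanged by `δ`, so a `δ`-stable `J` that
  -- misses one misses both.
  have key : ∀ k : ℤ, 2 ≤ k → k ≤ n → (∀ s ∈ J, ∃ c d, SimplePair n 0 c d ∧ s = signedSwap c d ∧
      (c ≠ k - 1 ∨ d ≠ k) ∧ (k = 2 → c ≠ -1)) →
      signedClass α ∩ {x | ∃ w ∈ Subgroup.closure J, x = w * (weylTwistedD n).eps} = ∅ := by
    intro k hk hk' h
    refine signedClass_inter_eq_empty α (Finset.Icc k n) (fun s hs x hx => ?_)
      (fun x hx => ?_) (Finset.mem_Icc.2 ⟨le_rfl, hk'⟩) (by rw [mem_signedLabels]; omega)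
      (by rw [Finset.mem_Icc]; omega)
    · obtain ⟨c, d, hcd, rfl, hne⟩ := h s hs
      rw [hcd.signedSwap_apply]
      rw [Finset.mem_Icc] at *
      unfold SimplePair at hcd
      split_ifs <;> omega
    · rw [Finset.mem_Icc] at *
      change k ≤ signChange x ∧ signChange x ≤ n
      rw [signChange_apply, if_neg (by omega), if_neg (by omega)]
      exact hx
  rcases hab with ⟨h1, rfl, h2⟩ | ⟨h, -⟩ | ⟨-, h, rfl, rfl⟩
  · refine key (a + 1) (by omega) h2 fun s hs => ?_
    obtain ⟨c, d, hcd, rfl, hne⟩ := hJ' s hs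
    refine ⟨c, d, hcd, rfl, by omega, fun ha hc => ?_⟩
    obtain rfl : a = 1 := by omega
    subst hc
    obtain rfl : d = 2 := by unfold SimplePair at hcd; omega
    exact habJ (h12' ▸ hε _ hs)
  · omega
  · refine key 2 le_rfl (by exact_mod_cast h) fun s hs => ?_
    obtain ⟨c, d, hcd, rfl, hne⟩ := hJ' s hs
    refine ⟨c, d, hcd, rfl, ?_, fun _ hc => ?_⟩
    · by_contra! hcd2
      obtain ⟨rfl, rfl⟩ := hcd2
      exact habJ (h12 ▸ hε _ hs)
    · subst hc
      unfold SimplePair at hcd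
      omega

/-! ### Permutations of an interval, with the number of non-inversions as length -/

/-- The permutations of the interval `(A, B]`. -/
def windowPerm (A B : ℤ) : Subgroup (Equiv.Perm ℤ) where
  carrier := {w | ∀ x, ¬ (A < x ∧ x ≤ B) → w x = x}
  one_mem' _ _ := rfl
  mul_mem' {a b} ha hb x hx := by rw [Equiv.Perm.mul_apply, hb x hx, ha x hx]
  inv_mem' {a} ha x hx := by rw [Equiv.Perm.inv_eq_iff_eq, ha x hx]

theorem windowPerm_apply_mem {A B : ℤ} {u : Equiv.Perm ℤ} (hu : u ∈ windowPerm A B) {x : ℤ}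
    (h1 : A < x) (h2 : x ≤ B) : A < u x ∧ u x ≤ B := by
  by_contra hn
  have := u.injective (hu _ hn)
  rw [this] at hn
  exact hn ⟨h1, h2⟩

theorem windowPerm_mono {A B A' B' : ℤ} (hA : A' ≤ A) (hB : B ≤ B') :
    windowPerm A B ≤ windowPerm A' B' := fun _ hu x hx => hu x (by omega)

theorem swap_mem_windowPerm {A B a b : ℤ} (ha : A < a ∧ a ≤ B) (hb : A < b ∧ b ≤ B) :
    Equiv.swap a b ∈ windowPerm A B := fun x hx =>
  Equiv.swap_apply_of_ne_of_ne (by rintro rfl; exact hx ha) (by rintro rfl; exact hx hb)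

/-- Permutations with disjoint supports commute. -/
theorem windowPerm_commute {A B : ℤ} {u g : Equiv.Perm ℤ} (hu : u ∈ windowPerm A B)
    (hg : ∀ x, A < x → x ≤ B → g x = x) : Commute u g := by
  refine Equiv.Perm.Disjoint.commute fun x => ?_
  by_cases hx : A < x ∧ x ≤ B
  · exact .inr (hg x hx.1 hx.2)
  · exact .inl (hu x hx)

/-- The number of non-inversions. -/
noncomputable def twLen (A B : ℤ) (u : Equiv.Perm ℤ) : ℕ :=
  invSum (Finset.Ioc A B) (fun _ _ => 1) (fun x => -u x)

theorem twLen_eq_card (A B : ℤ) (u : Equiv.Perm ℤ) : twLen A B u =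
    ((Finset.Ioc A B ×ˢ Finset.Ioc A B).filter (fun p => p.1 < p.2 ∧ u p.1 < u p.2)).card := by
  simp [twLen, invSum]

theorem twLen_inv {A B : ℤ} {u : Equiv.Perm ℤ} (hu : u ∈ windowPerm A B) :
    twLen A B u⁻¹ = twLen A B u := by
  rw [twLen_eq_card, twLen_eq_card]
  have key : ∀ v ∈ windowPerm A B, ∀ p ∈ (Finset.Ioc A B ×ˢ Finset.Ioc A B).filter
      (fun p => p.1 < p.2 ∧ v p.1 < v p.2), (v p.1, v p.2) ∈
      (Finset.Ioc A B ×ˢ Finset.Ioc A B).filter (fun p => p.1 < p.2 ∧ v⁻¹ p.1 < v⁻¹ p.2) := by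
    intro v hv p hp
    simp only [Finset.mem_filter, Finset.mem_product, Finset.mem_Ioc,
      ← Equiv.Perm.mul_apply, inv_mul_cancel, Equiv.Perm.one_apply] at hp ⊢
    exact ⟨⟨windowPerm_apply_mem hv hp.1.1.1 hp.1.1.2, windowPerm_apply_mem hv hp.1.2.1 hp.1.2.2⟩,
      hp.2.2, hp.2.1⟩
  refine Finset.card_nbij' (fun p => (u⁻¹ p.1, u⁻¹ p.2)) (fun p => (u p.1, u p.2)) ?_ (key u hu) ?_ ?_
  · intro p hp
    simpa using key u⁻¹ (inv_mem hu) p hp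
  · intro p _
    simp
  · intro p _
    simp

theorem mem_Ioc_swap {A B a b : ℤ} (ha : A < a ∧ a ≤ B) (hb : A < b ∧ b ≤ B) :
    ∀ c ∈ Finset.Ioc A B, Equiv.swap a b c ∈ Finset.Ioc A B := by
  intro c hc
  rw [Finset.mem_Ioc] at *
  rw [Equiv.swap_apply_def]
  split_ifs <;> assumption

/-- Right multiplication by `w₀` turns inversions into non-inversions, so the usual order is
reversed: a transposition lengthens when it exchanges decreasing values. -/
theorem twLen_lt {A B : ℤ} {u : Equiv.Perm ℤ} {a b : ℤ} (ha : A < a) (hab : a < b) (hb : b ≤ B)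
    (h : u b < u a) : twLen A B u < twLen A B (u * Equiv.swap a b) := by
  refine invSum_lt_comp (t := Equiv.swap a b) (a := a) (b := b) (fun c => Equiv.swap_apply_self a b c)
    (mem_Ioc_swap ⟨ha, by omega⟩ ⟨by omega, hb⟩) (fun _ _ _ _ => rfl)
    (Finset.mem_Ioc.2 ⟨ha, by omega⟩) (Finset.mem_Ioc.2 ⟨by omega, hb⟩) hab
    (Equiv.swap_apply_left a b) one_pos (by omega) fun c _ d _ hcd => ?_
  rw [Equiv.swap_apply_def, Equiv.swap_apply_def]
  split_ifs <;> subst_vars <;> intros <;> omega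

theorem twLen_lt_iff {A B : ℤ} {u : Equiv.Perm ℤ} {a b : ℤ} (ha : A < a) (hab : a < b) (hb : b ≤ B) :
    twLen A B u < twLen A B (u * Equiv.swap a b) ↔ u b < u a := by
  refine ⟨fun h => ?_, twLen_lt ha hab hb⟩
  by_contra hn
  have hne : u a ≠ u b := fun h => hab.ne (u.injective h)
  have := twLen_lt (u := u * Equiv.swap a b) ha hab hb (by simp; omega)
  rw [mul_assoc, Equiv.swap_mul_self, mul_one] at this
  omega

theorem twLen_mul_adjacent {A B : ℤ} {u : Equiv.Perm ℤ} {a : ℤ} (ha : A < a) (hb : a + 1 ≤ B)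
    (h : u (a + 1) < u a) : twLen A B (u * Equiv.swap a (a + 1)) = twLen A B u + 1 := by
  have hc : a + 1 ≠ a := by omega
  refine (invSum_comp_eq (t := Equiv.swap a (a + 1)) (x := fun x => - u x)
    (fun c => Equiv.swap_apply_self a _ c)
    (mem_Ioc_swap ⟨ha, by omega⟩ ⟨by omega, hb⟩) (fun _ _ _ _ => rfl) {(a, a + 1)} ?_ ?_)
  · intro c _ d _ hcd hr _
    rw [Finset.mem_singleton, Prod.mk.injEq]
    rw [Equiv.swap_apply_def, Equiv.swap_apply_def] at hr
    split_ifs at hr <;> omega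
  · intro p hp
    rw [Finset.mem_singleton] at hp
    subst hp
    simp only [Equiv.swap_apply_left, Equiv.swap_apply_right, Finset.mem_Ioc]
    omega

/-- The permutations of `(A, B]`, with the number of non-inversions as length. -/
noncomputable def twData (A B : ℤ) : ShiftData (Equiv.Perm ℤ) where
  H := windowPerm A B
  S := {s | ∃ a, A < a ∧ a + 1 ≤ B ∧ s = Equiv.swap a (a + 1)}
  T := {t | ∃ a b, A < a ∧ a < b ∧ b ≤ B ∧ t = Equiv.swap a b}
  Ω := ∅
  len := twLen A B
  gap := 1
  S_sub := by
    rintro s ⟨a, h1, h2, rfl⟩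
    exact ⟨a, a + 1, h1, by omega, h2, rfl⟩
  T_sub := by
    rintro t ⟨a, b, h1, h2, h3, rfl⟩
    exact swap_mem_windowPerm (by omega) (by omega)
  sq := by
    rintro t ⟨a, b, h1, h2, h3, rfl⟩
    exact Equiv.swap_mul_self a b
  conj_mem := by
    rintro g hg t ⟨a, b, h1, h2, h3, rfl⟩
    rw [← Equiv.swap_apply_apply]
    have ha := windowPerm_apply_mem hg (x := a) (by omega) (by omega)
    have hb := windowPerm_apply_mem hg (x := b) (by omega) (by omega)
    rcases lt_trichotomy (g a) (g b) with h | h | h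
    · exact ⟨_, _, ha.1, h, hb.2, rfl⟩
    · exact absurd (g.injective h) h2.ne
    · exact ⟨_, _, hb.1, h, ha.2, Equiv.swap_comm _ _⟩
  Ω_sub := by simp
  Ω_inv := by simp
  Ω_len := by simp
  gap_pos := one_pos
  len_inv := fun x hx => twLen_inv hx
  len_mul := by
    rintro x hx s ⟨a, h1, h2, rfl⟩
    have hne : x a ≠ x (a + 1) := fun h => by have := x.injective h; omega
    rcases lt_or_gt_of_ne hne with h | h
    · right
      have := twLen_mul_adjacent (u := x * Equiv.swap a (a + 1)) h1 h2 (by simpa using h)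
      rw [mul_assoc, Equiv.swap_mul_self, mul_one] at this
      exact this.symm
    · exact .inl (twLen_mul_adjacent h1 h2 h)
  len_exch := by
    rintro x hx s ⟨a, h1, h2, rfl⟩ t ⟨c, d, h3, h4, h5, rfl⟩ hst hlt
    rw [twLen_lt_iff h3 h4 h5] at hlt
    have h6 : Equiv.swap a (a + 1) c < Equiv.swap a (a + 1) d := by
      have : ¬ (c = a ∧ d = a + 1) := by
        rintro ⟨rfl, rfl⟩
        exact hst rfl
      rw [Equiv.swap_apply_def, Equiv.swap_apply_def]
      split_ifs <;> omega
    have e : x * Equiv.swap c d * Equiv.swap a (a + 1) = x * Equiv.swap a (a + 1) *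
        Equiv.swap (Equiv.swap a (a + 1) c) (Equiv.swap a (a + 1) d) := by
      rw [Equiv.swap_apply_apply, Equiv.swap_inv, ← mul_assoc, ← mul_assoc,
        mul_assoc x (Equiv.swap a (a + 1)), Equiv.swap_mul_self, mul_one]
    have hm := mem_Ioc_swap (A := A) (B := B) (a := a) (b := a + 1) (by omega) (by omega)
    have hc := Finset.mem_Ioc.1 (hm c (Finset.mem_Ioc.2 ⟨h3, by omega⟩))
    have hd := Finset.mem_Ioc.1 (hm d (Finset.mem_Ioc.2 ⟨by omega, h5⟩))
    rw [e]
    refine twLen_lt hc.1 h6 hd.2 ?_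
    simpa using hlt

theorem twData_step {A B : ℤ} {x : Equiv.Perm ℤ} {a b : ℤ} (ha : A < a) (hab : a < b) (hb : b ≤ B)
    (h : x b < x a) : (twData A B).Step x (x * Equiv.swap a b) :=
  ⟨_, ⟨a, b, ha, hab, hb, rfl⟩, rfl, twLen_lt ha hab hb h⟩

theorem twLen_mul_adjacent_lt_iff {A B : ℤ} {x : Equiv.Perm ℤ} (hx : x ∈ windowPerm A B) {a : ℤ}
    (ha : A < a) (hb : a + 1 ≤ B) :
    twLen A B (x * Equiv.swap a (a + 1)) < twLen A B x ↔ x a < x (a + 1) := by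
  have h := twLen_lt_iff (u := x) ha (by omega : a < a + 1) hb
  have h2 := (twData A B).len_mul x hx _ ⟨a, ha, hb, rfl⟩
  simp only [twData] at h2
  have hne : x a ≠ x (a + 1) := fun h => by have := x.injective h; omega
  omega

theorem twLen_adjacent_mul_lt_iff {A B : ℤ} {x : Equiv.Perm ℤ} (hx : x ∈ windowPerm A B) {a : ℤ}
    (ha : A < a) (hb : a + 1 ≤ B) :
    twLen A B (Equiv.swap a (a + 1) * x) < twLen A B x ↔ x⁻¹ a < x⁻¹ (a + 1) := by
  have hm : Equiv.swap a (a + 1) ∈ windowPerm A B := swap_mem_windowPerm (by omega) (by omega)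
  rw [← twLen_mul_adjacent_lt_iff (inv_mem hx) ha hb, twLen_inv hx,
    ← twLen_inv (mul_mem hm hx), mul_inv_rev, Equiv.swap_inv]

theorem twData_move {A B : ℤ} {x : Equiv.Perm ℤ} (hx : x ∈ windowPerm A B) {a : ℤ}
    (ha : A < a) (hb : a + 1 ≤ B) (h : x a < x (a + 1) ∨ x⁻¹ a < x⁻¹ (a + 1)) :
    (twData A B).Move x (Equiv.swap a (a + 1) * x * Equiv.swap a (a + 1)) := by
  refine .inl ⟨_, ⟨a, ha, hb, rfl⟩, rfl, ?_⟩
  rcases h with h | h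
  · exact .inr ((twLen_mul_adjacent_lt_iff hx ha hb).2 h)
  · exact .inl ((twLen_adjacent_mul_lt_iff hx ha hb).2 h)

/-- A factor that is trivial on `(A, B]` commutes with the shifts inside and does not affect the
descents that permit them. -/
theorem twData_red_mul {A B A' B' : ℤ} (hA : A' ≤ A) (hB : B ≤ B') {g : Equiv.Perm ℤ}
    (hg : g ∈ windowPerm A' B') (hfix : ∀ x, A < x → x ≤ B → g x = x) {u u' : Equiv.Perm ℤ}
    (hu : u ∈ windowPerm A B) (h : (twData A B).Red u u') :
    (twData A' B').Red (u * g) (u' * g) := by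
  induction h with
  | refl => exact .rfl
  | @tail v v' h1 h ih =>
    refine ih.trans (ShiftData.Move.red ?_)
    have hv : v ∈ windowPerm A B := ShiftData.Red.mem (D := twData A B) hu h1
    have hvg : v * g ∈ windowPerm A' B' := mul_mem (windowPerm_mono hA hB hv) hg
    rcases h with ⟨s, ⟨a, ha, hb, rfl⟩, rfl, h⟩ | ⟨g, hg, -⟩
    · have hs : Equiv.swap a (a + 1) ∈ windowPerm A B := swap_mem_windowPerm (by omega) (by omega)
      have e : Equiv.swap a (a + 1) * v * Equiv.swap a (a + 1) * g =
          Equiv.swap a (a + 1) * (v * g) * Equiv.swap a (a + 1) := by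
        rw [mul_assoc, (windowPerm_commute hs hfix).eq]
        simp only [mul_assoc]
      rw [e]
      have hgi : ∀ x, A < x → x ≤ B → g⁻¹ x = x := fun x h1 h2 => by
        rw [Equiv.Perm.inv_eq_iff_eq, hfix x h1 h2]
      refine twData_move hvg (by omega) (by omega) ?_
      rcases h with h | h
      · have h2 := (twLen_adjacent_mul_lt_iff hv ha hb).1 h
        right
        have h3 := windowPerm_apply_mem (inv_mem hv) (x := a) (by omega) (by omega)
        have h4 := windowPerm_apply_mem (inv_mem hv) (x := a + 1) (by omega) (by omega)
        rwa [mul_inv_rev, Equiv.Perm.mul_apply, Equiv.Perm.mul_apply, hgi _ h3.1 h3.2,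
          hgi _ h4.1 h4.2]
      · have h2 := (twLen_mul_adjacent_lt_iff hv ha hb).1 h
        left
        rwa [Equiv.Perm.mul_apply, Equiv.Perm.mul_apply, hfix _ (by omega) (by omega),
          hfix _ (by omega) (by omega)]
    · exact absurd hg (Set.notMem_empty _)

theorem twData_le_mul {A B A' B' : ℤ} (hA : A' ≤ A) (hB : B ≤ B') {g : Equiv.Perm ℤ}
    (hfix : ∀ x, A < x → x ≤ B → g x = x) {u u' : Equiv.Perm ℤ}
    (h : (twData A B).le u u') :
    (twData A' B').le (u * g) (u' * g) := by
  induction h with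
  | refl => exact .refl
  | @tail v v' h1 h ih =>
    refine ih.tail ?_
    obtain ⟨t, ⟨a, b, ha, hab, hb, rfl⟩, rfl, hl⟩ := h
    have hl' := (twLen_lt_iff ha hab hb).1 hl
    have hs : Equiv.swap a b ∈ windowPerm A B := swap_mem_windowPerm (by omega) (by omega)
    rw [mul_assoc, (windowPerm_commute hs hfix).eq, ← mul_assoc]
    refine twData_step (by omega) hab (by omega) ?_
    rwa [Equiv.Perm.mul_apply, Equiv.Perm.mul_apply, hfix a (by omega) (by omega),
      hfix b (by omega) (by omega)]

/-! ### Odd cycles spiralling around an interval -/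

/-- The cycle of length `2c + 1` spiralling around the interval `(A, B]`. -/
def spiral (A B : ℤ) (c : ℕ) : Equiv.Perm ℤ :=
  -- The cycle runs `B + 1 → A → B + 2 → A - 1 → ⋯ → B + c + 1 → B + 1`. It has `c` labels below the
  -- core and `c + 1` above it.
  if h : A ≤ B then
    { toFun x := if A - c < x ∧ x ≤ A then A + B + 2 - x else if B < x ∧ x ≤ B + c then A + B + 1 - x
        else if x = B + c + 1 then B + 1 else x
      invFun x := if A - c < x ∧ x ≤ A then A + B + 1 - x
        else if B + 1 < x ∧ x ≤ B + c + 1 then A + B + 2 - x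
        else if x = B + 1 then B + c + 1 else x
      left_inv x := by dsimp only; split_ifs <;> omega
      right_inv x := by dsimp only; split_ifs <;> omega }
  else 1

theorem spiral_apply {A B : ℤ} (h : A ≤ B) (c : ℕ) (x : ℤ) : spiral A B c x =
    if A - c < x ∧ x ≤ A then A + B + 2 - x else if B < x ∧ x ≤ B + c then A + B + 1 - x
      else if x = B + c + 1 then B + 1 else x := by
  simp [spiral, h]

theorem spiral_apply_core {A B : ℤ} (h : A ≤ B) (c : ℕ) {x : ℤ} (h1 : A < x) (h2 : x ≤ B) :
    spiral A B c x = x := by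
  rw [spiral_apply h]; split_ifs <;> omega

theorem spiral_mem {A B : ℤ} (h : A ≤ B) (c : ℕ) : spiral A B c ∈ windowPerm (A - c) (B + c + 1) :=
  fun x hx => by rw [spiral_apply h]; split_ifs <;> omega

/-- The cycle of length `b` around `(A, B]`, for `b` odd or zero. -/
def twBlock (A B : ℤ) (b : ℕ) : Equiv.Perm ℤ := if b = 0 then 1 else spiral A B (b / 2)

/-- The number of labels below the core. -/
def lowSum : List ℕ → ℕ
  | [] => 0
  | b :: L => b / 2 + lowSum L

/-- The number of labels above the core. -/
def highSum : List ℕ → ℕ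
  | [] => 0
  | b :: L => (b - b / 2) + highSum L

/-- Nested cycles of lengths `L` around `(A, B]`, the first one being outermost. -/
def twBlocks (A B : ℤ) : List ℕ → Equiv.Perm ℤ
  | [] => 1
  | b :: L => twBlocks A B L * twBlock (A - lowSum L) (B + highSum L) b

theorem twBlock_zero (A B : ℤ) : twBlock A B 0 = 1 := if_pos rfl

theorem twBlock_odd (A B : ℤ) (c : ℕ) : twBlock A B (2 * c + 1) = spiral A B c := by
  rw [twBlock, if_neg (by omega)]
  congr 1
  omega

theorem lowSum_append (K L : List ℕ) : lowSum (K ++ L) = lowSum K + lowSum L := by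
  induction K with
  | nil => simp [lowSum]
  | cons b K ih => simp only [List.cons_append, lowSum, ih]; ring

theorem highSum_append (K L : List ℕ) : highSum (K ++ L) = highSum K + highSum L := by
  induction K with
  | nil => simp [highSum]
  | cons b K ih => simp only [List.cons_append, highSum, ih]; ring

theorem lowSum_add_highSum (L : List ℕ) : lowSum L + highSum L = L.sum := by
  induction L with
  | nil => rfl
  | cons b L ih => simp only [lowSum, highSum, List.sum_cons]; omega

theorem highSum_le (L : List ℕ) : highSum L ≤ lowSum L + L.length := by
  induction L with
  | nil => simp [highSum]
  | cons b L ih => simp only [lowSum, highSum, List.length_cons]; omega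

theorem twBlocks_append (A B : ℤ) (K L : List ℕ) :
    twBlocks A B (K ++ L) = twBlocks A B L * twBlocks (A - lowSum L) (B + highSum L) K := by
  induction K with
  | nil => simp [twBlocks]
  | cons b K ih =>
    rw [List.cons_append, twBlocks, twBlocks, ih, lowSum_append, highSum_append, mul_assoc]
    congr 3 <;> omega

theorem twBlock_mem {A B : ℤ} (h : A ≤ B) {b : ℕ} (hb : b = 0 ∨ Odd b) :
    twBlock A B b ∈ windowPerm (A - (b / 2 : ℕ)) (B + (b - b / 2 : ℕ)) := by
  rcases hb with rfl | ⟨c, rfl⟩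
  · rw [twBlock_zero]; exact one_mem _
  · rw [twBlock_odd]
    exact windowPerm_mono (by omega) (by omega) (spiral_mem h c)

theorem twBlock_apply_core {A B : ℤ} (h : A ≤ B) (b : ℕ) {x : ℤ} (h1 : A < x) (h2 : x ≤ B) :
    twBlock A B b x = x := by
  rw [twBlock]
  split_ifs
  · rfl
  · exact spiral_apply_core h _ h1 h2

theorem twBlocks_apply_core {A B : ℤ} (h : A ≤ B) (L : List ℕ) {x : ℤ} (h1 : A < x) (h2 : x ≤ B) :
    twBlocks A B L x = x := by
  induction L with
  | nil => rfl
  | cons b L ih =>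
    rw [twBlocks, Equiv.Perm.mul_apply, twBlock_apply_core (by omega) _ (by omega) (by omega), ih]

theorem twBlocks_mem {A B : ℤ} (h : A ≤ B) {L : List ℕ} (hL : ∀ b ∈ L, b = 0 ∨ Odd b) :
    twBlocks A B L ∈ windowPerm (A - lowSum L) (B + highSum L) := by
  induction L with
  | nil => exact one_mem _
  | cons b L ih =>
    rw [twBlocks]
    simp only [lowSum, highSum]
    refine mul_mem (windowPerm_mono (by omega) (by omega) (ih fun c hc => hL c (by simp [hc]))) ?_
    exact windowPerm_mono (by omega) (by omega)
      (twBlock_mem (A := A - lowSum L) (B := B + highSum L) (by omega) (hL b (by simp)))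

theorem twBlocks_filter (A B : ℤ) (L : List ℕ) : twBlocks A B (L.filter (0 < ·)) = twBlocks A B L ∧
    lowSum (L.filter (0 < ·)) = lowSum L ∧ highSum (L.filter (0 < ·)) = highSum L := by
  induction L with
  | nil => exact ⟨rfl, rfl, rfl⟩
  | cons b L ih =>
    rcases Nat.eq_zero_or_pos b with rfl | hb
    · simpa [twBlocks, lowSum, highSum, twBlock_zero] using ih
    · rw [List.filter_cons_of_pos (by simpa using hb)]
      simp only [twBlocks, lowSum, highSum, ih, and_self]

/-! ### Permutations with cycles of odd lengths -/

/-- All cycles are infinite or of odd length. -/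
def OddCycles (u : Equiv.Perm ℤ) : Prop :=
  ∀ X : Finset ℤ, X.Nonempty → (∀ x ∈ X, u x ∉ X) → (∀ x ∈ X, u (u x) ∈ X) → False

theorem OddCycles.conj {u : Equiv.Perm ℤ} (hu : OddCycles u) (g : Equiv.Perm ℤ) :
    OddCycles (g * u * g⁻¹) := by
  intro X hX h1 h2
  have hm : ∀ y, y ∈ X.map g⁻¹.toEmbedding ↔ g y ∈ X := by
    intro y
    rw [Finset.mem_map]
    constructor
    · rintro ⟨z, hz, rfl⟩
      simpa using hz
    · intro h
      exact ⟨g y, h, by simp⟩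
  refine hu (X.map g⁻¹.toEmbedding) (by simpa using hX) (fun x hx => ?_) (fun x hx => ?_)
  · rw [hm] at hx ⊢
    simpa using h1 _ hx
  · rw [hm] at hx ⊢
    simpa using h2 _ hx

theorem OddCycles.of_mul {A B : ℤ} {v g : Equiv.Perm ℤ} (hv : v ∈ windowPerm A B)
    (hg : ∀ x, A < x → x ≤ B → g x = x) (h : OddCycles (v * g)) : OddCycles v := by
  intro X hX h1 h2
  have hin : ∀ x ∈ X, A < x ∧ x ≤ B := by
    intro x hx
    by_contra hn
    have := h1 x hx
    rw [hv x hn] at this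
    exact this hx
  have e : ∀ x, A < x ∧ x ≤ B → (v * g) x = v x := fun x hx => by
    rw [Equiv.Perm.mul_apply, hg x hx.1 hx.2]
  refine h X hX (fun x hx => ?_) (fun x hx => ?_)
  · rw [e x (hin x hx)]
    exact h1 x hx
  · have := hin x hx
    rw [e x this, e _ (windowPerm_apply_mem hv this.1 this.2)]
    exact h2 x hx

/-- If `u X` avoids `X` and `u² X ⊆ X`, the cycle `I` of a point of `X` is the disjoint union of `I
∩ X` and its image under `u`, hence has even size. -/
theorem oddCycles_of_classSizes {E : Finset ℤ} {u : Equiv.Perm ℤ} (hu : ∀ x ∉ E, u x = x)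
    (h : ∀ k ∈ classSizes u.SameCycle E, Odd k) : OddCycles u := by
  classical
  intro X ⟨x, hx⟩ h1 h2
  have hxE : x ∈ E := by
    by_contra hn
    have := h1 x hx
    rw [hu x hn] at this
    exact this hx
  obtain ⟨P, hP, hPc⟩ := exists_finpartition_classSizes (E := E)
    (⟨.refl u, .symm, .trans⟩ : Equivalence u.SameCycle)
  obtain ⟨I, hI, hxI⟩ := P.exists_mem hxE
  have hodd : Odd I.card := h _ (hP ▸ Multiset.mem_map_of_mem _ hI)
  have hmem : ∀ y, u.SameCycle x y → y ∈ I := by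
    intro y hy
    have hyE : y ∈ E := by
      by_contra hn
      rcases hy.symm with ⟨k, hk⟩
      have : (u ^ k) y = y := by
        have hf : Function.IsFixedPt u y := hu y hn
        exact (Equiv.Perm.zpow_apply_eq_self_of_apply_eq_self hf k)
      exact hn (by rwa [← this, hk])
    exact (hPc I hI x hxI y hyE).1 hy
  have hsame : ∀ y ∈ I, u.SameCycle x y := fun y hy => (hPc I hI x hxI y (P.le hI hy)).2 hy
  set Y := I.filter (· ∈ X) with hY
  have hst : ∀ y, u y ∈ X ∪ X.map u.toEmbedding ↔ y ∈ X ∪ X.map u.toEmbedding :=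
    Equiv.Perm.apply_mem_iff_of_mapsTo fun y hy => by
      rw [Finset.mem_union, Finset.mem_map] at hy ⊢
      rcases hy with hy | ⟨z, hz, rfl⟩
      · exact .inr ⟨y, hy, rfl⟩
      · exact .inl (h2 z hz)
  have hI2 : I = Y ∪ Y.map u.toEmbedding := by
    ext y
    rw [Finset.mem_union, Finset.mem_map]
    constructor
    · intro hy
      have := ((hsame y hy).mem_iff_of_stable (A := {y | y ∈ X ∪ X.map u.toEmbedding}) hst).1
        (Finset.mem_union_left _ hx)
      rw [Set.mem_ofPred_eq, Finset.mem_union, Finset.mem_map] at this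
      rcases this with hyX | ⟨z, hz, rfl⟩
      · exact .inl (Finset.mem_filter.2 ⟨hy, hyX⟩)
      · exact .inr ⟨z, Finset.mem_filter.2
          ⟨hmem z (Equiv.Perm.sameCycle_apply_right.1 (hsame _ hy)), hz⟩, rfl⟩
    · rintro (hy | ⟨z, hz, rfl⟩)
      · exact (Finset.mem_filter.1 hy).1
      · exact hmem _ (Equiv.Perm.sameCycle_apply_right.2 (hsame z (Finset.mem_filter.1 hz).1))
  have hdis : Disjoint Y (Y.map u.toEmbedding) := by
    rw [Finset.disjoint_left]
    intro y hy hy'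
    obtain ⟨z, hz, rfl⟩ := Finset.mem_map.1 hy'
    exact h1 z (Finset.mem_filter.1 hz).2 (Finset.mem_filter.1 hy).2
  rw [hI2, Finset.card_union_of_disjoint hdis, Finset.card_map] at hodd
  exact (Nat.not_odd_iff_even.2 ⟨_, rfl⟩) hodd

/-! ### Reduction to nested spirals by cyclic shifts -/

/-- The outermost `2k` arcs of `u` are those of a spiral. -/
structure OuterArcs (A B : ℤ) (k : ℕ) (u : Equiv.Perm ℤ) : Prop where
  mem : u ∈ windowPerm A B
  odd : OddCycles u
  lt : 2 * (k : ℤ) < B - A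
  low : ∀ x, A < x → x ≤ A + k → u x = A + B + 1 - x
  high : ∀ x, B - k ≤ x → x < B → u x = A + B - x

theorem OuterArcs.conj_swap {A B : ℤ} {k : ℕ} {u : Equiv.Perm ℤ} (hu : OuterArcs A B k u) {a : ℤ}
    (h1 : A + k < a) (h2 : a + 1 < B - k) :
    OuterArcs A B k (Equiv.swap a (a + 1) * u * Equiv.swap a (a + 1)) := by
  have hs : Equiv.swap a (a + 1) ∈ windowPerm A B := swap_mem_windowPerm (by omega) (by omega)
  refine ⟨mul_mem (mul_mem hs hu.mem) hs, ?_, hu.lt, fun x h3 h4 => ?_, fun x h3 h4 => ?_⟩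
  · have := hu.odd.conj (Equiv.swap a (a + 1))
    rwa [Equiv.swap_inv] at this
  · rw [Equiv.Perm.mul_apply, Equiv.Perm.mul_apply,
      Equiv.swap_apply_of_ne_of_ne (x := x) (by omega) (by omega), hu.low x h3 h4,
      Equiv.swap_apply_of_ne_of_ne (by omega) (by omega)]
  · rw [Equiv.Perm.mul_apply, Equiv.Perm.mul_apply,
      Equiv.swap_apply_of_ne_of_ne (x := x) (by omega) (by omega), hu.high x h3 h4,
      Equiv.swap_apply_of_ne_of_ne (by omega) (by omega)]

/-- The values outside `(A + k, B - k]` are already taken by the outer arcs. -/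
theorem OuterArcs.apply_ne {A B : ℤ} {k : ℕ} {u : Equiv.Perm ℤ} (hu : OuterArcs A B k u) {x : ℤ}
    (h1 : A + k < x) (h2 : x < B - k ∨ x = B) : A + k < u x ∧ u x ≤ B - k := by
  have hk := hu.lt
  have hm := windowPerm_apply_mem hu.mem (x := x) (by omega) (by omega)
  constructor
  · by_contra hn
    have := u.injective ((hu.high (A + B - u x) (by omega) (by omega)).trans
      (show A + B - (A + B - u x) = u x by ring))
    omega
  · by_contra hn
    have := u.injective ((hu.low (A + B + 1 - u x) (by omega) (by omega)).trans
      (show A + B + 1 - (A + B + 1 - u x) = u x by ring))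
    omega

/-- Here `B - k` is the largest value still free, so `u a < u (a + 1)` whenever `a + 1` is its
preimage. Shifts move this preimage down to the start `A + k + 1` of the next arc. -/
theorem OuterArcs.exists_red_low {A B : ℤ} {k : ℕ} (d : ℕ) {u : Equiv.Perm ℤ}
    (hu : OuterArcs A B k u) {p : ℤ} (hp : u p = B - k) (h1 : p = A + k + 1 + d) (h2 : p < B - k) :
    ∃ u', (twData A B).Red u u' ∧ OuterArcs A B k u' ∧ u' (A + k + 1) = B - k := by
  induction d generalizing u p with
  | zero =>
    obtain rfl : p = A + k + 1 := by omega
    exact ⟨u, .rfl, hu, hp⟩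
  | succ d ih =>
    have hk := hu.lt
    obtain ⟨a, rfl⟩ : ∃ a, p = a + 1 := ⟨p - 1, by ring⟩
    have h3 := hu.conj_swap (a := a) (by omega) h2
    have h4 := hu.apply_ne (x := a) (by omega) (by omega)
    have hne : u a ≠ u (a + 1) := fun h => by have := u.injective h; omega
    obtain ⟨u', hr, hu'⟩ := ih h3 (p := a) (by
      rw [Equiv.Perm.mul_apply, Equiv.Perm.mul_apply, Equiv.swap_apply_left, hp,
        Equiv.swap_apply_of_ne_of_ne (by omega) (by omega)]) (by push_cast at h1; omega) (by omega)
    exact ⟨u', (ShiftData.Move.red (twData_move hu.mem (by omega) (by omega)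
      (.inl (by omega)))).trans hr, hu'⟩

/-- Dually, `A + k + 1` is the smallest value still free, so its preimage can be moved up to `B - k
- 1`; this completes two more arcs. -/
theorem OuterArcs.exists_red_high {A B : ℤ} {k : ℕ} (d : ℕ) {u : Equiv.Perm ℤ}
    (hu : OuterArcs A B k u) (hp : u (A + k + 1) = B - k) {q : ℤ} (hq : u q = A + k + 1)
    (h1 : q = B - k - 1 - d) (h2 : A + k + 1 < q) :
    ∃ u', (twData A B).Red u u' ∧ OuterArcs A B (k + 1) u' := by
  induction d generalizing u q with
  | zero =>
    obtain rfl : q = B - k - 1 := by omega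
    refine ⟨u, .rfl, hu.mem, hu.odd, by push_cast; omega, fun x h3 h4 => ?_, fun x h3 h4 => ?_⟩
    · push_cast at h4
      rcases (by omega : x ≤ A + k ∨ x = A + k + 1) with h | rfl
      · exact hu.low x h3 h
      · rw [hp]; ring
    · push_cast at h3
      rcases (by omega : B - k ≤ x ∨ x = B - k - 1) with h | rfl
      · exact hu.high x h h4
      · rw [hq]; ring
  | succ d ih =>
    have hk := hu.lt
    push_cast at h1
    have h3 := hu.conj_swap (a := q) (by omega) (by omega)
    have h4 := hu.apply_ne (x := q + 1) (by omega) (by omega)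
    have hne : u q ≠ u (q + 1) := fun h => by have := u.injective h; omega
    obtain ⟨u', hr, hu'⟩ := ih h3 (q := q + 1) (by
      rw [Equiv.Perm.mul_apply, Equiv.Perm.mul_apply,
        Equiv.swap_apply_of_ne_of_ne (x := A + k + 1) (by omega) (by omega), hp,
        Equiv.swap_apply_of_ne_of_ne (by omega) (by omega)]) (by
      rw [Equiv.Perm.mul_apply, Equiv.Perm.mul_apply, Equiv.swap_apply_right, hq,
        Equiv.swap_apply_of_ne_of_ne (by omega) (by omega)]) (by omega) (by omega)
    exact ⟨u', (ShiftData.Move.red (twData_move hu.mem (by omega) (by omega)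
      (.inl (by omega)))).trans hr, hu'⟩

/-- As long as the top label does not close the cycle, the next two arcs of the spiral can be put in
place. -/
theorem OuterArcs.exists_red_succ {A B : ℤ} {k : ℕ} {u : Equiv.Perm ℤ} (hu : OuterArcs A B k u)
    (hB : u B ≠ B - k) : ∃ u', (twData A B).Red u u' ∧ OuterArcs A B (k + 1) u' := by
  have hk := hu.lt
  have hpw := windowPerm_apply_mem (inv_mem hu.mem) (x := B - k) (by omega) (by omega)
  have hp : u (u⁻¹ (B - k)) = B - k := by simp
  generalize u⁻¹ (B - k) = p at hp hpw
  have hp1 : A + k < p := by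
    by_contra hn
    have := hu.low p (by omega) (by omega)
    omega
  have hp2 : p < B - k := by
    by_contra hn
    rcases (by omega : p < B ∨ p = B) with h | rfl
    · have := hu.high p (by omega) h
      omega
    · exact hB hp
  obtain ⟨u₁, hr₁, hu₁, hp₁⟩ := hu.exists_red_low (p - (A + k + 1)).toNat hp (by omega) hp2
  have hqw := windowPerm_apply_mem (inv_mem hu₁.mem) (x := A + k + 1) (by omega) (by omega)
  have hq : u₁ (u₁⁻¹ (A + k + 1)) = A + k + 1 := by simp
  generalize u₁⁻¹ (A + k + 1) = q at hq hqw
  have hq1 : A + k + 1 < q := by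
    by_contra hn
    rcases (by omega : q ≤ A + k ∨ q = A + k + 1) with h | rfl
    · have := hu₁.low q (by omega) h
      omega
    · omega
  have hq2 : q < B - k := by
    by_contra hn
    rcases (by omega : q < B ∨ q = B) with h | rfl
    · have := hu₁.high q (by omega) h
      omega
    -- If the top label maps to `A + k + 1`, the arcs close to a cycle that alternates between `(A,
    -- A + k + 1]` and upper labels, which odd cycles exclude.
    · have hlow : ∀ x, A < x → x ≤ A + k + 1 → u₁ x = A + q + 1 - x := by
        intro x h1 h2
        rcases (by omega : x ≤ A + k ∨ x = A + k + 1) with h | rfl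
        · exact hu₁.low x h1 h
        · rw [hp₁]; ring
      refine hu₁.odd (Finset.Ioc A (A + k + 1)) ⟨A + 1, by simp⟩ (fun x hx => ?_) fun x hx => ?_
      · rw [Finset.mem_Ioc] at hx ⊢
        rw [hlow x hx.1 hx.2]
        omega
      · rw [Finset.mem_Ioc] at hx ⊢
        rw [hlow x hx.1 hx.2]
        rcases (by omega : x = A + 1 ∨ A + 1 < x) with rfl | h
        · rw [show A + q + 1 - (A + 1) = q by ring, hq]; omega
        · rw [hu₁.high _ (by omega) (by omega)]; omega
  obtain ⟨u₂, hr₂, hu₂⟩ := hu₁.exists_red_high (B - k - 1 - q).toNat hp₁ hq (by omega) hq1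
  exact ⟨u₂, hr₁.trans hr₂, hu₂⟩

/-- When the top label maps to `B - k`, the outer arcs are those of a spiral of length `2k + 1`.
Dividing it off leaves a permutation of the core, still with odd cycles. -/
theorem OuterArcs.eq_mul_spiral {A B : ℤ} {k : ℕ} {u : Equiv.Perm ℤ} (hu : OuterArcs A B k u)
    (hB : u B = B - k) : ∃ v ∈ windowPerm (A + k) (B - k - 1), OddCycles v ∧
      u = v * spiral (A + k) (B - k - 1) k := by
  have hk := hu.lt
  have hle : A + (k : ℤ) ≤ B - k - 1 := by omega
  set g := spiral (A + k) (B - k - 1) k with hg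
  have e : ∀ x, ¬ (A + k < x ∧ x ≤ B - k - 1) → u x = g x := by
    intro x hx
    rw [hg, spiral_apply hle]
    split_ifs with h1 h2 h3
    · rw [hu.low x (by omega) (by omega)]; ring
    · rw [hu.high x (by omega) (by omega)]; ring
    · obtain rfl : x = B := by omega
      rw [hB]; ring
    · exact hu.mem x (by omega)
  have hst : ∀ x, ¬ (A + k < x ∧ x ≤ B - k - 1) → ¬ (A + k < g⁻¹ x ∧ g⁻¹ x ≤ B - k - 1) := by
    intro x hx hn
    have := spiral_apply_core hle k hn.1 hn.2
    rw [← hg, ← Equiv.Perm.mul_apply, mul_inv_cancel, Equiv.Perm.one_apply] at this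
    exact hx (this ▸ hn)
  have hv : u * g⁻¹ ∈ windowPerm (A + k) (B - k - 1) := by
    intro x hx
    rw [Equiv.Perm.mul_apply, e _ (hst x hx), ← Equiv.Perm.mul_apply, mul_inv_cancel,
      Equiv.Perm.one_apply]
  refine ⟨u * g⁻¹, hv, ?_, by simp⟩
  refine OddCycles.of_mul (g := g) hv (fun x => spiral_apply_core hle k) ?_
  rw [inv_mul_cancel_right]
  exact hu.odd

/-- The number `d` bounds the steps left: `2k < B - A` always holds, so the spiral must close. -/
theorem OuterArcs.exists_red_mul_spiral {A B : ℤ} (d : ℕ) {k : ℕ} {u : Equiv.Perm ℤ}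
    (hu : OuterArcs A B k u) (hd : B - A ≤ 2 * (k + d : ℕ)) :
    ∃ k : ℕ, ∃ v ∈ windowPerm (A + k) (B - k - 1), 2 * (k : ℤ) < B - A ∧ OddCycles v ∧
      (twData A B).Red u (v * spiral (A + k) (B - k - 1) k) := by
  induction d generalizing k u with
  | zero =>
    have := hu.lt
    push_cast at hd
    omega
  | succ d ih =>
    by_cases hB : u B = B - k
    · obtain ⟨v, hv, ho, rfl⟩ := hu.eq_mul_spiral hB
      exact ⟨k, v, hv, hu.lt, ho, .rfl⟩
    · obtain ⟨u', hr, hu'⟩ := hu.exists_red_succ hB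
      obtain ⟨k', v, hv, h1, h2, hr'⟩ := ih hu' (by push_cast at hd ⊢; omega)
      exact ⟨k', v, hv, h1, h2, hr.trans hr'⟩

/-- Cyclic shifts lead to nested spirals. -/
theorem exists_red_twBlocks (d : ℕ) {A B : ℤ} {u : Equiv.Perm ℤ} (hu : u ∈ windowPerm A B)
    (ho : OddCycles u) (hAB : A ≤ B) (hd : B - A ≤ d) :
    ∃ (L : List ℕ) (a : ℤ), (∀ b ∈ L, Odd b) ∧ A = a - lowSum L ∧ B = a + highSum L ∧
      (twData A B).Red u (twBlocks a a L) := by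
  induction d using Nat.strong_induction_on generalizing A B u with
  | _ d ih =>
    rcases hAB.eq_or_lt with rfl | hlt
    · refine ⟨[], A, by simp, by simp [lowSum], by simp [highSum], ?_⟩
      have : u = 1 := by
        ext x
        exact hu x (by omega)
      rw [this]
      exact ShiftData.Red.rfl
    · have h0 : OuterArcs A B 0 u := by
        refine ⟨hu, ho, by push_cast; omega, fun x h1 h2 => ?_, fun x h1 h2 => ?_⟩ <;>
        · push_cast at *
          omega
      obtain ⟨k, v, hv, hk, hov, hr⟩ := h0.exists_red_mul_spiral d (by push_cast; omega)
      obtain ⟨L, a, hL, hA, hB, hr'⟩ := ih (B - k - 1 - (A + k)).toNat (by omega) hv hov (by omega)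
        (by omega)
      refine ⟨(2 * k + 1) :: L, a, ?_, ?_, ?_, hr.trans ?_⟩
      · rintro b hb
        rcases List.mem_cons.1 hb with rfl | hb
        · exact ⟨k, rfl⟩
        · exact hL b hb
      · simp only [lowSum]; omega
      · simp only [highSum]; omega
      · rw [twBlocks, twBlock_odd, ← hA, ← hB]
        exact twData_red_mul (by omega) (by omega)
          (windowPerm_mono (by omega) (by omega) (spiral_mem (by omega) k))
          (fun x => spiral_apply_core (by omega) k) hv hr'

/-! ### Classes of permutations with odd cycles -/

theorem sameCycle_spiral {A B : ℤ} (h : A ≤ B) {c : ℕ} {v : Equiv.Perm ℤ}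
    (hv : v ∈ windowPerm A B) {x : ℤ} (hx : (A - c < x ∧ x ≤ A) ∨ (B < x ∧ x ≤ B + c + 1)) :
    (v * spiral A B c).SameCycle (B + 1) x := by
  have hstep : ∀ x y, ¬ (A < y ∧ y ≤ B) → spiral A B c x = y → (v * spiral A B c).SameCycle x y := by
    intro x y hy e
    have : (v * spiral A B c) x = y := by rw [Equiv.Perm.mul_apply, e, hv y hy]
    rw [← this]
    exact Equiv.Perm.sameCycle_apply_right.2 (.refl _ _)
  have key : ∀ i : ℕ, i ≤ c → (v * spiral A B c).SameCycle (B + 1) (B + 1 + i) ∧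
      (0 < i → (v * spiral A B c).SameCycle (B + 1) (A + 1 - i)) := by
    intro i
    induction i with
    | zero => intro _; simpa using Equiv.Perm.SameCycle.refl _ _
    | succ i ih =>
      intro hi
      obtain ⟨h1, -⟩ := ih (by omega)
      have h2 := h1.trans (hstep (B + 1 + i) (A - i) (by omega) (by
        rw [spiral_apply h]; split_ifs <;> omega))
      have h3 := h2.trans (hstep (A - i) (B + 1 + (i + 1 : ℕ)) (by omega) (by
        rw [spiral_apply h]; split_ifs <;> omega))
      refine ⟨h3, fun _ => ?_⟩
      rwa [show A + 1 - ((i + 1 : ℕ) : ℤ) = A - i by push_cast; ring]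
  rcases hx with hx | hx
  · have := (key (A + 1 - x).toNat (by omega)).2 (by omega)
    rwa [show A + 1 - ((A + 1 - x).toNat : ℤ) = x by omega] at this
  · have := (key (x - (B + 1)).toNat (by omega)).1
    rwa [show B + 1 + ((x - (B + 1)).toNat : ℤ) = x by omega] at this

theorem classSizes_mul_spiral {A B : ℤ} (h : A ≤ B) (c : ℕ) {v : Equiv.Perm ℤ}
    (hv : v ∈ windowPerm A B) :
    classSizes (v * spiral A B c).SameCycle (Finset.Ioc (A - c) (B + (c + 1 : ℕ))) =
      (2 * c + 1) ::ₘ classSizes v.SameCycle (Finset.Ioc A B) := by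
  have hag : ∀ x ∈ Finset.Ioc A B, (v * spiral A B c) x = v x := by
    intro x hx
    have hx := Finset.mem_Ioc.1 hx
    rw [Equiv.Perm.mul_apply, spiral_apply_core h c hx.1 hx.2]
  have hst : ∀ x, (v * spiral A B c) x ∈ Finset.Ioc A B ↔ x ∈ Finset.Ioc A B :=
    Equiv.Perm.apply_mem_iff_of_mapsTo fun x hx => by
      rw [hag x hx]
      rw [Finset.mem_Ioc] at hx ⊢
      exact windowPerm_apply_mem hv hx.1 hx.2
  have hsplit : Finset.Ioc (A - c) (B + (c + 1 : ℕ)) =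
      Finset.Ioc A B ∪ (Finset.Ioc (A - c) A ∪ Finset.Ioc B (B + (c + 1 : ℕ))) := by
    ext x
    simp only [Finset.mem_Ioc, Finset.mem_union]
    omega
  have hout : ∀ x ∈ Finset.Ioc (A - c) A ∪ Finset.Ioc B (B + (c + 1 : ℕ)),
      (v * spiral A B c).SameCycle (B + 1) x := by
    intro x hx
    simp only [Finset.mem_Ioc, Finset.mem_union] at hx
    exact sameCycle_spiral h hv (by omega)
  have hcard : (Finset.Ioc (A - c) A ∪ Finset.Ioc B (B + (c + 1 : ℕ))).card = 2 * c + 1 := by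
    rw [Finset.card_union_of_disjoint, Int.card_Ioc, Int.card_Ioc]
    · omega
    · rw [Finset.disjoint_left]
      intro x hx hx'
      rw [Finset.mem_Ioc] at hx hx'
      omega
  have hnot : ∀ x ∈ Finset.Ioc (A - c) A ∪ Finset.Ioc B (B + (c + 1 : ℕ)),
      x ∉ Finset.Ioc A B := by
    intro x hx
    simp only [Finset.mem_Ioc, Finset.mem_union] at hx ⊢
    omega
  rw [hsplit, classSizes_union (fun x _ => Equiv.Perm.SameCycle.refl _ _), add_comm,
    classSizes_singleton, hcard, classSizes_congr (r' := v.SameCycle), Multiset.singleton_add]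
  · exact fun x hx y _ => Equiv.Perm.sameCycle_congr_of_stable
      (A := {x | x ∈ Finset.Ioc A B}) hst hag hx
  · exact ⟨B + 1, by simp⟩
  · exact fun x hx y hy => (hout x hx).symm.trans (hout y hy)
  · intro x hx y hy hxy
    exact hnot y hy ((hxy.mem_iff_of_stable (A := {x | x ∈ Finset.Ioc A B}) hst).1 hx)
  · intro x hx y hy hxy
    exact hnot x hx ((hxy.mem_iff_of_stable (A := {x | x ∈ Finset.Ioc A B}) hst).2 hy)

theorem classSizes_twBlocks {A B : ℤ} (h : A ≤ B) (L : List ℕ) (hL : ∀ b ∈ L, Odd b) :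
    classSizes (twBlocks A B L).SameCycle (Finset.Ioc (A - lowSum L) (B + highSum L)) =
      L + classSizes (1 : Equiv.Perm ℤ).SameCycle (Finset.Ioc A B) := by
  induction L with
  | nil => simp [twBlocks, lowSum, highSum]
  | cons b L ih =>
    obtain ⟨c, rfl⟩ := hL b (by simp)
    have hL' : ∀ b ∈ L, Odd b := fun b hb => hL b (by simp [hb])
    rw [twBlocks, twBlock_odd, ← Multiset.cons_coe, Multiset.cons_add, ← ih hL',
      ← classSizes_mul_spiral (by omega) c (twBlocks_mem h fun b hb => .inr (hL' b hb))]
    congr 2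
    · simp only [lowSum]; omega
    · simp only [highSum]; omega

/-- The new non-inversions are exactly the pairs of the top label `B + c + 1` with a label of `(A, B
+ c]`. All other pairs with an outer label are inverted, since the arcs reverse the order. -/
theorem twLen_mul_spiral {A B : ℤ} (h : A ≤ B) (c : ℕ) {v : Equiv.Perm ℤ}
    (hv : v ∈ windowPerm A B) :
    twLen (A - c) (B + (c + 1 : ℕ)) (v * spiral A B c) = twLen A B v + ((B - A).toNat + c) := by
  have hmap : ∀ x, A < x → x ≤ B → (v * spiral A B c) x = v x ∧ A < v x ∧ v x ≤ B := by
    intro x h1 h2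
    rw [Equiv.Perm.mul_apply, spiral_apply_core h c h1 h2]
    exact ⟨rfl, windowPerm_apply_mem hv h1 h2⟩
  have hout : ∀ x, ¬ (A < x ∧ x ≤ B) → (v * spiral A B c) x = spiral A B c x := by
    intro x hx
    rw [Equiv.Perm.mul_apply, hv]
    rw [spiral_apply h]; split_ifs <;> omega
  have hlow : ∀ x, A - c < x → x ≤ A → (v * spiral A B c) x = A + B + 2 - x := fun x h1 h2 => by
    rw [hout x (by omega), spiral_apply h, if_pos ⟨h1, h2⟩]
  have hhigh : ∀ x, B < x → x ≤ B + c → (v * spiral A B c) x = A + B + 1 - x := fun x h1 h2 => by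
    rw [hout x (by omega), spiral_apply h, if_neg (by omega), if_pos ⟨h1, h2⟩]
  have htop : (v * spiral A B c) (B + c + 1) = B + 1 := by
    rw [hout _ (by omega), spiral_apply h, if_neg (by omega), if_neg (by omega), if_pos rfl]
  have hinj : Set.InjOn (fun x : ℤ => (x, B + c + 1)) (Finset.Ioc A (B + c)) :=
    fun x _ y _ e => (Prod.mk.inj e).1
  rw [twLen_eq_card, twLen_eq_card,
    show (B - A).toNat + c = ((Finset.Ioc A (B + c)).image fun x => (x, B + c + 1)).card by
      rw [Finset.card_image_of_injOn hinj, Int.card_Ioc]; omega,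
    ← Finset.card_union_of_disjoint]
  · congr 1
    ext ⟨x, y⟩
    simp only [Finset.mem_filter, Finset.mem_product, Finset.mem_Ioc, Finset.mem_union,
      Finset.mem_image, Prod.mk.injEq]
    have hcx := hmap x
    have hcy := hmap y
    have hlx := hlow x
    have hly := hlow y
    have hhx := hhigh x
    have hhy := hhigh y
    constructor
    · rintro ⟨⟨hx, hy⟩, hlt, himg⟩
      by_cases hyt : y = B + c + 1
      · right
        subst hyt
        refine ⟨x, ⟨?_, by omega⟩, rfl, rfl⟩
        by_contra hn
        rw [hlx (by omega) (by omega), htop] at himg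
        omega
      · left
        by_cases hy1 : B < y
        · rw [hhy (by omega) (by omega)] at himg
          by_cases hx1 : x ≤ A
          · rw [hlx (by omega) hx1] at himg; omega
          · by_cases hx2 : x ≤ B
            · have := hcx (by omega) hx2; omega
            · rw [hhx (by omega) (by omega)] at himg; omega
        · by_cases hx1 : x ≤ A
          · rw [hlx (by omega) hx1] at himg
            by_cases hy2 : y ≤ A
            · rw [hly (by omega) hy2] at himg; omega
            · have := hcy (by omega) (by omega); omega
          · have h1 := hcx (by omega) (by omega)
            have h2 := hcy (by omega) (by omega)
            rw [h1.1, h2.1] at himg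
            exact ⟨by omega, by omega, himg⟩
    · rintro (⟨⟨hx, hy⟩, hlt, himg⟩ | ⟨z, hz, rfl, rfl⟩)
      · rw [(hcx hx.1 hx.2).1, (hcy hy.1 hy.2).1]
        exact ⟨by omega, by omega, himg⟩
      · refine ⟨by omega, by omega, ?_⟩
        rw [htop]
        by_cases hz2 : z ≤ B
        · have := hcx hz.1 hz2; omega
        · rw [hhx (by omega) hz.2]; omega
  · rw [Finset.disjoint_left]
    rintro ⟨x, y⟩ h1 h2
    simp only [Finset.mem_filter, Finset.mem_product, Finset.mem_Ioc,
      Finset.mem_image, Prod.mk.injEq] at h1 h2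
    obtain ⟨z, hz, rfl, rfl⟩ := h2
    omega

/-- Nested cycles of lengths `L` on `(0, L.sum]`. -/
def twStd (L : List ℕ) : Equiv.Perm ℤ := twBlocks (lowSum L) (lowSum L) L

/-- The term `lowSum` does not depend on the order of the parts, so the comparison of orderings
again reduces to `tailSums`. -/
theorem twLen_twBlocks (a : ℤ) (L : List ℕ) (hL : ∀ b ∈ L, Odd b) :
    twLen (a - lowSum L) (a + highSum L) (twBlocks a a L) = tailSums L + lowSum L := by
  induction L with
  | nil => simp [twBlocks, lowSum, highSum, tailSums, twLen_eq_card]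
  | cons b L ih =>
    obtain ⟨c, rfl⟩ := hL b (by simp)
    have hL' : ∀ b ∈ L, Odd b := fun b hb => hL b (by simp [hb])
    have := twLen_mul_spiral (by omega) c (twBlocks_mem le_rfl (A := a) fun b hb => .inr (hL' b hb))
    rw [ih hL'] at this
    have hs := lowSum_add_highSum L
    rw [twBlocks, twBlock_odd]
    simp only [lowSum, highSum, tailSums]
    rw [show a - ((2 * c + 1) / 2 + lowSum L : ℕ) = a - lowSum L - c by omega,
      show a + ((2 * c + 1 - (2 * c + 1) / 2) + highSum L : ℕ) = a + highSum L + (c + 1 : ℕ) by omega,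
      this]
    omega

/-! ### Minimal elements of classes with odd cycles. -/

/-- The permutations of `(0, n]` with odd cycles of the lengths in `M`. -/
def twClass (n : ℕ) (M : Multiset ℕ) : Set (Equiv.Perm ℤ) :=
  {w | w ∈ windowPerm 0 n ∧ OddCycles w ∧ classSizes w.SameCycle (Finset.Ioc 0 (n : ℤ)) = M}

theorem twStd_mem_twClass {L : List ℕ} (hL : ∀ b ∈ L, Odd b) : twStd L ∈ twClass L.sum L := by
  have hw := twBlocks_mem (A := lowSum L) le_rfl fun b hb => .inr (hL b hb)
  have hc := classSizes_twBlocks (A := lowSum L) le_rfl L hL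
  have hs := lowSum_add_highSum L
  rw [show (lowSum L : ℤ) - lowSum L = 0 by ring,
    show (lowSum L : ℤ) + highSum L = L.sum by omega] at hw hc
  rw [Finset.Ioc_self, classSizes_empty, add_zero] at hc
  refine ⟨hw, oddCycles_of_classSizes (E := Finset.Ioc 0 (L.sum : ℤ)) (fun x hx => hw x ?_) ?_, hc⟩
  · rwa [Finset.mem_Ioc] at hx
  · intro k hk
    change k ∈ classSizes (twBlocks _ _ L).SameCycle _ at hk
    rw [hc] at hk
    exact hL k (by simpa using hk)

theorem twStd_filter (L : List ℕ) : twStd (L.filter (0 < ·)) = twStd L := by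
  obtain ⟨-, h, -⟩ := twBlocks_filter 0 0 L
  rw [twStd, twStd, h, (twBlocks_filter _ _ L).1]

theorem twLen_twStd {L : List ℕ} (hL : ∀ b ∈ L, Odd b) :
    twLen 0 L.sum (twStd L) = tailSums L + lowSum L := by
  have := twLen_twBlocks (lowSum L) L hL
  have hs := lowSum_add_highSum L
  rwa [show (lowSum L : ℤ) - lowSum L = 0 by ring,
    show (lowSum L : ℤ) + highSum L = L.sum by omega] at this

theorem exists_red_twStd {n : ℕ} {w : Equiv.Perm ℤ} (hw : w ∈ windowPerm 0 n) (ho : OddCycles w) :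
    ∃ L : List ℕ, (∀ b ∈ L, Odd b) ∧ L.sum = n ∧ (twData 0 n).Red w (twStd L) := by
  obtain ⟨L, a, hL, hA, hB, hr⟩ := exists_red_twBlocks n hw ho (by omega) (by omega)
  have hs := lowSum_add_highSum L
  obtain rfl : a = lowSum L := by omega
  exact ⟨L, hL, by omega, hr⟩

theorem windowPerm_map_Ioc {A B : ℤ} {g : Equiv.Perm ℤ} (hg : g ∈ windowPerm A B) :
    (Finset.Ioc A B).image g = Finset.Ioc A B := by
  ext y
  rw [Finset.mem_image]
  constructor
  · rintro ⟨x, hx, rfl⟩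
    rw [Finset.mem_Ioc] at hx ⊢
    exact windowPerm_apply_mem hg hx.1 hx.2
  · intro hy
    rw [Finset.mem_Ioc] at hy
    exact ⟨g⁻¹ y, Finset.mem_Ioc.2 (windowPerm_apply_mem (inv_mem hg) hy.1 hy.2), by simp⟩

theorem twClass_conj {n : ℕ} {M : Multiset ℕ} {w g : Equiv.Perm ℤ} (hw : w ∈ twClass n M)
    (hg : g ∈ windowPerm 0 n) : g * w * g⁻¹ ∈ twClass n M := by
  refine ⟨mul_mem (mul_mem hg hw.1) (inv_mem hg), hw.2.1.conj g, ?_⟩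
  have key := classSizes_image (r := w.SameCycle) (r' := (g * w * g⁻¹).SameCycle)
    (E := Finset.Ioc 0 (n : ℤ)) g.injective.injOn fun x hx y hy => by
      rw [Equiv.Perm.sameCycle_conj]
      simp
  rw [windowPerm_map_Ioc hg] at key
  rw [key, hw.2.2]

theorem stable_twClass (n : ℕ) (M : Multiset ℕ) : (twData 0 n).Stable (twClass n M) where
  sub _ hx := hx.1
  simple x hx s hs := by
    have := twClass_conj hx (ShiftData.S_mem (D := twData 0 n) hs)
    rwa [ShiftData.inv_eq_self ((twData 0 n).S_sub hs)] at this
  omega _ _ g hg := absurd hg (Set.notMem_empty g)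

theorem lowSum_perm {L L' : List ℕ} (h : L.Perm L') : lowSum L = lowSum L' := by
  have : ∀ L, lowSum L = (L.map (· / 2)).sum := fun L => by
    induction L with
    | nil => rfl
    | cons b L ih => simp [lowSum, ih]
  rw [this, this, (h.map _).sum_eq]

theorem pairwise_of_twStd_mem_minSet {n : ℕ} {M : Multiset ℕ} {L : List ℕ} (hL : ∀ b ∈ L, Odd b)
    (hn : L.sum = n) (h : twStd L ∈ (twData 0 n).minSet (twClass n M)) : L.Pairwise (· ≥ ·) := by
  subst hn
  rw [← List.isChain_iff_pairwise, List.isChain_iff_forall_rel_of_append_cons_cons]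
  rintro a b X Y hXY
  by_contra hab
  subst hXY
  have hp : (X ++ a :: b :: Y).Perm (X ++ b :: a :: Y) := (List.Perm.swap b a Y).append_left X
  have hL' : ∀ c ∈ X ++ b :: a :: Y, Odd c := fun c hc => hL c (hp.mem_iff.2 hc)
  have h1 := twStd_mem_twClass hL'
  have h2 := twStd_mem_twClass hL
  rw [← hp.sum_eq, ← Multiset.coe_eq_coe.2 hp, ← h2.2.2, h.1.2.2] at h1
  have h3 := h.2 _ h1
  have h4 := twLen_twStd hL
  have h5 := twLen_twStd hL'
  change twLen _ _ _ ≤ twLen _ _ _ at h3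
  rw [← hp.sum_eq, ← lowSum_perm hp] at h5
  rw [h4, h5] at h3
  simp only [tailSums_append, tailSums, List.sum_cons] at h3
  rw [show b + (a + Y.sum) = a + (b + Y.sum) by ring] at h3
  omega

/-- As for signed permutations: minimality forces decreasing spiral sizes, and the cycle lengths
determine them. -/
theorem red_twStd_of_mem_minSet {n : ℕ} {L : List ℕ} (hL : L.Pairwise (· ≥ ·)) {w : Equiv.Perm ℤ}
    (hw : w ∈ (twData 0 n).minSet (twClass n (L.filter (0 < ·) : List ℕ))) :
    (twData 0 n).Red w (twStd L) := by
  obtain ⟨L', hL', hs, hr⟩ := exists_red_twStd hw.1.1 hw.1.2.1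
  have hm := Red.minSet (stable_twClass n _) hw hr
  have hp := pairwise_of_twStd_mem_minSet hL' hs hm
  subst hs
  have h1 := (twStd_mem_twClass hL').2.2
  rw [hm.1.2.2, Multiset.coe_eq_coe] at h1
  have h2 : L.filter (0 < ·) = L' := h1.eq_of_pairwise (le := (· ≥ ·))
    (fun a b _ _ h h' => le_antisymm h' h) (hL.filter _) hp
  rwa [← twStd_filter, h2]

theorem sum_filter_pos (L : List ℕ) : (L.filter (0 < ·)).sum = L.sum := by
  induction L with
  | nil => rfl
  | cons b L ih =>
    rcases Nat.eq_zero_or_pos b with rfl | hb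
    · simpa using ih
    · rw [List.filter_cons_of_pos (by simpa using hb), List.sum_cons, List.sum_cons, ih]

theorem twStd_mem_minSet {n : ℕ} {L : List ℕ} (hn : L.sum = n) (hodd : ∀ b ∈ L, b = 0 ∨ Odd b)
    (hL : L.Pairwise (· ≥ ·)) :
    twStd L ∈ (twData 0 n).minSet (twClass n (L.filter (0 < ·) : List ℕ)) := by
  have h0 : twStd L ∈ twClass n (L.filter (0 < ·) : List ℕ) := by
    rw [← twStd_filter, ← hn, ← sum_filter_pos]
    refine twStd_mem_twClass fun b hb => ?_
    obtain ⟨h1, h2⟩ := List.mem_filter.1 hb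
    exact (hodd b h1).resolve_left (by simpa using h2 : 0 < b).ne'
  obtain ⟨w, hw⟩ := exists_minSet (D := twData 0 n) ⟨_, h0⟩
  exact Red.minSet (stable_twClass _ _) hw (red_twStd_of_mem_minSet hL hw)

/-! ### Necessity of dominance -/

/-- The length counts non-inversions, so crossing numbers decrease upwards. -/
theorem crossing_le_of_twData_le {A B : ℤ} {x y : Equiv.Perm ℤ} (h : (twData A B).le x y)
    (i j : ℤ) : crossing (Finset.Ioc A B) y i j ≤ crossing (Finset.Ioc A B) x i j := by
  induction h with
  | refl => rfl
  | @tail y z h1 h ih =>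
    refine le_trans ?_ ih
    obtain ⟨t, ⟨a, b, ha, hab, hb, rfl⟩, rfl, hl⟩ := h
    have hlt := (twLen_lt_iff ha hab hb).1 hl
    have := crossing_le_comp_swap (E := Finset.Ioc A B) (x := ⇑(y * Equiv.swap a b))
      (Finset.mem_Ioc.2 ⟨ha, by omega⟩) (Finset.mem_Ioc.2 ⟨by omega, hb⟩) hab (by simpa using hlt) i j
    have e : ⇑(y * Equiv.swap a b) ∘ Equiv.swap a b = y := by
      ext x; simp
    rwa [e] at this

/-- Lower bounds for the values at the labels `≤ i` descend in the Bruhat order. -/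
theorem lt_apply_of_twData_le {A B : ℤ} {x y : Equiv.Perm ℤ} (h : (twData A B).le x y) {i j : ℤ}
    (hy : ∀ a, A < a → a ≤ B → a ≤ i → j < y a) {a : ℤ} (h1 : A < a) (h2 : a ≤ B) (h3 : a ≤ i) :
    j < x a := by
  have hc := crossing_le_of_twData_le h i j
  -- Every label `≤ i` is counted for `y`, the largest count possible; as `x` has at least as many
  -- crossings, every label is counted for `x` too.
  have e : (Finset.Ioc A B).filter (fun a => a ≤ i ∧ j < y a) =
      (Finset.Ioc A B).filter (fun a => a ≤ i) := Finset.filter_congr fun a ha => by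
    rw [Finset.mem_Ioc] at ha
    exact ⟨fun h => h.1, fun h => ⟨h, hy a ha.1 ha.2 h⟩⟩
  rw [crossing, crossing, e] at hc
  have hsub : (Finset.Ioc A B).filter (fun a => a ≤ i ∧ j < x a) ⊆
      (Finset.Ioc A B).filter (fun a => a ≤ i) :=
    Finset.monotone_filter_right _ fun a _ h => h.1
  have := Finset.eq_of_subset_of_card_le hsub hc
  have hm : a ∈ (Finset.Ioc A B).filter (fun a => a ≤ i) :=
    Finset.mem_filter.2 ⟨Finset.mem_Ioc.2 ⟨h1, h2⟩, h3⟩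
  rw [← this] at hm
  exact (Finset.mem_filter.1 hm).2.2

theorem twBlocks_apply_low {A B : ℤ} (h : A ≤ B) {K : List ℕ} (hK : ∀ b ∈ K, b = 0 ∨ Odd b) {x : ℤ}
    (h1 : A - lowSum K < x) (h2 : x ≤ A) : B < twBlocks A B K x := by
  induction K with
  | nil => simp only [lowSum] at h1; omega
  | cons b K ih =>
    have hK' : ∀ b ∈ K, b = 0 ∨ Odd b := fun c hc => hK c (by simp [hc])
    have hm := twBlocks_mem h hK'
    simp only [lowSum] at h1
    rw [twBlocks, Equiv.Perm.mul_apply]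
    by_cases hx : A - lowSum K < x
    · rw [twBlock_apply_core (by omega) _ hx (by omega)]
      exact ih hK' hx
    · rcases hK b (by simp) with rfl | ⟨c, rfl⟩
      · omega
      · rw [twBlock_odd, spiral_apply (by omega), if_pos (by omega), hm _ (by omega)]
        omega

/-- A permutation with odd cycles that maps `(0, A]` to `(B, n]` and whose inverse does so has
large cycles. -/
theorem card_le_sum_take_of_lt_apply {n s : ℕ} {A B : ℤ} {w : Equiv.Perm ℤ} {L : List ℕ}
    (hL : L.Pairwise (· ≥ ·)) (hw : w ∈ twClass n L) (hA : 0 ≤ A) (hAB : A ≤ B) (hBn : B ≤ n)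
    (hs : (n - B) - A ≤ s) (h1 : ∀ a, 0 < a → a ≤ A → B < w a)
    (h2 : ∀ a, 0 < a → a ≤ B → A < w a) : A + (n - B) ≤ (L.take s).sum := by
  classical
  set O := Finset.Ioc 0 A ∪ Finset.Ioc B n with hO
  set Z := (Finset.Ioc B (n : ℤ)).filter (fun h => A < w h) with hZ
  have hpre : ∀ a, 0 < a → a ≤ A → B < w⁻¹ a ∧ w⁻¹ a ≤ n := by
    intro a ha ha'
    have := windowPerm_apply_mem (inv_mem hw.1) ha (by omega)
    refine ⟨?_, this.2⟩
    by_contra hn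
    have h3 := h2 (w⁻¹ a) this.1 (by omega)
    rw [← Equiv.Perm.mul_apply, mul_inv_cancel, Equiv.Perm.one_apply] at h3
    omega
  -- The preimages of `(0, A]` all lie in `(B, n]`, so exactly `A` labels there have low images.
  have hZc : (Z.card : ℤ) = (n - B) - A := by
    have hcard := Finset.card_filter_add_card_filter_not (s := Finset.Ioc B (n : ℤ))
      (fun h => A < w h)
    have : ((Finset.Ioc B (n : ℤ)).filter (fun h => ¬ A < w h)).card = (Finset.Ioc 0 A).card := by
      refine Finset.card_nbij' w (w⁻¹ : Equiv.Perm ℤ) ?_ ?_ (fun x _ => by simp) (fun x _ => by simp)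
      · intro x hx
        have hx := Finset.mem_filter.1 hx
        have hx1 := Finset.mem_Ioc.1 hx.1
        have := windowPerm_apply_mem hw.1 (x := x) (by omega) (by omega)
        exact Finset.mem_Ioc.2 ⟨this.1, by omega⟩
      · intro x hx
        have hx := Finset.mem_Ioc.1 hx
        refine Finset.mem_filter.2 ⟨Finset.mem_Ioc.2 (hpre x hx.1 hx.2), ?_⟩
        rw [← Equiv.Perm.mul_apply, mul_inv_cancel, Equiv.Perm.one_apply]
        omega
    rw [this, Int.card_Ioc, Int.card_Ioc] at hcard
    change Z.card + _ = _ at hcard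
    omega
  -- A cycle through an outer label that avoids `Z` alternates between `(0, A]` and `(B, n]`; its
  -- low labels would witness an even cycle.
  have hcov : ∀ y ∈ O, ∃ z ∈ Z, w.SameCycle z y := by
    intro y hy
    by_contra hno
    have hin : ∀ h, B < h → h ≤ n → w.SameCycle y h → 0 < w h ∧ w h ≤ A := by
      intro h h3 h4 h5
      have := windowPerm_apply_mem hw.1 (x := h) (by omega) h4
      refine ⟨this.1, ?_⟩
      by_contra hn
      exact hno ⟨h, Finset.mem_filter.2 ⟨Finset.mem_Ioc.2 ⟨h3, h4⟩, by omega⟩, h5.symm⟩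
    have hup : ∀ {z}, w.SameCycle y z → w.SameCycle y (w z) := fun h =>
      Equiv.Perm.sameCycle_apply_right.2 h
    refine hw.2.1 ((Finset.Ioc 0 A).filter (fun a => w.SameCycle y a)) ?_ (fun x hx => ?_)
      (fun x hx => ?_)
    · rw [hO, Finset.mem_union, Finset.mem_Ioc, Finset.mem_Ioc] at hy
      rcases hy with hy | hy
      · exact ⟨y, Finset.mem_filter.2 ⟨Finset.mem_Ioc.2 hy, .refl _ _⟩⟩
      · exact ⟨w y, Finset.mem_filter.2 ⟨Finset.mem_Ioc.2 (hin y hy.1 hy.2 (.refl _ _)),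
          hup (.refl _ _)⟩⟩
    · rw [Finset.mem_filter, Finset.mem_Ioc] at hx ⊢
      have := h1 x hx.1.1 hx.1.2
      omega
    · rw [Finset.mem_filter, Finset.mem_Ioc] at hx ⊢
      have h3 := h1 x hx.1.1 hx.1.2
      have h4 := windowPerm_apply_mem hw.1 (x := x) hx.1.1 (by omega)
      exact ⟨hin _ h3 h4.2 (hup hx.2), hup (hup hx.2)⟩
  have hOE : O ⊆ Finset.Ioc 0 (n : ℤ) := Finset.union_subset
    (Finset.Ioc_subset_Ioc_right (by omega)) (Finset.Ioc_subset_Ioc_left (by omega))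
  have hZE : Z ⊆ Finset.Ioc 0 (n : ℤ) :=
    (Finset.filter_subset _ _).trans (Finset.Ioc_subset_Ioc_left (by omega))
  obtain ⟨M, hM, hM1, hM2⟩ := exists_le_classSizes hOE hZE hcov
  rw [hw.2.2] at hM
  have hsum := Multiset.sum_le_sum_take hL hM (s := s) (by omega)
  have hOc : O.card = (Finset.Ioc 0 A).card + (Finset.Ioc B (n : ℤ)).card := by
    refine Finset.card_union_of_disjoint (Finset.disjoint_left.2 fun x hx hx' => ?_)
    rw [Finset.mem_Ioc] at hx hx'
    omega
  rw [Int.card_Ioc, Int.card_Ioc] at hOc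
  omega

/-- The first `s` spirals of the normal form occupy the outer labels. They send lower outer labels
above the core, and only outer upper labels can go to the low region. Both properties pass to
elements below it. Each spiral has at most one more upper than lower label, so at most `s` cycles
cover the outer region. -/
theorem sum_take_le_of_twData_below {n : ℕ} {L L' : List ℕ} (hL : L.Pairwise (· ≥ ·))
    (hL' : L'.sum = n) (hodd : ∀ b ∈ L', b = 0 ∨ Odd b)
    (h : (twData 0 n).Below (twClass n L) (twStd L')) (s : ℕ) :
    (L'.take s).sum ≤ (L.take s).sum := by
  obtain ⟨x, hx, hle⟩ := h
  have e := List.take_append_drop s L'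
  set K := L'.take s with hK
  set Y := L'.drop s with hY
  have hKo : ∀ b ∈ K, b = 0 ∨ Odd b := fun b hb => hodd b (List.mem_of_mem_take hb)
  have hYo : ∀ b ∈ Y, b = 0 ∨ Odd b := fun b hb => hodd b (List.mem_of_mem_drop hb)
  have hl : lowSum L' = lowSum K + lowSum Y := by rw [← e, lowSum_append]
  have hks := lowSum_add_highSum K
  have hys := lowSum_add_highSum Y
  have hsum : K.sum + Y.sum = n := by rw [← List.sum_append, e, hL']
  have hhigh := highSum_le K
  have hlen : K.length ≤ s := List.length_take_le _ _
  have hstd : twStd L' = twBlocks (lowSum L') (lowSum L') Y *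
      twBlocks (lowSum K) (lowSum L' + highSum Y) K := by
    rw [twStd]
    nth_rw 3 [← e]
    rw [twBlocks_append]
    congr 2
    omega
  have hYm := twBlocks_mem (A := lowSum L') le_rfl hYo
  have hlow : ∀ a : ℤ, 0 < a → a ≤ lowSum K → (lowSum L' + highSum Y : ℤ) < twStd L' a := by
    intro a h1 h2
    have := twBlocks_apply_low (A := lowSum K) (B := lowSum L' + highSum Y) (by omega) hKo
      (x := a) (by omega) h2
    rw [hstd, Equiv.Perm.mul_apply, hYm _ (by omega)]
    exact this
  have hcore : ∀ a : ℤ, 0 < a → a ≤ lowSum L' + highSum Y → (lowSum K : ℤ) < twStd L' a := by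
    intro a h1 h2
    by_cases ha : a ≤ lowSum K
    · have := hlow a h1 ha
      omega
    · rw [hstd, Equiv.Perm.mul_apply, twBlocks_apply_core (by omega) K (by omega) h2]
      have := windowPerm_apply_mem hYm (x := a) (by omega) (by omega)
      omega
  have := card_le_sum_take_of_lt_apply (s := s) (A := lowSum K) (B := lowSum L' + highSum Y) hL hx.1
    (by omega) (by omega) (by omega) (by omega)
    (fun a h1 h2 => lt_apply_of_twData_le hle (fun b h3 _ h5 => hlow b h3 h5) h1 (by omega) h2)
    (fun a h1 h2 => lt_apply_of_twData_le hle (fun b h3 _ h5 => hcore b h3 h5) h1 (by omega) h2)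
  omega

/-! ### Passing two labels from one odd cycle to another -/

/-- The cycle `b ↦ a`, `x ↦ x + 1` for `a ≤ x < b`. -/
def rotDown (a b : ℤ) : Equiv.Perm ℤ where
  toFun x := if x = b ∧ a ≤ b then a else if a ≤ x ∧ x < b then x + 1 else x
  invFun x := if x = a ∧ a ≤ b then b else if a < x ∧ x ≤ b then x - 1 else x
  left_inv x := by dsimp only; split_ifs <;> omega
  right_inv x := by dsimp only; split_ifs <;> omega

theorem rotDown_apply (a b x : ℤ) : rotDown a b x =
    if x = b ∧ a ≤ b then a else if a ≤ x ∧ x < b then x + 1 else x := rfl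

theorem rotDown_inv_apply (a b x : ℤ) : (rotDown a b)⁻¹ x =
    if x = a ∧ a ≤ b then b else if a < x ∧ x ≤ b then x - 1 else x := rfl

theorem rotDown_self (a : ℤ) : rotDown a a = 1 := by
  ext x
  rw [rotDown_apply, Equiv.Perm.one_apply]
  split_ifs <;> omega

theorem rotDown_mem {A B a b : ℤ} (ha : A < a) (hb : b ≤ B) : rotDown a b ∈ windowPerm A B :=
  fun x hx => by rw [rotDown_apply]; split_ifs <;> omega

theorem rotDown_sub_one {a b : ℤ} (h : a ≤ b) :
    rotDown (a - 1) b = Equiv.swap (a - 1) a * rotDown a b := by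
  ext x
  rw [Equiv.Perm.mul_apply, rotDown_apply, rotDown_apply, Equiv.swap_apply_def]
  split_ifs <;> omega

theorem rotDown_add_one_inv {a b : ℤ} (h : a ≤ b) :
    (rotDown a (b + 1))⁻¹ = Equiv.swap b (b + 1) * (rotDown a b)⁻¹ := by
  ext x
  rw [Equiv.Perm.mul_apply, rotDown_inv_apply, rotDown_inv_apply, Equiv.swap_apply_def]
  split_ifs <;> omega

theorem swap_mul_conj_mul_swap (a b : ℤ) (g u : Equiv.Perm ℤ) :
    Equiv.swap a b * (g * u * g⁻¹) * Equiv.swap a b =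
      (Equiv.swap a b * g) * u * (Equiv.swap a b * g)⁻¹ := by
  rw [mul_inv_rev, Equiv.swap_inv]
  simp only [mul_assoc]

/-- The image of the largest label may be moved down by cyclic shifts. -/
theorem red_conj_rotDown {P Q f : ℤ} (d : ℕ) {u : Equiv.Perm ℤ} (hu : u ∈ windowPerm P Q)
    (hf : u Q = f) (hQ : f < Q) (hd : P < f - d) :
    (twData P Q).Red u (rotDown (f - d) f * u * (rotDown (f - d) f)⁻¹) := by
  induction d with
  | zero => simpa [rotDown_self] using ShiftData.Red.rfl
  | succ d ih =>
    push_cast at hd ⊢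
    refine (ih (by omega)).trans (ShiftData.Move.red ?_)
    obtain ⟨a, ha⟩ : ∃ a, f - d = a + 1 := ⟨f - d - 1, by ring⟩
    have e : f - (d + 1 : ℤ) = a := by omega
    have hr := rotDown_mem (A := P) (B := Q) (a := f - d) (b := f) (by omega) (by omega)
    have hm := mul_mem (mul_mem hr hu) (inv_mem hr)
    have h1 : (rotDown (f - d) f * u * (rotDown (f - d) f)⁻¹)⁻¹ (a + 1) = Q := by
      rw [Equiv.Perm.inv_eq_iff_eq, Equiv.Perm.mul_apply, Equiv.Perm.mul_apply, rotDown_inv_apply,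
        if_neg (by omega), if_neg (by omega), hf, rotDown_apply, if_pos (by omega)]
      omega
    have h2 := windowPerm_apply_mem (inv_mem hm) (x := a) (by omega) (by omega)
    have h3 : (rotDown (f - d) f * u * (rotDown (f - d) f)⁻¹)⁻¹ a ≠ Q := by
      rw [← h1]
      intro h
      have := Equiv.injective _ h
      omega
    have hmove := twData_move hm (a := a) (by omega) (by omega) (.inr (by omega))
    rw [swap_mul_conj_mul_swap, ha] at hmove
    have e2 := rotDown_sub_one (a := a + 1) (b := f) (by omega)
    rw [add_sub_cancel_right] at e2
    rwa [e, e2, ha]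

/-- A label may be moved up past labels whose preimages are larger. -/
theorem red_conj_rotDown_inv {P Q e g : ℤ} (d : ℕ) {u : Equiv.Perm ℤ} (hu : u ∈ windowPerm P Q)
    (hg : u g = e) (hP : P < e) (hd : e + d < g) (hQ : g ≤ Q)
    (h : ∀ x, e < x → x ≤ e + d → g < u⁻¹ x) :
    (twData P Q).Red u ((rotDown e (e + d))⁻¹ * u * (rotDown e (e + d))⁻¹⁻¹) := by
  induction d with
  | zero => simpa [rotDown_self] using ShiftData.Red.rfl
  | succ d ih =>
    push_cast at hd h ⊢
    refine (ih (by omega) fun x h1 h2 => h x h1 (by omega)).trans (ShiftData.Move.red ?_)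
    have hr := inv_mem (rotDown_mem (A := P) (B := Q) (a := e) (b := e + d) (by omega) (by omega))
    have hm := mul_mem (mul_mem hr hu) (inv_mem hr)
    set ρ := (rotDown e (e + d))⁻¹ with hρ
    have hρg : ∀ y, e + d < y → ρ y = y := fun y hy => by
      rw [hρ, rotDown_inv_apply, if_neg (by omega), if_neg (by omega)]
    have hρe : ρ e = e + d := by rw [hρ, rotDown_inv_apply, if_pos (by omega)]
    have hρg' : ∀ y, e + d < y → ρ⁻¹ y = y := fun y hy => by
      rw [Equiv.Perm.inv_eq_iff_eq, hρg y hy]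
    have h1 : (ρ * u * ρ⁻¹)⁻¹ (e + d) = g := by
      rw [Equiv.Perm.inv_eq_iff_eq, Equiv.Perm.mul_apply, Equiv.Perm.mul_apply, hρg' g (by omega),
        hg, hρe]
    have h2 : (ρ * u * ρ⁻¹)⁻¹ (e + d + 1) = u⁻¹ (e + d + 1) := by
      have := h (e + d + 1) (by omega) (by omega)
      rw [Equiv.Perm.inv_eq_iff_eq, Equiv.Perm.mul_apply, Equiv.Perm.mul_apply,
        hρg' _ (by omega), ← Equiv.Perm.mul_apply u, mul_inv_cancel, Equiv.Perm.one_apply,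
        hρg _ (by omega)]
    have hmove := twData_move hm (a := e + d) (by omega) (by omega)
      (.inr (by rw [h1, h2]; exact h _ (by omega) (by omega)))
    rw [swap_mul_conj_mul_swap, hρ, ← rotDown_add_one_inv (by omega)] at hmove
    rwa [← add_assoc]

theorem conj_spiral {A B : ℤ} (h : A ≤ B) {c : ℕ} {σ : Equiv.Perm ℤ}
    (hl : ∀ x, A - c < x → x ≤ A → σ x = x - 1)
    (hh : ∀ x, B < x → x ≤ B + c + 1 → σ x = x + 1) :
    σ * spiral A B c * σ⁻¹ = spiral (A - 1) (B + 1) c := by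
  rw [mul_inv_eq_iff_eq_mul]
  ext x
  rw [Equiv.Perm.mul_apply, Equiv.Perm.mul_apply]
  by_cases h1 : A - c < x ∧ x ≤ A
  · rw [hl x h1.1 h1.2, spiral_apply h, if_pos h1, spiral_apply (by omega), if_pos (by omega),
      hh _ (by omega) (by omega)]
    ring
  by_cases h2 : B < x ∧ x ≤ B + c
  · rw [hh x h2.1 (by omega), spiral_apply h, if_neg h1, if_pos h2, spiral_apply (by omega),
      if_neg (by omega), if_pos (by omega), hl _ (by omega) (by omega)]
    ring
  by_cases h3 : x = B + c + 1
  · rw [hh x (by omega) (by omega), spiral_apply h, if_neg h1, if_neg h2, if_pos h3,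
      spiral_apply (by omega), if_neg (by omega), if_neg (by omega), if_pos (by omega),
      hh _ (by omega) (by omega)]
  · rw [spiral_apply h, if_neg h1, if_neg h2, if_neg h3]
    have h4 : ¬ (A - 1 - c < σ x ∧ σ x ≤ A - 1) := fun hn => by
      have := σ.injective ((hl (σ x + 1) (by omega) (by omega)).trans (by ring))
      omega
    have h5 : ¬ (B + 1 < σ x ∧ σ x ≤ B + 1 + c + 1) := fun hn => by
      have := σ.injective ((hh (σ x - 1) (by omega) (by omega)).trans (by ring))
      omega
    rw [spiral_apply (by omega), if_neg h4, if_neg (by omega), if_neg (by omega)]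

theorem conj_twBlocks {A B : ℤ} (h : A ≤ B) {K : List ℕ} (hK : ∀ b ∈ K, b = 0 ∨ Odd b)
    {σ : Equiv.Perm ℤ} (hl : ∀ x, A - lowSum K < x → x ≤ A → σ x = x - 1)
    (hh : ∀ x, B < x → x ≤ B + highSum K → σ x = x + 1) :
    σ * twBlocks A B K * σ⁻¹ = twBlocks (A - 1) (B + 1) K := by
  induction K with
  | nil => simp [twBlocks]
  | cons b K ih =>
    simp only [lowSum, highSum] at hl hh
    have h1 := ih (fun c hc => hK c (by simp [hc])) (fun x h1 h2 => hl x (by omega) h2)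
      (fun x h1 h2 => hh x h1 (by omega))
    have h2 : σ * twBlock (A - lowSum K) (B + highSum K) b * σ⁻¹ =
        twBlock (A - 1 - lowSum K) (B + 1 + highSum K) b := by
      rcases hK b (by simp) with rfl | ⟨c, rfl⟩
      · simp [twBlock_zero]
      · rw [twBlock_odd, twBlock_odd, conj_spiral (by omega) (fun x h1 h2 => hl x (by omega) (by omega))
          (fun x h1 h2 => hh x (by omega) (by omega))]
        congr 1 <;> ring
    rw [twBlocks, twBlocks, ← h1, ← h2]
    group

/-- The core is fixed and low labels are sent above it, so neither can be the preimage of a low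
label. This permits another label to be shifted past the low ones. -/
theorem lt_twBlocks_inv_apply_low {A B : ℤ} (h : A ≤ B) {K : List ℕ}
    (hK : ∀ b ∈ K, b = 0 ∨ Odd b) {x : ℤ} (h1 : A - lowSum K < x) (h2 : x ≤ A) :
    B < (twBlocks A B K)⁻¹ x := by
  have hm := windowPerm_apply_mem (inv_mem (twBlocks_mem h hK)) (x := x) h1 (by omega)
  have e : twBlocks A B K ((twBlocks A B K)⁻¹ x) = x := by simp
  generalize (twBlocks A B K)⁻¹ x = y at *
  by_contra hn
  by_cases hy : y ≤ A
  · have := twBlocks_apply_low h hK hm.1 hy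
    omega
  · rw [twBlocks_apply_core h K (by omega) (by omega)] at e
    omega

/-- Detaches the two innermost labels `A` and `B + 1` of a spiral, leaving a spiral around the core
enlarged by one label on each side. -/
theorem spiral_succ {A B : ℤ} (h : A ≤ B) (c : ℕ) : spiral A B (c + 1) =
    Equiv.swap A (B + 1) * spiral (A - 1) (B + 1) c * Equiv.swap A (B + c + 2) := by
  ext x
  rw [Equiv.Perm.mul_apply, Equiv.Perm.mul_apply]
  by_cases h1 : x = A
  · rw [h1, Equiv.swap_apply_left, spiral_apply h, if_pos (by push_cast; omega),
      spiral_apply (by omega), if_neg (by omega), if_neg (by omega), if_pos (by omega),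
      Equiv.swap_apply_of_ne_of_ne (by omega) (by omega)]
    ring
  by_cases h2 : x = B + c + 2
  · rw [h2, Equiv.swap_apply_right, spiral_apply h, if_neg (by omega), if_neg (by push_cast; omega),
      if_pos (by push_cast; omega),
      spiral_apply (by omega), if_neg (by omega), if_neg (by omega), if_neg (by omega),
      Equiv.swap_apply_left]
  · rw [Equiv.swap_apply_of_ne_of_ne h1 h2, spiral_apply h, spiral_apply (by omega),
      Equiv.swap_apply_def]
    push_cast
    split_ifs <;> omega

/-- Exhibits a spiral with two outer labels exchanged as the longer spiral times an adjacent
transposition, so that one Bruhat step leads to the longer spiral. -/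
theorem spiral_mul_swap {A B : ℤ} (h : A ≤ B) (d : ℕ) :
    spiral A B d * Equiv.swap (A - d) (B + d + 2) =
      spiral A B (d + 1) * Equiv.swap (B + d + 1) (B + d + 2) := by
  ext x
  rw [Equiv.Perm.mul_apply, Equiv.Perm.mul_apply, spiral_apply h, spiral_apply h,
    Equiv.swap_apply_def, Equiv.swap_apply_def]
  push_cast
  split_ifs <;> omega

/-- The outer spiral gives up its two innermost labels. They move past the blocks of `K` to `A₀` and
`B₀ + 1`, next to the inner part `z`, where they appear as a transposition multiplying `z`; `hle`
absorbs this product into `z'`. -/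
theorem redLE_absorb {A₀ B₀ : ℤ} (h₀ : A₀ ≤ B₀) {z z' : Equiv.Perm ℤ} (hz : z ∈ windowPerm A₀ B₀)
    (hle : (twData (A₀ - 1) (B₀ + 1)).le (z * Equiv.swap A₀ (B₀ + 1)) z')
    {K : List ℕ} (hK : ∀ b ∈ K, b = 0 ∨ Odd b) (c : ℕ) {A B : ℤ} (hA : A = A₀ - lowSum K)
    (hB : B = B₀ + highSum K) :
    (twData (A - 1 - c) (B + c + 2)).RedLE (z * twBlocks A₀ B₀ K * spiral A B (c + 1))
      (z' * twBlocks (A₀ - 1) (B₀ + 1) K * spiral (A - 1) (B + 1) c) := by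
  have hAB : A ≤ B := by omega
  set v := z * twBlocks A₀ B₀ K with hv
  have hvm : v ∈ windowPerm A B := by
    rw [hv, hA, hB]
    exact mul_mem (windowPerm_mono (by omega) (by omega) hz) (twBlocks_mem h₀ hK)
  set w := v * spiral A B (c + 1) with hw
  have hwm : w ∈ windowPerm (A - 1 - c) (B + c + 2) := by
    refine mul_mem (windowPerm_mono (by omega) (by omega) hvm)
      (windowPerm_mono ?_ ?_ (spiral_mem hAB (c + 1))) <;> push_cast <;> omega
  have hwtop : w (B + c + 2) = B + 1 := by
    rw [hw, Equiv.Perm.mul_apply, spiral_apply hAB, if_neg (by omega),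
      if_neg (by push_cast; omega), if_pos (by push_cast; omega), hvm _ (by omega)]
  have hwA : w A = B + 2 := by
    rw [hw, Equiv.Perm.mul_apply, spiral_apply hAB, if_pos (by push_cast; omega),
      hvm _ (by omega)]
    ring
  have hwB : w (B + 1) = A := by
    rw [hw, Equiv.Perm.mul_apply, spiral_apply hAB, if_neg (by omega),
      if_pos (by push_cast; omega), hvm _ (by omega)]
    ring
  set τ := rotDown (B₀ + 1) (B + 1) with hτ
  set ρ := (rotDown A A₀)⁻¹ with hρ
  have hτa : ∀ x, τ x = if x = B + 1 then B₀ + 1 else if B₀ < x ∧ x ≤ B then x + 1 else x := by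
    intro x
    rw [hτ, rotDown_apply]
    split_ifs <;> omega
  have hρa : ∀ x, ρ x = if x = A then A₀ else if A < x ∧ x ≤ A₀ then x - 1 else x := by
    intro x
    rw [hρ, rotDown_inv_apply]
    split_ifs <;> omega
  have hτi : ∀ x y, τ y = x → τ⁻¹ x = y := fun x y e => by rw [Equiv.Perm.inv_eq_iff_eq, e]
  -- The label `B + 1` is the image of the top label, so shifts may move it down to `B₀ + 1`.
  have r1 : (twData (A - 1 - c) (B + c + 2)).Red w (τ * w * τ⁻¹) := by
    have := red_conj_rotDown (highSum K) hwm hwtop (by omega) (by omega)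
    rwa [show B + 1 - (highSum K : ℤ) = B₀ + 1 by omega] at this
  have hτm : τ ∈ windowPerm (A - 1 - c) (B + c + 2) := rotDown_mem (by omega) (by omega)
  -- The label `A` now has preimage `B₀ + 1`, and the low labels of `K` that it passes have larger
  -- preimages, so it may move up to `A₀`.
  have r2 : (twData (A - 1 - c) (B + c + 2)).Red (τ * w * τ⁻¹) (ρ * (τ * w * τ⁻¹) * ρ⁻¹) := by
    have := red_conj_rotDown_inv (e := A) (g := B₀ + 1) (lowSum K)
      (mul_mem (mul_mem hτm hwm) (inv_mem hτm)) ?_ (by omega) (by omega) (by omega) ?_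
    · rwa [show A + (lowSum K : ℤ) = A₀ by omega] at this
    · rw [Equiv.Perm.mul_apply, Equiv.Perm.mul_apply, hτi (B₀ + 1) (B + 1) (by rw [hτa, if_pos rfl]),
        hwB, hτa, if_neg (by omega), if_neg (by omega)]
    · intro x h1 h2
      have h3 := lt_twBlocks_inv_apply_low h₀ hK (x := x) (by omega) (by omega)
      have h4 := windowPerm_apply_mem (inv_mem (twBlocks_mem h₀ hK)) (x := x) (by omega) (by omega)
      rw [← hB] at h4
      have h5 : (τ * w * τ⁻¹)⁻¹ x = (twBlocks A₀ B₀ K)⁻¹ x + 1 := by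
        rw [Equiv.Perm.inv_eq_iff_eq, Equiv.Perm.mul_apply, Equiv.Perm.mul_apply,
          hτi _ ((twBlocks A₀ B₀ K)⁻¹ x) (by rw [hτa, if_neg (by omega), if_pos (by omega)]),
          hw, Equiv.Perm.mul_apply, spiral_apply_core hAB _ (by omega) (by omega), hv,
          Equiv.Perm.mul_apply, ← Equiv.Perm.mul_apply (twBlocks A₀ B₀ K), mul_inv_cancel,
          Equiv.Perm.one_apply, hz _ (by omega), hτa, if_neg (by omega), if_neg (by omega)]
      omega
  set σ := ρ * τ with hσ
  have hσa : ∀ x, σ x = if x = A then A₀ else if A < x ∧ x ≤ A₀ then x - 1 else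
      if x = B + 1 then B₀ + 1 else if B₀ < x ∧ x ≤ B then x + 1 else x := by
    intro x
    rw [hσ, Equiv.Perm.mul_apply, hρa, hτa]
    split_ifs <;> omega
  have hσm : σ ∈ windowPerm (A - 1) (B + 1) := fun x hx => by
    rw [hσa]; split_ifs <;> omega
  have econj : ρ * (τ * w * τ⁻¹) * ρ⁻¹ = σ * w * σ⁻¹ := by
    rw [hσ, mul_inv_rev]; simp only [mul_assoc]
  rw [econj] at r2
  refine ⟨σ * w * σ⁻¹, r1.trans r2, ?_⟩
  set κ := twBlocks (A₀ - 1) (B₀ + 1) K with hκ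
  set S := spiral (A - 1) (B + 1) c with hS
  have hκσ : σ * twBlocks A₀ B₀ K * σ⁻¹ = κ := conj_twBlocks h₀ hK
    (fun x h1 h2 => by rw [hσa, if_neg (by omega), if_pos (by omega)])
    (fun x h1 h2 => by
      rw [hσa, if_neg (by omega), if_neg (by omega), if_neg (by omega), if_pos (by omega)])
  have hzσ : z * σ = σ * z := (windowPerm_commute hz fun x h1 h2 => by
    rw [hσa]; split_ifs <;> omega).eq
  have hSσ : σ * S = S * σ := (windowPerm_commute hσm fun x h1 h2 =>
    spiral_apply_core (by omega) c h1 h2).eq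
  have hκs : Equiv.swap A₀ (B₀ + 1) * κ = κ * Equiv.swap A₀ (B₀ + 1) :=
    (windowPerm_commute (A := A₀ - 1) (B := B₀ + 1)
      (swap_mem_windowPerm (by omega) (by omega)) fun x h1 h2 =>
      twBlocks_apply_core (by omega) K h1 h2).eq
  have hs1 : σ * Equiv.swap A (B + 1) = Equiv.swap A₀ (B₀ + 1) * σ := by
    have := Equiv.swap_apply_apply σ A (B + 1)
    rw [hσa A, hσa (B + 1), if_pos rfl, if_neg (by omega), if_neg (by omega), if_pos rfl] at this
    rw [this, inv_mul_cancel_right]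
  have hs2 : σ * Equiv.swap A (B + c + 2) = Equiv.swap A₀ (B + c + 2) * σ := by
    have := Equiv.swap_apply_apply σ A (B + c + 2)
    rw [hσa A, if_pos rfl, hσm (B + c + 2) (by omega)] at this
    rw [this, inv_mul_cancel_right]
  -- Split the outer spiral by `spiral_succ`. Conjugation by `σ` fixes `z` and the shortened spiral,
  -- spreads the blocks of `K` by one label on each side, and moves the end points of both
  -- transpositions.
  have ew : σ * w * σ⁻¹ = z * Equiv.swap A₀ (B₀ + 1) * (κ * S) * Equiv.swap A₀ (B + c + 2) := by
    have h1 : σ * v = z * κ * σ := by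
      rw [← hκσ, hv]
      simp only [← mul_assoc, inv_mul_cancel_right]
      rw [hzσ]
    rw [mul_inv_eq_iff_eq_mul, hw, ← mul_assoc, h1, spiral_succ hAB]
    calc z * κ * σ * (Equiv.swap A (B + 1) * S * Equiv.swap A (B + c + 2))
        = z * κ * (σ * Equiv.swap A (B + 1)) * S * Equiv.swap A (B + c + 2) := by
          simp only [mul_assoc]
      _ = z * (κ * Equiv.swap A₀ (B₀ + 1)) * (σ * S) * Equiv.swap A (B + c + 2) := by
          rw [hs1]; simp only [mul_assoc]
      _ = z * (Equiv.swap A₀ (B₀ + 1) * κ) * S * (σ * Equiv.swap A (B + c + 2)) := by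
          rw [hκs, hSσ]; simp only [mul_assoc]
      _ = _ := by rw [hs2]; simp only [mul_assoc]
  have hσi : ∀ x y, σ y = x → σ⁻¹ x = y := fun x y e => by rw [Equiv.Perm.inv_eq_iff_eq, e]
  have hv1 : (σ * w * σ⁻¹) (B + c + 2) = B₀ + 1 := by
    change σ (w (σ⁻¹ (B + c + 2))) = _
    rw [hσi _ _ (hσm (B + c + 2) (by omega)), hwtop, hσa, if_neg (by omega), if_neg (by omega),
      if_pos rfl]
  have hv2 : (σ * w * σ⁻¹) A₀ = B + 2 := by
    change σ (w (σ⁻¹ A₀)) = _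
    rw [hσi A₀ A (by rw [hσa, if_pos rfl]), hwA, hσm (B + 2) (by omega)]
  -- Removing the last transposition lengthens, since the value `B + 2` at `A₀` exceeds the value
  -- `B₀ + 1` at the top label.
  have hstep := twData_step (A := A - 1 - c) (B := B + c + 2) (x := σ * w * σ⁻¹) (a := A₀)
    (b := B + c + 2) (by omega) (by omega) (by omega) (by omega)
  rw [ew, mul_assoc _ (Equiv.swap A₀ (B + c + 2)), Equiv.swap_mul_self, mul_one, ← ew] at hstep
  refine hstep.le.trans ?_
  rw [mul_assoc z']
  refine twData_le_mul (by omega) (by omega) (fun x h1 h2 => ?_) hle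
  rw [Equiv.Perm.mul_apply, spiral_apply_core (by omega) c (by omega) (by omega),
    twBlocks_apply_core (by omega) K h1 h2]

/-- Embeds `redLE_absorb` into a full nest with outer blocks `X`. The hypotheses `hl` and `hh` say
that `R'` occupies one label more than `R` on each side, even if its centre `a'` differs from `a`.
-/
theorem redLE_twBlocks {n : ℕ} {a a' : ℤ} {X K R R' : List ℕ} (hX : ∀ b ∈ X, b = 0 ∨ Odd b)
    (hK : ∀ b ∈ K, b = 0 ∨ Odd b) (hR : ∀ b ∈ R, b = 0 ∨ Odd b) (c : ℕ)
    (hl : a' - lowSum R' = a - lowSum R - 1) (hh : a' + highSum R' = a + highSum R + 1)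
    (hle : (twData (a - lowSum R - 1) (a + highSum R + 1)).le
      (twBlocks a a R * Equiv.swap (a - lowSum R) (a + highSum R + 1)) (twBlocks a' a' R'))
    (ha : a = lowSum (X ++ (2 * c + 3) :: (K ++ R)))
    (hn : (X ++ (2 * c + 3) :: (K ++ R)).sum = n) :
    (twData 0 n).RedLE (twBlocks a a (X ++ (2 * c + 3) :: (K ++ R)))
      (twBlocks a' a' (X ++ (2 * c + 1) :: (K ++ R'))) := by
  have hs := lowSum_add_highSum (X ++ (2 * c + 3) :: (K ++ R))
  simp only [lowSum_append, highSum_append, lowSum, highSum, hn] at ha hs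
  have hz := twBlocks_mem (A := a) le_rfl hR
  obtain ⟨w, hr, hw⟩ := redLE_absorb (by omega) hz hle hK c rfl rfl
  have e1 : twBlocks a a (X ++ (2 * c + 3) :: (K ++ R)) =
      twBlocks a a R * twBlocks (a - lowSum R) (a + highSum R) K *
        spiral (a - lowSum R - lowSum K) (a + highSum R + highSum K) (c + 1) *
        twBlocks (a - lowSum R - lowSum K - 1 - c) (a + highSum R + highSum K + c + 2) X := by
    rw [twBlocks_append, twBlocks, twBlocks_append, show 2 * c + 3 = 2 * (c + 1) + 1 by ring,
      twBlock_odd]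
    simp only [lowSum_append, highSum_append, lowSum, highSum]
    congr 2
    · congr 1 <;> omega
    · omega
    · omega
  have e2 : twBlocks a' a' (X ++ (2 * c + 1) :: (K ++ R')) =
      twBlocks a' a' R' * twBlocks (a - lowSum R - 1) (a + highSum R + 1) K *
        spiral (a - lowSum R - lowSum K - 1) (a + highSum R + highSum K + 1) c *
        twBlocks (a - lowSum R - lowSum K - 1 - c) (a + highSum R + highSum K + c + 2) X := by
    rw [twBlocks_append, twBlocks, twBlocks_append, twBlock_odd, hl, hh]
    simp only [lowSum_append, highSum_append, lowSum, highSum]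
    congr 2
    · congr 1 <;> omega
    · omega
    · omega
  rw [e1, e2]
  have hcore : ∀ x : ℤ, a - lowSum R - lowSum K - 1 - c < x →
      x ≤ a + highSum R + highSum K + c + 2 →
      twBlocks (a - lowSum R - lowSum K - 1 - c) (a + highSum R + highSum K + c + 2) X x = x :=
    fun x h1 h2 => twBlocks_apply_core (by omega) X h1 h2
  refine ⟨_, twData_red_mul (by omega) (by omega) (windowPerm_mono (by omega) (by omega)
    (twBlocks_mem (by omega) hX)) hcore ?_ hr, twData_le_mul (by omega) (by omega) hcore hw⟩
  refine mul_mem (mul_mem (windowPerm_mono (by omega) (by omega) hz)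
    (windowPerm_mono (by omega) (by omega) (twBlocks_mem (by omega) hK)))
    (windowPerm_mono ?_ ?_ (spiral_mem (by omega) _)) <;> push_cast <;> omega

/-! ### The order on classes of permutations with odd cycles -/

theorem twData_below_of_redLE {n : ℕ} {L : List ℕ} {y : Equiv.Perm ℤ} (hL : L.Pairwise (· ≥ ·))
    (hodd : ∀ b ∈ L, b = 0 ∨ Odd b) (hn : L.sum = n) (h : (twData 0 n).RedLE (twStd L) y) :
    (twData 0 n).Below (twClass n (L.filter (0 < ·) : List ℕ)) y := by
  obtain ⟨w, hr, hle⟩ := h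
  exact ⟨w, Red.minSet (stable_twClass n _) (twStd_mem_minSet hn hodd hL) hr, hle⟩

/-- The innermost case for an existing part `q`: its spiral, multiplied by the transposition of the
two free labels around it, is one step below the spiral of length `q + 2`. -/
theorem twData_le_of_odd {a : ℤ} {q : ℕ} {Y : List ℕ} (hq : Odd q) (hY : ∀ b ∈ Y, b = 0 ∨ Odd b) :
    (twData (a - lowSum (q :: Y) - 1) (a + highSum (q :: Y) + 1)).le
      (twBlocks a a (q :: Y) * Equiv.swap (a - lowSum (q :: Y)) (a + highSum (q :: Y) + 1))
      (twBlocks a a ((q + 2) :: Y)) := by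
  obtain ⟨d, rfl⟩ := hq
  have hYm := twBlocks_mem (A := a) le_rfl hY
  have hle : a - lowSum Y ≤ a + highSum Y := by omega
  have el : a - lowSum ((2 * d + 1) :: Y) = a - lowSum Y - d := by simp only [lowSum]; omega
  have eh : a + highSum ((2 * d + 1) :: Y) + 1 = a + highSum Y + d + 2 := by
    simp only [highSum]; omega
  rw [el, eh]
  simp only [twBlocks]
  rw [show 2 * d + 1 + 2 = 2 * (d + 1) + 1 by ring, twBlock_odd, twBlock_odd, mul_assoc,
    spiral_mul_swap hle, ← mul_assoc]
  set y := twBlocks a a Y * spiral (a - lowSum Y) (a + highSum Y) (d + 1) with hy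
  have h1 : y (a + highSum Y + d + 1) = a - lowSum Y - d := by
    rw [hy, Equiv.Perm.mul_apply, spiral_apply hle, if_neg (by omega),
      if_pos (by push_cast; omega), hYm _ (by omega)]
    ring
  have h2 : y (a + highSum Y + d + 2) = a + highSum Y + 1 := by
    rw [hy, Equiv.Perm.mul_apply, spiral_apply hle, if_neg (by omega),
      if_neg (by push_cast; omega), if_pos (by push_cast; ring), hYm _ (by omega)]
  clear_value y
  have := twData_step (A := a - lowSum Y - d - 1) (B := a + highSum Y + d + 2)
    (x := y * Equiv.swap (a + highSum Y + d + 1) (a + highSum Y + d + 2))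
    (a := a + highSum Y + d + 1) (b := a + highSum Y + d + 2) (by omega) (by omega) le_rfl (by
      rw [Equiv.Perm.mul_apply, Equiv.Perm.mul_apply, Equiv.swap_apply_left,
        Equiv.swap_apply_right, h1, h2]
      omega)
  rw [mul_assoc, Equiv.swap_mul_self, mul_one] at this
  exact this.le

theorem twBlocks_of_desc_zero {A B : ℤ} {Z : List ℕ} (hZ : Desc 0 Z) : twBlocks A B Z = 1 ∧
    lowSum Z = 0 ∧ highSum Z = 0 := by
  induction Z with
  | nil => exact ⟨rfl, rfl, rfl⟩
  | cons b Z ih =>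
    obtain rfl : b = 0 := by have := hZ.1; omega
    obtain ⟨h1, h2, h3⟩ := ih hZ.2
    simp [twBlocks, lowSum, highSum, h1, h2, h3, twBlock_zero]

theorem exists_redLE_raise_odd {n : ℕ} {L M : List ℕ}
    (hlen : L.length = M.length) (hL : L.Pairwise (· ≥ ·)) (hM : M.Pairwise (· ≥ ·)) (hn : L.sum = n)
    (hs : L.sum = M.sum) (h : Dom 0 L M) (hne : L ≠ M)
    (hoL : ∀ b ∈ L, b = 0 ∨ Odd b) (hoM : ∀ b ∈ M, b = 0 ∨ Odd b) :
    ∃ L', Raises L L' M ∧ (∀ b ∈ L', b = 0 ∨ Odd b) ∧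
      (twData 0 n).RedLE (twStd L') (twStd L) := by
  have hL' := desc_of_pairwise hL fun b hb => List.le_sum_of_mem hb
  have hM' := desc_of_pairwise hM fun b hb => List.le_sum_of_mem hb
  rcases exists_raise_odd hlen hL' hM' hs h hne hoL hoM with
    ⟨X, p, K, q, Y, ⟨c, rfl⟩, hq, rfl, hR⟩ | ⟨X, p, K, Z, ⟨c, rfl⟩, hZ, rfl, hR⟩
  · simp only [List.mem_append, List.mem_cons] at hoL
    have hX : ∀ b ∈ X, b = 0 ∨ Odd b := fun b hb => hoL b (by simp [hb])
    have hK : ∀ b ∈ K, b = 0 ∨ Odd b := fun b hb => hoL b (by simp [hb])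
    have hY : ∀ b ∈ Y, b = 0 ∨ Odd b := fun b hb => hoL b (by simp [hb])
    refine ⟨_, hR, ?_, ?_⟩
    · simp only [List.mem_append, List.mem_cons]
      rintro b (hb | rfl | hb | rfl | hb)
      · exact hX b hb
      · exact .inr ⟨c + 1, by ring⟩
      · exact hK b hb
      · exact .inr hq
      · exact hY b hb
    · have := redLE_twBlocks (n := n) (a := lowSum (X ++ (2 * c + 3) :: (K ++ q :: Y)))
        (a' := lowSum (X ++ (2 * c + 3) :: (K ++ q :: Y))) hX hK (R := q :: Y) (R' := (q + 2) :: Y)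
        (by simpa using ⟨.inr hq, hY⟩) c (by simp only [lowSum]; omega) (by simp only [highSum]; omega)
        (twData_le_of_odd hq hY) rfl (hR.sum.trans hn)
      have ea : lowSum (X ++ (2 * c + 1) :: (K ++ (q + 2) :: Y)) =
          lowSum (X ++ (2 * c + 3) :: (K ++ q :: Y)) := by
        simp only [lowSum_append, lowSum]
        omega
      rw [twStd, twStd, ea]
      exact this
  · simp only [List.mem_append, List.mem_cons] at hoL
    have hX : ∀ b ∈ X, b = 0 ∨ Odd b := fun b hb => hoL b (by simp [hb])
    have hK : ∀ b ∈ K, b = 0 ∨ Odd b := fun b hb => hoL b (by simp [hb])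
    have hZ0 : ∀ b ∈ Z, b = 0 ∨ Odd b := fun b hb => hoL b (by simp [hb])
    have hZ' := fun A B : ℤ => twBlocks_of_desc_zero (A := A) (B := B) hZ
    refine ⟨_, hR, ?_, ?_⟩
    · simp only [List.mem_append, List.mem_cons]
      rintro b (hb | rfl | hb | rfl | rfl | hb)
      · exact hX b hb
      · exact .inr ⟨c + 1, by ring⟩
      · exact hK b hb
      · exact .inl rfl
      · exact .inl rfl
      · exact hZ0 b hb
    · obtain ⟨a, ha⟩ : ∃ a : ℤ, a = (lowSum (X ++ (2 * c + 3) :: (K ++ 0 :: 0 :: Z)) : ℕ) := ⟨_, rfl⟩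
      have ha' : (lowSum (X ++ (2 * c + 1) :: (K ++ 1 :: 1 :: Z)) : ℤ) = a - 1 := by
        simp only [ha, lowSum_append, lowSum]
        omega
      -- Parts equal to 1 are fixed points. The transposition of `a` and `a + 1` lies below the
      -- identity, as non-inversions are counted. Both new labels count as upper ones, so the centre
      -- becomes `a - 1`.
      have hb1 : twBlocks (a - 1) (a - 1) (1 :: 1 :: Z) = 1 := by
        have hs0 : ∀ A B : ℤ, A ≤ B → twBlock A B 1 = 1 := fun A B hAB => by
          ext x
          have := twBlock_odd A B 0
          rw [show 2 * 0 + 1 = 1 by rfl] at this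
          rw [this, spiral_apply hAB, Equiv.Perm.one_apply]
          push_cast
          split_ifs <;> omega
        rw [twBlocks, twBlocks, (hZ' _ _).1, hs0 _ _ (by omega), hs0 _ _ (by omega)]
        rfl
      have := redLE_twBlocks (n := n) (a := a) (a' := a - 1) hX hK (R := 0 :: 0 :: Z)
        (R' := 1 :: 1 :: Z) (by simpa using hZ0) c (by simp only [lowSum]; omega)
        (by simp only [highSum]; omega) (by
          rw [hb1]
          simp only [twBlocks, lowSum, highSum, (hZ' _ _).1, (hZ' 0 0).2, twBlock_zero, one_mul]
          have := twData_step (A := a - 1) (B := a + 1) (x := Equiv.swap a (a + 1)) (a := a)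
            (b := a + 1) (by omega) (by omega) le_rfl (by simp)
          rw [Equiv.swap_mul_self] at this
          simpa using this.le) ha (hR.sum.trans hn)
      rw [twStd, twStd, ha', show 2 * c + 1 + 2 = 2 * c + 3 from rfl, ← ha]
      exact this

/-- Sufficiency for odd parts, by the same induction on `tailSums` as in `below_of_dom`. -/
theorem twData_below_of_dom {n : ℕ} {L M : List ℕ}
    (hlen : L.length = M.length) (hL : L.Pairwise (· ≥ ·)) (hM : M.Pairwise (· ≥ ·)) (hn : L.sum = n)
    (hs : L.sum = M.sum) (h : Dom 0 L M) (hoL : ∀ b ∈ L, b = 0 ∨ Odd b)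
    (hoM : ∀ b ∈ M, b = 0 ∨ Odd b) :
    (twData 0 n).Below (twClass n (M.filter (0 < ·) : List ℕ)) (twStd L) := by
  by_cases hne : L = M
  · subst hne
    exact ⟨_, twStd_mem_minSet hn hoL hL, ShiftData.le.rfl⟩
  · obtain ⟨L', hR, ho', hr⟩ := exists_redLE_raise_odd hlen hL hM hn hs h hne hoL hoM
    obtain ⟨c, hc⟩ := hR.desc
    have hn' : L'.sum = n := hR.sum.trans hn
    have := hR.tail
    have ih := twData_below_of_dom (hR.length.trans hlen) hc.pairwise hM hn' (hR.sum.trans hs)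
      hR.dom ho' hoM
    exact Below.trans (stable_twClass n _) (stable_twClass n _)
      (fun x hx => red_twStd_of_mem_minSet hc.pairwise hx) ih
      (twData_below_of_redLE hc.pairwise ho' hn' hr)
termination_by tailSums L

theorem exists_below_twClass_iff {n : ℕ} (α β : n.Partition) (hα : ∀ k ∈ α.parts, Odd k)
    (hβ : ∀ k ∈ β.parts, Odd k) :
    (∃ y ∈ (twData 0 n).minSet (twClass n β.parts), (twData 0 n).Below (twClass n α.parts) y) ↔
      β.DominanceLE α := by
  have hodd : ∀ γ : n.Partition, (∀ k ∈ γ.parts, Odd k) → ∀ b ∈ γ.padded, b = 0 ∨ Odd b := by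
    intro γ hγ b hb
    rcases Nat.eq_zero_or_pos b with h | h
    · exact .inl h
    · have : b ∈ γ.padded.filter (0 < ·) := List.mem_filter.2 ⟨hb, by simpa using h⟩
      rw [γ.filter_padded] at this
      exact .inr (hγ b ((Multiset.mem_sort _).1 this))
  have e : ∀ γ : n.Partition, γ.parts = (γ.padded.filter (0 < ·) : List ℕ) := fun γ => by
    rw [γ.filter_padded, γ.coe_sorted]
  rw [α.dominanceLE_iff, e α, e β]
  constructor
  · rintro ⟨y, hy, hb⟩ k
    have hr := red_twStd_of_mem_minSet β.pairwise_padded hy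
    have h1 := (hr.below_iff (stable_twClass n _) (stable_twClass n _) hy).1 hb
    have h2 := sum_take_le_of_twData_below (α.pairwise_padded.filter _) β.sum_padded (hodd β hβ) h1 k
    rw [α.filter_padded] at h2
    rw [α.sum_take_padded]
    exact h2
  · intro hd
    exact ⟨_, twStd_mem_minSet β.sum_padded (hodd β hβ) β.pairwise_padded, twData_below_of_dom
      (β.length_padded.trans α.length_padded.symm) β.pairwise_padded α.pairwise_padded β.sum_padded
      (β.sum_padded.trans α.sum_padded.symm) (dom_of_take fun k => by simpa using hd k)
      (hodd β hβ) (hodd α hα)⟩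

/-! ### Permutations of `Fin n` as permutations of the integers in `(0, n]` -/

theorem cycleType_eq_classSizes {α : Type*} [Fintype α] [DecidableEq α] (σ : Equiv.Perm α) :
    σ.cycleType = classSizes σ.SameCycle σ.support := by
  classical
  have e : ∀ x ∈ σ.support, σ.support.filter (σ.SameCycle x) = (σ.cycleOf x).support := by
    intro x hx
    ext y
    rw [Finset.mem_filter, Equiv.Perm.mem_support_cycleOf_iff]
    exact ⟨fun h => ⟨h.2, hx⟩, fun h => ⟨h.1.mem_support_iff.1 hx, h.1⟩⟩
  have e1 : σ.support.image (fun x => σ.support.filter (σ.SameCycle x)) =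
      (σ.support.image σ.cycleOf).image Equiv.Perm.support := by
    rw [Finset.image_image]
    exact Finset.image_congr e
  have e2 : σ.support.image σ.cycleOf = σ.cycleFactorsFinset := by
    ext c
    rw [Finset.mem_image]
    constructor
    · rintro ⟨x, hx, rfl⟩
      exact Equiv.Perm.cycleOf_mem_cycleFactorsFinset_iff.2 hx
    · intro hc
      obtain ⟨x, hx⟩ := (Equiv.Perm.mem_cycleFactorsFinset_iff.1 hc).1.nonempty_support
      refine ⟨x, Equiv.Perm.mem_cycleFactorsFinset_support_le hc hx, ?_⟩
      exact (Equiv.Perm.cycle_is_cycleOf hx hc).symm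
  have hinj : Set.InjOn Equiv.Perm.support (σ.cycleFactorsFinset : Set (Equiv.Perm α)) := by
    intro c hc d hd h
    obtain ⟨x, hx⟩ := (Equiv.Perm.mem_cycleFactorsFinset_iff.1 hc).1.nonempty_support
    rw [Equiv.Perm.cycle_is_cycleOf hx hc, Equiv.Perm.cycle_is_cycleOf (h ▸ hx) hd]
  have e3 : classSizes σ.SameCycle σ.support =
      (σ.support.image (fun x => σ.support.filter (σ.SameCycle x))).val.map Finset.card := by
    unfold classSizes
    congr!
  rw [e3, e1, e2, Finset.image_val_of_injOn hinj, Multiset.map_map, Equiv.Perm.cycleType_def]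

theorem classSizes_eq_replicate {α : Type*} [DecidableEq α] {r : α → α → Prop} {E : Finset α}
    (hr : ∀ x ∈ E, ∀ y ∈ E, r x y ↔ x = y) : classSizes r E = Multiset.replicate E.card 1 := by
  classical
  induction E using Finset.induction_on with
  | empty => simp
  | insert a s ha ih =>
    rw [Finset.insert_eq, classSizes_union, ih fun x hx y hy => hr x (by simp [hx]) y (by simp [hy]),
      classSizes_singleton (by simp) (by simpa using (hr a (by simp) a (by simp)).2 rfl),
      Finset.card_union_of_disjoint (by simpa using ha), Finset.card_singleton, add_comm 1,
      Multiset.replicate_succ, Multiset.singleton_add]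
    · intro x hx
      exact (hr x (by simpa using hx) x (by simpa using hx)).2 rfl
    · intro x hx y hy h
      rw [Finset.mem_singleton] at hx
      subst hx
      rw [hr x (by simp) y (by simp [hy])] at h
      exact ha (h ▸ hy)
    · intro x hx y hy h
      rw [Finset.mem_singleton] at hy
      subst hy
      rw [hr x (by simp [hx]) y (by simp)] at h
      exact ha (h ▸ hx)

theorem parts_partition_eq_classSizes {α : Type*} [Fintype α] [DecidableEq α] (σ : Equiv.Perm α) :
    σ.partition.parts = classSizes σ.SameCycle Finset.univ := by
  have hfix : ∀ x ∈ (σ.supportᶜ : Finset α), ∀ y, σ.SameCycle x y ↔ x = y := by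
    intro x hx y
    have hx' : σ x = x := by simpa using hx
    refine ⟨fun ⟨k, hk⟩ => ?_, fun h => h ▸ .refl _ _⟩
    rwa [Equiv.Perm.zpow_apply_eq_self_of_apply_eq_self hx'] at hk
  rw [Equiv.Perm.parts_partition, cycleType_eq_classSizes,
    ← Finset.union_compl σ.support, classSizes_union (fun x _ => .refl _ _),
    classSizes_eq_replicate fun x hx y _ => hfix x hx y, Finset.card_compl]
  · intro x hx y hy h
    rw [Equiv.Perm.sameCycle_comm, hfix y hy] at h
    rw [h, Finset.mem_compl] at hy
    exact hy hx
  · intro x hx y hy h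
    rw [hfix x hx] at h
    rw [h, Finset.mem_compl] at hx
    exact hx hy

theorem exists_partition_parts_eq {n : ℕ} (α : n.Partition) :
    ∃ u : Equiv.Perm (Fin n), u.partition.parts = α.parts := by
  have h1 : α.parts.filter (2 ≤ ·) + α.parts.filter (¬ 2 ≤ ·) = α.parts := Multiset.filter_add_not _ _
  have h2 : α.parts.filter (¬ 2 ≤ ·) =
      Multiset.replicate (Multiset.card (α.parts.filter (¬ 2 ≤ ·))) 1 := by
    refine Multiset.eq_replicate_card.2 fun b hb => ?_
    obtain ⟨h3, h4⟩ := Multiset.mem_filter.1 hb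
    have := α.parts_pos h3
    omega
  have h3 := congrArg Multiset.sum h1
  rw [Multiset.sum_add, h2, Multiset.sum_replicate, α.parts_sum, smul_eq_mul, mul_one] at h3
  obtain ⟨u, hu⟩ := (Equiv.Perm.exists_with_cycleType_iff (Fin n)
    (m := α.parts.filter (2 ≤ ·))).2 ⟨by rw [Fintype.card_fin]; omega,
      fun a ha => (Multiset.mem_filter.1 ha).2⟩
  refine ⟨u, ?_⟩
  rw [Equiv.Perm.parts_partition, ← Equiv.Perm.sum_cycleType, hu, Fintype.card_fin]
  conv_rhs => rw [← h1, h2]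
  congr 2
  omega

/-- The label `i + 1` of `i : Fin n`. -/
def finLabel (n : ℕ) : Fin n ≃ {x : ℤ // 0 < x ∧ x ≤ n} where
  toFun i := ⟨i + 1, by omega⟩
  invFun x := ⟨(x.1 - 1).toNat, by have := x.2; omega⟩
  left_inv i := by ext; simp
  right_inv x := by
    have := x.2
    ext
    simp only
    omega

/-- A permutation of `Fin n` as a permutation of the integers in `(0, n]`. -/
noncomputable def permLabel (n : ℕ) : Equiv.Perm (Fin n) →* Equiv.Perm ℤ :=
  Equiv.Perm.extendDomainHom (finLabel n)

theorem permLabel_apply {n : ℕ} (u : Equiv.Perm (Fin n)) (i : Fin n) :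
    permLabel n u (i + 1) = u i + 1 :=
  Equiv.Perm.extendDomain_apply_image u (finLabel n) i

theorem permLabel_mem {n : ℕ} (u : Equiv.Perm (Fin n)) : permLabel n u ∈ windowPerm 0 n :=
  fun _ hx => Equiv.Perm.extendDomain_apply_not_subtype u (finLabel n) hx

theorem permLabel_injective (n : ℕ) : Function.Injective (permLabel n) :=
  Equiv.Perm.extendDomainHom_injective _

theorem exists_fin_label {n : ℕ} {x : ℤ} (h1 : 0 < x) (h2 : x ≤ n) : ∃ i : Fin n, x = i + 1 :=
  ⟨⟨(x - 1).toNat, by omega⟩, by simp; omega⟩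

theorem windowPerm_ext {A B : ℤ} {u v : Equiv.Perm ℤ} (hu : u ∈ windowPerm A B)
    (hv : v ∈ windowPerm A B) (h : ∀ x, A < x → x ≤ B → u x = v x) : u = v := by
  ext x
  by_cases hx : A < x ∧ x ≤ B
  · exact h x hx.1 hx.2
  · rw [hu x hx, hv x hx]

theorem exists_permLabel_eq {n : ℕ} {w : Equiv.Perm ℤ} (hw : w ∈ windowPerm 0 n) :
    ∃ u, permLabel n u = w := by
  have key : ∀ v ∈ windowPerm 0 (n : ℤ), ∀ i : Fin n, ∃ j : Fin n, v (i + 1) = j + 1 :=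
    fun v hv i => by
      have := windowPerm_apply_mem hv (x := i + 1) (by omega) (by omega)
      exact exists_fin_label this.1 this.2
  choose f hf using key w hw
  choose g hg using key w⁻¹ (inv_mem hw)
  refine ⟨⟨f, g, fun i => ?_, fun i => ?_⟩, windowPerm_ext (permLabel_mem _) hw fun x h1 h2 => ?_⟩
  · have := hg (f i)
    rw [← hf, ← Equiv.Perm.mul_apply, inv_mul_cancel, Equiv.Perm.one_apply] at this
    ext
    omega
  · have := hf (g i)
    rw [← hg, ← Equiv.Perm.mul_apply, mul_inv_cancel, Equiv.Perm.one_apply] at this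
    ext
    omega
  · obtain ⟨i, rfl⟩ := exists_fin_label h1 h2
    rw [permLabel_apply, hf]
    rfl

theorem permLabel_swap {n : ℕ} (i j : Fin n) :
    permLabel n (Equiv.swap i j) = Equiv.swap (i + 1 : ℤ) (j + 1) := by
  refine windowPerm_ext (permLabel_mem _) (swap_mem_windowPerm (by omega) (by omega))
    fun x h1 h2 => ?_
  obtain ⟨k, rfl⟩ := exists_fin_label h1 h2
  rw [permLabel_apply, Equiv.swap_apply_def, Equiv.swap_apply_def]
  simp only [Fin.ext_iff]
  split_ifs <;> omega

theorem permLabel_rev {n : ℕ} {x : ℤ} (h1 : 0 < x) (h2 : x ≤ n) :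
    permLabel n Fin.revPerm x = n + 1 - x := by
  obtain ⟨k, rfl⟩ := exists_fin_label h1 h2
  rw [permLabel_apply, Fin.revPerm_apply, Fin.val_rev]
  omega

theorem classSizes_permLabel {n : ℕ} (u : Equiv.Perm (Fin n)) :
    classSizes (permLabel n u).SameCycle (Finset.Ioc 0 (n : ℤ)) = u.partition.parts := by
  have him : Finset.Ioc 0 (n : ℤ) = Finset.univ.image (fun i : Fin n => (i : ℤ) + 1) := by
    ext x
    rw [Finset.mem_Ioc, Finset.mem_image]
    constructor
    · rintro ⟨h1, h2⟩
      obtain ⟨i, rfl⟩ := exists_fin_label h1 h2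
      exact ⟨i, by simp, rfl⟩
    · rintro ⟨i, -, rfl⟩
      omega
  rw [parts_partition_eq_classSizes, him]
  refine classSizes_image (fun i _ j _ h => Fin.ext (by simpa using h)) fun i _ j _ => ?_
  have hz : ∀ k : ℤ, ((permLabel n u) ^ k) (i + 1) = (u ^ k) i + 1 := fun k => by
    rw [← map_zpow, permLabel_apply]
  simp only [Equiv.Perm.SameCycle, hz, add_left_inj, Nat.cast_inj, Fin.ext_iff]

/-! ### The elliptic classes in types A and ²A -/

theorem mem_prod_bot_iff {n : ℕ} {g : Equiv.Perm (Fin n) × ℤˣ} :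
    g ∈ (⊤ : Subgroup (Equiv.Perm (Fin n))).prod (⊥ : Subgroup ℤˣ) ↔ g.2 = 1 := by
  simp [Subgroup.mem_prod]

/-- The action of an element of the extended Weyl group on labels. -/
noncomputable def permLabelFst (n : ℕ) : Equiv.Perm (Fin n) × ℤˣ →* Equiv.Perm ℤ :=
  (permLabel n).comp (MonoidHom.fst _ _)

theorem permLabelFst_apply {n : ℕ} (g : Equiv.Perm (Fin n) × ℤˣ) :
    permLabelFst n g = permLabel n g.1 := rfl

theorem exists_swap_of_mem_simpleA {n : ℕ} {s : Equiv.Perm (Fin n) × ℤˣ} (hs : s ∈ simpleA n) :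
    s.2 = 1 ∧ ∃ a : ℤ, 0 < a ∧ a + 1 ≤ n ∧ permLabelFst n s = Equiv.swap a (a + 1) := by
  obtain ⟨i, j, hij, rfl⟩ := hs
  refine ⟨rfl, i + 1, by omega, by omega, ?_⟩
  rw [permLabelFst_apply, permLabel_swap, hij]
  push_cast
  rfl

theorem revPerm_mul_self (n : ℕ) : (Fin.revPerm : Equiv.Perm (Fin n)) * Fin.revPerm = 1 := by
  ext; simp

theorem apply_add_le_of_descents {n : ℕ} {x : Equiv.Perm ℤ}
    (h : ∀ a : ℤ, 0 < a → a + 1 ≤ n → x (a + 1) < x a) {a : ℤ} (ha : 0 < a) (d : ℕ) (hd : a + d ≤ n) :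
    x (a + d) + d ≤ x a := by
  induction d with
  | zero => simp
  | succ d ih =>
    push_cast at hd ⊢
    have h1 := ih (by omega)
    have h2 := h (a + d) (by omega) (by omega)
    rw [add_assoc] at h2
    omega

theorem twLen_eq_zero_of_descents {n : ℕ} {x : Equiv.Perm ℤ}
    (h : ∀ a : ℤ, 0 < a → a + 1 ≤ n → x (a + 1) < x a) : twLen 0 n x = 0 := by
  rw [twLen_eq_card, Finset.card_eq_zero, Finset.filter_eq_empty_iff]
  rintro ⟨a, b⟩ hab ⟨h1, h2⟩
  rw [Finset.mem_product, Finset.mem_Ioc, Finset.mem_Ioc] at hab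
  have := apply_add_le_of_descents h hab.1.1 (b - a).toNat (by simp at *; omega)
  simp only at *
  rw [show a + ((b - a).toNat : ℤ) = b by omega] at this
  omega

theorem descents_of_twLen_eq_zero {n : ℕ} {x : Equiv.Perm ℤ} (h : twLen 0 n x = 0) {a : ℤ}
    (h1 : 0 < a) (h2 : a + 1 ≤ n) : x (a + 1) < x a := by
  rw [twLen_eq_card, Finset.card_eq_zero, Finset.filter_eq_empty_iff] at h
  have h3 := @h (a, a + 1) (by simp; omega)
  have hne : x a ≠ x (a + 1) := fun h => by have := x.injective h; omega
  simp only at h3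
  omega

theorem model_weylTwistedA (n : ℕ) : (weylTwistedA n).Model (twData 0 n) (permLabelFst n) where
  S_sub s hs := mem_prod_bot_iff.2 (exists_swap_of_mem_simpleA hs).1
  eps_S s hs := by
    have einv : (weylTwistedA n).eps⁻¹ = (weylTwistedA n).eps :=
      inv_eq_of_mul_eq_one_left (Prod.ext (revPerm_mul_self n) (by simp [weylTwistedA]))
    rw [einv, and_self]
    obtain ⟨i, j, hij, rfl⟩ := hs
    refine ⟨j.rev, i.rev, by rw [Fin.val_rev, Fin.val_rev]; omega, Prod.ext ?_ (by simp [weylTwistedA])⟩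
    have := Equiv.swap_apply_apply Fin.revPerm j i
    rw [inv_eq_of_mul_eq_one_left (revPerm_mul_self n), Equiv.swap_comm j] at this
    exact this.symm
  eps_W0 g hg := by
    have hg : g.2 = 1 := mem_prod_bot_iff.1 hg
    exact ⟨mem_prod_bot_iff.2 (by simp [hg]), mem_prod_bot_iff.2 (by simp [hg])⟩
  map_mem w _ := permLabel_mem _
  inj w hw h := Prod.ext (permLabel_injective n (h.trans (map_one _).symm)) (mem_prod_bot_iff.1 hw)
  map_S s hs := by
    obtain ⟨-, a, h1, h2, h3⟩ := exists_swap_of_mem_simpleA hs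
    exact ⟨a, h1, h2, h3⟩
  map_reflections t ht := by
    obtain ⟨g, -, s, hs, rfl⟩ := ht
    obtain ⟨-, a, h1, h2, h3⟩ := exists_swap_of_mem_simpleA hs
    rw [map_mul, map_mul, map_inv]
    exact (twData 0 n).conj_mem _ (permLabel_mem _) _ ((twData 0 n).S_sub ⟨a, h1, h2, h3⟩)
  exists_reflection t ht := by
    obtain ⟨a, b, h1, h2, h3, rfl⟩ := ht
    obtain ⟨i, rfl⟩ := exists_fin_label h1 (by omega : a ≤ n)
    obtain ⟨j, rfl⟩ := exists_fin_label (by omega : 0 < b) h3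
    have h01 : (⟨0, by omega⟩ : Fin n) ≠ ⟨1, by omega⟩ := by simp
    have hij : i ≠ j := by rintro rfl; omega
    obtain ⟨g, hg⟩ := isConj_iff.1 (Equiv.Perm.isConj_swap h01 hij)
    refine ⟨(Equiv.swap i j, 1), ⟨(g, 1), mem_prod_bot_iff.2 rfl, (_, 1),
      ⟨⟨0, by omega⟩, ⟨1, by omega⟩, rfl, rfl⟩, ?_⟩,
      permLabel_swap i j⟩
    exact Prod.ext hg.symm (by simp)
  -- The element `ε` acts as `w₀`, which has no non-inversions.
  len_eps := twLen_eq_zero_of_descents fun a h1 h2 => by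
    change permLabel n Fin.revPerm _ < permLabel n Fin.revPerm _
    rw [permLabel_rev (by omega) h2, permLabel_rev h1 (by omega)]
    omega
  exists_descent w _ h := by
    have hx : permLabelFst n (w * (weylTwistedA n).eps) ∈ windowPerm 0 n := permLabel_mem _
    by_contra hn
    push Not at hn
    refine h (twLen_eq_zero_of_descents fun a h1 h2 => ?_)
    obtain ⟨i, hi⟩ := exists_fin_label h1 (by omega : a ≤ n)
    obtain ⟨j, hj⟩ := exists_fin_label (n := n) (x := a + 1) (by omega) h2
    have h3 := hn (Equiv.swap i j, 1) ⟨i, j, by omega, rfl⟩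
    rw [permLabelFst_apply (Equiv.swap i j, 1), permLabel_swap, ← hi, ← hj] at h3
    have h4 := (twLen_mul_adjacent_lt_iff hx h1 h2).not.1 (not_lt.2 h3)
    have hne : ∀ x : Equiv.Perm ℤ, x a ≠ x (a + 1) := fun x h => by
      have := x.injective h; omega
    exact lt_of_le_of_ne (not_lt.1 h4) (hne _).symm
  eq_one w hw h := by
    refine Prod.ext (permLabel_injective n ?_) (mem_prod_bot_iff.1 hw)
    have hx : permLabelFst n (w * (weylTwistedA n).eps) ∈ windowPerm 0 n := permLabel_mem _
    have hd := fun a => descents_of_twLen_eq_zero (a := a) h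
    have key : permLabelFst n (w * (weylTwistedA n).eps) = permLabel n Fin.revPerm := by
      refine windowPerm_ext hx (permLabel_mem _) fun a h1 h2 => ?_
      rw [permLabel_rev h1 h2]
      -- A strictly decreasing map with values in `(0, n]` must be `w₀`: comparison with both ends
      -- leaves only `n + 1 - a` as value at `a`.
      have h3 := apply_add_le_of_descents hd one_pos (a - 1).toNat (by omega)
      have h4 := apply_add_le_of_descents hd h1 (n - a).toNat (by omega)
      have h5 := windowPerm_apply_mem hx (x := 1) (by omega) (by omega)
      have h6 := windowPerm_apply_mem hx (x := n) (by omega) le_rfl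
      rw [show 1 + ((a - 1).toNat : ℤ) = a by omega] at h3
      rw [show a + ((n - a).toNat : ℤ) = n by omega] at h4
      omega
    rw [map_mul] at key
    exact (mul_eq_right.1 key).trans (map_one _).symm

theorem permClass_eq_conjClass {n : ℕ} (α : n.Partition) (c : ℤˣ)
    (D : WeylCoset (Equiv.Perm (Fin n) × ℤˣ))
    (hD : D.W0 = (⊤ : Subgroup (Equiv.Perm (Fin n))).prod ⊥) :
    ∃ x ∈ permClass α c, permClass α c = D.conjClass x := by
  obtain ⟨u, hu⟩ := exists_partition_parts_eq α
  refine ⟨(u, c), ⟨hu, rfl⟩, ?_⟩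
  ext ⟨v, d⟩
  constructor
  · rintro ⟨hv, rfl⟩
    have he : u.partition = v.partition := Nat.Partition.ext (hu.trans hv.symm)
    obtain ⟨g, hg⟩ := isConj_iff.1 (Equiv.Perm.partition_eq_of_isConj.2 he)
    refine ⟨(g, 1), by rw [hD]; exact mem_prod_bot_iff.2 rfl, Prod.ext hg.symm (by simp)⟩
  · rintro ⟨g, hg, e⟩
    rw [hD, mem_prod_bot_iff] at hg
    have h1 : v = g.1 * u * g.1⁻¹ := congrArg Prod.fst e
    have h2 : d = g.2 * c * g.2⁻¹ := congrArg Prod.snd e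
    refine ⟨?_, by simp [h2, hg]⟩
    have : IsConj u v := isConj_iff.2 ⟨g.1, h1.symm⟩
    change v.partition.parts = _
    rw [← Equiv.Perm.partition_eq_of_isConj.1 this, hu]

theorem permLabelFst_image_permClass {n : ℕ} {α : n.Partition} (hα : ∀ k ∈ α.parts, Odd k)
    (c : ℤˣ) : permLabelFst n '' permClass α c = twClass n α.parts := by
  ext w
  constructor
  · rintro ⟨u, ⟨hu, -⟩, rfl⟩
    have hc : classSizes (permLabel n u.1).SameCycle (Finset.Ioc 0 (n : ℤ)) = α.parts :=
      (classSizes_permLabel u.1).trans hu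
    refine ⟨permLabel_mem _, oddCycles_of_classSizes (E := Finset.Ioc 0 (n : ℤ))
      (fun x hx => permLabel_mem u.1 x (by rwa [Finset.mem_Ioc] at hx)) fun k hk => ?_, hc⟩
    rw [permLabelFst_apply, hc] at hk
    exact hα k hk
  · rintro ⟨hw, -, hc⟩
    obtain ⟨u, rfl⟩ := exists_permLabel_eq hw
    exact ⟨(u, c), ⟨(classSizes_permLabel u).symm.trans hc, rfl⟩, rfl⟩

/-- A subgroup generated by simple reflections without the one at `a` preserves `(0, a]`. -/
theorem permLabelFst_mem_Ioc {n : ℕ} {J : Set (Equiv.Perm (Fin n) × ℤˣ)} (hJ : J ⊆ simpleA n) {a : ℤ}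
    (ha : ∀ s ∈ J, permLabelFst n s ≠ Equiv.swap a (a + 1)) {w : Equiv.Perm (Fin n) × ℤˣ}
    (hw : w ∈ Subgroup.closure J) (x : ℤ) :
    permLabelFst n w x ∈ Finset.Ioc 0 a ↔ x ∈ Finset.Ioc 0 a := by
  refine Equiv.Perm.apply_mem_iff_of_mapsTo (Subgroup.apply_mem_of_mem_closure
    (J := permLabelFst n '' J) ?_ ?_) x
  · rintro _ ⟨s, hs, rfl⟩ y hy
    obtain ⟨-, b, h1, h2, h3⟩ := exists_swap_of_mem_simpleA (hJ hs)
    have hne : b ≠ a := by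
      rintro rfl
      exact ha s hs h3
    rw [Finset.mem_Ioc] at *
    rw [h3, Equiv.swap_apply_def]
    split_ifs <;> omega
  · rw [← MonoidHom.map_closure]
    exact Subgroup.mem_map_of_mem _ hw

theorem exists_simpleA_notMem {n : ℕ} {J : Set (Equiv.Perm (Fin n) × ℤˣ)} (hJ : J ⊆ simpleA n)
    (hne : J ≠ simpleA n) : ∃ a : ℤ, 0 < a ∧ a + 1 ≤ n ∧
      ∀ s ∈ J, permLabelFst n s ≠ Equiv.swap a (a + 1) := by
  obtain ⟨s, hs, hsJ⟩ := Set.exists_of_ssubset (hJ.ssubset_of_ne hne)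
  obtain ⟨h0, a, h1, h2, h3⟩ := exists_swap_of_mem_simpleA hs
  refine ⟨a, h1, h2, fun t ht h => hsJ ?_⟩
  have h4 := (exists_swap_of_mem_simpleA (hJ ht)).1
  have : t = s := Prod.ext (permLabel_injective n (h.trans h3.symm)) (h4.trans h0.symm)
  exact this ▸ ht

theorem ellipticOrderReversing_weylTwistedA (n : ℕ) :
    EllipticOrderReversing (weylTwistedA n) (fun α : n.Partition => ∀ k ∈ α.parts, Odd k)
      (fun α => permClass α (-1)) := by
  have hsub : ∀ α : n.Partition, permClass α (-1) ⊆ (weylTwistedA n).coset := by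
    rintro α ⟨u, c⟩ ⟨-, rfl⟩
    exact ⟨(u * Fin.revPerm⁻¹, 1), mem_prod_bot_iff.2 rfl, Prod.ext (by simp [weylTwistedA])
      (by simp [weylTwistedA])⟩
  refine ⟨fun α hα => ⟨?_, fun J hJ hne hε => ?_⟩, fun α β hα hβ => ?_⟩
  · obtain ⟨x, hx, e⟩ := permClass_eq_conjClass α (-1) (weylTwistedA n) rfl
    exact ⟨x, hsub α hx, e⟩
  · obtain ⟨a, h1, h2, h3⟩ := exists_simpleA_notMem hJ hne
    have hrev : ∀ x : ℤ, 0 < x → x ≤ n → permLabelFst n (weylTwistedA n).eps x = n + 1 - x :=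
      fun x h1 h2 => permLabel_rev h1 h2
    have h4 : ∀ s ∈ J, permLabelFst n s ≠ Equiv.swap (n - a) (n - a + 1) := by
      intro s hs h
      have hs' : (weylTwistedA n).eps * s * (weylTwistedA n).eps⁻¹ ∈ J := by
        rw [← hε]
        exact ⟨s, hs, rfl⟩
      refine h3 _ hs' ?_
      rw [map_mul, map_mul, map_inv, h, ← Equiv.swap_apply_apply, hrev _ (by omega) (by omega),
        hrev _ (by omega) (by omega), Equiv.swap_comm]
      congr 1 <;> ring
    -- Conjugation by `ε` exchanges the reflections at `a` and `n - a`, so `J` misses both; `k` is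
    -- the smaller of the two positions.
    obtain ⟨k, hk1, hk2, h5, h6⟩ : ∃ k : ℤ, 0 < k ∧ k ≤ n - k ∧
        (∀ s ∈ J, permLabelFst n s ≠ Equiv.swap k (k + 1)) ∧
        ∀ s ∈ J, permLabelFst n s ≠ Equiv.swap (n - k) (n - k + 1) := by
      rcases le_total a (n - a) with h | h
      · exact ⟨a, h1, h, h3, h4⟩
      · exact ⟨n - a, by omega, by omega, h4, by simpa using h3⟩
    rw [Set.eq_empty_iff_forall_notMem]
    rintro _ ⟨hx, w, hw, rfl⟩
    have hodd : OddCycles (permLabelFst n (w * (weylTwistedA n).eps)) := by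
      have : permLabelFst n (w * (weylTwistedA n).eps) ∈ twClass n α.parts := by
        rw [← permLabelFst_image_permClass hα (-1)]
        exact ⟨_, hx, rfl⟩
      exact this.2.1
    have hlow := permLabelFst_mem_Ioc hJ h5 hw
    have hhigh := permLabelFst_mem_Ioc hJ h6 hw
    have hw0 : permLabelFst n w ∈ windowPerm 0 n := permLabel_mem _
    have hstep : ∀ x : ℤ, 0 < x → x ≤ k → n - k < permLabelFst n (w * (weylTwistedA n).eps) x ∧
        permLabelFst n (w * (weylTwistedA n).eps) x ≤ n := by
      intro x hx1 hx2
      rw [map_mul, Equiv.Perm.mul_apply, hrev x hx1 (by omega)]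
      have e1 := (hhigh (n + 1 - x)).not
      have e2 := windowPerm_apply_mem hw0 (x := n + 1 - x) (by omega) (by omega)
      rw [Finset.mem_Ioc, Finset.mem_Ioc] at e1
      omega
    -- The group `W_J` preserves `(0, k]` and `(0, n - k]`, and `ε` exchanges `(0, k]` with `(n - k,
    -- n]`. So labels of `(0, k]` leave it at the first step and return at the second, which gives
    -- cycles of even length.
    refine hodd (Finset.Ioc 0 k) ⟨1, by simp; omega⟩ (fun x hx => ?_) fun x hx => ?_
    · rw [Finset.mem_Ioc] at hx ⊢
      have := hstep x hx.1 hx.2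
      omega
    · rw [Finset.mem_Ioc] at hx
      have := hstep x hx.1 hx.2
      rw [map_mul, Equiv.Perm.mul_apply, ← map_mul, hrev _ (by omega) (by omega), hlow,
        Finset.mem_Ioc]
      omega
  · rw [(model_weylTwistedA n).precW_iff (hsub α) (hsub β), permLabelFst_image_permClass hα,
      permLabelFst_image_permClass hβ, exists_below_twClass_iff α β hα hβ]

theorem ellipticOrderReversing_weylA (n : ℕ) :
    EllipticOrderReversing (weylA n) (fun α : n.Partition => α = Nat.Partition.indiscrete n)
      (fun α => permClass α 1) := by
  refine ⟨?_, ?_⟩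
  · rintro α rfl
    refine ⟨?_, fun J hJ hne _ => ?_⟩
    · obtain ⟨x, hx, e⟩ := permClass_eq_conjClass (Nat.Partition.indiscrete n) 1 (weylA n) rfl
      exact ⟨x, ⟨x, mem_prod_bot_iff.2 hx.2, (mul_one x).symm⟩, e⟩
    · obtain ⟨a, h1, h2, h3⟩ := exists_simpleA_notMem hJ hne
      rw [Set.eq_empty_iff_forall_notMem]
      rintro _ ⟨⟨hx, -⟩, w, hw, rfl⟩
      have hw : w * (weylA n).eps ∈ Subgroup.closure J := by
        rwa [show (weylA n).eps = 1 from rfl, mul_one]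
      generalize w * (weylA n).eps = u at hw hx
      have hst := permLabelFst_mem_Ioc hJ h3 hw
      rw [← classSizes_permLabel, Nat.Partition.indiscrete_parts (by omega)] at hx
      obtain ⟨P, hP, hPc⟩ := exists_finpartition_classSizes (E := Finset.Ioc 0 (n : ℤ))
        (⟨.refl (permLabel n u.1), .symm, .trans⟩ : Equivalence (permLabel n u.1).SameCycle)
      obtain ⟨I, hI, h1I⟩ := P.exists_mem (a := 1) (Finset.mem_Ioc.2 ⟨one_pos, by omega⟩)
      have hcard : I.card = n := by
        have := Multiset.mem_map_of_mem Finset.card (s := P.parts.val) hI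
        rw [hP, hx] at this
        simpa using this
      have hIE : I = Finset.Ioc 0 (n : ℤ) :=
        Finset.eq_of_subset_of_card_le (P.le hI) (by rw [Int.card_Ioc]; omega)
      have hn : (n : ℤ) ∈ Finset.Ioc 0 (n : ℤ) := Finset.mem_Ioc.2 ⟨by omega, le_rfl⟩
      -- A single orbit joins 1 and `n`, while `W_J` preserves `(0, a]`, which contains 1 but not
      -- `n`.
      have hsame := (hPc I hI 1 h1I n hn).2 (hIE ▸ hn)
      have := (hsame.mem_iff_of_stable (A := {x | x ∈ Finset.Ioc 0 a}) hst).1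
        (Finset.mem_Ioc.2 ⟨one_pos, by omega⟩)
      have := (Finset.mem_Ioc.1 this).2
      omega
  · rintro α β rfl rfl
    -- Only one class occurs, so a minimal element compared with itself suffices.
    refine ⟨fun _ k => le_rfl, fun _ => ?_⟩
    obtain ⟨x, hx, -⟩ := permClass_eq_conjClass (Nat.Partition.indiscrete n) 1 (weylA n) rfl
    obtain ⟨m, hm, hmin⟩ := (measure (weylA n).cosetLen).wf.has_min
      (permClass (Nat.Partition.indiscrete n) 1) ⟨x, hx⟩
    have hm' : m ∈ (weylA n).minElts (permClass (Nat.Partition.indiscrete n) 1) :=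
      ⟨hm, fun y hy => not_lt.1 (hmin y hy)⟩
    exact ⟨m, hm', m, hm', .refl⟩

theorem proposition3p8 (n : ℕ) :
    EllipticOrderReversing (weylB n) (fun _ : n.Partition => True) signedClass ∧
    EllipticOrderReversing (weylD n) (fun α : n.Partition => Even α.parts.card) signedClass ∧
    EllipticOrderReversing (weylTwistedD n) (fun α : n.Partition => Odd α.parts.card)
      signedClass ∧
    EllipticOrderReversing (weylA n) (fun α : n.Partition => α = Nat.Partition.indiscrete n)
      (fun α => permClass α 1) ∧
    EllipticOrderReversing (weylTwistedA n) (fun α : n.Partition => ∀ k ∈ α.parts, Odd k)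
      (fun α => permClass α (-1)) := by
  exact ⟨ellipticOrderReversing_weylB n, ellipticOrderReversing_weylD n,
    ellipticOrderReversing_weylTwistedD n, ellipticOrderReversing_weylA n,
    ellipticOrderReversing_weylTwistedA n⟩
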